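/- **Setting.** Let $\mathbb S^2\subset\mathbb R^3$ be the unit sphere and $n=(0,0,1)$. For $\varepsilon>0$ let $\mathcal L_\varepsilon=\{\varepsilon(a\,(1,0)+b\,(\tfrac12,\tfrac{\sqrt3}2)):a,b\in\mathbb Z\}$, let $\mathcal T_\varepsilon$ be the set of closed triangles $[i,j,k]$ with vertices in $\mathcal L_\varepsilon$ and side length $\varepsilon$, and call $[i,j]$ with $i,j\in\mathcal L_\varepsilon$, $|i-j|=\varepsilon$, an edge. Let $\Omega\subset\mathbb R^2$ be bounded and open, and let $u:\mathcal L_\varepsilon\to\mathbb S^2$ be a spin field in $\mathcal{SF}_\varepsilon(\Omega)$, that is, $u=n$ on $\mathcal L_\varepsilon\setminus\Omega$ and, moreover, $u=n$ on the vertices of every $T\in\mathcal T_\varepsilon$ that is not compactly contained in $\Omega$. Put $$H_\varepsilon(u,\Omega)=\sum_{[i,j,k]\in\mathcal T_\varepsilon,\ [i,j,k]\subset\Omega}\tfrac12\big(|u(i)-u(j)|^2+|u(j)-u(k)|^2+|u(k)-u(i)|^2\big),$$ $$Z_\varepsilon(u,\Omega)=\sum_{[i,j,k]\in\mathcal T_\varepsilon,\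 [i,j,k]\subset\Omega}\tfrac12\big(|u(i)-n|^2+|u(j)-n|^2+|u(k)-n|^2\big).$$ **Regions and surfaces.** Two triangles are neighbors if their intersection is an edge $[i,j]$ with $u(i)=-u(j)$, and connected if they are joined by a finite chain of successive neighbors. $\mathcal R_\varepsilon(u)$ is the set of those sets $R$ that are maximal for inclusion among the finite unions of pairwise connected triangles. For $R\in\mathcal R_\varepsilon(u)$ let $K_R$ be the convex cone of nonnegative combinations of the values of $u$ on $\mathcal L_\varepsilon\cap R$. A set $S_R\subset\mathbb S^2$ is an admissible interpolation surface for $u$ in $R$ if $S_R=\{y/|y|:0\ne y\in K_R\}$ when $K_R$ is not a linear subspace, and $S_R=\{y/|y|:0\neq y\in K_R+[0,\infty)h\}$ for some $h\in\mathbb S^2$ orthogonal to $K_R$ when $K_R$ is a linear subspace. **Signs.** An edge $[i,j]$ with $u(i)\neq-u(j)$ is a boundary edge of $R$, oriented from $i$ to $j$ and written $(i,j)_R$, if the triangle of $\mathcal T_\varepsilon$ on the left of the segment from $i$ to $j$ lies in $R$ and the one on its right lies in $\mathbb R^2\setminus\mathrm{int}\,R$. Write $(i,j)_R\prec(j,k)_R$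 if $[i,j]$ is obtained by rotating $[j,k]$ counterclockwise around $j$, sweeping only over triangles contained in $R$; extend $\prec$ to chains. An induced boundary curve is a simple closed parametrization $\gamma:[0,N]\to\mathbb S^2$, $N\in\{3,4\}$, of the boundary of $S_R$ relative to $\mathbb S^2$ which is the concatenation of the minimizing geodesics from $u(i_m)$ to $u(j_m)$ for oriented boundary edges $\Gamma_m=(i_m,j_m)_R$ with $\Gamma_1\prec\dots\prec\Gamma_N\prec\Gamma_1$. It is positively oriented with respect to $S_R$ if at all its smooth points $\gamma(t)\times\gamma'(t)$ points toward $S_R$, i.e. $(\gamma(t)\times\gamma'(t))\cdot\beta'(0)\ge0$ for every curve $\beta$ in $S_R$ that starts at $\gamma(t)$ and is differentiable there. An admissible sign is $\sigma_R\in\{1,-1\}$ such that, if $\mathcal H^2(S_R)>0$, $\sigma_R=1$ when an induced boundary curve is positively oriented with respect to $S_R$ and $\sigma_R=-1$ otherwise. **Admissible charge.** Let $\mu$ be an admissible topological charge for $u$, that is, an atomic measure $$\mu=\sum_{R\in\mathcal R_\varepsilon(u)}\sigma_R\,\mathcal H^2(S_R)\,\delta_{x_R},\qquad x_R\in\mathrm{int}\,R,$$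 with admissible interpolation surfaces $S_R$ and admissible signs $\sigma_R$ (only finitely many coefficients are nonzero). **Continuum notions.** $\mathcal U(\Omega)$ is the set of $w:\mathbb R^2\to\mathbb R^3$ with $w-n\in H^1(\mathbb R^2;\mathbb R^3)$, $|w|=1$ a.e., and $w=n$ a.e. in $\mathbb R^2\setminus\Omega$; $q(w)=w\cdot(\partial_1w\times\partial_2w)$; and, for a signed measure $\nu$, $\|\nu\|_{\mathrm{flat},\Omega}=\sup\{\int\phi\,d\nu:\phi\in C_c^\infty(\Omega),\ |\phi|\le1,\ |\nabla\phi|\le1\}$. **Theorem.** There are universal constants $C_1,C_2>0$ such that for all $\varepsilon,\Omega,u$ and $\mu$ as above (with $S_R,\sigma_R,x_R$) there is a Lipschitz map $\mathring u\in\mathcal U(\Omega)$ with $\mathring u=u$ on $\mathcal L_\varepsilon$, of the form $\mathring u=v/|v|$ where $v:\mathbb R^2\to\mathbb R^3\setminus\{0\}$ is continuous and affine on each triangle of the refined lattice (the triangles $[i,\frac{i+j}2,\frac{i+j+k}3]$ with $[i,j,k]\in\mathcal T_\varepsilon$), such that $$\frac12\int_\Omega|\nabla\mathring u|^2\,dx\le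 C_1H_\varepsilon(u,\Omega),\qquad \frac1{\varepsilon^2}\int_\Omega|\mathring u-n|^2\,dx\le C_1Z_\varepsilon(u,\Omega),$$ $$\int_Rq(\mathring u)\,dx=\sigma_R\,\mathcal H^2(S_R)\quad\text{for every }R\in\mathcal R_\varepsilon(u),$$ $$\|q(\mathring u)\,dx-\mu\|_{\mathrm{flat},\Omega}\le C_2\,\varepsilon\,(H_\varepsilon(u,\Omega)+1)\,H_\varepsilon(u,\Omega).$$ Moreover, $\mu(\mathbb R^2)\in4\pi\mathbb Z$. -/

import Mathlib

open MeasureTheory Set Filter Topology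
open scoped ContDiff NNReal ENNReal

namespace LatticeSpin

/-- The Euclidean plane. -/
abbrev E2 := EuclideanSpace ℝ (Fin 2)

/-- Euclidean three-space. -/
abbrev E3 := EuclideanSpace ℝ (Fin 3)

/-- The unit sphere of three-space. -/
abbrev S2 : Set E3 := Metric.sphere (0 : E3) 1

/-- The north pole `n = (0, 0, 1)`. -/
noncomputable def north : E3 := !₂[0, 0, 1]

/-- The cross product on Euclidean three-space. -/
noncomputable def cross (a b : E3) : E3 := WithLp.toLp 2 (crossProduct a.ofLp b.ofLp)

/-! ### The triangular lattice and spin fields -/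

/-- The triangular lattice with spacing `ε`, spanned by `ε (1, 0)` and `ε (1/2, √3/2)`. -/
def lattice (ε : ℝ) : Set E2 :=
  {x | ∃ a b : ℤ, x = ε • ((a : ℝ) • (!₂[1, 0] : E2) + (b : ℝ) • (!₂[1 / 2, √3 / 2] : E2))}

/-- A spin field assigns a unit vector to every lattice node. -/
abbrev SpinField (ε : ℝ) := lattice ε → S2

variable {ε : ℝ}

/-- The discrete Dirichlet condition: `u = n` on the lattice nodes outside `Ω`. -/
def IsSpinFieldOn (Ω : Set E2) (u : SpinField ε) : Prop :=
  ∀ i : lattice ε, (i : E2) ∉ Ω → (u i : E3) = north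

/-- `t` is the set of vertices of an elementary triangle of the lattice. -/
def IsTriangle (t : Finset (lattice ε)) : Prop :=
  t.card = 3 ∧ ∀ i ∈ t, ∀ j ∈ t, i ≠ j → dist i j = ε

/-- The closed triangle with vertex set `t`. -/
def cell (t : Finset (lattice ε)) : Set E2 := convexHull ℝ (Subtype.val '' (t : Set (lattice ε)))

/-- The exchange energy of a triangle: half of the sum of `|u(i) - u(j)|²` over its three edges.
The double sum below counts each edge twice. -/
noncomputable def exchangeT (u : SpinField ε) (t : Finset (lattice ε)) : ℝ :=
  1 / 4 * ∑ i ∈ t, ∑ j ∈ t, ‖(u i : E3) - (u j : E3)‖ ^ 2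

/-- The Zeeman energy of a triangle. -/
noncomputable def zeemanT (u : SpinField ε) (t : Finset (lattice ε)) : ℝ :=
  1 / 2 * ∑ i ∈ t, ‖(u i : E3) - north‖ ^ 2

/-- The discrete exchange energy on `Ω`: the sum over the elementary triangles contained in `Ω`
(there are finitely many when `Ω` is bounded). -/
noncomputable def exchange (u : SpinField ε) (Ω : Set E2) : ℝ :=
  ∑ᶠ t ∈ {t : Finset (lattice ε) | IsTriangle t ∧ cell t ⊆ Ω}, exchangeT u t

/-- The discrete Zeeman energy on `Ω`. -/
noncomputable def zeeman (u : SpinField ε) (Ω : Set E2) : ℝ :=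
  ∑ᶠ t ∈ {t : Finset (lattice ε) | IsTriangle t ∧ cell t ⊆ Ω}, zeemanT u t

/-! ### Interpolation regions -/

/-- Two triangles are neighbors if they intersect exactly in a lattice edge on whose endpoints the
spin field takes antipodal values. -/
def Neighbor (u : SpinField ε) (t t' : Finset (lattice ε)) : Prop :=
  IsTriangle t ∧ IsTriangle t' ∧ ∃ i j : lattice ε,
    dist i j = ε ∧ u i = -u j ∧ cell t ∩ cell t' = segment ℝ (i : E2) (j : E2)

/-- A finite union of elementary triangles which are pairwise joined by chains of neighbors. -/
def IsConnectedRegion (u : SpinField ε) (R : Set E2) : Prop :=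
  ∃ F : Finset (Finset (lattice ε)), (∀ t ∈ F, IsTriangle t) ∧
    (∀ t ∈ F, ∀ t' ∈ F, Relation.ReflTransGen (Neighbor u) t t') ∧ R = ⋃ t ∈ F, cell t

/-- The admissible interpolation regions: connected regions that are maximal for inclusion. -/
def regions (u : SpinField ε) : Set (Set E2) := {R | Maximal (IsConnectedRegion u) R}

/-! ### Interpolation surfaces -/

/-- The values of the spin field on the lattice nodes lying in `R`. -/
def values (u : SpinField ε) (R : Set E2) : Set E3 :=
  {w | ∃ i : lattice ε, (i : E2) ∈ R ∧ (u i : E3) = w}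

/-- The convex cone of all nonnegative combinations of the vectors in `W`. -/
noncomputable def cone (W : Set E3) : Set E3 := (PointedCone.hull ℝ W : Set E3)

/-- The radial projection to the unit sphere of the nonzero vectors of `K`. -/
noncomputable def radial (K : Set E3) : Set E3 := {z | ∃ y ∈ K, y ≠ 0 ∧ z = ‖y‖⁻¹ • y}

/-- `S` is an admissible interpolation surface for `u` in `R`: the radial projection of the cone
spanned by the values of `u` in `R`, to which, if the cone is a linear subspace, a unit vector
`h` orthogonal to it is added as a generator. -/
def IsAdmissibleSurface (u : SpinField ε) (R : Set E2) (S : Set E3) : Prop :=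
  ((¬ ∃ L : Submodule ℝ E3, (L : Set E3) = cone (values u R)) ∧
      S = radial (cone (values u R))) ∨
  ((∃ L : Submodule ℝ E3, (L : Set E3) = cone (values u R)) ∧
      ∃ h : E3, ‖h‖ = 1 ∧ (∀ y ∈ cone (values u R), inner ℝ h y = 0) ∧
        S = radial (cone (insert h (values u R))))

/-- The two-dimensional Hausdorff measure in three-space (normalized so that it is area). -/
noncomputable def area (S : Set E3) : ℝ≥0∞ := (Measure.euclideanHausdorffMeasure 2 : Measure E3) S

/-! ### Boundary edges and their orientation -/

/-- The counterclockwise rotation of the plane by sixty degrees. -/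
noncomputable def rot60 (x : E2) : E2 :=
  !₂[1 / 2 * x 0 - √3 / 2 * x 1, √3 / 2 * x 0 + 1 / 2 * x 1]

/-- The third vertex of the equilateral triangle on the left of the edge from `i` to `j`. -/
noncomputable def leftVertex (i j : E2) : E2 := i + rot60 (j - i)

/-- `(i, j)` is a boundary edge of `R`, oriented from `i` to `j`: the values of `u` at its endpoints
are not antipodal, the triangle on its left lies in `R`, and the triangle on its right lies in the
complement of the interior of `R`. -/
def IsBoundaryEdge (u : SpinField ε) (R : Set E2) (e : lattice ε × lattice ε) : Prop :=
  dist e.1 e.2 = ε ∧ u e.1 ≠ -u e.2 ∧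
    convexHull ℝ {(e.1 : E2), (e.2 : E2), leftVertex e.1 e.2} ⊆ R ∧
    convexHull ℝ {(e.1 : E2), (e.2 : E2), leftVertex e.2 e.1} ⊆ (interior R)ᶜ

/-- The oriented boundary edge `e = (i, j)` precedes the oriented boundary edge `f = (j, k)`:
`[i, j]` is obtained by rotating `[j, k]` counterclockwise around `j`, and the rotation sweeps
only over triangles contained in `R`. -/
def Precedes (u : SpinField ε) (R : Set E2) (e f : lattice ε × lattice ε) : Prop :=
  IsBoundaryEdge u R e ∧ IsBoundaryEdge u R f ∧ e.2 = f.1 ∧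
    ∃ m : ℕ, 1 ≤ m ∧ m ≤ 5 ∧
      (e.1 : E2) - (f.1 : E2) = rot60^[m] ((f.2 : E2) - (f.1 : E2)) ∧
      ∀ a < m, convexHull ℝ {(f.1 : E2),
        (f.1 : E2) + rot60^[a] ((f.2 : E2) - (f.1 : E2)),
        (f.1 : E2) + rot60^[a + 1] ((f.2 : E2) - (f.1 : E2))} ⊆ R

open Classical in
/-- The minimizing geodesic of the sphere from `p` to `q`, with constant speed on `[0, 1]`
(for unit vectors `p`, `q` that are not antipodal). -/
noncomputable def geodesic (p q : E3) (s : ℝ) : E3 :=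
  if p = q then p else
    (Real.sin (InnerProductGeometry.angle p q))⁻¹ •
      (Real.sin ((1 - s) * InnerProductGeometry.angle p q) • p +
        Real.sin (s * InnerProductGeometry.angle p q) • q)

/-- The boundary relative to the sphere of a subset `S` of the sphere. -/
def relBoundary (S : Set E3) : Set E3 := closure S ∩ closure (S2 \ S)

/-- `α` is, on `[0, N]`, a simple closed parametrization of the relative boundary of `S`, and it is
the concatenation of the geodesics associated by `u` to `N` oriented boundary edges
`Γ 0, …, Γ (N - 1)` of `R` which follow each other cyclically in the order of precedence. -/
def IsBoundaryCurve (u : SpinField ε) (R : Set E2) (S : Set E3) (N : ℕ) (α : ℝ → E3) : Prop :=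
  (N = 3 ∨ N = 4) ∧
  (∃ Γ : ℕ → lattice ε × lattice ε,
    Γ N = Γ 0 ∧
    (∀ m < N, IsBoundaryEdge u R (Γ m)) ∧
    (∀ m < N, Relation.TransGen (Precedes u R) (Γ m) (Γ (m + 1))) ∧
    ∀ m < N, ∀ s ∈ Icc (0 : ℝ) 1, α (m + s) = geodesic (u (Γ m).1) (u (Γ m).2) s) ∧
  α 0 = α N ∧ InjOn α (Ico 0 (N : ℝ)) ∧ α '' Icc 0 (N : ℝ) = relBoundary S

/-- The curve `α`, smooth on `(0, N)` away from the integers, is positively oriented with respect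
to `S`: at each smooth point the vector `α × α'` points toward `S`, that is, it has nonnegative
product with the initial velocity of every curve that starts at that point and runs in `S`. -/
def IsPositivelyOriented (S : Set E3) (N : ℕ) (α : ℝ → E3) : Prop :=
  ∀ t ∈ Ioo 0 (N : ℝ), (∀ m : ℕ, t ≠ m) → ∀ (β : ℝ → E3) (b : E3), β 0 = α t →
    HasDerivWithinAt β b (Ici 0) 0 → (∀ᶠ s in 𝓝[>] (0 : ℝ), β s ∈ S) →
    0 ≤ inner ℝ (cross (α t) (deriv α t)) b

/-- `σ` is an admissible sign for `u`, `R` and `S`. It is `1` or `-1`; if `S` has positive area, it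
is `1` when the boundary curve induced by `u` is positively oriented with respect to `S`, and `-1`
otherwise. -/
def IsAdmissibleSign (u : SpinField ε) (R : Set E2) (S : Set E3) (σ : ℝ) : Prop :=
  (σ = 1 ∨ σ = -1) ∧
  (0 < area S → ∃ (N : ℕ) (α : ℝ → E3), IsBoundaryCurve u R S N α ∧
    (σ = 1 ↔ IsPositivelyOriented S N α))

/-- `μ` is the admissible topological charge `∑_R σ_R area(S_R) δ_{x_R}` for the spin field `u`,
given by the points `x`, the surfaces `S` and the signs `σ`; being an atomic measure, it has only
finitely many nonzero coefficients. -/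
structure IsAdmissibleCharge (u : SpinField ε) (μ : SignedMeasure E2)
    (x : Set E2 → E2) (S : Set E2 → Set E3) (σ : Set E2 → ℝ) : Prop where
  mem_interior : ∀ R ∈ regions u, x R ∈ interior R
  surface : ∀ R ∈ regions u, IsAdmissibleSurface u R (S R)
  sign : ∀ R ∈ regions u, IsAdmissibleSign u R (S R) (σ R)
  finite : {R | R ∈ regions u ∧ σ R * (area (S R)).toReal ≠ 0}.Finite
  eq_sum : μ = ∑ᶠ R ∈ regions u, VectorMeasure.dirac (x R) (σ R * (area (S R)).toReal)

/-! ### Sobolev maps into the sphere, topological charge density, flat norm -/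

/-- `D` is the weak partial derivative of `w` in the `k`-th coordinate direction. -/
def IsWeakPartial (w : E2 → E3) (k : Fin 2) (D : E2 → E3) : Prop :=
  ∀ φ : E2 → ℝ, ContDiff ℝ ∞ φ → HasCompactSupport φ →
    ∫ x, (fderiv ℝ φ x (EuclideanSpace.single k 1)) • w x = - ∫ x, φ x • D x

/-- `w` belongs to the class `𝒰(Ω)` and `D` is its weak gradient: `|w| = 1` almost everywhere,
`w = n` almost everywhere outside `Ω`, and `w - n` is of class `H¹` on the plane. -/
structure MemU (Ω : Set E2) (w : E2 → E3) (D : Fin 2 → E2 → E3) : Prop where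
  norm_eq_one : ∀ᵐ x, ‖w x‖ = 1
  eq_north : ∀ᵐ x, x ∉ Ω → w x = north
  memLp : MemLp (fun x => w x - north) 2
  memLp_grad : ∀ k, MemLp (D k) 2
  weak_grad : ∀ k, IsWeakPartial w k (D k)

/-- The topological charge density `w · ∂₁w × ∂₂w`. -/
noncomputable def chargeDensity (w : E2 → E3) (D : Fin 2 → E2 → E3) (x : E2) : ℝ :=
  inner ℝ (w x) (cross (D 0 x) (D 1 x))

/-- The flat norm on the open set `U`: the supremum of `∫ φ dν` over all `φ ∈ C_c^∞(U)` such that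
`|φ| ≤ 1` and `|∇φ| ≤ 1`. (The supremum is nonnegative since `φ = 0` is allowed.) -/
noncomputable def flatNorm (U : Set E2) (ν : SignedMeasure E2) : ℝ≥0∞ :=
  ⨆ φ ∈ {φ : E2 → ℝ | ContDiff ℝ ∞ φ ∧ HasCompactSupport φ ∧ tsupport φ ⊆ U ∧
      (∀ x, |φ x| ≤ 1) ∧ ∀ x, ‖fderiv ℝ φ x‖ ≤ 1},
    ENNReal.ofReal (∫ᵛ x, φ x ∂•ν)

/-- `w` is the radial projection of a continuous nowhere vanishing map which is affine on each
triangle of the refined lattice. The refined triangles are spanned by a vertex of an elementary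
triangle, the midpoint of an adjacent edge and the barycenter. -/
def IsRefinedInterpolation (ε : ℝ) (w : E2 → E3) : Prop :=
  ∃ v : E2 → E3, Continuous v ∧ (∀ x, v x ≠ 0) ∧ (∀ x, w x = ‖v x‖⁻¹ • v x) ∧
    ∀ i j k : lattice ε, dist i j = ε → dist j k = ε → dist k i = ε →
      ∃ A : E2 →ᵃ[ℝ] E3, EqOn v A (convexHull ℝ {(i : E2), (1 / 2 : ℝ) • ((i : E2) + j),
        (1 / 3 : ℝ) • ((i : E2) + j + k)})

end LatticeSpin

open LatticeSpin

namespace LatticeSpin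

/-! ### Coordinates, triple products -/

/-! The charge of a normalized piecewise affine map is computed exactly, as a sum of signed solid
angles, and the same solid angles tile the surfaces `S R`. Everything rests on one vector per
region, its apex `e` (`IsApex`): a unit vector at no obtuse angle to any spin of the region, lying
in the cone of these spins, or orthogonal to it when the cone is a subspace.

Interpolation. The values are the spins at the nodes, `e` at the barycenters, the normalized sum of
the two spins at the midpoint of a non-antipodal edge, and `e` again at the midpoint of an antipodal
edge. The two triangles along an antipodal edge belong to the same region and hence have the same
apex, so the piecewise affine map `lin` is continuous. Nonobtuse angles keep it at distance at least
`1 / 2` from the origin (`norm_combo_ge`), so its normalization `sph` is Lipschitz. Apex and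
midpoint values deviate from the spins of a triangle by a multiple of the oscillation of these
spins, which bounds the gradient by the root of the exchange energy over `ε` and gives both energy
estimates.

Charge of a region. On a refined triangle the charge density integrates to the solid angle of the
three vertex values (`integral_chargeDensity_openTri`). An antipodal edge contributes nothing
because `e` is repeated, and the two halves of any other edge recombine (`solidAngle_midVec_add`).
What remains is the sum of `solidAngle a b e` over the non-antipodal edges. Counting antipodal edges
(`HasAxis.exists_ends`) shows that a region is a single triangle without antipodal edge, or carries
only spins `p` and `-p`, or has values `p, -p, q₁, q₂` with exactly two end triangles. In the first
and the last case the spherical triangles over `e` share one orientation `s` and tile `S R`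
(`IsApex.area_three`, `IsApex.area_four`); in the second the area is zero (`IsApex.area_axis`). The
sign of `triple a b` on `S R` decides to which side of the boundary curve the surface lies, so `s`
is the admissible sign whenever the area is positive (`RegionData.charge_eq`).

Flat distance. Every triangle with an antipodal edge has energy at least one, so a region has
diameter at most `ε` times energy plus one. On each triangle a test function differs from its value
at `x R` by at most that diameter, and the charge density is bounded by the exchange energy density
(`IsFilling.flatNorm_le`).

Quantization. Unit vectors lift to spinors, and the product of the overlaps around a triple has half
the solid angle as its phase (`overlap_mul_three`). In the product over all triangles each interior
edge is traversed in both directions and cancels, while all edges leaving the support carry the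
constant spin `north`. The total phase is therefore trivial (`exists_int_sum_edgeSum`). -/

lemma inner_E3 (a b : E3) : inner ℝ a b = a 0 * b 0 + a 1 * b 1 + a 2 * b 2 := by
  simp [PiLp.inner_apply, Fin.sum_univ_three, mul_comm]

lemma norm_sq_E3 (a : E3) : ‖a‖ ^ 2 = a 0 ^ 2 + a 1 ^ 2 + a 2 ^ 2 := by
  simp [EuclideanSpace.norm_sq_eq, Fin.sum_univ_three]

lemma cross_zero (a b : E3) : cross a b 0 = a 1 * b 2 - a 2 * b 1 := by
  simp [cross, cross_apply]

lemma cross_one (a b : E3) : cross a b 1 = a 2 * b 0 - a 0 * b 2 := by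
  simp [cross, cross_apply]

lemma cross_two (a b : E3) : cross a b 2 = a 0 * b 1 - a 1 * b 0 := by
  simp [cross, cross_apply]

/-- The scalar triple product. -/
noncomputable def triple (a b c : E3) : ℝ := inner ℝ a (cross b c)

lemma triple_eq (a b c : E3) : triple a b c =
    a 0 * (b 1 * c 2 - b 2 * c 1) + a 1 * (b 2 * c 0 - b 0 * c 2)
      + a 2 * (b 0 * c 1 - b 1 * c 0) := by
  rw [triple, inner_E3, cross_zero, cross_one, cross_two]

lemma inner_cross_eq_triple (a b c : E3) : inner ℝ (cross a b) c = triple a b c := by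
  rw [triple_eq, inner_E3, cross_zero, cross_one, cross_two]; ring

lemma triple_rotate (a b c : E3) : triple b c a = triple a b c := by
  simp only [triple_eq]; ring

lemma triple_swap (a b c : E3) : triple b a c = - triple a b c := by
  simp only [triple_eq]; ring

lemma triple_self_left (a b : E3) : triple a a b = 0 := by
  simp only [triple_eq]; ring

lemma triple_self_right (a b : E3) : triple a b b = 0 := by
  simp only [triple_eq]; ring

lemma triple_self_outer (a b : E3) : triple a b a = 0 := by
  simp only [triple_eq]; ring

lemma triple_neg_left (a b c : E3) : triple (-a) b c = - triple a b c := by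
  simp only [triple_eq, PiLp.neg_apply]; ring

lemma triple_neg_mid (a b c : E3) : triple a (-b) c = - triple a b c := by
  simp only [triple_eq, PiLp.neg_apply]; ring

lemma triple_neg_right (a b c : E3) : triple a b (-c) = - triple a b c := by
  simp only [triple_eq, PiLp.neg_apply]; ring

lemma triple_add_right (a b c d : E3) : triple a b (c + d) = triple a b c + triple a b d := by
  simp only [triple_eq, PiLp.add_apply]; ring

lemma triple_smul_right (a b c : E3) (r : ℝ) : triple a b (r • c) = r * triple a b c := by
  simp only [triple_eq, PiLp.smul_apply, smul_eq_mul]; ring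

/-- The Gram determinant identity. -/
lemma triple_sq (a b c : E3) : triple a b c ^ 2 =
    ‖a‖ ^ 2 * ‖b‖ ^ 2 * ‖c‖ ^ 2 + 2 * inner ℝ a b * inner ℝ b c * inner ℝ c a
      - ‖a‖ ^ 2 * inner ℝ b c ^ 2 - ‖b‖ ^ 2 * inner ℝ c a ^ 2 - ‖c‖ ^ 2 * inner ℝ a b ^ 2 := by
  simp only [triple_eq, norm_sq_E3, inner_E3]; ring

/-! ### The solid angle -/

/-- The real part of the complex number whose argument is half of the solid angle. -/
noncomputable def solidRe (a b c : E3) : ℝ :=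
  ‖a‖ * ‖b‖ * ‖c‖ + inner ℝ a b * ‖c‖ + inner ℝ b c * ‖a‖ + inner ℝ c a * ‖b‖

/-- The complex number whose argument is half of the solid angle. -/
noncomputable def solidZ (a b c : E3) : ℂ := ⟨solidRe a b c, triple a b c⟩

/-- The signed solid angle of the triangle with vertices `a`, `b`, `c`. -/
noncomputable def solidAngle (a b c : E3) : ℝ := 2 * (solidZ a b c).arg

lemma solidRe_swap (a b c : E3) : solidRe b a c = solidRe a b c := by
  simp only [solidRe, real_inner_comm]; ring

lemma one_add_inner_pos {a b : E3} (ha : ‖a‖ = 1) (hb : ‖b‖ = 1) (h : a ≠ -b) :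
    0 < 1 + inner ℝ a b := by
  have h1 : ‖a + b‖ ^ 2 = 2 * (1 + inner ℝ a b) := by
    rw [norm_add_sq_real, ha, hb]; ring
  have h2 : 0 < ‖a + b‖ := norm_pos_iff.2 fun h0 => h (eq_neg_of_add_eq_zero_left h0)
  nlinarith [pow_pos h2 2]

/-! ### Spinors, overlaps, and the phase of a spherical triangle. -/

/-- Two vectors representing the pure states of a unit vector. -/
lemma exists_spinor (a : E3) (ha : ‖a‖ = 1) : ∃ p q : ℂ,
    p * starRingEnd ℂ p = 1 + a 2 ∧ q * starRingEnd ℂ q = 1 - a 2 ∧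
      starRingEnd ℂ p * q = a 0 + a 1 * Complex.I := by
  have hn := norm_sq_E3 a
  rw [ha] at hn
  by_cases h : 1 + a 2 = 0
  · have h2 : a 2 = -1 := by linarith
    have h0 : a 0 = 0 := by nlinarith [sq_nonneg (a 0), sq_nonneg (a 1)]
    have h1 : a 1 = 0 := by nlinarith [sq_nonneg (a 0), sq_nonneg (a 1)]
    refine ⟨0, (√2 : ℝ), ?_, ?_, ?_⟩
    · simp [h2]
    · rw [Complex.conj_ofReal, ← Complex.ofReal_mul, Real.mul_self_sqrt (by norm_num), h2]
      push_cast; ring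
    · simp [h0, h1]
  · have hp : 0 < 1 + a 2 := by
      refine lt_of_le_of_ne ?_ (Ne.symm h)
      nlinarith [sq_nonneg (a 0), sq_nonneg (a 1)]
    set r := √(1 + a 2) with hr
    have hr0 : 0 < r := Real.sqrt_pos.2 hp
    have hrr : (r : ℂ) * r = 1 + a 2 := by
      rw [← Complex.ofReal_mul, hr, Real.mul_self_sqrt hp.le]; push_cast; ring
    have hrne : (r : ℂ) ≠ 0 := by exact_mod_cast hr0.ne'
    refine ⟨r, (a 0 + a 1 * Complex.I) / r, ?_, ?_, ?_⟩
    · rw [Complex.conj_ofReal, hrr]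
    · simp only [map_div₀, map_add, map_mul, Complex.conj_ofReal, Complex.conj_I]
      rw [div_mul_div_comm, hrr, div_eq_iff (by simpa using Complex.ofReal_ne_zero.2 h)]
      have : ((a 0 : ℂ) + a 1 * Complex.I) * (a 0 + a 1 * -Complex.I) = a 0 ^ 2 + a 1 ^ 2 := by
        linear_combination (-(a 1 : ℂ) ^ 2) * Complex.I_sq
      rw [this]
      have h3 : (a 0) ^ 2 + (a 1) ^ 2 = (1 - a 2) * (1 + a 2) := by linarith
      simpa using congrArg (fun t : ℝ => (t : ℂ)) h3
    · rw [Complex.conj_ofReal]; field_simp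

open Classical in
/-- A chosen spinor over a unit vector. -/
noncomputable def spinor (a : E3) : ℂ × ℂ :=
  if ha : ‖a‖ = 1 then ((exists_spinor a ha).choose, (exists_spinor a ha).choose_spec.choose)
  else 0

lemma spinor_spec {a : E3} (ha : ‖a‖ = 1) :
    (spinor a).1 * starRingEnd ℂ (spinor a).1 = 1 + a 2 ∧
    (spinor a).2 * starRingEnd ℂ (spinor a).2 = 1 - a 2 ∧
      starRingEnd ℂ (spinor a).1 * (spinor a).2 = a 0 + a 1 * Complex.I := by
  rw [spinor, dif_pos ha]
  exact (exists_spinor a ha).choose_spec.choose_spec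

/-- The overlap of the spinors of two unit vectors. -/
noncomputable def overlap (a b : E3) : ℂ :=
  starRingEnd ℂ (spinor a).1 * (spinor b).1 + starRingEnd ℂ (spinor a).2 * (spinor b).2

lemma conj_overlap (a b : E3) : starRingEnd ℂ (overlap a b) = overlap b a := by
  simp only [overlap, map_add, map_mul, Complex.conj_conj]; ring

lemma spinor_conj {a : E3} (ha : ‖a‖ = 1) :
    (spinor a).1 * starRingEnd ℂ (spinor a).2 = a 0 - a 1 * Complex.I := by
  have := congrArg (starRingEnd ℂ) (spinor_spec ha).2.2
  simp only [map_add, map_mul, Complex.conj_conj, Complex.conj_ofReal, Complex.conj_I] at this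
  rw [this]; ring

/-- The matrix `ψψ*` of a spinor over `a` is `1 + a·σ` with the Pauli matrices `σ`; this is the
trace of a product of two such matrices. -/
lemma overlap_mul_overlap {a b : E3} (ha : ‖a‖ = 1) (hb : ‖b‖ = 1) :
    overlap a b * overlap b a = ((2 * (1 + inner ℝ a b) : ℝ) : ℂ) := by
  obtain ⟨a1, a2, a3⟩ := spinor_spec ha
  obtain ⟨b1, b2, b3⟩ := spinor_spec hb
  have a4 := spinor_conj ha
  have b4 := spinor_conj hb
  have : overlap a b * overlap b a =
      ((spinor a).1 * starRingEnd ℂ (spinor a).1) * ((spinor b).1 * starRingEnd ℂ (spinor b).1)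
      + ((spinor a).2 * starRingEnd ℂ (spinor a).2) * ((spinor b).2 * starRingEnd ℂ (spinor b).2)
      + (starRingEnd ℂ (spinor a).1 * (spinor a).2) * ((spinor b).1 * starRingEnd ℂ (spinor b).2)
      + ((spinor a).1 * starRingEnd ℂ (spinor a).2) *
        (starRingEnd ℂ (spinor b).1 * (spinor b).2) := by
    simp only [overlap]; ring
  rw [this, a1, a2, a3, a4, b1, b2, b3, b4, inner_E3]
  push_cast
  linear_combination (-2 * (a 1 : ℂ) * b 1) * Complex.I_sq

/-- Trace of `(1 + a·σ)(1 + b·σ)(1 + c·σ)` in terms of Pauli matrices. The choice of phase of each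
spinor cancels around the loop, and this makes solid angles multiplicative under gluing. -/
lemma overlap_mul_three {a b c : E3} (ha : ‖a‖ = 1) (hb : ‖b‖ = 1) (hc : ‖c‖ = 1) :
    overlap a b * overlap b c * overlap c a = 2 * solidZ a b c := by
  obtain ⟨a1, a2, a3⟩ := spinor_spec ha
  obtain ⟨b1, b2, b3⟩ := spinor_spec hb
  obtain ⟨c1, c2, c3⟩ := spinor_spec hc
  have a4 := spinor_conj ha
  have b4 := spinor_conj hb
  have c4 := spinor_conj hc
  have : overlap a b * overlap b c * overlap c a =
      ((spinor a).1 * starRingEnd ℂ (spinor a).1) * ((spinor b).1 * starRingEnd ℂ (spinor b).1)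
        * ((spinor c).1 * starRingEnd ℂ (spinor c).1)
      + ((spinor a).1 * starRingEnd ℂ (spinor a).1) * ((spinor b).1 * starRingEnd ℂ (spinor b).2)
        * (starRingEnd ℂ (spinor c).1 * (spinor c).2)
      + ((spinor a).1 * starRingEnd ℂ (spinor a).2) * (starRingEnd ℂ (spinor b).1 * (spinor b).2)
        * ((spinor c).1 * starRingEnd ℂ (spinor c).1)
      + ((spinor a).1 * starRingEnd ℂ (spinor a).2) * ((spinor b).2 * starRingEnd ℂ (spinor b).2)
        * (starRingEnd ℂ (spinor c).1 * (spinor c).2)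
      + (starRingEnd ℂ (spinor a).1 * (spinor a).2) * ((spinor b).1 * starRingEnd ℂ (spinor b).1)
        * ((spinor c).1 * starRingEnd ℂ (spinor c).2)
      + (starRingEnd ℂ (spinor a).1 * (spinor a).2) * ((spinor b).1 * starRingEnd ℂ (spinor b).2)
        * ((spinor c).2 * starRingEnd ℂ (spinor c).2)
      + ((spinor a).2 * starRingEnd ℂ (spinor a).2) * (starRingEnd ℂ (spinor b).1 * (spinor b).2)
        * ((spinor c).1 * starRingEnd ℂ (spinor c).2)
      + ((spinor a).2 * starRingEnd ℂ (spinor a).2) * ((spinor b).2 * starRingEnd ℂ (spinor b).2)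
        * ((spinor c).2 * starRingEnd ℂ (spinor c).2) := by
    simp only [overlap]; ring
  rw [this, a1, a2, a3, a4, b1, b2, b3, b4, c1, c2, c3, c4, solidZ, solidRe, ha, hb, hc]
  apply Complex.ext
  · simp [inner_E3]; ring
  · simp [triple_eq]; ring

lemma overlap_ne_zero {a b : E3} (ha : ‖a‖ = 1) (hb : ‖b‖ = 1) (h : a ≠ -b) :
    overlap a b ≠ 0 := by
  intro h0
  have h1 := overlap_mul_overlap ha hb
  rw [h0, zero_mul] at h1
  have h2 := one_add_inner_pos ha hb h
  have h3 : (2 * (1 + inner ℝ a b) : ℝ) = 0 := by exact_mod_cast h1.symm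
  linarith

lemma exp_solidAngle_mul_norm (a b c : E3) :
    (‖solidZ a b c‖ : ℂ) * Complex.exp ((solidAngle a b c / 2 : ℝ) * Complex.I) =
      solidZ a b c := by
  rw [solidAngle, mul_div_cancel_left₀ _ (by norm_num : (2 : ℝ) ≠ 0)]
  exact Complex.norm_mul_exp_arg_mul_I _

lemma solidAngle_nonneg {a b c : E3} (h : 0 ≤ triple a b c) : 0 ≤ solidAngle a b c :=
  mul_nonneg zero_le_two (Complex.arg_nonneg_iff.2 h)

/-- Exchanging two vertices conjugates `solidZ`. The argument changes sign except on the negative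
real axis, which the hypothesis excludes. -/
lemma solidAngle_swap_of_ne {a b c : E3} (h : triple a b c ≠ 0 ∨ 0 < solidRe a b c) :
    solidAngle b a c = - solidAngle a b c := by
  have h1 : solidZ b a c = starRingEnd ℂ (solidZ a b c) := by
    apply Complex.ext
    · simp [solidZ, solidRe_swap]
    · simp [solidZ, triple_swap a b c]
  rw [solidAngle, solidAngle, h1, Complex.arg_conj, if_neg]
  · ring
  · intro h2
    rw [Complex.arg_eq_pi_iff] at h2
    rcases h with h | h
    · exact h h2.2
    · exact absurd h2.1 (not_lt.2 h.le)

lemma solidAngle_eq_zero {a b c : E3} (h : triple a b c = 0) (h' : 0 ≤ solidRe a b c) :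
    solidAngle a b c = 0 := by
  rw [solidAngle, Complex.arg_eq_zero_iff.2 ⟨h', h⟩, mul_zero]

lemma solidRe_pos {a b e : E3} (ha : ‖a‖ = 1) (hb : ‖b‖ = 1) (he : ‖e‖ = 1) (hab : a ≠ -b)
    (hea : 0 ≤ inner ℝ e a) (heb : 0 ≤ inner ℝ e b) : 0 < solidRe a b e := by
  have := one_add_inner_pos ha hb hab
  rw [real_inner_comm] at heb
  rw [solidRe, ha, hb, he]
  linarith

lemma abs_arg_solidZ_lt {a b e : E3} (h : 0 < solidRe a b e) :
    |(solidZ a b e).arg| < Real.pi / 2 :=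
  Complex.abs_arg_lt_pi_div_two_iff.2 (Or.inl h)

lemma solidAngle_eq_arctan {a b e : E3} (h : 0 < solidRe a b e) :
    solidAngle a b e = 2 * Real.arctan (triple a b e / solidRe a b e) := by
  have h1 := abs_lt.1 (abs_arg_solidZ_lt h)
  have h2 := Complex.tan_arg (solidZ a b e)
  rw [solidAngle, ← Real.arctan_tan h1.1 h1.2, h2]
  rfl

/-- The normalized sum of two vectors. -/
noncomputable def midVec (a b : E3) : E3 := ‖a + b‖⁻¹ • (a + b)

lemma add_ne_zero_of_ne_neg {a b : E3} (hab : a ≠ -b) : a + b ≠ 0 :=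
  fun h => hab (eq_neg_of_add_eq_zero_left h)

lemma norm_midVec {a b : E3} (hab : a ≠ -b) : ‖midVec a b‖ = 1 := by
  rw [midVec, norm_smul, norm_inv, norm_norm,
    inv_mul_cancel₀ (norm_ne_zero_iff.2 (add_ne_zero_of_ne_neg hab))]

lemma midVec_comm (a b : E3) : midVec a b = midVec b a := by
  rw [midVec, midVec, add_comm]

lemma inner_midVec (a b c : E3) :
    inner ℝ (midVec a b) c = ‖a + b‖⁻¹ * (inner ℝ a c + inner ℝ b c) := by
  rw [midVec, inner_smul_left, inner_add_left]; simp

lemma inner_midVec_left_nonneg {a b : E3} (ha : ‖a‖ = 1) (hb : ‖b‖ = 1) :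
    0 ≤ inner ℝ (midVec a b) a := by
  rw [inner_midVec, real_inner_self_eq_norm_sq, ha]
  have h := neg_le_of_abs_le (abs_real_inner_le_norm b a)
  rw [ha, hb] at h
  exact mul_nonneg (by positivity) (by linarith)

lemma inner_midVec_right_nonneg {a b : E3} (ha : ‖a‖ = 1) (hb : ‖b‖ = 1) :
    0 ≤ inner ℝ (midVec a b) b := by
  rw [midVec_comm]; exact inner_midVec_left_nonneg hb ha

lemma inner_midVec_nonneg {a b e : E3} (hea : 0 ≤ inner ℝ e a) (heb : 0 ≤ inner ℝ e b) :
    0 ≤ inner ℝ e (midVec a b) := by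
  rw [real_inner_comm, inner_midVec]
  rw [real_inner_comm] at hea heb
  positivity

lemma ne_neg_of_inner_nonneg {a b : E3} (ha : ‖a‖ = 1) (h : 0 ≤ inner ℝ a b) : a ≠ -b := by
  intro h1
  have h2 : b = -a := by rw [h1, neg_neg]
  rw [h2, inner_neg_right, real_inner_self_eq_norm_sq, ha] at h
  norm_num at h

/-- Subdividing the edge `ab` of a spherical triangle at its midpoint. -/
lemma solidAngle_midVec_add {a b e : E3} (ha : ‖a‖ = 1) (hb : ‖b‖ = 1) (he : ‖e‖ = 1)
    (hab : a ≠ -b) (hea : 0 ≤ inner ℝ e a) (heb : 0 ≤ inner ℝ e b) :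
    solidAngle a (midVec a b) e + solidAngle (midVec a b) b e = solidAngle a b e := by
  set m := midVec a b with hmdef
  have hm : ‖m‖ = 1 := norm_midVec hab
  have hma := inner_midVec_left_nonneg ha hb
  have hmb := inner_midVec_right_nonneg ha hb
  have hem := inner_midVec_nonneg hea heb
  rw [← hmdef] at hma hmb hem
  have r1 : 0 < solidRe a m e := solidRe_pos ha hm he
    (ne_neg_of_inner_nonneg ha (by rwa [real_inner_comm])) hea hem
  have r2 : 0 < solidRe m b e := solidRe_pos hm hb he (ne_neg_of_inner_nonneg hm hmb) hem heb
  have h1 := abs_lt.1 (abs_arg_solidZ_lt r1)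
  have h2 := abs_lt.1 (abs_arg_solidZ_lt r2)
  have n1 : solidZ a m e ≠ 0 := fun h => r1.ne' (congrArg Complex.re h)
  have n2 : solidZ m b e ≠ 0 := fun h => r2.ne' (congrArg Complex.re h)
  -- Both arguments lie strictly between `-π/2` and `π/2`, so their sum does not wrap around.
  have hsum : (solidZ a m e * solidZ m b e).arg = (solidZ a m e).arg + (solidZ m b e).arg :=
    (Complex.arg_mul_eq_add_arg_iff n1 n2).2 ⟨by linarith [h1.1, h2.1], by linarith [h1.2, h2.2]⟩
  have hk := one_add_inner_pos ha hb hab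
  have hamb : solidZ a m b = ((solidRe a m b : ℝ) : ℂ) := by
    apply Complex.ext
    · simp [solidZ]
    · have : triple a m b = 0 := by
        simp only [hmdef, midVec, triple_eq, PiLp.smul_apply, PiLp.add_apply, smul_eq_mul]; ring
      simp [solidZ, this]
  have hr : 0 < solidRe a m b := by
    rw [solidRe, ha, hb, hm]
    rw [real_inner_comm] at hma
    rw [real_inner_comm] at hk
    linarith
  -- Overlaps along the path through `m` recombine into the loop `a b e`, up to the loop `a m b` and
  -- factors `|overlap|²`. The loop `a m b` is a positive real because the three vectors are
  -- coplanar.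
  have key : solidZ a m e * solidZ m b e =
      (((1 + inner ℝ m e) * solidRe a m b / (1 + inner ℝ a b) : ℝ) : ℂ) * solidZ a b e := by
    have e1 := overlap_mul_three ha hm he
    have e2 := overlap_mul_three hm hb he
    have e3 := overlap_mul_three ha hb he
    have e4 := overlap_mul_three ha hm hb
    have e5 := overlap_mul_overlap hm he
    have e6 := overlap_mul_overlap ha hb
    rw [hamb] at e4
    have hkc : ((1 + inner ℝ a b : ℝ) : ℂ) ≠ 0 := Complex.ofReal_ne_zero.2 hk.ne'
    have e7 : (2 * solidZ a m e) * (2 * solidZ m b e) * (overlap a b * overlap b a) =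
        (overlap m e * overlap e m) * (overlap a m * overlap m b * overlap b a) *
          (overlap a b * overlap b e * overlap e a) := by
      rw [← e1, ← e2]; ring
    rw [e3, e4, e5, e6] at e7
    rw [Complex.ofReal_div, Complex.ofReal_mul, div_mul_eq_mul_div, eq_div_iff hkc]
    push_cast at e7 ⊢
    linear_combination e7 / 8
  have hpos : 0 < (1 + inner ℝ m e) * solidRe a m b / (1 + inner ℝ a b) := by
    rw [real_inner_comm] at hem
    positivity
  rw [key, Complex.arg_real_mul _ hpos] at hsum
  rw [solidAngle, solidAngle, solidAngle, hsum]; ring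

/-! ### The solid angle as an integral -/

/-- The parametrization by the unit square of the triangle with vertices `c`, `a`, `b`. -/
noncomputable def coneParam {E : Type*} [AddCommGroup E] [Module ℝ E] (a b c : E) (r θ : ℝ) : E :=
  (1 - r) • c + r • (a + θ • (b - a))

/-- The hypotheses on spherical triangles under which solid angles are computed. -/
structure GoodTriple (a b c : E3) : Prop where
  left : ‖a‖ = 1
  mid : ‖b‖ = 1
  right : ‖c‖ = 1
  ne_neg : a ≠ -b
  inner_left : 0 ≤ inner ℝ c a
  inner_mid : 0 ≤ inner ℝ c b

/-- The product with `a + b` equals `1 + ⟪a, b⟫` for every `θ`, and this is positive. -/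
lemma edge_ne_zero {a b : E3} (ha : ‖a‖ = 1) (hb : ‖b‖ = 1) (hab : a ≠ -b) (θ : ℝ) :
    a + θ • (b - a) ≠ 0 := by
  intro h
  have hk := one_add_inner_pos ha hb hab
  have h1 : inner ℝ (a + θ • (b - a)) a + inner ℝ (a + θ • (b - a)) b = 0 := by simp [h]
  simp only [inner_add_left, inner_smul_left, inner_sub_left, real_inner_self_eq_norm_sq, ha, hb,
    RCLike.conj_to_real, real_inner_comm a b] at h1
  linarith

/-- The product with `c` is at least `1 - r`, so a zero could only occur at `r = 1`, on the edge
from `a` to `b`. -/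
lemma coneParam_ne_zero {a b c : E3} (h : GoodTriple a b c) {r θ : ℝ} (hr : r ∈ Icc (0 : ℝ) 1)
    (hθ : θ ∈ Icc (0 : ℝ) 1) : coneParam a b c r θ ≠ 0 := by
  intro h0
  have h1 : inner ℝ c (coneParam a b c r θ) = 0 := by rw [h0, inner_zero_right]
  have h2 : inner ℝ c (coneParam a b c r θ) =
      (1 - r) + r * ((1 - θ) * inner ℝ c a + θ * inner ℝ c b) := by
    simp only [coneParam, inner_add_right, inner_smul_right, inner_sub_right,
      real_inner_self_eq_norm_sq, h.right]
    ring
  have h3 : 0 ≤ r * ((1 - θ) * inner ℝ c a + θ * inner ℝ c b) :=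
    mul_nonneg hr.1 (add_nonneg (mul_nonneg (by linarith [hθ.2]) h.inner_left)
      (mul_nonneg hθ.1 h.inner_mid))
  have h4 : r = 1 := by linarith [hr.2]
  rw [coneParam, h4] at h0
  simp only [sub_self, zero_smul, one_smul, zero_add] at h0
  exact edge_ne_zero h.left h.mid h.ne_neg θ h0

lemma continuous_coneParam (a b c : E3) :
    Continuous fun p : ℝ × ℝ => coneParam a b c p.1 p.2 := by
  unfold coneParam; fun_prop

/-- With `s` the norm of the point at parameter `r` and `1 + B * r` its product with `c`, a
primitive is `r² / (s (s + 1 + B r))`. It vanishes at `0`, so no boundary term is left at the apex.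
-/
lemma integral_radial {c p : E3} (hc : ‖c‖ = 1) (hp : p ≠ 0) (hcp : 0 ≤ inner ℝ c p) :
    ∫ r in (0 : ℝ)..1, r / ‖(1 - r) • c + r • p‖ ^ 3 = 1 / (‖p‖ * (‖p‖ + inner ℝ c p)) := by
  set B := inner ℝ c p - 1 with hB
  set C := ‖p‖ ^ 2 - 2 * inner ℝ c p + 1 with hC
  have hQ : ∀ r : ℝ, ‖(1 - r) • c + r • p‖ ^ 2 = 1 + 2 * B * r + C * r ^ 2 := by
    intro r
    rw [norm_add_sq_real, norm_smul, norm_smul, mul_pow, mul_pow, hc, inner_smul_left,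
      inner_smul_right, Real.norm_eq_abs, Real.norm_eq_abs, sq_abs, sq_abs]
    simp only [RCLike.conj_to_real]
    ring
  have hN : ∀ r : ℝ, ‖(1 - r) • c + r • p‖ = √(1 + 2 * B * r + C * r ^ 2) := by
    intro r; rw [← hQ, Real.sqrt_sq (norm_nonneg _)]
  have hpos : ∀ r ∈ Icc (0 : ℝ) 1, 0 < 1 + 2 * B * r + C * r ^ 2 := by
    intro r hr
    rw [← hQ]
    refine pow_pos (norm_pos_iff.2 fun h0 => ?_) 2
    have h1 : inner ℝ c ((1 - r) • c + r • p) = 0 := by rw [h0, inner_zero_right]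
    rw [inner_add_right, inner_smul_right, inner_smul_right, real_inner_self_eq_norm_sq, hc] at h1
    have : r = 1 := by nlinarith [hr.1, hr.2, mul_nonneg hr.1 hcp]
    rw [this] at h0
    simp at h0
    exact hp h0
  have hM : ∀ r ∈ Icc (0 : ℝ) 1, 0 ≤ 1 + B * r := by
    intro r hr
    rw [hB]
    nlinarith [hr.1, hr.2, mul_nonneg hr.1 hcp]
  clear_value B C
  have hderiv : ∀ r ∈ uIcc (0 : ℝ) 1, HasDerivAt
      (fun r => r ^ 2 / (√(1 + 2 * B * r + C * r ^ 2) * (√(1 + 2 * B * r + C * r ^ 2) +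
        (1 + B * r)))) (r / ‖(1 - r) • c + r • p‖ ^ 3) r := by
    intro r hr
    rw [uIcc_of_le zero_le_one] at hr
    have h1 := hpos r hr
    have h2 := hM r hr
    have hq : HasDerivAt (fun r : ℝ => 1 + 2 * B * r + C * r ^ 2) (2 * B + C * (2 * r)) r := by
      have := (((hasDerivAt_id r).const_mul (2 * B)).const_add 1).add
        (((hasDerivAt_id r).pow 2).const_mul C)
      refine this.congr_deriv ?_
      simp
    have hs := hq.sqrt h1.ne'
    have hl : HasDerivAt (fun r : ℝ => 1 + B * r) B r := by
      simpa using ((hasDerivAt_id r).const_mul B).const_add 1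
    have hs0 : 0 < √(1 + 2 * B * r + C * r ^ 2) := Real.sqrt_pos.2 h1
    have hsq := Real.sq_sqrt h1.le
    rw [hN]
    set s := √(1 + 2 * B * r + C * r ^ 2) with hsdef
    have hden : s * (s + (1 + B * r)) ≠ 0 := by positivity
    have hsl : s + (1 + B * r) ≠ 0 := by positivity
    refine (((hasDerivAt_id r).pow 2).div (hs.mul (hs.add hl)) hden).congr_deriv ?_
    simp only [id, Pi.add_apply, Pi.mul_apply, Pi.pow_apply, ← hsdef]
    rw [div_eq_div_iff (pow_ne_zero 2 hden) (pow_ne_zero 3 hs0.ne')]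
    field_simp
    norm_num
    linear_combination r * (2 * s + 1 + B * r) * hsq
  rw [intervalIntegral.integral_eq_sub_of_hasDerivAt hderiv]
  · have e1 : √(1 + 2 * B * 1 + C * 1 ^ 2) = ‖p‖ := by rw [← hN]; simp
    rw [e1, hB]
    simp
  · apply ContinuousOn.intervalIntegrable
    rw [uIcc_of_le zero_le_one]
    apply ContinuousOn.div continuousOn_id (by fun_prop)
    intro r hr
    rw [hN]
    exact pow_ne_zero 3 (Real.sqrt_pos.2 (hpos r hr)).ne'

/-- The primitive is the solid angle swept so far, that of the triangle with vertices `a`, `a + θ(b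
- a)`, `c`, written through the arctangent of half of it. -/
lemma integral_angular {a b c : E3} (h : GoodTriple a b c) :
    ∫ θ in (0 : ℝ)..1, triple a b c /
      (‖a + θ • (b - a)‖ * (‖a + θ • (b - a)‖ + inner ℝ c (a + θ • (b - a)))) =
      solidAngle a b c := by
  have hk := one_add_inner_pos h.left h.mid h.ne_neg
  have hl := h.inner_left
  have hm := h.inner_mid
  have hD := triple_sq a b c
  rw [h.left, h.mid, h.right] at hD
  have hre : solidRe a b c = 1 + inner ℝ a b + inner ℝ c a + inner ℝ c b := by
    rw [solidRe, h.left, h.mid, h.right, real_inner_comm b c]; ring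
  have hpos := solidRe_pos h.left h.mid h.right h.ne_neg hl hm
  rw [solidAngle_eq_arctan hpos, hre]
  rw [hre] at hpos
  rw [real_inner_comm c b] at hD
  have hQ : ∀ θ : ℝ, ‖a + θ • (b - a)‖ ^ 2 =
      1 + 2 * (inner ℝ a b - 1) * θ + (2 - 2 * inner ℝ a b) * θ ^ 2 := by
    intro θ
    rw [norm_add_sq_real, norm_smul, mul_pow, norm_sub_sq_real, h.left, h.mid, inner_smul_right,
      inner_sub_right, real_inner_self_eq_norm_sq, h.left, Real.norm_eq_abs, sq_abs,
      real_inner_comm]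
    ring
  have hN : ∀ θ : ℝ, ‖a + θ • (b - a)‖ =
      √(1 + 2 * (inner ℝ a b - 1) * θ + (2 - 2 * inner ℝ a b) * θ ^ 2) := by
    intro θ; rw [← hQ, Real.sqrt_sq (norm_nonneg _)]
  have hQpos : ∀ θ : ℝ, 0 < 1 + 2 * (inner ℝ a b - 1) * θ + (2 - 2 * inner ℝ a b) * θ ^ 2 := by
    intro θ
    rw [← hQ]
    exact pow_pos (norm_pos_iff.2 (edge_ne_zero h.left h.mid h.ne_neg θ)) 2
  have hin : ∀ θ : ℝ, inner ℝ c (a + θ • (b - a)) =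
      inner ℝ c a + θ * (inner ℝ c b - inner ℝ c a) := by
    intro θ; rw [inner_add_right, inner_smul_right, inner_sub_right]
  simp_rw [hN, hin]
  generalize inner ℝ a b = k at *
  generalize inner ℝ c a = l at *
  generalize inner ℝ c b = m at *
  generalize triple a b c = D at *
  have hbeta : ∀ θ ∈ Icc (0 : ℝ) 1, 0 ≤ l + θ * (m - l) := by
    intro θ hθ
    nlinarith [mul_nonneg hθ.1 hm, mul_nonneg (sub_nonneg.2 hθ.2) hl]
  -- The denominator of the tangent is `solidRe` of `a`, the moving point and `c`. If the product `1
  -- + θ(k - 1)` of the moving point with `a` is nonpositive, then the strict Cauchy-Schwarz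
  -- inequality bounds its modulus by the norm of the point.
  have hX : ∀ θ ∈ Icc (0 : ℝ) 1, 0 < √(1 + 2 * (k - 1) * θ + (2 - 2 * k) * θ ^ 2) * (1 + l) +
      (1 + θ * (k - 1)) + (l + θ * (m - l)) := by
    intro θ hθ
    have h1 := hbeta θ hθ
    have h2 := Real.sqrt_pos.2 (hQpos θ)
    have h3 := Real.sq_sqrt (hQpos θ).le
    set s := √(1 + 2 * (k - 1) * θ + (2 - 2 * k) * θ ^ 2)
    have h4 : s ^ 2 - (1 + θ * (k - 1)) ^ 2 = θ ^ 2 * ((1 - k) * (1 + k)) := by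
      rw [h3]; ring
    by_cases hk1 : 1 + θ * (k - 1) > 0
    · have := mul_nonneg h2.le hl
      linarith
    · have hk2 : k < 1 := by
        by_contra hcon
        have := mul_nonneg hθ.1 (sub_nonneg.2 (not_lt.1 hcon))
        linarith
      have hθ0 : 0 < θ := by
        rcases hθ.1.eq_or_lt with h0 | h0
        · rw [← h0] at hk1; norm_num at hk1
        · exact h0
      have h5 : 0 < θ ^ 2 * ((1 - k) * (1 + k)) :=
        mul_pos (pow_pos hθ0 2) (mul_pos (by linarith) hk)
      have h6 : -(1 + θ * (k - 1)) < s := by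
        apply lt_of_pow_lt_pow_left₀ 2 h2.le
        nlinarith
      have := mul_nonneg h2.le hl
      linarith
  have hderiv : ∀ θ ∈ uIcc (0 : ℝ) 1, HasDerivAt (fun θ : ℝ => 2 * Real.arctan (θ * D /
      (√(1 + 2 * (k - 1) * θ + (2 - 2 * k) * θ ^ 2) * (1 + l) +
      (1 + θ * (k - 1)) + (l + θ * (m - l)))))
      (D / (√(1 + 2 * (k - 1) * θ + (2 - 2 * k) * θ ^ 2) *
        (√(1 + 2 * (k - 1) * θ + (2 - 2 * k) * θ ^ 2) + (l + θ * (m - l))))) θ := by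
    intro θ hθ
    rw [uIcc_of_le zero_le_one] at hθ
    have hq : HasDerivAt (fun θ : ℝ => 1 + 2 * (k - 1) * θ + (2 - 2 * k) * θ ^ 2)
        (2 * (k - 1) + (2 - 2 * k) * (2 * θ)) θ := by
      have := (((hasDerivAt_id θ).const_mul (2 * (k - 1))).const_add 1).add
        (((hasDerivAt_id θ).pow 2).const_mul (2 - 2 * k))
      refine this.congr_deriv ?_
      simp
    have hs := (hq.sqrt (hQpos θ).ne').mul_const (1 + l)
    have h1 : HasDerivAt (fun θ : ℝ => 1 + θ * (k - 1)) (k - 1) θ := by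
      simpa using ((hasDerivAt_id θ).mul_const (k - 1)).const_add 1
    have h2 : HasDerivAt (fun θ : ℝ => l + θ * (m - l)) (m - l) θ := by
      simpa using ((hasDerivAt_id θ).mul_const (m - l)).const_add l
    have h3 : HasDerivAt (fun θ : ℝ => θ * D) D θ := by
      simpa using (hasDerivAt_id θ).mul_const D
    have hXp := hX θ hθ
    have hs0 := Real.sqrt_pos.2 (hQpos θ)
    have hsq := Real.sq_sqrt (hQpos θ).le
    have hb := hbeta θ hθ
    refine ((h3.div ((hs.add h1).add h2) hXp.ne').arctan.const_mul 2).congr_deriv ?_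
    simp only [Pi.add_apply, Pi.div_apply]
    set s := √(1 + 2 * (k - 1) * θ + (2 - 2 * k) * θ ^ 2) with hsdef
    set X := s * (1 + l) + (1 + θ * (k - 1)) + (l + θ * (m - l)) with hXdef
    -- Factorization of the squared modulus of `solidZ`; it follows from the Gram identity `hD` and
    -- cancels the factors in the derivative of the arctangent.
    have key : X ^ 2 + (θ * D) ^ 2 = 2 * (1 + l) * (s + (l + θ * (m - l))) *
        (s + (1 + θ * (k - 1))) := by
      rw [hXdef]
      linear_combination θ ^ 2 * hD + (l ^ 2 - 1) * hsq
    have hpos2 : 0 < X ^ 2 + (θ * D) ^ 2 := by positivity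
    have hden : 0 < s + (l + θ * (m - l)) := by positivity
    have e1 : 1 + (θ * D / X) ^ 2 = (X ^ 2 + (θ * D) ^ 2) / X ^ 2 := by
      field_simp
    have hnum : s * (D * X - θ * D * ((2 * (k - 1) + (2 - 2 * k) * (2 * θ)) / (2 * s) * (1 + l) +
        (k - 1) + (m - l))) = D * (1 + l) * (s + (1 + θ * (k - 1))) := by
      rw [hXdef]
      field_simp
      linear_combination D * (1 + l) * hsq
    have hsum : 0 < s + (1 + θ * (k - 1)) := by
      by_contra hcon
      have : X ^ 2 + (θ * D) ^ 2 ≤ 0 := by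
        rw [key]
        exact mul_nonpos_of_nonneg_of_nonpos (by positivity) (not_lt.1 hcon)
      linarith
    rw [e1, key]
    have e2 : D * X - θ * D * ((2 * (k - 1) + (2 - 2 * k) * (2 * θ)) / (2 * s) * (1 + l) +
        (k - 1) + (m - l)) = D * (1 + l) * (s + (1 + θ * (k - 1))) / s := by
      rw [← hnum]; field_simp
    rw [e2]
    have hl1 : 0 < 1 + l := by linarith
    field_simp
  rw [intervalIntegral.integral_eq_sub_of_hasDerivAt hderiv]
  · have e1 : (1 : ℝ) + 2 * (k - 1) * 1 + (2 - 2 * k) * 1 ^ 2 = 1 := by ring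
    rw [e1, Real.sqrt_one]
    have e2 : 1 * (1 + l) + (1 + 1 * (k - 1)) + (l + 1 * (m - l)) = 1 + k + l + m := by ring
    rw [e2]
    simp
  · apply ContinuousOn.intervalIntegrable
    rw [uIcc_of_le zero_le_one]
    apply ContinuousOn.div continuousOn_const (by fun_prop)
    intro θ hθ
    have h1 := hbeta θ hθ
    have h2 := Real.sqrt_pos.2 (hQpos θ)
    positivity

/-- The open unit square. -/
def openSquare : Set (ℝ × ℝ) := Ioo 0 1 ×ˢ Ioo 0 1

/-- The integrand is the pullback of the area form of the sphere under the normalized cone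
parametrization. Fubini integrates first along the rays from `c` and then along the edge. -/
lemma setIntegral_openSquare {a b c : E3} (h : GoodTriple a b c) :
    ∫ p in openSquare, p.1 * triple a b c / ‖coneParam a b c p.1 p.2‖ ^ 3 =
      solidAngle a b c := by
  have hcont : ContinuousOn (fun p : ℝ × ℝ => p.1 * triple a b c / ‖coneParam a b c p.1 p.2‖ ^ 3)
      (Icc 0 1 ×ˢ Icc 0 1) := by
    apply ContinuousOn.div (by fun_prop) ((continuous_coneParam a b c).norm.pow 3).continuousOn
    intro p hp
    exact pow_ne_zero 3 (norm_ne_zero_iff.2 (coneParam_ne_zero h hp.1 hp.2))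
  have hint : IntegrableOn (fun p : ℝ × ℝ => p.1 * triple a b c / ‖coneParam a b c p.1 p.2‖ ^ 3)
      (Icc 0 1 ×ˢ Icc 0 1) := hcont.integrableOn_compact (isCompact_Icc.prod isCompact_Icc)
  have hint2 := hint.mono_set (prod_mono Ioo_subset_Icc_self Ioo_subset_Icc_self :
    openSquare ⊆ Icc 0 1 ×ˢ Icc 0 1)
  rw [IntegrableOn, Measure.volume_eq_prod, ← Measure.prod_restrict] at hint2
  rw [openSquare, Measure.volume_eq_prod, ← Measure.prod_restrict, integral_prod_symm _ hint2,
    ← integral_Ioc_eq_integral_Ioo, ← intervalIntegral.integral_of_le zero_le_one,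
    ← integral_angular h]
  refine intervalIntegral.integral_congr fun θ hθ => ?_
  rw [uIcc_of_le zero_le_one] at hθ
  simp only
  rw [← integral_Ioc_eq_integral_Ioo, ← intervalIntegral.integral_of_le zero_le_one]
  have h0 : 0 ≤ inner ℝ c (a + θ • (b - a)) := by
    rw [inner_add_right, inner_smul_right, inner_sub_right]
    nlinarith [mul_nonneg hθ.1 h.inner_mid, mul_nonneg (sub_nonneg.2 hθ.2) h.inner_left]
  have h1 := integral_radial h.right (edge_ne_zero h.left h.mid h.ne_neg θ) h0
  rw [← mul_one_div, ← h1, ← intervalIntegral.integral_const_mul]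
  refine intervalIntegral.integral_congr fun r _ => ?_
  simp only [coneParam]
  ring

/-! ### Plane determinants and changes of variables -/

/-- The determinant of two vectors of the plane. -/
def det2 (x y : E2) : ℝ := x 0 * y 1 - x 1 * y 0

/-- The standard basis vectors of the plane. -/
noncomputable abbrev bv (k : Fin 2) : E2 := EuclideanSpace.single k 1

lemma E2_eq_sum (x : E2) : x = x 0 • bv 0 + x 1 • bv 1 := by
  ext i; fin_cases i <;> simp

lemma det_clm_E2 (L : E2 →L[ℝ] E2) : L.det = det2 (L (bv 0)) (L (bv 1)) := by
  have h := LinearMap.det_toMatrix (EuclideanSpace.basisFun (Fin 2) ℝ).toBasis (L : E2 →ₗ[ℝ] E2)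
  rw [ContinuousLinearMap.det, ← h, Matrix.det_fin_two]
  simp [LinearMap.toMatrix_apply, det2]
  ring

/-- The open unit square in the Euclidean plane. -/
def openSquare' : Set E2 := {p | p 0 ∈ Ioo (0 : ℝ) 1 ∧ p 1 ∈ Ioo (0 : ℝ) 1}

lemma isOpen_openSquare' : IsOpen openSquare' :=
  (isOpen_Ioo.preimage (by fun_prop : Continuous fun p : E2 => p 0)).inter
    (isOpen_Ioo.preimage (by fun_prop : Continuous fun p : E2 => p 1))

lemma setIntegral_openSquare' (g : ℝ → ℝ → ℝ) :
    ∫ p in openSquare', g (p 0) (p 1) = ∫ p in openSquare, g p.1 p.2 := by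
  have hmp : MeasurePreserving (fun p : E2 => (p 0, p 1)) volume volume :=
    (volume_preserving_finTwoArrow ℝ).comp (PiLp.volume_preserving_ofLp (Fin 2))
  have hemb : MeasurableEmbedding (fun p : E2 => (p 0, p 1)) :=
    ((MeasurableEquiv.toLp 2 (Fin 2 → ℝ)).symm.trans
      MeasurableEquiv.finTwoArrow).measurableEmbedding
  exact hmp.setIntegral_preimage_emb hemb (fun p => g p.1 p.2) openSquare

lemma hasFDerivAt_coord (k : Fin 2) (p : E2) :
    HasFDerivAt (fun p : E2 => p k) (EuclideanSpace.proj k : E2 →L[ℝ] ℝ) p :=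
  (EuclideanSpace.proj k : E2 →L[ℝ] ℝ).hasFDerivAt

/-- The derivative of the parametrization of a triangle. -/
lemma hasFDerivAt_coneParam {E : Type*} [NormedAddCommGroup E] [NormedSpace ℝ E] (a b c : E)
    (p : E2) : ∃ L : E2 →L[ℝ] E, HasFDerivAt (fun p : E2 => coneParam a b c (p 0) (p 1)) L p ∧
      L (bv 0) = a + p 1 • (b - a) - c ∧ L (bv 1) = p 0 • (b - a) := by
  have h0 := hasFDerivAt_coord 0 p
  have h1 := hasFDerivAt_coord 1 p
  refine ⟨_, (((h0.const_sub 1).smul_const c).add (h0.smul ((h1.smul_const (b - a)).const_add a))),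
    ?_, ?_⟩
  · simp
    abel
  · simp

lemma coneParam_eq_lineMap {E : Type*} [AddCommGroup E] [Module ℝ E] (a b c : E) (r θ : ℝ) :
    coneParam a b c r θ = AffineMap.lineMap c (AffineMap.lineMap a b θ) r := by
  rw [coneParam, AffineMap.lineMap_apply_module, AffineMap.lineMap_apply_module]
  module

lemma affine_coneParam {E F : Type*} [AddCommGroup E] [Module ℝ E] [AddCommGroup F] [Module ℝ F]
    (A : E →ᵃ[ℝ] F) (a b c : E) (r θ : ℝ) :
    A (coneParam a b c r θ) = coneParam (A a) (A b) (A c) r θ := by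
  simp only [coneParam_eq_lineMap, AffineMap.apply_lineMap]

/-- The open triangle with vertices `a`, `b`, `c`. -/
def openTri (a b c : E2) : Set E2 := (fun p : E2 => coneParam a b c (p 0) (p 1)) '' openSquare'

lemma det2_coneParam (a b c : E2) (r θ : ℝ) :
    det2 (a + θ • (b - a) - c) (r • (b - a)) = r * det2 (b - a) (c - a) := by
  simp only [det2, PiLp.sub_apply, PiLp.add_apply, PiLp.smul_apply, smul_eq_mul]; ring

lemma injOn_coneParam {a b c : E2} (hd : det2 (b - a) (c - a) ≠ 0) :
    InjOn (fun p : E2 => coneParam a b c (p 0) (p 1)) openSquare' := by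
  intro p hp q hq h
  have h0 := congrArg (fun x : E2 => x 0) h
  have h1 := congrArg (fun x : E2 => x 1) h
  simp only [coneParam, PiLp.sub_apply, PiLp.add_apply, PiLp.smul_apply, smul_eq_mul] at h0 h1
  have hp0 : 0 < p 0 := hp.1.1
  have e0 : (p 0 - q 0) * det2 (b - a) (c - a) = 0 := by
    simp only [det2, PiLp.sub_apply]
    linear_combination (b 1 - a 1) * h0 - (b 0 - a 0) * h1
  have e0' : p 0 = q 0 := by
    rcases mul_eq_zero.1 e0 with h | h
    · linarith
    · exact absurd h hd
  rw [← e0'] at h0 h1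
  have e1 : (p 1 - q 1) * (p 0 * det2 (b - a) (c - a)) = 0 := by
    simp only [det2, PiLp.sub_apply]
    linear_combination (c 1 - a 1) * h0 - (c 0 - a 0) * h1
  have e1' : p 1 = q 1 := by
    rcases mul_eq_zero.1 e1 with h | h
    · linarith
    · exact absurd h (mul_ne_zero hp0.ne' hd)
  ext i
  fin_cases i
  · exact e0'
  · exact e1'

lemma setIntegral_openTri {a b c : E2} (hd : 0 < det2 (b - a) (c - a)) (g : E2 → ℝ) :
    ∫ x in openTri a b c, g x =
      ∫ p in openSquare', p 0 * det2 (b - a) (c - a) * g (coneParam a b c (p 0) (p 1)) := by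
  choose L hL hL0 hL1 using fun p : E2 => hasFDerivAt_coneParam a b c p
  rw [openTri, integral_image_eq_integral_abs_det_fderiv_smul volume
    isOpen_openSquare'.measurableSet (fun p _ => (hL p).hasFDerivWithinAt)
    (injOn_coneParam hd.ne')]
  refine setIntegral_congr_fun isOpen_openSquare'.measurableSet fun p hp => ?_
  have hp0 : 0 < p 0 := hp.1.1
  simp only [det_clm_E2, hL0, hL1, det2_coneParam, smul_eq_mul, abs_of_pos (mul_pos hp0 hd)]

/-! ### The charge density of a normalized affine map -/

/-- The partial derivatives of a map. -/
noncomputable def grad (w : E2 → E3) (k : Fin 2) (x : E2) : E3 := fderiv ℝ w x (bv k)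

/-- Differentiating the scalar factor only produces multiples of `A x`, and these drop out of the
triple product with `A x`. -/
lemma chargeDensity_normalized {w : E2 → E3} {A : E2 → E3} {L : E2 →L[ℝ] E3} {x : E2}
    (hA : HasFDerivAt A L x) (h0 : A x ≠ 0) (hw : w =ᶠ[𝓝 x] fun y => ‖A y‖⁻¹ • A y) :
    chargeDensity w (grad w) x = triple (A x) (L (bv 0)) (L (bv 1)) / ‖A x‖ ^ 3 := by
  have hn : DifferentiableAt ℝ (fun y => ‖A y‖⁻¹) x :=
    (hA.differentiableAt.norm ℝ h0).inv (norm_ne_zero_iff.2 h0)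
  have hf := (hn.hasFDerivAt.smul hA).congr_of_eventuallyEq hw
  have hw0 : w x = ‖A x‖⁻¹ • A x := hw.self_of_nhds
  rw [chargeDensity, grad, grad, hf.fderiv, hw0]
  simp only [add_apply, smul_apply, ContinuousLinearMap.smulRight_apply]
  generalize (fderiv ℝ (fun y => ‖A y‖⁻¹) x) (bv 0) = s
  generalize (fderiv ℝ (fun y => ‖A y‖⁻¹) x) (bv 1) = t
  rw [← triple]
  simp only [triple_eq, PiLp.add_apply, PiLp.smul_apply, smul_eq_mul]
  rw [div_eq_mul_inv, ← inv_pow]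
  ring

/-- The integral of the charge density over a triangle is the solid angle of the values at its
vertices. -/
lemma integral_chargeDensity_openTri {a b c : E2} {A : E2 →ᵃ[ℝ] E3} {w : E2 → E3}
    (hd : 0 < det2 (b - a) (c - a)) (h : GoodTriple (A a) (A b) (A c))
    (hw : ∀ x ∈ openTri a b c, w =ᶠ[𝓝 x] fun y => ‖A y‖⁻¹ • A y) :
    ∫ x in openTri a b c, chargeDensity w (grad w) x = solidAngle (A a) (A b) (A c) := by
  rw [setIntegral_openTri hd, ← setIntegral_openSquare h, ← setIntegral_openSquare'
    (fun r θ => r * triple (A a) (A b) (A c) / ‖coneParam (A a) (A b) (A c) r θ‖ ^ 3)]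
  refine setIntegral_congr_fun isOpen_openSquare'.measurableSet fun p hp => ?_
  simp only
  set x := coneParam a b c (p 0) (p 1) with hx
  have hxm : x ∈ openTri a b c := ⟨p, hp, rfl⟩
  have hAx : A x = coneParam (A a) (A b) (A c) (p 0) (p 1) := affine_coneParam A _ _ _ _ _
  have hne : A x ≠ 0 := by
    rw [hAx]
    exact coneParam_ne_zero h (Ioo_subset_Icc_self hp.1) (Ioo_subset_Icc_self hp.2)
  have hA : HasFDerivAt A (LinearMap.toContinuousLinearMap A.linear) x := by
    have h1 : (A : E2 → E3) = fun y => A.linear y + A 0 := AffineMap.decomp A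
    rw [h1]
    exact (LinearMap.toContinuousLinearMap A.linear).hasFDerivAt.add_const _
  rw [chargeDensity_normalized hA hne (hw x hxm)]
  have hlin : ∀ y z : E2, A y - A z = (y 0 - z 0) • A.linear (bv 0) +
      (y 1 - z 1) • A.linear (bv 1) := by
    intro y z
    have h1 : A y - A z = A.linear (y - z) := by
      have := A.linearMap_vsub y z
      simpa using this.symm
    rw [h1]
    conv_lhs => rw [E2_eq_sum (y - z)]
    simp
  have hab := hlin b a
  have hca := hlin c a
  have hxa := hlin x a
  simp only [LinearMap.coe_toContinuousLinearMap']
  generalize A.linear (bv 0) = L0 at *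
  generalize A.linear (bv 1) = L1 at *
  -- The triple product of an affine map with its two derivatives does not depend on the point, so
  -- it can be evaluated on the vertex values.
  have e1 : det2 (b - a) (c - a) * triple (A x) L0 L1 = triple (A a) (A b) (A c) := by
    have hb : A b = A a + ((b 0 - a 0) • L0 + (b 1 - a 1) • L1) := by rw [← hab]; abel
    have hc : A c = A a + ((c 0 - a 0) • L0 + (c 1 - a 1) • L1) := by rw [← hca]; abel
    have hxx : A x = A a + ((x 0 - a 0) • L0 + (x 1 - a 1) • L1) := by rw [← hxa]; abel
    rw [hb, hc, hxx]
    simp only [det2, triple_eq, PiLp.sub_apply, PiLp.add_apply, PiLp.smul_apply, smul_eq_mul]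
    ring
  rw [← hAx, ← e1]
  ring

/-! ### Area on the sphere -/

lemma area_union_le (s t : Set E3) : area (s ∪ t) ≤ area s + area t := measure_union_le s t

lemma area_mono {s t : Set E3} (h : s ⊆ t) : area s ≤ area t := measure_mono h

/-- The factor between the Hausdorff measure and its Euclidean normalization. -/
lemma exists_area_factor : ∃ κ : ℝ≥0∞, (∀ s : Set E3, area s = κ * μH[2] s) ∧
    ∀ s : Set E2, volume s = κ * μH[2] s := by
  refine ⟨((Measure.addHaarScalarFactor (volume : Measure E2) μH[((2 : ℕ) : ℝ)] : ℝ≥0) : ℝ≥0∞),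
    fun s => ?_, fun s => ?_⟩
  · rw [area, Measure.euclideanHausdorffMeasure_def, Measure.smul_apply, ENNReal.smul_def,
      smul_eq_mul]
    norm_num
  · conv_lhs => rw [← EuclideanSpace.euclideanHausdorffMeasure_eq_volume 2,
      Measure.euclideanHausdorffMeasure_def, Measure.smul_apply, ENNReal.smul_def, smul_eq_mul]
    norm_num

lemma area_image_le {f : E2 → E3} {K : ℝ≥0} {s : Set E2} (h : LipschitzOnWith K f s) :
    area (f '' s) ≤ (K : ℝ≥0∞) ^ 2 * volume s := by
  obtain ⟨κ, h1, h2⟩ := exists_area_factor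
  have := h.hausdorffMeasure_image_le (d := 2) (by norm_num)
  rw [h1, h2]
  calc κ * μH[2] (f '' s) ≤ κ * ((K : ℝ≥0∞) ^ (2 : ℝ) * μH[2] s) := by gcongr
    _ = _ := by rw [ENNReal.rpow_two]; ring

lemma volume_image_le {g : E3 → E2} {K : ℝ≥0} {s : Set E3} (h : LipschitzOnWith K g s) :
    volume (g '' s) ≤ (K : ℝ≥0∞) ^ 2 * area s := by
  obtain ⟨κ, h1, h2⟩ := exists_area_factor
  have := h.hausdorffMeasure_image_le (d := 2) (by norm_num)
  rw [h1, h2]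
  calc κ * μH[2] (g '' s) ≤ κ * ((K : ℝ≥0∞) ^ (2 : ℝ) * μH[2] s) := by gcongr
    _ = _ := by rw [ENNReal.rpow_two]; ring

lemma area_isometry_image (f : E3 ≃ₗᵢ[ℝ] E3) (s : Set E3) : area (f '' s) = area s :=
  f.isometry.euclideanHausdorffMeasure_image s

/-- Great circles have no area. -/
lemma area_great_circle {n : E3} (hn : n ≠ 0) : area {z : E3 | ‖z‖ = 1 ∧ inner ℝ n z = 0} = 0 := by
  have : Fact (Module.finrank ℝ E3 = 2 + 1) := ⟨by simp⟩
  have hr : Module.finrank ℝ (ℝ ∙ n)ᗮ = 2 := Submodule.finrank_orthogonal_span_singleton hn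
  have : Nontrivial (ℝ ∙ n)ᗮ := Module.nontrivial_of_finrank_pos (R := ℝ) (by omega)
  have himg : {z : E3 | ‖z‖ = 1 ∧ inner ℝ n z = 0} ⊆
      (Subtype.val : (ℝ ∙ n)ᗮ → E3) '' Metric.sphere 0 1 := by
    intro z hz
    exact ⟨⟨z, Submodule.mem_orthogonal_singleton_iff_inner_right.2 hz.2⟩, by simpa using hz.1, rfl⟩
  refine measure_mono_null himg ?_
  have h := (isometry_subtype_coe (s := ((ℝ ∙ n)ᗮ : Set E3))).euclideanHausdorffMeasure_image
    (d := 2) (Metric.sphere (0 : (ℝ ∙ n)ᗮ) 1)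
  refine h.trans ?_
  have h2 : (Measure.euclideanHausdorffMeasure 2 : Measure (ℝ ∙ n)ᗮ) = volume := by
    rw [← hr]; exact InnerProductSpace.euclideanHausdorffMeasure_eq_volume
  exact (congrArg (fun m : Measure (ℝ ∙ n)ᗮ => m (Metric.sphere 0 1)) h2).trans
    (Measure.addHaar_sphere _ _ _)

/-! ### Stereographic coordinates -/

/-- The inverse of the stereographic projection from the south pole. -/
noncomputable def stereoInv (x : E2) : E3 :=
  (1 + ‖x‖ ^ 2)⁻¹ • !₂[2 * x 0, 2 * x 1, 1 - ‖x‖ ^ 2]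

/-- The stereographic projection from the south pole, extended to be homogeneous. -/
noncomputable def stereo (y : E3) : E2 := (‖y‖ + y 2)⁻¹ • !₂[y 0, y 1]

lemma norm_sq_E2 (x : E2) : ‖x‖ ^ 2 = x 0 ^ 2 + x 1 ^ 2 := by
  simp [EuclideanSpace.norm_sq_eq, Fin.sum_univ_two]

lemma stereoInv_zero (x : E2) : stereoInv x 0 = (1 + ‖x‖ ^ 2)⁻¹ * (2 * x 0) := by
  simp [stereoInv]

lemma stereoInv_one (x : E2) : stereoInv x 1 = (1 + ‖x‖ ^ 2)⁻¹ * (2 * x 1) := by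
  simp [stereoInv]

lemma stereoInv_two (x : E2) : stereoInv x 2 = (1 + ‖x‖ ^ 2)⁻¹ * (1 - ‖x‖ ^ 2) := by
  simp [stereoInv]

lemma stereo_zero (y : E3) : stereo y 0 = (‖y‖ + y 2)⁻¹ * y 0 := by simp [stereo]

lemma stereo_one (y : E3) : stereo y 1 = (‖y‖ + y 2)⁻¹ * y 1 := by simp [stereo]

/-- The exact chordal distance. On a thin annulus the map is almost a similarity, so Lipschitz
bounds on Hausdorff measure in both directions yield the area formula for `stereoInv`. -/
lemma dist_stereoInv_sq (x y : E2) : dist (stereoInv x) (stereoInv y) ^ 2 =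
    4 * dist x y ^ 2 / ((1 + ‖x‖ ^ 2) * (1 + ‖y‖ ^ 2)) := by
  have hx : 0 < 1 + ‖x‖ ^ 2 := by positivity
  have hy : 0 < 1 + ‖y‖ ^ 2 := by positivity
  rw [dist_eq_norm, dist_eq_norm, norm_sq_E3, norm_sq_E2 (x - y)]
  simp only [PiLp.sub_apply, stereoInv_zero, stereoInv_one, stereoInv_two]
  have h1 := norm_sq_E2 x
  have h2 := norm_sq_E2 y
  rw [h1] at hx ⊢
  rw [h2] at hy ⊢
  field_simp
  ring

lemma stereoInv_stereo {y : E3} (h0 : y ≠ 0) (h : 0 ≤ y 2) : stereoInv (stereo y) = ‖y‖⁻¹ • y := by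
  have hn : 0 < ‖y‖ := norm_pos_iff.2 h0
  have hm : 0 < ‖y‖ + y 2 := by positivity
  have hsq := norm_sq_E3 y
  have h1 : ‖stereo y‖ ^ 2 = (‖y‖ - y 2) / (‖y‖ + y 2) := by
    rw [norm_sq_E2, stereo_zero, stereo_one]
    field_simp
    linear_combination -hsq
  have h2 : 1 + ‖stereo y‖ ^ 2 = 2 * ‖y‖ / (‖y‖ + y 2) := by
    rw [h1]; field_simp; ring
  have h3 : 1 - ‖stereo y‖ ^ 2 = 2 * y 2 / (‖y‖ + y 2) := by
    rw [h1]; field_simp; ring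
  ext i
  fin_cases i
  · simp only [Fin.zero_eta, stereoInv_zero, stereo_zero, PiLp.smul_apply, smul_eq_mul, h2]
    field_simp
  · simp only [Fin.mk_one, stereoInv_one, stereo_one, PiLp.smul_apply, smul_eq_mul, h2]
    field_simp
  · simp only [Fin.reduceFinMk, stereoInv_two, PiLp.smul_apply, smul_eq_mul, h2, h3]
    field_simp

lemma injective_stereoInv : Function.Injective stereoInv := by
  intro x y h
  have h1 := dist_stereoInv_sq x y
  have hp : 0 < (1 + ‖x‖ ^ 2) * (1 + ‖y‖ ^ 2) := by positivity
  rw [h, dist_self, eq_div_iff hp.ne'] at h1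
  have h2 : dist x y ^ 2 = 0 := by linarith
  exact dist_eq_zero.1 (pow_eq_zero_iff two_ne_zero |>.1 h2)

lemma continuous_stereoInv : Continuous stereoInv := by
  unfold stereoInv
  have h : Continuous fun x : E2 => (1 + ‖x‖ ^ 2)⁻¹ :=
    Continuous.inv₀ (by fun_prop) fun x => by positivity
  refine h.smul ?_
  refine (PiLp.continuous_toLp 2 _).comp (continuous_pi fun i => ?_)
  fin_cases i <;> simp <;> fun_prop

/-- The area density of the stereographic coordinates. -/
noncomputable def stereoDens (x : E2) : ℝ := 4 / (1 + ‖x‖ ^ 2) ^ 2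

lemma area_stereoInv_le {s : ℝ} (hs : 0 ≤ s) {B : Set E2} (hB : ∀ x ∈ B, s ≤ ‖x‖ ^ 2) :
    area (stereoInv '' B) ≤ ENNReal.ofReal (4 / (1 + s) ^ 2) * volume B := by
  have hL : LipschitzOnWith (Real.toNNReal (2 / (1 + s))) stereoInv B := by
    refine LipschitzOnWith.of_dist_le_mul fun x hx y hy => ?_
    rw [Real.coe_toNNReal _ (by positivity)]
    refine abs_le_of_sq_le_sq' ?_ (by positivity) |>.2
    rw [dist_stereoInv_sq, div_le_iff₀ (by positivity), mul_pow, div_pow]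
    have h1 := hB x hx
    have h2 := hB y hy
    have h3 : (1 + s) ^ 2 ≤ (1 + ‖x‖ ^ 2) * (1 + ‖y‖ ^ 2) := by
      rw [sq (1 + s)]; gcongr
    calc 4 * dist x y ^ 2 = 2 ^ 2 / (1 + s) ^ 2 * dist x y ^ 2 * (1 + s) ^ 2 := by
          field_simp; ring
      _ ≤ _ := by gcongr
  refine (area_image_le hL).trans (le_of_eq ?_)
  congr 1
  have e : ((Real.toNNReal (2 / (1 + s)) : ℝ≥0∞)) = ENNReal.ofReal (2 / (1 + s)) := rfl
  rw [e, ← ENNReal.ofReal_pow (by positivity)]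
  congr 1
  rw [div_pow]; norm_num

lemma volume_le_area_stereoInv {t : ℝ} (ht : 0 ≤ t) {B : Set E2} (hB : ∀ x ∈ B, ‖x‖ ^ 2 ≤ t) :
    ENNReal.ofReal (4 / (1 + t) ^ 2) * volume B ≤ area (stereoInv '' B) := by
  have hinv : ∀ x, Function.invFun stereoInv (stereoInv x) = x :=
    Function.leftInverse_invFun injective_stereoInv
  have hL : LipschitzOnWith (Real.toNNReal ((1 + t) / 2)) (Function.invFun stereoInv)
      (stereoInv '' B) := by
    refine LipschitzOnWith.of_dist_le_mul ?_
    rintro _ ⟨x, hx, rfl⟩ _ ⟨y, hy, rfl⟩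
    rw [Real.coe_toNNReal _ (by positivity), hinv, hinv]
    refine abs_le_of_sq_le_sq' ?_ (by positivity) |>.2
    rw [mul_pow, dist_stereoInv_sq, div_pow, div_mul_div_comm, le_div_iff₀ (by positivity)]
    have h1 := hB x hx
    have h2 := hB y hy
    have h3 : (1 + ‖x‖ ^ 2) * (1 + ‖y‖ ^ 2) ≤ (1 + t) ^ 2 := by
      rw [sq (1 + t)]; gcongr
    calc dist x y ^ 2 * (2 ^ 2 * ((1 + ‖x‖ ^ 2) * (1 + ‖y‖ ^ 2)))
        ≤ dist x y ^ 2 * (2 ^ 2 * (1 + t) ^ 2) := by gcongr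
      _ = _ := by ring
  have h1 := volume_image_le hL
  rw [← image_comp] at h1
  have h2 : (Function.invFun stereoInv ∘ stereoInv) '' B = B := by
    have : Function.invFun stereoInv ∘ stereoInv = id := funext hinv
    rw [this, image_id]
  rw [h2] at h1
  have h3 : ENNReal.ofReal (4 / (1 + t) ^ 2) * ((Real.toNNReal ((1 + t) / 2) : ℝ≥0∞)) ^ 2 = 1 := by
    have e : ((Real.toNNReal ((1 + t) / 2) : ℝ≥0∞)) = ENNReal.ofReal ((1 + t) / 2) := rfl
    rw [e, ← ENNReal.ofReal_pow (by positivity), ← ENNReal.ofReal_mul (by positivity)]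
    rw [← ENNReal.ofReal_one]
    congr 1
    field_simp
    norm_num
  calc ENNReal.ofReal (4 / (1 + t) ^ 2) * volume B
      ≤ ENNReal.ofReal (4 / (1 + t) ^ 2) *
        (((Real.toNNReal ((1 + t) / 2) : ℝ≥0∞)) ^ 2 * area (stereoInv '' B)) := by gcongr
    _ = area (stereoInv '' B) := by rw [← mul_assoc, h3, one_mul]

lemma measurableSet_stereoInv_image {B : Set E2} (hB : MeasurableSet B) :
    MeasurableSet (stereoInv '' B) :=
  hB.image_of_continuousOn_injOn continuous_stereoInv.continuousOn injective_stereoInv.injOn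

/-- Cut the set into annuli on which `‖x‖²` varies by at most `1 / (n + 1)`. On each of them the
Lipschitz bounds for `stereoInv` and for its inverse compare area and weighted volume up to the
factor `(1 + 1 / (n + 1))²`, which tends to `1`. -/
lemma area_stereoInv_image {A : Set E2} (hA : MeasurableSet A) :
    area (stereoInv '' A) = ∫⁻ x in A, ENNReal.ofReal (stereoDens x) := by
  set ν : ℝ≥0∞ := ∫⁻ x in A, ENNReal.ofReal (stereoDens x) with hν
  have hmeas : Measurable fun x : E2 => ENNReal.ofReal (stereoDens x) := by
    unfold stereoDens; fun_prop
  have key : ∀ n : ℕ, area (stereoInv '' A) ≤ ENNReal.ofReal ((1 + 1 / ((n : ℝ) + 1)) ^ 2) * ν ∧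
      ν ≤ ENNReal.ofReal ((1 + 1 / ((n : ℝ) + 1)) ^ 2) * area (stereoInv '' A) := by
    intro n
    have hn : (0 : ℝ) < (n : ℝ) + 1 := by positivity
    set c := ENNReal.ofReal ((1 + 1 / ((n : ℝ) + 1)) ^ 2) with hc
    let B : ℕ → Set E2 := fun k => A ∩ {x | ⌊((n : ℝ) + 1) * ‖x‖ ^ 2⌋₊ = k}
    have hBm : ∀ k, MeasurableSet (B k) := fun k => hA.inter
      ((Nat.measurable_floor.comp (by fun_prop)) (measurableSet_singleton k))
    have hBd : Pairwise (Function.onFun Disjoint B) := by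
      intro k l hkl
      refine Set.disjoint_left.2 fun x hx hy => hkl ?_
      exact hx.2.symm.trans hy.2
    have hBU : ⋃ k, B k = A := by
      ext x
      simp [B]
    have hBlo : ∀ k, ∀ x ∈ B k, (k : ℝ) / (n + 1) ≤ ‖x‖ ^ 2 := by
      rintro k x ⟨-, hx⟩
      rw [div_le_iff₀ hn, mul_comm, ← (show ⌊((n : ℝ) + 1) * ‖x‖ ^ 2⌋₊ = k from hx)]
      exact Nat.floor_le (by positivity)
    have hBhi : ∀ k, ∀ x ∈ B k, ‖x‖ ^ 2 ≤ ((k : ℝ) + 1) / (n + 1) := by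
      rintro k x ⟨-, hx⟩
      rw [le_div_iff₀ hn, mul_comm, ← (show ⌊((n : ℝ) + 1) * ‖x‖ ^ 2⌋₊ = k from hx)]
      exact (Nat.lt_floor_add_one _).le
    have hratio : ∀ k : ℕ, 4 / (1 + (k : ℝ) / (n + 1)) ^ 2 ≤
        (1 + 1 / ((n : ℝ) + 1)) ^ 2 * (4 / (1 + ((k : ℝ) + 1) / (n + 1)) ^ 2) := by
      intro k
      rw [← mul_div_assoc, div_le_div_iff₀ (by positivity) (by positivity)]
      have : 1 + ((k : ℝ) + 1) / (n + 1) ≤ (1 + 1 / ((n : ℝ) + 1)) * (1 + (k : ℝ) / (n + 1)) := by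
        have e : (1 + 1 / ((n : ℝ) + 1)) * (1 + (k : ℝ) / (n + 1)) =
          1 + ((k : ℝ) + 1) / (n + 1) + (1 / ((n : ℝ) + 1)) * ((k : ℝ) / (n + 1)) := by ring
        rw [e]
        have : 0 ≤ (1 / ((n : ℝ) + 1)) * ((k : ℝ) / (n + 1)) := by positivity
        linarith
      calc 4 * (1 + ((k : ℝ) + 1) / (n + 1)) ^ 2
          ≤ 4 * ((1 + 1 / ((n : ℝ) + 1)) * (1 + (k : ℝ) / (n + 1))) ^ 2 := by gcongr
        _ = _ := by ring
    have hratio' : ∀ k : ℕ, ENNReal.ofReal (4 / (1 + (k : ℝ) / (n + 1)) ^ 2) ≤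
        c * ENNReal.ofReal (4 / (1 + ((k : ℝ) + 1) / (n + 1)) ^ 2) := by
      intro k
      rw [hc, ← ENNReal.ofReal_mul (by positivity)]
      exact ENNReal.ofReal_le_ofReal (hratio k)
    have hlo : ∀ k : ℕ, ENNReal.ofReal (4 / (1 + ((k : ℝ) + 1) / (n + 1)) ^ 2) * volume (B k) ≤
        ∫⁻ x in B k, ENNReal.ofReal (stereoDens x) := by
      intro k
      rw [← setLIntegral_const]
      refine setLIntegral_mono hmeas fun x hx => ENNReal.ofReal_le_ofReal ?_
      have := hBhi k x hx
      unfold stereoDens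
      gcongr
    have hhi : ∀ k, ∫⁻ x in B k, ENNReal.ofReal (stereoDens x) ≤
        ENNReal.ofReal (4 / (1 + (k : ℝ) / (n + 1)) ^ 2) * volume (B k) := by
      intro k
      rw [← setLIntegral_const]
      refine setLIntegral_mono measurable_const fun x hx => ENNReal.ofReal_le_ofReal ?_
      have := hBlo k x hx
      unfold stereoDens
      gcongr
    have h1 : area (stereoInv '' A) = ∑' k, area (stereoInv '' B k) := by
      rw [← hBU, image_iUnion]
      refine measure_iUnion (fun k l hkl => ?_) fun k => measurableSet_stereoInv_image (hBm k)
      exact (disjoint_image_iff injective_stereoInv).2 (hBd hkl)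
    have h2 : ν = ∑' k, ∫⁻ x in B k, ENNReal.ofReal (stereoDens x) := by
      rw [hν, ← lintegral_iUnion hBm hBd, hBU]
    rw [h1, h2, ← ENNReal.tsum_mul_left, ← ENNReal.tsum_mul_left]
    constructor
    · refine ENNReal.tsum_le_tsum fun k => ?_
      calc area (stereoInv '' B k)
          ≤ ENNReal.ofReal (4 / (1 + (k : ℝ) / (n + 1)) ^ 2) * volume (B k) :=
            area_stereoInv_le (by positivity) (hBlo k)
        _ ≤ c * ENNReal.ofReal (4 / (1 + ((k : ℝ) + 1) / (n + 1)) ^ 2) * volume (B k) := by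
            gcongr; exact hratio' k
        _ ≤ _ := by rw [mul_assoc]; gcongr; exact hlo k
    · refine ENNReal.tsum_le_tsum fun k => ?_
      calc ∫⁻ x in B k, ENNReal.ofReal (stereoDens x)
          ≤ ENNReal.ofReal (4 / (1 + (k : ℝ) / (n + 1)) ^ 2) * volume (B k) := hhi k
        _ ≤ c * ENNReal.ofReal (4 / (1 + ((k : ℝ) + 1) / (n + 1)) ^ 2) * volume (B k) := by
            gcongr; exact hratio' k
        _ ≤ _ := by
            rw [mul_assoc]; gcongr
            exact volume_le_area_stereoInv (by positivity) (hBhi k)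
  have hlim : ∀ y : ℝ≥0∞, Tendsto (fun n : ℕ => ENNReal.ofReal ((1 + 1 / ((n : ℝ) + 1)) ^ 2) * y)
      atTop (𝓝 y) := by
    intro y
    have h1 : Tendsto (fun n : ℕ => (1 + 1 / ((n : ℝ) + 1)) ^ 2) atTop (𝓝 ((1 + 0) ^ 2)) :=
      (tendsto_one_div_add_atTop_nhds_zero_nat.const_add 1).pow 2
    have h2 := ENNReal.Tendsto.mul_const (b := y) (ENNReal.tendsto_ofReal h1) (Or.inl (by simp))
    simpa using h2
  exact le_antisymm (ge_of_tendsto' (hlim ν) fun n => (key n).1)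
    (ge_of_tendsto' (hlim _) fun n => (key n).2)

lemma stereoDens_stereo {y : E3} (h0 : y ≠ 0) (h : 0 ≤ y 2) :
    stereoDens (stereo y) = (‖y‖ + y 2) ^ 2 / ‖y‖ ^ 2 := by
  have hn : 0 < ‖y‖ := norm_pos_iff.2 h0
  have hm : 0 < ‖y‖ + y 2 := by positivity
  have hsq := norm_sq_E3 y
  have h1 : 1 + ‖stereo y‖ ^ 2 = 2 * ‖y‖ / (‖y‖ + y 2) := by
    rw [norm_sq_E2, stereo_zero, stereo_one]
    field_simp
    linear_combination -hsq
  rw [stereoDens, h1]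
  field_simp
  norm_num

/-- The Jacobian of a surface in stereographic coordinates. -/
lemma hasFDerivAt_stereo_comp {V : E2 → E3} {V' : E2 →L[ℝ] E3} {p : E2} (hV : HasFDerivAt V V' p)
    (h0 : V p ≠ 0) (h : 0 ≤ V p 2) : ∃ L : E2 →L[ℝ] E2,
      HasFDerivAt (fun p => stereo (V p)) L p ∧
      L.det = triple (V p) (V' (bv 0)) (V' (bv 1)) / (‖V p‖ * (‖V p‖ + V p 2) ^ 2) := by
  have hn : 0 < ‖V p‖ := norm_pos_iff.2 h0
  have hm : 0 < ‖V p‖ + V p 2 := by positivity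
  have hnorm : HasFDerivAt (fun p => ‖V p‖) _ p :=
    (hV.norm_sq.sqrt (pow_ne_zero 2 hn.ne')).congr_of_eventuallyEq
      (Eventually.of_forall fun q => (Real.sqrt_sq (norm_nonneg _)).symm)
  have hc : ∀ i : Fin 3, HasFDerivAt (fun p => V p i)
      ((EuclideanSpace.proj i : E3 →L[ℝ] ℝ).comp V') p :=
    fun i => (EuclideanSpace.proj i : E3 →L[ℝ] ℝ).hasFDerivAt.comp p hV
  have hinv := (hasDerivAt_inv hm.ne').comp_hasFDerivAt p (hnorm.add (hc 2))
  have hcomp : ∀ i : Fin 2, HasFDerivAt (fun p => stereo (V p) i) _ p := fun i =>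
    (hinv.mul (hc (Fin.castSucc i))).congr_of_eventuallyEq (Eventually.of_forall fun q => by
      fin_cases i <;> simp [stereo])
  have hd : DifferentiableAt ℝ (fun p => stereo (V p)) p :=
    differentiableAt_euclidean.2 fun i => (hcomp i).differentiableAt
  refine ⟨_, hd.hasFDerivAt, ?_⟩
  have hval : ∀ (i : Fin 2) (v : E2), (fderiv ℝ (fun p => stereo (V p)) p v) i =
      (‖V p‖ + V p 2)⁻¹ * (V' v) (Fin.castSucc i) - ((‖V p‖ + V p 2) ^ 2)⁻¹ *
        (inner ℝ (V p) (V' v) / ‖V p‖ + V' v 2) * V p (Fin.castSucc i) := by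
    intro i v
    have h1 : HasFDerivAt (fun p => stereo (V p) i)
        ((EuclideanSpace.proj i : E2 →L[ℝ] ℝ).comp (fderiv ℝ (fun p => stereo (V p)) p)) p :=
      (EuclideanSpace.proj i : E2 →L[ℝ] ℝ).hasFDerivAt.comp p hd.hasFDerivAt
    have h2 : (fderiv ℝ (fun p => stereo (V p)) p v) i = _ := congrArg (fun L : E2 →L[ℝ] ℝ => L v) (h1.unique (hcomp i))
    rw [h2]
    simp [Real.sqrt_sq]
    ring
  rw [det_clm_E2, det2, hval, hval, hval, hval, inner_E3, inner_E3, triple_eq]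
  have hsq := norm_sq_E3 (V p)
  generalize V' (bv 0) = a at *
  generalize V' (bv 1) = b at *
  generalize V p = y at *
  simp only [Fin.castSucc_zero, Fin.castSucc_one]
  generalize ‖y‖ = ρ at *
  generalize y 0 = y0 at *
  generalize y 1 = y1 at *
  generalize y 2 = y2 at *
  field_simp
  linear_combination ρ * (ρ + y2) * (a 0 * b 1 - a 1 * b 0) * hsq

/-! ### The area of a spherical triangle -/

/-- The spherical triangle with vertices `a`, `b`, `c`. -/
noncomputable def sphTri (a b c : E3) : Set E3 := radial (cone {a, b, c})

lemma mem_cone_three {a b c y : E3} : y ∈ cone {a, b, c} ↔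
    ∃ α β γ : ℝ, 0 ≤ α ∧ 0 ≤ β ∧ 0 ≤ γ ∧ y = α • a + β • b + γ • c := by
  rw [cone, SetLike.mem_coe, PointedCone.hull]
  simp only [Submodule.mem_span_insert, Submodule.mem_span_singleton]
  constructor
  · rintro ⟨α, _, ⟨β, _, ⟨γ, rfl⟩, rfl⟩, rfl⟩
    exact ⟨α, β, γ, α.2, β.2, γ.2, by rw [← add_assoc]; rfl⟩
  · rintro ⟨α, β, γ, hα, hβ, hγ, rfl⟩
    exact ⟨⟨α, hα⟩, _, ⟨⟨β, hβ⟩, _, ⟨⟨γ, hγ⟩, rfl⟩, rfl⟩, by rw [← add_assoc]; rfl⟩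

/-- The image of the open unit square in the spherical triangle. -/
noncomputable def openSphTri (a b c : E3) : Set E3 :=
  (fun p : E2 => ‖coneParam a b c (p 0) (p 1)‖⁻¹ • coneParam a b c (p 0) (p 1)) '' openSquare'

lemma coneParam_mem_cone {a b c : E3} {r θ : ℝ} (hr : r ∈ Icc (0 : ℝ) 1)
    (hθ : θ ∈ Icc (0 : ℝ) 1) : coneParam a b c r θ ∈ cone {a, b, c} := by
  refine mem_cone_three.2 ⟨r * (1 - θ), r * θ, 1 - r, mul_nonneg hr.1 (sub_nonneg.2 hθ.2),
    mul_nonneg hr.1 hθ.1, sub_nonneg.2 hr.2, ?_⟩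
  rw [coneParam]; module

lemma openSphTri_subset {a b c : E3} (h : GoodTriple a b c) :
    openSphTri a b c ⊆ sphTri a b c := by
  rintro _ ⟨p, hp, rfl⟩
  exact ⟨_, coneParam_mem_cone (Ioo_subset_Icc_self hp.1) (Ioo_subset_Icc_self hp.2),
    coneParam_ne_zero h (Ioo_subset_Icc_self hp.1) (Ioo_subset_Icc_self hp.2), rfl⟩

lemma mem_openSphTri {a b c : E3} {α β γ : ℝ} (hα : 0 < α) (hβ : 0 < β) (hγ : 0 < γ) :
    ‖α • a + β • b + γ • c‖⁻¹ • (α • a + β • b + γ • c) ∈ openSphTri a b c := by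
  have hs : 0 < α + β + γ := by positivity
  refine ⟨!₂[(α + β) / (α + β + γ), β / (α + β)], ⟨⟨by simp; positivity, ?_⟩,
    ⟨by simp; positivity, ?_⟩⟩, ?_⟩
  · simp; rw [div_lt_one hs]; linarith
  · simp; rw [div_lt_one (by positivity)]; linarith
  · simp only [Matrix.cons_val_zero, Matrix.cons_val_one]
    have e : coneParam a b c ((α + β) / (α + β + γ)) (β / (α + β)) =
        (α + β + γ)⁻¹ • (α • a + β • b + γ • c) := by
      have h1 : 1 - (α + β) / (α + β + γ) = (α + β + γ)⁻¹ * γ := by field_simp; ring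
      have h2 : (α + β) / (α + β + γ) = (α + β + γ)⁻¹ * (α + β) := by field_simp
      have h3 : (α + β) * (β / (α + β)) = β := by field_simp
      rw [coneParam, h1, h2]
      calc ((α + β + γ)⁻¹ * γ) • c + ((α + β + γ)⁻¹ * (α + β)) • (a + (β / (α + β)) • (b - a))
          = (α + β + γ)⁻¹ • (γ • c + ((α + β) • a + ((α + β) * (β / (α + β))) • (b - a))) := by
            module
        _ = _ := by rw [h3]; module
    rw [e, norm_smul, Real.norm_of_nonneg (by positivity), mul_inv, inv_inv, smul_smul]
    congr 1
    field_simp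

/-- Three vectors that are linearly dependent span a cone without area. -/
lemma area_radial_eq_zero {n : E3} (hn : n ≠ 0) {K : Set E3} (hK : ∀ y ∈ K, inner ℝ n y = 0) :
    area (radial K) = 0 := by
  refine measure_mono_null ?_ (area_great_circle hn)
  rintro _ ⟨y, hy, h0, rfl⟩
  refine ⟨?_, by rw [inner_smul_right, hK y hy, mul_zero]⟩
  rw [norm_smul, norm_inv, norm_norm, inv_mul_cancel₀ (norm_ne_zero_iff.2 h0)]

lemma cross_ne_zero_of_triple {a b c : E3} (h : triple a b c ≠ 0) : cross a b ≠ 0 := by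
  intro h0
  rw [← inner_cross_eq_triple, h0, inner_zero_left] at h
  exact h rfl

lemma inner_cross_left (a b : E3) : inner ℝ (cross a b) a = 0 := by
  rw [inner_cross_eq_triple, triple_self_outer]

lemma inner_cross_right (a b : E3) : inner ℝ (cross a b) b = 0 := by
  rw [inner_cross_eq_triple, triple_self_right]

/-- The missing points have a vanishing cone coefficient and so lie on three great circles. -/
lemma area_sphTri_eq_open {a b c : E3} (h : GoodTriple a b c) (hD : triple a b c ≠ 0) :
    area (sphTri a b c) = area (openSphTri a b c) := by
  refine le_antisymm ?_ (area_mono (openSphTri_subset h))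
  have hD' : triple b c a ≠ 0 := by rwa [triple_rotate]
  have hD'' : triple c a b ≠ 0 := by rwa [triple_rotate]
  have hsub : sphTri a b c ⊆ openSphTri a b c ∪ (radial {y | inner ℝ (cross a b) y = 0} ∪
      (radial {y | inner ℝ (cross b c) y = 0} ∪ radial {y | inner ℝ (cross c a) y = 0})) := by
    rintro _ ⟨y, hy, h0, rfl⟩
    obtain ⟨α, β, γ, hα, hβ, hγ, rfl⟩ := mem_cone_three.1 hy
    rcases hγ.eq_or_lt with h1 | hγ
    · exact Or.inr (Or.inl ⟨_, by simp [← h1, inner_add_right, inner_smul_right, inner_cross_left,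
        inner_cross_right], h0, rfl⟩)
    rcases hα.eq_or_lt with h1 | hα
    · exact Or.inr (Or.inr (Or.inl ⟨_, by simp [← h1, inner_add_right, inner_smul_right,
        inner_cross_left, inner_cross_right], h0, rfl⟩))
    rcases hβ.eq_or_lt with h1 | hβ
    · exact Or.inr (Or.inr (Or.inr ⟨_, by simp [← h1, inner_add_right, inner_smul_right,
        inner_cross_left, inner_cross_right], h0, rfl⟩))
    exact Or.inl (mem_openSphTri hα hβ hγ)
  refine (area_mono hsub).trans ((area_union_le _ _).trans ?_)
  have z : area (radial {y | inner ℝ (cross a b) y = 0} ∪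
      (radial {y | inner ℝ (cross b c) y = 0} ∪ radial {y | inner ℝ (cross c a) y = 0})) = 0 :=
    measure_union_null (area_radial_eq_zero (cross_ne_zero_of_triple hD) fun y hy => hy)
      (measure_union_null (area_radial_eq_zero (cross_ne_zero_of_triple hD') fun y hy => hy)
        (area_radial_eq_zero (cross_ne_zero_of_triple hD'') fun y hy => hy))
  rw [z, add_zero]

/-- The triple products with pairs of vertices recover the barycentric coordinates up to a common
factor. These coordinates sum to one, so the two normalizing factors agree. -/
lemma injOn_normalized_coneParam {a b c : E3} (h : GoodTriple a b c) (hD : triple a b c ≠ 0) :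
    InjOn (fun p : E2 => ‖coneParam a b c (p 0) (p 1)‖⁻¹ • coneParam a b c (p 0) (p 1))
      openSquare' := by
  intro p hp q hq hpq
  simp only at hpq
  have hy := coneParam_ne_zero h (Ioo_subset_Icc_self hp.1) (Ioo_subset_Icc_self hp.2)
  have hz := coneParam_ne_zero h (Ioo_subset_Icc_self hq.1) (Ioo_subset_Icc_self hq.2)
  set s := ‖coneParam a b c (p 0) (p 1)‖⁻¹
  set t := ‖coneParam a b c (q 0) (q 1)‖⁻¹
  have hs : 0 < s := inv_pos.2 (norm_pos_iff.2 hy)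
  have ht : 0 < t := inv_pos.2 (norm_pos_iff.2 hz)
  have e1 := congrArg (fun y => triple a b y) hpq
  have e2 := congrArg (fun y => triple b c y) hpq
  have e3 := congrArg (fun y => triple c a y) hpq
  have hab : ∀ r θ, triple a b (coneParam a b c r θ) = (1 - r) * triple a b c := by
    intro r θ
    simp only [coneParam, triple_eq, PiLp.add_apply, PiLp.smul_apply, PiLp.sub_apply, smul_eq_mul]
    ring
  have hbc : ∀ r θ, triple b c (coneParam a b c r θ) = r * (1 - θ) * triple a b c := by
    intro r θ
    simp only [coneParam, triple_eq, PiLp.add_apply, PiLp.smul_apply, PiLp.sub_apply, smul_eq_mul]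
    ring
  have hca : ∀ r θ, triple c a (coneParam a b c r θ) = r * θ * triple a b c := by
    intro r θ
    simp only [coneParam, triple_eq, PiLp.add_apply, PiLp.smul_apply, PiLp.sub_apply, smul_eq_mul]
    ring
  simp only [triple_smul_right, hab, hbc, hca, ← mul_assoc] at e1 e2 e3
  replace e1 := mul_right_cancel₀ hD e1
  replace e2 := mul_right_cancel₀ hD e2
  replace e3 := mul_right_cancel₀ hD e3
  have est : s = t := by linarith
  rw [est] at e1 e2 e3
  have f0 : p 0 = q 0 := by
    have := mul_left_cancel₀ ht.ne' e1
    linarith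
  rw [f0] at e3
  have f1 : p 1 = q 1 := mul_left_cancel₀ (mul_pos ht hq.1.1).ne' e3
  ext i
  fin_cases i
  · exact f0
  · exact f1

lemma GoodTriple.map {a b c : E3} (h : GoodTriple a b c) (f : E3 ≃ₗᵢ[ℝ] E3) :
    GoodTriple (f a) (f b) (f c) where
  left := by rw [f.norm_map, h.left]
  mid := by rw [f.norm_map, h.mid]
  right := by rw [f.norm_map, h.right]
  ne_neg := by
    rw [← map_neg]
    exact fun h1 => h.ne_neg (f.injective h1)
  inner_left := by rw [f.inner_map_map]; exact h.inner_left
  inner_mid := by rw [f.inner_map_map]; exact h.inner_mid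

lemma abs_triple_map (f : E3 ≃ₗᵢ[ℝ] E3) (a b c : E3) :
    |triple (f a) (f b) (f c)| = |triple a b c| := by
  rw [← sq_eq_sq_iff_abs_eq_abs, triple_sq, triple_sq]
  simp only [f.norm_map, f.inner_map_map]

/-- With `c` at the north pole the whole triangle lies in the closed upper hemisphere, where
projection from the south pole is regular. Its Jacobian times `stereoDens` is the absolute value of
the solid angle density. -/
lemma area_openSphTri_north {a b c : E3} (h : GoodTriple a b c) (hD : triple a b c ≠ 0)
    (hc : c = north) : area (openSphTri a b c) = ENNReal.ofReal |solidAngle a b c| := by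
  set V : E2 → E3 := fun p => coneParam a b c (p 0) (p 1) with hV
  have hne : ∀ p ∈ openSquare', V p ≠ 0 := fun p hp =>
    coneParam_ne_zero h (Ioo_subset_Icc_self hp.1) (Ioo_subset_Icc_self hp.2)
  have hinner : ∀ y : E3, inner ℝ c y = y 2 := by
    intro y; rw [hc, inner_E3]; simp [north]
  have hup : ∀ p ∈ openSquare', 0 ≤ V p 2 := by
    intro p hp
    obtain ⟨α, β, γ, hα, hβ, hγ, e⟩ := mem_cone_three.1 (coneParam_mem_cone (a := a) (b := b)
      (c := c) (Ioo_subset_Icc_self hp.1) (Ioo_subset_Icc_self hp.2))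
    rw [← hinner, hV]
    simp only
    rw [e, inner_add_right, inner_add_right, inner_smul_right, inner_smul_right, inner_smul_right,
      real_inner_self_eq_norm_sq]
    have := h.inner_left
    have := h.inner_mid
    positivity
  choose V' hV' hV0 hV1 using fun p : E2 => hasFDerivAt_coneParam a b c p
  choose L hL hLdet using fun (p : E2) (hp : p ∈ openSquare') =>
    hasFDerivAt_stereo_comp (hV' p) (hne p hp) (hup p hp)
  classical
  let L' : E2 → E2 →L[ℝ] E2 := fun p => if hp : p ∈ openSquare' then L p hp else 0
  have himg : openSphTri a b c = stereoInv '' ((fun p => stereo (V p)) '' openSquare') := by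
    rw [← image_comp, openSphTri]
    refine image_congr fun p hp => ?_
    exact (stereoInv_stereo (hne p hp) (hup p hp)).symm
  have hdiff : ∀ p ∈ openSquare', HasFDerivWithinAt (fun p => stereo (V p)) (L' p)
      openSquare' p := by
    intro p hp
    simp only [L', dif_pos hp]
    exact (hL p hp).hasFDerivWithinAt
  have hinj : InjOn (fun p => stereo (V p)) openSquare' := by
    intro p hp q hq hpq
    refine injOn_normalized_coneParam h hD hp hq ?_
    have := congrArg stereoInv hpq
    simp only at this
    rwa [stereoInv_stereo (hne p hp) (hup p hp), stereoInv_stereo (hne q hq) (hup q hq)] at this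
  have hms : MeasurableSet ((fun p => stereo (V p)) '' openSquare') :=
    isOpen_openSquare'.measurableSet.image_of_continuousOn_injOn
      (fun p hp => (hdiff p hp).continuousWithinAt) hinj
  have hpt : ∀ p ∈ openSquare', |(L' p).det| * stereoDens (stereo (V p)) =
      |p 0 * triple a b c / ‖coneParam a b c (p 0) (p 1)‖ ^ 3| := by
    intro p hp
    simp only [L', dif_pos hp]
    have hn : 0 < ‖V p‖ := norm_pos_iff.2 (hne p hp)
    have hm : 0 < ‖V p‖ + V p 2 := by have := hup p hp; positivity
    have htr : triple (V p) (V' p (bv 0)) (V' p (bv 1)) = p 0 * triple a b c := by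
      rw [hV0, hV1, hV]
      simp only [coneParam, triple_eq, PiLp.add_apply, PiLp.smul_apply, PiLp.sub_apply,
        smul_eq_mul]
      ring
    rw [stereoDens_stereo (hne p hp) (hup p hp), hLdet, htr, abs_div, abs_div,
      abs_of_pos (pow_pos hn 3),
      abs_of_pos (mul_pos hn (pow_pos hm 2))]
    change _ = |p 0 * triple a b c| / ‖V p‖ ^ 3
    field_simp
  rw [himg, area_stereoInv_image hms, lintegral_image_eq_lintegral_abs_det_fderiv_mul volume
    isOpen_openSquare'.measurableSet hdiff hinj]
  have h1 : ∫⁻ p in openSquare', ENNReal.ofReal |(L' p).det| *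
      ENNReal.ofReal (stereoDens (stereo (V p))) =
      ∫⁻ p in openSquare', ENNReal.ofReal
        |p 0 * triple a b c / ‖coneParam a b c (p 0) (p 1)‖ ^ 3| := by
    refine setLIntegral_congr_fun isOpen_openSquare'.measurableSet fun p hp => ?_
    simp only
    rw [← ENNReal.ofReal_mul (abs_nonneg _), hpt p hp]
  rw [h1, ← setIntegral_openSquare h, ← setIntegral_openSquare'
    (fun r θ => r * triple a b c / ‖coneParam a b c r θ‖ ^ 3)]
  have hint : IntegrableOn (fun p : E2 => p 0 * triple a b c / ‖coneParam a b c (p 0) (p 1)‖ ^ 3)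
      openSquare' := by
    -- The integral of a non-integrable function is zero by default, whereas here it equals a
    -- nonzero solid angle.
    by_contra hcon
    have h2 : ∫ p in openSquare', p 0 * triple a b c / ‖coneParam a b c (p 0) (p 1)‖ ^ 3 = 0 :=
      integral_undef hcon
    rw [setIntegral_openSquare' (fun r θ => r * triple a b c / ‖coneParam a b c r θ‖ ^ 3),
      setIntegral_openSquare h] at h2
    have h3 := solidRe_pos h.left h.mid h.right h.ne_neg h.inner_left h.inner_mid
    rw [solidAngle_eq_arctan h3] at h2
    have h4 : triple a b c / solidRe a b c = 0 := by
      rw [← Real.arctan_eq_zero_iff]; linarith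
    rcases div_eq_zero_iff.1 h4 with h5 | h5
    · exact hD h5
    · exact h3.ne' h5
  rw [← ofReal_integral_eq_lintegral_ofReal hint.abs (Eventually.of_forall fun p => abs_nonneg _)]
  congr 1
  rcases lt_or_gt_of_ne hD with hneg | hpos
  · have e : ∀ p ∈ openSquare', |p 0 * triple a b c / ‖coneParam a b c (p 0) (p 1)‖ ^ 3| =
        -(p 0 * triple a b c / ‖coneParam a b c (p 0) (p 1)‖ ^ 3) := by
      intro p hp
      refine abs_of_nonpos (div_nonpos_of_nonpos_of_nonneg ?_ (by positivity))
      exact mul_nonpos_of_nonneg_of_nonpos hp.1.1.le hneg.le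
    rw [abs_of_nonpos, ← integral_neg]
    · exact setIntegral_congr_fun isOpen_openSquare'.measurableSet e
    · refine setIntegral_nonpos isOpen_openSquare'.measurableSet fun p hp => ?_
      rw [← neg_nonneg, ← e p hp]
      exact abs_nonneg _
  · have e : ∀ p ∈ openSquare', |p 0 * triple a b c / ‖coneParam a b c (p 0) (p 1)‖ ^ 3| =
        (p 0 * triple a b c / ‖coneParam a b c (p 0) (p 1)‖ ^ 3) := by
      intro p hp
      exact abs_of_nonneg (div_nonneg (mul_nonneg hp.1.1.le hpos.le) (by positivity))
    rw [abs_of_nonneg]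
    · exact setIntegral_congr_fun isOpen_openSquare'.measurableSet e
    · refine setIntegral_nonneg isOpen_openSquare'.measurableSet fun p hp => ?_
      rw [← e p hp]
      exact abs_nonneg _

lemma norm_north : ‖north‖ = 1 := by
  rw [← sq_eq_sq₀ (norm_nonneg _) zero_le_one, norm_sq_E3]; simp [north]

/-- The area of a spherical triangle is the absolute value of its solid angle. -/
lemma area_sphTri {a b c : E3} (h : GoodTriple a b c) :
    area (sphTri a b c) = ENNReal.ofReal |solidAngle a b c| := by
  have hre := solidRe_pos h.left h.mid h.right h.ne_neg h.inner_left h.inner_mid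
  by_cases hD : triple a b c = 0
  · rw [solidAngle_eq_zero hD hre.le, abs_zero, ENNReal.ofReal_zero]
    -- Dependent vertices lie in a plane, so the triangle lies on a great circle. The normal is a
    -- cross product of two vertices unless all three are parallel.
    have hex : ∃ n : E3, n ≠ 0 ∧ inner ℝ n a = 0 ∧ inner ℝ n b = 0 ∧ inner ℝ n c = 0 := by
      by_cases h1 : cross a b = 0
      · by_cases h2 : cross a c = 0
        · have hpar : ∀ y : E3, cross a y = 0 → y = (inner ℝ a y : ℝ) • a := by
            intro y hy
            have hn := norm_sq_E3 a
            rw [h.left] at hn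
            have y0 := cross_zero a y
            have y1 := cross_one a y
            have y2 := cross_two a y
            rw [hy] at y0 y1 y2
            simp only [PiLp.zero_apply] at y0 y1 y2
            ext i
            fin_cases i
            · simp [inner_E3]; linear_combination (y 0) * hn - a 2 * y1 + a 1 * y2
            · simp [inner_E3]; linear_combination (y 1) * hn + a 2 * y0 - a 0 * y2
            · simp [inner_E3]; linear_combination (y 2) * hn - a 1 * y0 + a 0 * y1
          have hex : ∃ n : E3, n ≠ 0 ∧ inner ℝ n a = 0 := by
            by_cases h3 : a 0 = 0 ∧ a 1 = 0
            · refine ⟨!₂[1, 0, 0], fun h0 => ?_, ?_⟩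
              · have := congrArg (fun y : E3 => y 0) h0
                simp at this
              · simp [inner_E3, h3.1]
            · refine ⟨!₂[-(a 1), a 0, 0], fun h0 => h3 ?_, ?_⟩
              · have e1 := congrArg (fun y : E3 => y 0) h0
                have e2 := congrArg (fun y : E3 => y 1) h0
                simp at e1 e2
                exact ⟨e2, e1⟩
              · simp [inner_E3]; ring
          obtain ⟨n, hn, hna⟩ := hex
          exact ⟨n, hn, hna, by rw [hpar b h1, inner_smul_right, hna, mul_zero],
            by rw [hpar c h2, inner_smul_right, hna, mul_zero]⟩
        · refine ⟨_, h2, inner_cross_left a c, ?_, inner_cross_right a c⟩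
          rw [inner_cross_eq_triple, ← triple_rotate, triple_swap, triple_rotate, hD, neg_zero]
      · exact ⟨_, h1, inner_cross_left a b, inner_cross_right a b, by
          rw [inner_cross_eq_triple, hD]⟩
    obtain ⟨n, hn, na, nb, nc⟩ := hex
    refine area_radial_eq_zero hn fun y hy => ?_
    obtain ⟨α, β, γ, -, -, -, rfl⟩ := mem_cone_three.1 hy
    simp [inner_add_right, inner_smul_right, na, nb, nc]
  -- A reflection moving `c` to the pole reduces to the previous case. It may reverse the
  -- orientation, and therefore only absolute values are compared.
  · set f : E3 ≃ₗᵢ[ℝ] E3 := (ℝ ∙ (c - north))ᗮ.reflection with hf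
    have hfc : f c = north := Submodule.reflection_sub (by rw [h.right, norm_north])
    have hD' : triple (f a) (f b) (f c) ≠ 0 := by
      rw [← abs_ne_zero, abs_triple_map, abs_ne_zero]; exact hD
    have himg : openSphTri (f a) (f b) (f c) = f '' openSphTri a b c := by
      rw [openSphTri, openSphTri, ← image_comp]
      refine image_congr fun p _ => ?_
      have e : coneParam (f a) (f b) (f c) (p 0) (p 1) = f (coneParam a b c (p 0) (p 1)) := by
        simp [coneParam]
      simp [e]
    rw [area_sphTri_eq_open h hD, ← area_isometry_image f, ← himg,
      area_openSphTri_north (h.map f) hD' hfc]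
    congr 1
    have hre' := (h.map f)
    have hre2 := solidRe_pos hre'.left hre'.mid hre'.right hre'.ne_neg hre'.inner_left
      hre'.inner_mid
    rw [solidAngle_eq_arctan hre, solidAngle_eq_arctan hre2]
    have e : solidRe (f a) (f b) (f c) = solidRe a b c := by
      simp only [solidRe, f.norm_map, f.inner_map_map]
    rw [e]
    rcases abs_eq_abs.1 (abs_triple_map f a b c) with h1 | h1
    · rw [h1]
    · rw [h1, neg_div, Real.arctan_neg, mul_neg, abs_neg]

/-! ### Combinatorics of the triangular lattice -/

/-- Indices of the elementary triangles: a base point, and `true` for triangles pointing up. -/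
abbrev Tri := ℤ × ℤ × Bool

/-- The lattice coordinates of the vertices of a triangle, in counterclockwise order. -/
def vert : Tri → Fin 3 → ℤ × ℤ
  | (a, b, true) => ![(a, b), (a + 1, b), (a, b + 1)]
  | (a, b, false) => ![(a + 1, b + 1), (a, b + 1), (a + 1, b)]

/-- The triangle on the other side of the edge from vertex `k` to vertex `k + 1`. -/
def nb : Tri → Fin 3 → Tri
  | (a, b, true) => ![(a, b - 1, false), (a, b, false), (a - 1, b, false)]
  | (a, b, false) => ![(a, b + 1, true), (a, b, true), (a + 1, b, true)]

/-- The vertices are labelled so that a common edge has the same index in both triangles, traversed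
in opposite directions. -/
lemma nb_nb (τ : Tri) (k : Fin 3) : nb (nb τ k) k = τ := by
  obtain ⟨a, b, _ | _⟩ := τ <;> fin_cases k <;> simp [nb]

lemma vert_nb (τ : Tri) (k : Fin 3) : vert (nb τ k) k = vert τ (k + 1) := by
  obtain ⟨a, b, _ | _⟩ := τ <;> fin_cases k <;> simp [nb, vert]

lemma vert_nb_succ (τ : Tri) (k : Fin 3) : vert (nb τ k) (k + 1) = vert τ k := by
  obtain ⟨a, b, _ | _⟩ := τ <;> fin_cases k <;> simp [nb, vert]

lemma nb_injective (τ : Tri) : Function.Injective (nb τ) := by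
  intro k l h
  obtain ⟨a, b, _ | _⟩ := τ <;> fin_cases k <;> fin_cases l <;> simp [nb] at h ⊢ <;> omega

lemma nb_ne (τ : Tri) (k : Fin 3) : nb τ k ≠ τ := by
  obtain ⟨a, b, _ | _⟩ := τ <;> fin_cases k <;> simp [nb]

lemma vert_injective (τ : Tri) : Function.Injective (vert τ) := by
  intro k l h
  obtain ⟨a, b, _ | _⟩ := τ <;> fin_cases k <;> fin_cases l <;> simp [vert] at h ⊢

/-- A triangle containing an edge of `τ` is `τ` or its neighbor. -/
lemma eq_or_eq_nb {τ τ' : Tri} {k l m : Fin 3} (h1 : vert τ' l = vert τ k)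
    (h2 : vert τ' m = vert τ (k + 1)) : τ' = τ ∨ τ' = nb τ k := by
  obtain ⟨a, b, _ | _⟩ := τ <;> obtain ⟨a', b', _ | _⟩ := τ' <;> fin_cases k <;> fin_cases l <;>
    fin_cases m <;> simp [nb, vert] at h1 h2 ⊢ <;> omega

/-- Being at unit distance in the triangular lattice. -/
def UnitStep (z w : ℤ × ℤ) : Prop :=
  (w.1 - z.1) ^ 2 + (w.1 - z.1) * (w.2 - z.2) + (w.2 - z.2) ^ 2 = 1

/-- The six units of the Eisenstein integers. -/
lemma unit_cases {A B : ℤ} (h : A ^ 2 + A * B + B ^ 2 = 1) :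
    (A = 1 ∧ B = 0) ∨ (A = 0 ∧ B = 1) ∨ (A = -1 ∧ B = 1) ∨ (A = -1 ∧ B = 0) ∨
      (A = 0 ∧ B = -1) ∨ (A = 1 ∧ B = -1) := by
  have h1 : A ≤ 1 := by nlinarith [sq_nonneg (A + 2 * B), sq_nonneg (2 * A + B)]
  have h2 : -1 ≤ A := by nlinarith [sq_nonneg (A + 2 * B), sq_nonneg (2 * A + B)]
  have h3 : B ≤ 1 := by nlinarith [sq_nonneg (A + 2 * B), sq_nonneg (2 * A + B)]
  have h4 : -1 ≤ B := by nlinarith [sq_nonneg (A + 2 * B), sq_nonneg (2 * A + B)]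
  interval_cases A <;> interval_cases B <;> simp_all

/-- The lattice point on the left of the edge from `z` to `w`. -/
def leftPt (z w : ℤ × ℤ) : ℤ × ℤ := (z.1 - (w.2 - z.2), z.2 + (w.1 - z.1) + (w.2 - z.2))

lemma exists_left_triangle {z w : ℤ × ℤ} (h : UnitStep z w) :
    ∃ τ k, vert τ k = z ∧ vert τ (k + 1) = w ∧ vert τ (k + 2) = leftPt z w := by
  obtain ⟨a, b⟩ := z
  obtain ⟨c, d⟩ := w
  rcases unit_cases h with h | h | h | h | h | h <;> obtain ⟨h1, h2⟩ := h <;> simp only at h1 h2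
  · exact ⟨(a, b, true), 0, by simp [vert], by simp [vert]; omega, by simp [vert, leftPt]; omega⟩
  · exact ⟨(a - 1, b, false), 2, by simp [vert], by simp [vert]; omega,
      by simp [vert, leftPt]; omega⟩
  · exact ⟨(a - 1, b, true), 1, by simp [vert], by simp [vert]; omega,
      by simp [vert, leftPt]; omega⟩
  · exact ⟨(a - 1, b - 1, false), 0, by simp [vert], by simp [vert]; omega,
      by simp [vert, leftPt]; omega⟩
  · exact ⟨(a, b - 1, true), 2, by simp [vert], by simp [vert]; omega,
      by simp [vert, leftPt]; omega⟩
  · exact ⟨(a, b - 1, false), 1, by simp [vert], by simp [vert]; omega,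
      by simp [vert, leftPt]; omega⟩

lemma UnitStep.symm {z w : ℤ × ℤ} (h : UnitStep z w) : UnitStep w z := by
  unfold UnitStep at *; linarith

lemma eq_leftPt_or {z w y : ℤ × ℤ} (h1 : UnitStep z w) (h2 : UnitStep w y) (h3 : UnitStep z y) :
    y = leftPt z w ∨ y = leftPt w z := by
  obtain ⟨a, b⟩ := z
  obtain ⟨c, d⟩ := w
  obtain ⟨e, f⟩ := y
  simp only [UnitStep, leftPt, Prod.mk.injEq] at *
  have h4 := unit_cases h1
  have h5 := unit_cases h3
  have h6 := unit_cases h2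
  omega

lemma unitStep_vert (τ : Tri) {k l : Fin 3} (h : k ≠ l) : UnitStep (vert τ k) (vert τ l) := by
  obtain ⟨a, b, _ | _⟩ := τ <;> fin_cases k <;> fin_cases l <;> simp [vert, UnitStep] at h ⊢

/-- Three lattice points at mutual unit distance are the vertices of a triangle. -/
lemma exists_triangle {z w y : ℤ × ℤ} (h1 : UnitStep z w) (h2 : UnitStep w y)
    (h3 : UnitStep z y) : ∃ τ k, (vert τ k = z ∧ vert τ (k + 1) = w ∧ vert τ (k + 2) = y) ∨
      (vert τ k = w ∧ vert τ (k + 1) = z ∧ vert τ (k + 2) = y) := by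
  rcases eq_leftPt_or h1 h2 h3 with h | h
  · obtain ⟨τ, k, e1, e2, e3⟩ := exists_left_triangle h1
    exact ⟨τ, k, Or.inl ⟨e1, e2, e3.trans h.symm⟩⟩
  · obtain ⟨τ, k, e1, e2, e3⟩ := exists_left_triangle h1.symm
    exact ⟨τ, k, Or.inr ⟨e1, e2, e3.trans h.symm⟩⟩

/-! ### Lattice points and barycentric coordinates -/

/-- The lattice node with given coordinates. -/
noncomputable def pos (ε : ℝ) (z : ℤ × ℤ) : lattice ε :=
  ⟨ε • ((z.1 : ℝ) • (!₂[1, 0] : E2) + (z.2 : ℝ) • (!₂[1 / 2, √3 / 2] : E2)), z.1, z.2, rfl⟩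

lemma pos_surjective (ε : ℝ) : Function.Surjective (pos ε) := by
  rintro ⟨x, a, b, rfl⟩
  exact ⟨(a, b), rfl⟩

lemma pos_zero (ε : ℝ) (z : ℤ × ℤ) : (pos ε z : E2) 0 = ε * (z.1 + z.2 / 2) := by
  simp [pos]; ring

lemma pos_one (ε : ℝ) (z : ℤ × ℤ) : (pos ε z : E2) 1 = ε * (z.2 * (√3 / 2)) := by
  simp [pos]

lemma dist_pos_sq (ε : ℝ) (z w : ℤ × ℤ) : dist (pos ε z) (pos ε w) ^ 2 =
    ε ^ 2 * (((w.1 - z.1) ^ 2 + (w.1 - z.1) * (w.2 - z.2) + (w.2 - z.2) ^ 2 : ℤ) : ℝ) := by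
  rw [Subtype.dist_eq, dist_eq_norm, norm_sq_E2]
  simp only [PiLp.sub_apply, pos_zero, pos_one]
  have h3 : √3 ^ 2 = (3 : ℝ) := Real.sq_sqrt (by norm_num)
  push_cast
  linear_combination (ε ^ 2 * ((z.2 : ℝ) - w.2) ^ 2 / 4) * h3

lemma dist_pos_eq_iff {ε : ℝ} (hε : 0 < ε) (z w : ℤ × ℤ) :
    dist (pos ε z) (pos ε w) = ε ↔ UnitStep z w := by
  rw [← sq_eq_sq₀ dist_nonneg hε.le, dist_pos_sq, UnitStep]
  constructor
  · intro h
    have := mul_left_cancel₀ (pow_pos hε 2).ne' (h.trans (mul_one _).symm)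
    exact_mod_cast this
  · intro h
    rw [h]; simp

/-- The first lattice coordinate of a point of the plane. -/
noncomputable def cs (ε : ℝ) (x : E2) : ℝ := (x 0 - x 1 / √3) / ε

/-- The second lattice coordinate of a point of the plane. -/
noncomputable def ct (ε : ℝ) (x : E2) : ℝ := (2 * x 1 / √3) / ε

lemma cs_pos {ε : ℝ} (hε : 0 < ε) (z : ℤ × ℤ) : cs ε (pos ε z) = z.1 := by
  have h3 : 0 < √(3 : ℝ) := by positivity
  rw [cs, pos_zero, pos_one]; field_simp; ring

lemma ct_pos {ε : ℝ} (hε : 0 < ε) (z : ℤ × ℤ) : ct ε (pos ε z) = z.2 := by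
  have h3 : 0 < √(3 : ℝ) := by positivity
  rw [ct, pos_one]; field_simp

lemma pos_injective {ε : ℝ} (hε : 0 < ε) : Function.Injective (pos ε) := by
  intro z w h
  have h1 := cs_pos hε z
  have h2 := ct_pos hε z
  rw [h, cs_pos hε] at h1
  rw [h, ct_pos hε] at h2
  exact Prod.ext (by exact_mod_cast h1.symm) (by exact_mod_cast h2.symm)

/-- Barycentric coordinates in terms of lattice coordinates. -/
def baryC : Tri → Fin 3 → ℝ → ℝ → ℝ
  | (a, b, true), k, s, t => ![1 - (s - a) - (t - b), s - a, t - b] k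
  | (a, b, false), k, s, t => ![(s - a) + (t - b) - 1, a + 1 - s, b + 1 - t] k

/-- The barycentric coordinates of a point with respect to a triangle. -/
noncomputable def bary (ε : ℝ) (τ : Tri) (k : Fin 3) (x : E2) : ℝ := baryC τ k (cs ε x) (ct ε x)

lemma sum_bary (ε : ℝ) (τ : Tri) (x : E2) : ∑ k, bary ε τ k x = 1 := by
  obtain ⟨a, b, _ | _⟩ := τ <;> simp [bary, baryC, Fin.sum_univ_three] <;> ring

lemma bary_combo (ε : ℝ) (τ : Tri) (k : Fin 3) {ι : Type*} (s : Finset ι) (c : ι → ℝ) (x : ι → E2)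
    (hc : ∑ i ∈ s, c i = 1) : bary ε τ k (∑ i ∈ s, c i • x i) = ∑ i ∈ s, c i * bary ε τ k (x i) := by
  have e1 : cs ε (∑ i ∈ s, c i • x i) = ∑ i ∈ s, c i * cs ε (x i) := by
    simp only [cs, WithLp.ofLp_sum, Finset.sum_apply, PiLp.smul_apply, smul_eq_mul,
      Finset.sum_div, ← Finset.sum_sub_distrib]
    exact Finset.sum_congr rfl fun i _ => by ring
  have e2 : ct ε (∑ i ∈ s, c i • x i) = ∑ i ∈ s, c i * ct ε (x i) := by
    simp only [ct, WithLp.ofLp_sum, Finset.sum_apply, PiLp.smul_apply, smul_eq_mul,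
      Finset.sum_div, Finset.mul_sum]
    exact Finset.sum_congr rfl fun i _ => by ring
  have key : ∀ α β γ : ℝ, α + β * (∑ i ∈ s, c i * cs ε (x i)) + γ * (∑ i ∈ s, c i * ct ε (x i)) =
      ∑ i ∈ s, c i * (α + β * cs ε (x i) + γ * ct ε (x i)) := by
    intro α β γ
    calc _ = α * (∑ i ∈ s, c i) + β * (∑ i ∈ s, c i * cs ε (x i)) +
          γ * (∑ i ∈ s, c i * ct ε (x i)) := by rw [hc, mul_one]
      _ = _ := by
        rw [Finset.mul_sum, Finset.mul_sum, Finset.mul_sum, ← Finset.sum_add_distrib,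
          ← Finset.sum_add_distrib]
        exact Finset.sum_congr rfl fun i _ => by ring
  have aff : ∃ α β γ : ℝ, ∀ y : E2, bary ε τ k y = α + β * cs ε y + γ * ct ε y := by
    obtain ⟨a, b, _ | _⟩ := τ <;> fin_cases k
    · exact ⟨-a - b - 1, 1, 1, fun y => by simp [bary, baryC]; ring⟩
    · exact ⟨a + 1, -1, 0, fun y => by simp [bary, baryC]; ring⟩
    · exact ⟨b + 1, 0, -1, fun y => by simp [bary, baryC]; ring⟩
    · exact ⟨1 + a + b, -1, -1, fun y => by simp [bary, baryC]; ring⟩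
    · exact ⟨-a, 1, 0, fun y => by simp [bary, baryC]; ring⟩
    · exact ⟨-b, 0, 1, fun y => by simp [bary, baryC]; ring⟩
  obtain ⟨α, β, γ, h⟩ := aff
  simp only [h, e1, e2]
  exact key α β γ

lemma bary_vert {ε : ℝ} (hε : 0 < ε) (τ : Tri) (k l : Fin 3) :
    bary ε τ k (pos ε (vert τ l)) = if k = l then 1 else 0 := by
  rw [bary, cs_pos hε, ct_pos hε]
  obtain ⟨a, b, _ | _⟩ := τ <;> fin_cases k <;> fin_cases l <;> simp [baryC, vert]

lemma eq_sum_bary {ε : ℝ} (hε : 0 < ε) (τ : Tri) (x : E2) :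
    x = ∑ k, bary ε τ k x • (pos ε (vert τ k) : E2) := by
  have h3 : 0 < √(3 : ℝ) := by positivity
  have h3' : √3 ^ 2 = (3 : ℝ) := Real.sq_sqrt (by norm_num)
  ext i
  fin_cases i
  · obtain ⟨a, b, _ | _⟩ := τ <;>
      simp [Fin.sum_univ_three, pos_zero, bary, baryC, vert, cs, ct] <;> field_simp <;> ring
  · obtain ⟨a, b, _ | _⟩ := τ <;>
      simp [Fin.sum_univ_three, pos_one, bary, baryC, vert, cs, ct] <;> field_simp <;> ring

/-- The closed triangle with index `τ`. -/
def tcell (ε : ℝ) (τ : Tri) : Set E2 := {x | ∀ k, 0 ≤ bary ε τ k x}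

/-- The open triangle with index `τ`. -/
def ocell (ε : ℝ) (τ : Tri) : Set E2 := {x | ∀ k, 0 < bary ε τ k x}

lemma continuous_bary (ε : ℝ) (τ : Tri) (k : Fin 3) : Continuous (bary ε τ k) := by
  change Continuous fun x => baryC τ k (cs ε x) (ct ε x)
  obtain ⟨a, b, _ | _⟩ := τ <;> fin_cases k <;> simp [baryC, cs, ct] <;> fun_prop

lemma isClosed_tcell (ε : ℝ) (τ : Tri) : IsClosed (tcell ε τ) := by
  rw [tcell, ofPred_forall]
  exact isClosed_iInter fun k => isClosed_le continuous_const (continuous_bary ε τ k)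

lemma isOpen_ocell (ε : ℝ) (τ : Tri) : IsOpen (ocell ε τ) := by
  rw [ocell, ofPred_forall]
  exact isOpen_iInter_of_finite fun k => isOpen_lt continuous_const (continuous_bary ε τ k)

lemma ocell_subset_tcell (ε : ℝ) (τ : Tri) : ocell ε τ ⊆ tcell ε τ := fun _ hx k => (hx k).le

lemma bary_two (ε : ℝ) (τ : Tri) (k : Fin 3) {α β : ℝ} (x y : E2) (h : α + β = 1) :
    bary ε τ k (α • x + β • y) = α * bary ε τ k x + β * bary ε τ k y := by
  have := bary_combo ε τ k Finset.univ ![α, β] ![x, y] (by simp [Fin.sum_univ_two, h])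
  simpa [Fin.sum_univ_two] using this

lemma convex_tcell (ε : ℝ) (τ : Tri) : Convex ℝ (tcell ε τ) := by
  intro x hx y hy α β hα hβ h k
  rw [bary_two ε τ k x y h]
  exact add_nonneg (mul_nonneg hα (hx k)) (mul_nonneg hβ (hy k))

lemma pos_vert_mem_tcell {ε : ℝ} (hε : 0 < ε) (τ : Tri) (k : Fin 3) :
    (pos ε (vert τ k) : E2) ∈ tcell ε τ := by
  intro l
  rw [bary_vert hε]
  split_ifs <;> norm_num

/-- The set of vertices of a triangle. -/
noncomputable def vset (ε : ℝ) (τ : Tri) : Finset (lattice ε) :=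
  open Classical in Finset.univ.image fun k => pos ε (vert τ k)

lemma mem_vset {ε : ℝ} {τ : Tri} {i : lattice ε} : i ∈ vset ε τ ↔ ∃ k, pos ε (vert τ k) = i := by
  classical
  simp [vset]

lemma cell_vset {ε : ℝ} (hε : 0 < ε) (τ : Tri) : cell (vset ε τ) = tcell ε τ := by
  apply Subset.antisymm
  · refine convexHull_min ?_ (convex_tcell ε τ)
    rintro _ ⟨i, hi, rfl⟩
    obtain ⟨k, rfl⟩ := mem_vset.1 hi
    exact pos_vert_mem_tcell hε τ k
  · intro x hx
    rw [eq_sum_bary hε τ x]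
    refine (convex_convexHull ℝ _).sum_mem (fun k _ => hx k) (sum_bary ε τ x) fun k _ => ?_
    exact subset_convexHull ℝ _ ⟨_, mem_vset.2 ⟨k, rfl⟩, rfl⟩

lemma pos_vert_injective {ε : ℝ} (hε : 0 < ε) (τ : Tri) :
    Function.Injective fun k => pos ε (vert τ k) := (pos_injective hε).comp (vert_injective τ)

lemma sum_vset {ε : ℝ} (hε : 0 < ε) (τ : Tri) {M : Type*} [AddCommMonoid M] (f : lattice ε → M) :
    ∑ i ∈ vset ε τ, f i = ∑ k, f (pos ε (vert τ k)) := by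
  classical
  rw [vset, Finset.sum_image fun k _ l _ h => pos_vert_injective hε τ h]

lemma isTriangle_vset {ε : ℝ} (hε : 0 < ε) (τ : Tri) : IsTriangle (vset ε τ) := by
  classical
  refine ⟨?_, ?_⟩
  · rw [vset, Finset.card_image_of_injective _ (pos_vert_injective hε τ)]; simp
  · intro i hi j hj hij
    obtain ⟨k, rfl⟩ := mem_vset.1 hi
    obtain ⟨l, rfl⟩ := mem_vset.1 hj
    exact (dist_pos_eq_iff hε _ _).2 (unitStep_vert τ fun h => hij (by rw [h]))

lemma exists_fin_three (k : Fin 3) {P : Fin 3 → Prop} :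
    (∃ l, P l) ↔ P k ∨ P (k + 1) ∨ P (k + 2) := by
  fin_cases k <;> simp [Fin.exists_fin_succ] <;> tauto

lemma isTriangle_iff {ε : ℝ} (hε : 0 < ε) {t : Finset (lattice ε)} :
    IsTriangle t ↔ ∃ τ, t = vset ε τ := by
  classical
  constructor
  · rintro ⟨hc, hd⟩
    obtain ⟨i, j, k, hij, hik, hjk, rfl⟩ := Finset.card_eq_three.1 hc
    have h1 := hd i (by simp) j (by simp) hij
    have h2 := hd j (by simp) k (by simp) hjk
    have h3 := hd i (by simp) k (by simp) hik
    obtain ⟨z, rfl⟩ := pos_surjective ε i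
    obtain ⟨w, rfl⟩ := pos_surjective ε j
    obtain ⟨y, rfl⟩ := pos_surjective ε k
    rw [dist_pos_eq_iff hε] at h1 h2 h3
    obtain ⟨τ, l, ⟨rfl, rfl, rfl⟩ | ⟨rfl, rfl, rfl⟩⟩ := exists_triangle h1 h2 h3
    · refine ⟨τ, Finset.ext fun i => ?_⟩
      rw [mem_vset, exists_fin_three l]
      simp [eq_comm]
    · refine ⟨τ, Finset.ext fun i => ?_⟩
      rw [mem_vset, exists_fin_three l]
      simp [eq_comm]; tauto
  · rintro ⟨τ, rfl⟩
    exact isTriangle_vset hε τ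

/-- An interior point of a triangle belongs to no other triangle. -/
lemma eq_of_mem_ocell {ε : ℝ} {τ τ' : Tri} {x : E2} (h : x ∈ ocell ε τ) (h' : x ∈ tcell ε τ') :
    τ' = τ := by
  have h0 := h 0
  have h1 := h 1
  have h2 := h 2
  have k0 := h' 0
  have k1 := h' 1
  have k2 := h' 2
  simp only [bary] at *
  generalize cs ε x = s at *
  generalize ct ε x = t at *
  obtain ⟨a, b, _ | _⟩ := τ <;> obtain ⟨a', b', _ | _⟩ := τ' <;> simp [baryC] at *
  · have e1 : (a : ℝ) < a' + 1 := by linarith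
    have e2 : (b : ℝ) < b' + 1 := by linarith
    have e3 : (a' : ℝ) + b' < a + b + 1 := by linarith
    norm_cast at e1 e2 e3
    omega
  · have e1 : (a' : ℝ) < a + 1 := by linarith
    have e2 : (b' : ℝ) < b + 1 := by linarith
    have e3 : (a : ℝ) + b < a' + b' := by linarith
    norm_cast at e1 e2 e3
    omega
  · have e1 : (a : ℝ) < a' + 1 := by linarith
    have e2 : (b : ℝ) < b' + 1 := by linarith
    have e3 : (a' : ℝ) + b' < a + b := by linarith
    norm_cast at e1 e2 e3
    omega
  · have e1 : (a' : ℝ) < a + 1 := by linarith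
    have e2 : (b' : ℝ) < b + 1 := by linarith
    have e3 : (a : ℝ) + b < a' + b' + 1 := by linarith
    norm_cast at e1 e2 e3
    omega

lemma pos_mem_tcell {ε : ℝ} (hε : 0 < ε) {τ : Tri} {z : ℤ × ℤ} (h : (pos ε z : E2) ∈ tcell ε τ) :
    ∃ k, vert τ k = z := by
  have k0 := h 0
  have k1 := h 1
  have k2 := h 2
  simp only [bary, cs_pos hε, ct_pos hε] at *
  obtain ⟨c, d⟩ := z
  obtain ⟨a, b, _ | _⟩ := τ <;> simp [baryC] at * <;> norm_cast at * <;>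
    simp only [vert, Fin.exists_fin_succ] <;> simp <;> omega

/-- The barycenter of a triangle. -/
noncomputable def center (ε : ℝ) (τ : Tri) : E2 := ∑ k, (1 / 3 : ℝ) • (pos ε (vert τ k) : E2)

lemma bary_center {ε : ℝ} (hε : 0 < ε) (τ : Tri) (k : Fin 3) :
    bary ε τ k (center ε τ) = 1 / 3 := by
  rw [center, bary_combo ε τ k _ _ _ (by simp)]
  simp [bary_vert hε]

lemma center_mem_ocell {ε : ℝ} (hε : 0 < ε) (τ : Tri) : center ε τ ∈ ocell ε τ := by
  intro k; rw [bary_center hε]; norm_num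

lemma vset_injective {ε : ℝ} (hε : 0 < ε) : Function.Injective (vset ε) := by
  intro τ τ' h
  have h1 : tcell ε τ = tcell ε τ' := by rw [← cell_vset hε, ← cell_vset hε, h]
  refine (eq_of_mem_ocell (center_mem_ocell hε τ) ?_).symm
  rw [← h1]
  exact ocell_subset_tcell _ _ (center_mem_ocell hε τ)

/-- The coordinate vanishing on the common edge changes sign, so the two triangles lie on opposite
sides of it. -/
lemma bary_nb (ε : ℝ) (τ : Tri) (k : Fin 3) (x : E2) :
    bary ε (nb τ k) (k + 2) x = - bary ε τ (k + 2) x := by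
  simp only [bary]
  obtain ⟨a, b, _ | _⟩ := τ <;> fin_cases k <;> simp [nb, baryC] <;> ring

lemma sum_fin_three {M : Type*} [AddCommMonoid M] (f : Fin 3 → M) (k : Fin 3) :
    ∑ l, f l = f k + f (k + 1) + f (k + 2) := by
  rw [Fin.sum_univ_three]
  fin_cases k
  · rfl
  · simp only [Fin.mk_one]; rw [add_assoc, add_comm]; rfl
  · simp only [Fin.reduceFinMk]; rw [add_comm, ← add_assoc]; rfl

lemma tcell_inter_nb {ε : ℝ} (hε : 0 < ε) (τ : Tri) (k : Fin 3) :
    tcell ε τ ∩ tcell ε (nb τ k) =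
      segment ℝ (pos ε (vert τ k) : E2) (pos ε (vert τ (k + 1))) := by
  apply Subset.antisymm
  · rintro x ⟨hx, hx'⟩
    have h1 := hx' (k + 2)
    rw [bary_nb] at h1
    have h2 : bary ε τ (k + 2) x = 0 := le_antisymm (by linarith) (hx (k + 2))
    have h3 := sum_bary ε τ x
    have h4 := eq_sum_bary hε τ x
    rw [sum_fin_three _ k, h2, add_zero] at h3
    rw [sum_fin_three _ k, h2, zero_smul, add_zero] at h4
    exact ⟨_, _, hx k, hx (k + 1), h3, h4.symm⟩
  · refine subset_inter ((convex_tcell ε τ).segment_subset (pos_vert_mem_tcell hε τ _)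
      (pos_vert_mem_tcell hε τ _)) ((convex_tcell ε _).segment_subset ?_ ?_)
    · rw [← vert_nb_succ]; exact pos_vert_mem_tcell hε _ _
    · rw [← vert_nb]; exact pos_vert_mem_tcell hε _ _

lemma fin_three_cases {k l : Fin 3} (h : k ≠ l) : l = k + 1 ∨ k = l + 1 := by
  fin_cases k <;> fin_cases l <;> simp at h ⊢

lemma neighbor_iff {ε : ℝ} (hε : 0 < ε) (u : SpinField ε) (τ τ' : Tri) :
    Neighbor u (vset ε τ) (vset ε τ') ↔
      ∃ k, u (pos ε (vert τ k)) = -u (pos ε (vert τ (k + 1))) ∧ τ' = nb τ k := by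
  constructor
  · rintro ⟨-, -, i, j, hd, hu, hcell⟩
    rw [cell_vset hε, cell_vset hε] at hcell
    obtain ⟨z, rfl⟩ := pos_surjective ε i
    obtain ⟨w, rfl⟩ := pos_surjective ε j
    have hz := hcell.symm ▸ left_mem_segment ℝ (pos ε z : E2) (pos ε w)
    have hw := hcell.symm ▸ right_mem_segment ℝ (pos ε z : E2) (pos ε w)
    obtain ⟨k, rfl⟩ := pos_mem_tcell hε hz.1
    obtain ⟨l, rfl⟩ := pos_mem_tcell hε hw.1
    obtain ⟨k', hk'⟩ := pos_mem_tcell hε hz.2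
    obtain ⟨l', hl'⟩ := pos_mem_tcell hε hw.2
    have hkl : k ≠ l := by
      rintro rfl
      rw [dist_self] at hd
      exact hε.ne hd
    -- The three indices sum to zero modulo three, so `-(k + l)` is the index of the third vertex.
    have hthird : ∀ k l : Fin 3, k ≠ l → -(k + l) ≠ k ∧ -(k + l) ≠ l := by decide
    have hne : τ' ≠ τ := by
      rintro rfl
      rw [inter_self] at hcell
      have h1 := hcell ▸ pos_vert_mem_tcell hε τ' (-(k + l))
      obtain ⟨α, β, -, -, hαβ, h2⟩ := h1
      have h3 := congrArg (bary ε τ' (-(k + l))) h2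
      rw [bary_two _ _ _ _ _ hαβ, bary_vert hε, bary_vert hε, bary_vert hε, if_pos rfl, if_neg,
        if_neg] at h3
      · norm_num at h3
      · exact (hthird k l hkl).2
      · exact (hthird k l hkl).1
    rcases fin_three_cases hkl with rfl | rfl
    · exact ⟨k, hu, (eq_or_eq_nb hk' hl').resolve_left hne⟩
    · exact ⟨l, by rw [hu, neg_neg], (eq_or_eq_nb hl' hk').resolve_left hne⟩
  · rintro ⟨k, hu, rfl⟩
    refine ⟨isTriangle_vset hε _, isTriangle_vset hε _, _, _, ?_, hu, ?_⟩
    · exact (dist_pos_eq_iff hε _ _).2 (unitStep_vert τ (by fin_cases k <;> simp))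
    · rw [cell_vset hε, cell_vset hε, tcell_inter_nb hε]

lemma leftVertex_pos (ε : ℝ) (z w : ℤ × ℤ) :
    leftVertex (pos ε z) (pos ε w) = pos ε (leftPt z w) := by
  have h3 : √3 ^ 2 = (3 : ℝ) := Real.sq_sqrt (by norm_num)
  ext i
  fin_cases i
  · simp [leftVertex, rot60, pos_zero, pos_one, leftPt]
    linear_combination (-ε * ((w.2 : ℝ) - z.2) / 4) * h3
  · simp [leftVertex, rot60, pos_zero, pos_one, leftPt]
    ring

/-! ### Locating points in triangles -/

/-- A triangle containing a given point. -/
noncomputable def loc (ε : ℝ) (x : E2) : Tri :=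
  open Classical in
  (⌊cs ε x⌋, ⌊ct ε x⌋, decide (Int.fract (cs ε x) + Int.fract (ct ε x) ≤ 1))

lemma mem_tcell_loc (ε : ℝ) (x : E2) : x ∈ tcell ε (loc ε x) := by
  have h1 := Int.floor_le (cs ε x)
  have h2 := Int.floor_le (ct ε x)
  have h3 := (Int.lt_floor_add_one (cs ε x)).le
  have h4 := (Int.lt_floor_add_one (ct ε x)).le
  intro k
  by_cases h : Int.fract (cs ε x) + Int.fract (ct ε x) ≤ 1
  · rw [loc, decide_eq_true h]
    rw [Int.fract, Int.fract] at h
    simp only [bary, baryC]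
    generalize cs ε x = s at *
    generalize ct ε x = t at *
    fin_cases k <;> simp only [Fin.zero_eta, Fin.mk_one, Fin.reduceFinMk, Matrix.cons_val] <;>
      linarith
  · rw [loc, decide_eq_false h]
    rw [Int.fract, Int.fract] at h
    simp only [bary, baryC]
    generalize cs ε x = s at *
    generalize ct ε x = t at *
    fin_cases k <;> simp only [Fin.zero_eta, Fin.mk_one, Fin.reduceFinMk, Matrix.cons_val] <;>
      linarith

lemma iUnion_tcell (ε : ℝ) : ⋃ τ, tcell ε τ = univ :=
  eq_univ_of_forall fun x => mem_iUnion.2 ⟨_, mem_tcell_loc ε x⟩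

lemma eq_pos_of_int {ε : ℝ} (hε : 0 < ε) {x : E2} {a b : ℤ} (h1 : cs ε x = a) (h2 : ct ε x = b) :
    x = pos ε (a, b) := by
  have h3 : 0 < √(3 : ℝ) := by positivity
  have h3' : √3 ^ 2 = (3 : ℝ) := Real.sq_sqrt (by norm_num)
  rw [cs, div_eq_iff hε.ne'] at h1
  rw [ct, div_eq_iff hε.ne', div_eq_iff h3.ne'] at h2
  have e1 : x 1 / √3 = b * ε / 2 := by
    rw [div_eq_iff h3.ne']; linarith
  ext i
  fin_cases i
  · simp [pos_zero]; linarith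
  · simp [pos_one]; linarith

/-- Outside of the lattice, a triangle containing a point is the located one, or one of its
neighbors. -/
lemma loc_cases {ε : ℝ} (hε : 0 < ε) {τ : Tri} {x : E2} (hx : x ∈ tcell ε τ) :
    (∃ z, x = pos ε z) ∨ loc ε x = τ ∨ ∃ k, loc ε x = nb τ k ∧ bary ε τ (k + 2) x = 0 := by
  have k0 := hx 0
  have k1 := hx 1
  have k2 := hx 2
  have hp := fun a b => eq_pos_of_int hε (x := x) (a := a) (b := b)
  unfold loc
  simp only [bary] at *
  generalize cs ε x = s at *
  generalize ct ε x = t at *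
  obtain ⟨a, b, _ | _⟩ := τ <;> simp [baryC] at k0 k1 k2
  · by_cases h1 : s = a + 1
    · by_cases h2 : t = b + 1
      · exact Or.inl ⟨_, hp (a + 1) (b + 1) (by push_cast; exact h1) (by push_cast; exact h2)⟩
      · have f1 : ⌊s⌋ = a + 1 := Int.floor_eq_iff.2 ⟨by push_cast; linarith, by push_cast; linarith⟩
        have f2 : ⌊t⌋ = b := Int.floor_eq_iff.2 ⟨by linarith, lt_of_le_of_ne k2 h2⟩
        have f3 : Int.fract s + Int.fract t ≤ 1 := by
          rw [Int.fract, Int.fract, f1, f2]; push_cast; linarith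
        refine Or.inr (Or.inr ⟨2, ?_, ?_⟩)
        · rw [f1, f2, decide_eq_true f3]; simp [nb]
        · simp [baryC]; linarith
    · have g1 : s < a + 1 := lt_of_le_of_ne k1 h1
      have f1 : ⌊s⌋ = a := Int.floor_eq_iff.2 ⟨by linarith, g1⟩
      by_cases h2 : t = b + 1
      · have f2 : ⌊t⌋ = b + 1 := Int.floor_eq_iff.2 ⟨by push_cast; linarith, by push_cast; linarith⟩
        have f3 : Int.fract s + Int.fract t ≤ 1 := by
          rw [Int.fract, Int.fract, f1, f2]; push_cast; linarith
        refine Or.inr (Or.inr ⟨0, ?_, ?_⟩)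
        · rw [f1, f2, decide_eq_true f3]; simp [nb]
        · simp [baryC]; linarith
      · have f2 : ⌊t⌋ = b := Int.floor_eq_iff.2 ⟨by linarith, lt_of_le_of_ne k2 h2⟩
        by_cases f3 : Int.fract s + Int.fract t ≤ 1
        · refine Or.inr (Or.inr ⟨1, ?_, ?_⟩)
          · rw [f1, f2, decide_eq_true f3]; simp [nb]
          · rw [Int.fract, Int.fract, f1, f2] at f3
            simp [baryC]; linarith
        · exact Or.inr (Or.inl (by rw [f1, f2, decide_eq_false f3]))
  · by_cases h1 : s = a + 1
    · exact Or.inl ⟨_, hp (a + 1) b (by push_cast; exact h1) (by linarith)⟩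
    · by_cases h2 : t = b + 1
      · exact Or.inl ⟨_, hp a (b + 1) (by linarith) (by push_cast; exact h2)⟩
      · have g1 : s < a + 1 := lt_of_le_of_ne (by linarith) h1
        have g2 : t < b + 1 := lt_of_le_of_ne (by linarith) h2
        have f1 : ⌊s⌋ = a := Int.floor_eq_iff.2 ⟨by linarith, g1⟩
        have f2 : ⌊t⌋ = b := Int.floor_eq_iff.2 ⟨by linarith, g2⟩
        have f3 : Int.fract s + Int.fract t ≤ 1 := by
          rw [Int.fract, Int.fract, f1, f2]; linarith
        exact Or.inr (Or.inl (by rw [f1, f2, decide_eq_true f3]))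

lemma abs_sub_cs_le {ε : ℝ} (hε : 0 < ε) (x y : E2) : |cs ε x - cs ε y| ≤ 2 / ε * ‖x - y‖ ∧
    |ct ε x - ct ε y| ≤ 2 / ε * ‖x - y‖ ∧
    |(cs ε x + ct ε x) - (cs ε y + ct ε y)| ≤ 2 / ε * ‖x - y‖ := by
  have h3 : 1 ≤ √(3 : ℝ) := Real.one_le_sqrt.2 (by norm_num)
  have hs : 0 < √(3 : ℝ) := by positivity
  have h0 : |(x - y) 0| ≤ ‖x - y‖ := PiLp.norm_apply_le (x - y) 0
  have h1 : |(x - y) 1| ≤ ‖x - y‖ := PiLp.norm_apply_le (x - y) 1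
  have h1' : |(x - y) 1 / √3| ≤ ‖x - y‖ := by
    rw [abs_div, abs_of_pos hs]
    exact (div_le_self (abs_nonneg _) h3).trans h1
  have e1 : cs ε x - cs ε y = ((x - y) 0 - (x - y) 1 / √3) / ε := by
    simp only [cs, PiLp.sub_apply]; ring
  have e2 : ct ε x - ct ε y = (2 * ((x - y) 1 / √3)) / ε := by
    simp only [ct, PiLp.sub_apply]; ring
  have e3 : (cs ε x + ct ε x) - (cs ε y + ct ε y) = ((x - y) 0 + (x - y) 1 / √3) / ε := by
    simp only [cs, ct, PiLp.sub_apply]; ring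
  rw [e1, e2, e3, abs_div, abs_div, abs_div, abs_of_pos hε, div_mul_eq_mul_div]
  generalize (x - y) 1 / √3 = β at *
  generalize (x - y) 0 = α at *
  obtain ⟨a1, a2⟩ := abs_le.1 h0
  obtain ⟨b1, b2⟩ := abs_le.1 h1'
  refine ⟨?_, ?_, ?_⟩ <;> gcongr <;> rw [abs_le] <;> constructor <;> linarith

lemma abs_sub_bary_le {ε : ℝ} (hε : 0 < ε) (τ : Tri) (k : Fin 3) (x y : E2) :
    |bary ε τ k x - bary ε τ k y| ≤ 2 / ε * ‖x - y‖ := by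
  obtain ⟨h1, h2, h3⟩ := abs_sub_cs_le hε x y
  obtain ⟨a, b, _ | _⟩ := τ <;> fin_cases k <;> simp only [bary, baryC]
  · convert h3 using 2; simp; ring
  · rw [abs_sub_comm]; convert h1 using 2; simp
  · rw [abs_sub_comm]; convert h2 using 2; simp
  · rw [abs_sub_comm]; convert h3 using 2; simp; ring
  · convert h1 using 2; simp
  · convert h2 using 2; simp

lemma locallyFinite_tcell {ε : ℝ} (hε : 0 < ε) : LocallyFinite (tcell ε) := by
  intro x
  refine ⟨Metric.ball x (ε / 2), Metric.ball_mem_nhds x (by positivity), ?_⟩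
  have hfin : (((Finset.Icc (⌊cs ε x⌋ - 3) (⌊cs ε x⌋ + 3)) ×ˢ
    ((Finset.Icc (⌊ct ε x⌋ - 3) (⌊ct ε x⌋ + 3)) ×ˢ (Finset.univ : Finset Bool)) : Finset Tri) :
      Set Tri).Finite := Finset.finite_toSet _
  refine hfin.subset ?_
  rintro ⟨a, b, c⟩ ⟨y, hy, hyx⟩
  have hd : 2 / ε * ‖y - x‖ < 1 := by
    rw [Metric.mem_ball, dist_eq_norm] at hyx
    calc 2 / ε * ‖y - x‖ < 2 / ε * (ε / 2) := by gcongr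
      _ = 1 := by field_simp
  obtain ⟨h1, h2, -⟩ := abs_sub_cs_le hε y x
  obtain ⟨p1, p2⟩ := abs_lt.1 (h1.trans_lt hd)
  obtain ⟨q1, q2⟩ := abs_lt.1 (h2.trans_lt hd)
  have k0 := hy 0
  have k1 := hy 1
  have k2 := hy 2
  simp only [bary] at k0 k1 k2
  generalize cs ε y = s at *
  generalize ct ε y = t at *
  have f1 := Int.floor_le (cs ε x)
  have f2 := Int.lt_floor_add_one (cs ε x)
  have f3 := Int.floor_le (ct ε x)
  have f4 := Int.lt_floor_add_one (ct ε x)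
  have hs : (a : ℝ) ≤ s ∧ s ≤ a + 1 ∧ (b : ℝ) ≤ t ∧ t ≤ b + 1 := by
    cases c <;> simp [baryC] at k0 k1 k2 <;> refine ⟨?_, ?_, ?_, ?_⟩ <;> linarith
  obtain ⟨g1, g2, g3, g4⟩ := hs
  have r1 : (a : ℝ) < (⌊cs ε x⌋ : ℝ) + 3 := by linarith
  have r2 : (⌊cs ε x⌋ : ℝ) - 3 < a := by linarith
  have r3 : (b : ℝ) < (⌊ct ε x⌋ : ℝ) + 3 := by linarith
  have r4 : (⌊ct ε x⌋ : ℝ) - 3 < b := by linarith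
  norm_cast at r1 r2 r3 r4
  simp
  omega

/-! ### Lipschitz maps -/

/-- A map which is Lipschitz on the members of a locally finite closed cover is Lipschitz. -/
lemma lipschitz_of_locallyFinite_cover {ι : Type*} {C : ι → Set E2} (hC : LocallyFinite C)
    (hcl : ∀ i, IsClosed (C i)) (hcov : ⋃ i, C i = univ) {f : E2 → E3} {K : ℝ}
    (hf : ∀ i, ∀ x ∈ C i, ∀ y ∈ C i, ‖f x - f y‖ ≤ K * ‖x - y‖) (x y : E2) :
    ‖f x - f y‖ ≤ K * ‖x - y‖ := by
  -- By local finiteness, a member of the cover that contains a point close to `x` contains `x` as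
  -- well. This compares nearby points with `x` only, which is enough for one-sided slopes.
  have hloc : ∀ x, ∀ᶠ y in 𝓝 x, ‖f y - f x‖ ≤ K * ‖y - x‖ := by
    intro x
    filter_upwards [hC.eventually_subset hcl x] with y hy
    obtain ⟨i, hi⟩ := mem_iUnion.1 (hcov.symm ▸ mem_univ y)
    exact hf i y hi x (hy hi)
  have hcont : Continuous f := by
    rw [continuous_iff_continuousAt]
    intro x
    rw [ContinuousAt, tendsto_iff_norm_sub_tendsto_zero]
    have h1 : Tendsto (fun y => K * ‖y - x‖) (𝓝 x) (𝓝 0) := by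
      have : Continuous fun y : E2 => K * ‖y - x‖ := by fun_prop
      have := this.tendsto x
      simpa using this
    exact squeeze_zero' (Eventually.of_forall fun _ => norm_nonneg _) (hloc x) h1
  -- Along the segment from `y` to `x`, local slope bounds integrate to a global bound by a
  -- comparison theorem.
  set g : ℝ → E3 := fun t => f (y + t • (x - y)) - f y with hg
  have hgc : Continuous g := by rw [hg]; fun_prop
  have hslope : ∀ t : ℝ, ∀ᶠ s in 𝓝[>] t, ‖g s - g t‖ ≤ K * ‖x - y‖ * (s - t) := by
    intro t
    have h1 : Tendsto (fun s : ℝ => y + s • (x - y)) (𝓝[>] t) (𝓝 (y + t • (x - y))) := by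
      have : Continuous fun s : ℝ => y + s • (x - y) := by fun_prop
      exact (this.tendsto t).mono_left nhdsWithin_le_nhds
    filter_upwards [h1.eventually (hloc _), self_mem_nhdsWithin] with s hs hst
    have e : y + s • (x - y) - (y + t • (x - y)) = (s - t) • (x - y) := by module
    rw [e, norm_smul, Real.norm_of_nonneg (sub_nonneg.2 (le_of_lt hst))] at hs
    rw [hg]
    simp only [sub_sub_sub_cancel_right]
    linarith
  have hmain : ∀ η : ℝ, 0 < η → ‖g 1‖ ≤ (K * ‖x - y‖ + η) * 1 := by
    intro η hη
    refine image_norm_le_of_liminf_right_slope_norm_lt_deriv_boundary (a := 0) (b := 1)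
      (f' := fun _ => K * ‖x - y‖) (B := fun t => (K * ‖x - y‖ + η) * t)
      (B' := fun _ => K * ‖x - y‖ + η) hgc.continuousOn ?_ ?_ ?_ ?_ ?_ (right_mem_Icc.2 zero_le_one)
    · intro t _ r hr
      refine Eventually.frequently ?_
      filter_upwards [hslope t, self_mem_nhdsWithin] with s hs hst
      have hst' : 0 < s - t := sub_pos.2 hst
      rw [slope_def_field, div_lt_iff₀ hst']
      calc ‖g s‖ - ‖g t‖ ≤ ‖g s - g t‖ := norm_sub_norm_le _ _
        _ ≤ K * ‖x - y‖ * (s - t) := hs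
        _ < r * (s - t) := by gcongr
    · simp [hg]
    · fun_prop
    · intro t _
      simpa using ((hasDerivAt_id t).const_mul (K * ‖x - y‖ + η)).hasDerivWithinAt
    · intro t _ _
      linarith
  have h1 : ‖g 1‖ ≤ K * ‖x - y‖ := le_of_forall_pos_le_add fun η hη => by
    have := hmain η hη; linarith
  simpa [hg] using h1

/-- The vector `a - b` and the defect of the norms each contribute at most `‖a - b‖`, divided by
`‖a‖ ≥ 1 / 2`. No lower bound on `‖b‖` is needed. -/
lemma norm_normalize_sub_le {a b : E3} (ha : 1 / 2 ≤ ‖a‖) (hb : b ≠ 0) :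
    ‖‖a‖⁻¹ • a - ‖b‖⁻¹ • b‖ ≤ 4 * ‖a - b‖ := by
  have ha0 : 0 < ‖a‖ := by linarith
  have hb0 : 0 < ‖b‖ := norm_pos_iff.2 hb
  have e : ‖a‖⁻¹ • a - ‖b‖⁻¹ • b = ‖a‖⁻¹ • ((a - b) + (‖b‖ - ‖a‖) • (‖b‖⁻¹ • b)) := by
    rw [smul_add, smul_smul ‖a‖⁻¹, mul_sub, inv_mul_cancel₀ ha0.ne', sub_smul, one_smul, smul_smul,
      mul_assoc, mul_inv_cancel₀ hb0.ne', mul_one]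
    module
  have h1 : ‖(‖b‖ - ‖a‖) • (‖b‖⁻¹ • b)‖ ≤ ‖a - b‖ := by
    rw [norm_smul, norm_smul, norm_inv, norm_norm, inv_mul_cancel₀ hb0.ne', mul_one,
      Real.norm_eq_abs, abs_sub_comm]
    exact abs_norm_sub_norm_le a b
  rw [e, norm_smul, norm_inv, norm_norm]
  have h2 : ‖a‖⁻¹ ≤ 2 := by
    rw [inv_le_comm₀ ha0 two_pos]; linarith
  calc ‖a‖⁻¹ * ‖(a - b) + (‖b‖ - ‖a‖) • (‖b‖⁻¹ • b)‖ ≤ 2 * (‖a - b‖ + ‖a - b‖) := by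
        gcongr
        exact (norm_add_le _ _).trans (by gcongr)
    _ = 4 * ‖a - b‖ := by ring

/-! ### The refined interpolation -/

lemma exists_affine_bary (ε : ℝ) (τ : Tri) (k : Fin 3) :
    ∃ A : E2 →ᵃ[ℝ] ℝ, ∀ x, A x = bary ε τ k x := by
  have key : ∀ α β γ : ℝ, ∃ A : E2 →ᵃ[ℝ] ℝ, ∀ x, A x = α + β * cs ε x + γ * ct ε x := by
    intro α β γ
    refine ⟨((β * ε⁻¹) • ((EuclideanSpace.proj 0 : E2 →L[ℝ] ℝ) : E2 →ₗ[ℝ] ℝ) +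
      (γ * 2 * ε⁻¹ * (√3)⁻¹ - β * ε⁻¹ * (√3)⁻¹) •
        ((EuclideanSpace.proj 1 : E2 →L[ℝ] ℝ) : E2 →ₗ[ℝ] ℝ)).toAffineMap +
      AffineMap.const ℝ E2 α, fun x => ?_⟩
    simp [cs, ct]
    ring
  obtain ⟨a, b, _ | _⟩ := τ <;> fin_cases k
  · obtain ⟨A, hA⟩ := key (-a - b - 1) 1 1
    exact ⟨A, fun y => by rw [hA]; simp [bary, baryC]; ring⟩
  · obtain ⟨A, hA⟩ := key (a + 1) (-1) 0
    exact ⟨A, fun y => by rw [hA]; simp [bary, baryC]; ring⟩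
  · obtain ⟨A, hA⟩ := key (b + 1) 0 (-1)
    exact ⟨A, fun y => by rw [hA]; simp [bary, baryC]; ring⟩
  · obtain ⟨A, hA⟩ := key (1 + a + b) (-1) (-1)
    exact ⟨A, fun y => by rw [hA]; simp [bary, baryC]; ring⟩
  · obtain ⟨A, hA⟩ := key (-a) 1 0
    exact ⟨A, fun y => by rw [hA]; simp [bary, baryC]; ring⟩
  · obtain ⟨A, hA⟩ := key (-b) 0 1
    exact ⟨A, fun y => by rw [hA]; simp [bary, baryC]; ring⟩

lemma exists_affine_sum_bary (ε : ℝ) (τ : Tri) (X : Fin 3 → E3) :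
    ∃ A : E2 →ᵃ[ℝ] E3, ∀ x, A x = ∑ k, bary ε τ k x • X k := by
  choose A hA using exists_affine_bary ε τ
  refine ⟨∑ k, ((LinearMap.toSpanSingleton ℝ E3 (X k)).toAffineMap.comp (A k)), fun x => ?_⟩
  simp [Fin.sum_univ_three, hA, LinearMap.toSpanSingleton_apply]

/-- Unit vectors prescribed at the lattice nodes, at the midpoints of the edges, and at the
barycenters of the triangles, forming no obtuse angle within a refined triangle. -/
structure InterpData where
  /-- The values at the nodes. -/
  U : ℤ × ℤ → E3
  /-- The values at the midpoints of edges. -/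
  M : Tri → Fin 3 → E3
  /-- The values at the barycenters. -/
  B : Tri → E3
  M_nb : ∀ τ k, M (nb τ k) k = M τ k
  norm_U : ∀ z, ‖U z‖ = 1
  norm_M : ∀ τ k, ‖M τ k‖ = 1
  norm_B : ∀ τ, ‖B τ‖ = 1
  inner_BU : ∀ τ k, 0 ≤ inner ℝ (B τ) (U (vert τ k))
  inner_BM : ∀ τ k, 0 ≤ inner ℝ (B τ) (M τ k)
  inner_MU : ∀ τ k, 0 ≤ inner ℝ (M τ k) (U (vert τ k))
  inner_MU_succ : ∀ τ k, 0 ≤ inner ℝ (M τ k) (U (vert τ (k + 1)))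

namespace InterpData

variable (I : InterpData) (ε : ℝ)

/-- The interpolation formula in a triangle. -/
noncomputable def cellMap (τ : Tri) (x : E2) : E3 :=
  ∑ k, bary ε τ k x • I.U (vert τ k) +
  ∑ k, min (bary ε τ k x) (bary ε τ (k + 1) x) •
    ((2 : ℝ) • I.M τ k - I.U (vert τ k) - I.U (vert τ (k + 1))) +
  min (min (bary ε τ 0 x) (bary ε τ 1 x)) (bary ε τ 2 x) •
    ((3 : ℝ) • I.B τ - (2 : ℝ) • ∑ k, I.M τ k + ∑ k, I.U (vert τ k))

/-- The piecewise affine interpolation. -/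
noncomputable def lin (x : E2) : E3 := I.cellMap ε (loc ε x) x

/-- The normalized interpolation. -/
noncomputable def sph (x : E2) : E3 := ‖I.lin ε x‖⁻¹ • I.lin ε x

/-- If coordinate `k + 2` is the smallest, the point lies in one of the two refined triangles along
edge `k`, and all minima but one resolve. -/
lemma cellMap_eq (τ : Tri) (k : Fin 3) (x : E2) (h1 : bary ε τ (k + 2) x ≤ bary ε τ k x)
    (h2 : bary ε τ (k + 2) x ≤ bary ε τ (k + 1) x) :
    I.cellMap ε τ x =
      (bary ε τ k x - min (bary ε τ k x) (bary ε τ (k + 1) x)) • I.U (vert τ k) +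
      (bary ε τ (k + 1) x - min (bary ε τ k x) (bary ε τ (k + 1) x)) • I.U (vert τ (k + 1)) +
      (2 * (min (bary ε τ k x) (bary ε τ (k + 1) x) - bary ε τ (k + 2) x)) • I.M τ k +
      (3 * bary ε τ (k + 2) x) • I.B τ := by
  have e3 : min (min (bary ε τ 0 x) (bary ε τ 1 x)) (bary ε τ 2 x) = bary ε τ (k + 2) x := by
    fin_cases k
    · exact min_eq_right (le_min h1 h2)
    · change min (min (bary ε τ 0 x) _) _ = bary ε τ 0 x
      rw [min_assoc]; exact min_eq_left (le_min h1 h2)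
    · change min (min _ (bary ε τ 1 x)) _ = bary ε τ 1 x
      rw [min_comm (bary ε τ 0 x), min_assoc]; exact min_eq_left (le_min h2 h1)
  have a1 : k + 1 + 1 = k + 2 := by fin_cases k <;> rfl
  have a2 : k + 2 + 1 = k := by fin_cases k <;> rfl
  rw [cellMap, e3, sum_fin_three _ k, sum_fin_three (fun k => _ • (_ - _ - _)) k,
    sum_fin_three (fun l => I.M τ l) k, sum_fin_three (fun l => I.U (vert τ l)) k, a1, a2,
    min_eq_right h2, min_eq_left h1]
  module

/-- One of the coordinates is the smallest. -/
lemma exists_smallest (f : Fin 3 → ℝ) : ∃ k, f (k + 2) ≤ f k ∧ f (k + 2) ≤ f (k + 1) := by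
  rcases le_total (f 0) (f 1) with h | h <;> rcases le_total (f 1) (f 2) with h' | h' <;>
    rcases le_total (f 0) (f 2) with h'' | h''
  · exact ⟨1, h, h''⟩
  · exact ⟨1, h, h'.trans' h⟩
  · exact ⟨1, h, h''⟩
  · exact ⟨0, h'', h'⟩
  · exact ⟨2, h', h⟩
  · exact ⟨2, h', h⟩
  · exact ⟨0, h'.trans h, h'⟩
  · exact ⟨0, h'', h'⟩

variable {ε}

/-- On the common edge the barycentric term vanishes and the remaining data, end spins and midpoint
value, are the same from both sides. -/
lemma cellMap_nb {τ : Tri} {k : Fin 3} {x : E2} (hx : x ∈ tcell ε τ) (hx' : x ∈ tcell ε (nb τ k))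
    (h0 : bary ε τ (k + 2) x = 0) : I.cellMap ε (nb τ k) x = I.cellMap ε τ x := by
  have h0' : bary ε (nb τ k) (k + 2) x = 0 := by rw [bary_nb, h0, neg_zero]
  rw [I.cellMap_eq ε τ k x (by rw [h0]; exact hx k) (by rw [h0]; exact hx _),
    I.cellMap_eq ε _ k x (by rw [h0']; exact hx' k) (by rw [h0']; exact hx' _), vert_nb,
    vert_nb_succ, I.M_nb, h0, h0']
  have e : bary ε (nb τ k) k x = bary ε τ (k + 1) x := by
    simp only [bary]
    simp only [bary] at h0
    obtain ⟨a, b, _ | _⟩ := τ <;> fin_cases k <;> simp [nb, baryC] at h0 ⊢ <;> linarith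
  have e' : bary ε (nb τ k) (k + 1) x = bary ε τ k x := by
    have h1 := sum_bary ε τ x
    have h2 := sum_bary ε (nb τ k) x
    rw [sum_fin_three _ k] at h1 h2
    linarith
  rw [e, e', min_comm]
  module

lemma cellMap_pos (hε : 0 < ε) (τ : Tri) (k : Fin 3) :
    I.cellMap ε τ (pos ε (vert τ k)) = I.U (vert τ k) := by
  have h1 : k ≠ k + 1 := by fin_cases k <;> simp
  have h2 : k + 2 ≠ k := by fin_cases k <;> simp
  rw [I.cellMap_eq ε τ k _ ?_ ?_] <;>
    simp [bary_vert hε, h1.symm, h2]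

/-- The triangle chosen by `loc` does not matter: the formulas of all triangles containing a point
agree there. -/
lemma lin_eq (hε : 0 < ε) {τ : Tri} {x : E2} (hx : x ∈ tcell ε τ) :
    I.lin ε x = I.cellMap ε τ x := by
  have hl := mem_tcell_loc ε x
  rw [lin]
  rcases loc_cases hε hx with ⟨z, rfl⟩ | h | ⟨k, h, h0⟩
  · obtain ⟨k, rfl⟩ := pos_mem_tcell hε hx
    obtain ⟨l, hl'⟩ := pos_mem_tcell hε hl
    rw [I.cellMap_pos hε]
    generalize loc ε (pos ε (vert τ k)) = τ' at *
    rw [← hl', I.cellMap_pos hε]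
  · rw [h]
  · rw [h] at hl ⊢
    exact I.cellMap_nb hx hl h0

lemma lin_pos (hε : 0 < ε) (z : ℤ × ℤ) : I.lin ε (pos ε z) = I.U z := by
  obtain ⟨l, hl'⟩ := pos_mem_tcell hε (mem_tcell_loc ε (pos ε z))
  rw [lin]
  generalize loc ε (pos ε z) = τ' at *
  rw [← hl', I.cellMap_pos hε]

/-- On each half of an edge, the interpolation is a convex combination of a vertex value, the
value at the midpoint and the value at the barycenter. -/
lemma exists_combo (hε : 0 < ε) {τ : Tri} {x : E2} (hx : x ∈ tcell ε τ) :
    ∃ k, ∃ P, (P = I.U (vert τ k) ∨ P = I.U (vert τ (k + 1))) ∧ ∃ a b c : ℝ, 0 ≤ a ∧ 0 ≤ b ∧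
      0 ≤ c ∧ a + b + c = 1 ∧ I.lin ε x = a • P + b • I.M τ k + c • I.B τ := by
  obtain ⟨k, h1, h2⟩ := exists_smallest fun k => bary ε τ k x
  have hs := sum_bary ε τ x
  rw [sum_fin_three _ k] at hs
  have h3 := hx (k + 2)
  rw [I.lin_eq hε hx, I.cellMap_eq ε τ k x h1 h2]
  rcases le_total (bary ε τ k x) (bary ε τ (k + 1) x) with h | h
  · refine ⟨k, _, Or.inr rfl, bary ε τ (k + 1) x - bary ε τ k x,
      2 * (bary ε τ k x - bary ε τ (k + 2) x), 3 * bary ε τ (k + 2) x, ?_, ?_, ?_, ?_, ?_⟩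
    rotate_left 4
    · rw [min_eq_left h, sub_self, zero_smul, zero_add]
    all_goals linarith
  · refine ⟨k, _, Or.inl rfl, bary ε τ k x - bary ε τ (k + 1) x,
      2 * (bary ε τ (k + 1) x - bary ε τ (k + 2) x), 3 * bary ε τ (k + 2) x, ?_, ?_, ?_, ?_, ?_⟩
    rotate_left 4
    · rw [min_eq_right h, sub_self, zero_smul, add_zero]
    all_goals linarith

/-- The mixed terms of the square are nonnegative, so the squared norm is at least `a² + b² + c² ≥ 1
/ 3`. -/
lemma norm_combo_ge {P Q R : E3} (hP : ‖P‖ = 1) (hQ : ‖Q‖ = 1) (hR : ‖R‖ = 1)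
    (h1 : 0 ≤ inner ℝ Q P) (h2 : 0 ≤ inner ℝ R P) (h3 : 0 ≤ inner ℝ R Q) {a b c : ℝ} (ha : 0 ≤ a)
    (hb : 0 ≤ b) (hc : 0 ≤ c) (h : a + b + c = 1) : 1 / 2 ≤ ‖a • P + b • Q + c • R‖ := by
  refine le_of_sq_le_sq ?_ (norm_nonneg _)
  rw [norm_add_sq_real, norm_add_sq_real]
  simp only [inner_add_left, inner_smul_left, inner_smul_right, norm_smul, hP, hQ, hR, mul_one,
    Real.norm_eq_abs, sq_abs, RCLike.conj_to_real]
  rw [real_inner_comm P Q] at *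
  rw [real_inner_comm P R, real_inner_comm Q R] at *
  have i1 := mul_nonneg (mul_nonneg ha hb) h1
  have i2 := mul_nonneg (mul_nonneg ha hc) h2
  have i3 := mul_nonneg (mul_nonneg hb hc) h3
  have : c = 1 - a - b := by linarith
  nlinarith [sq_nonneg (a - b), sq_nonneg (a - c), sq_nonneg (b - c)]

lemma norm_lin_ge (hε : 0 < ε) (x : E2) : 1 / 2 ≤ ‖I.lin ε x‖ := by
  obtain ⟨k, P, hP, a, b, c, ha, hb, hc, h, e⟩ := I.exists_combo hε (mem_tcell_loc ε x)
  rw [e]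
  rcases hP with rfl | rfl
  · exact norm_combo_ge (I.norm_U _) (I.norm_M _ _) (I.norm_B _) (I.inner_MU _ _) (I.inner_BU _ _)
      (I.inner_BM _ _) ha hb hc h
  · exact norm_combo_ge (I.norm_U _) (I.norm_M _ _) (I.norm_B _) (I.inner_MU_succ _ _)
      (I.inner_BU _ _) (I.inner_BM _ _) ha hb hc h

lemma lin_ne_zero (hε : 0 < ε) (x : E2) : I.lin ε x ≠ 0 := by
  have := I.norm_lin_ge hε x
  rw [← norm_pos_iff]; linarith

lemma norm_sph (hε : 0 < ε) (x : E2) : ‖I.sph ε x‖ = 1 := by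
  rw [sph, norm_smul, norm_inv, norm_norm, inv_mul_cancel₀ (norm_ne_zero_iff.2 (I.lin_ne_zero hε x))]

lemma norm_lin_sub_le (hε : 0 < ε) {τ : Tri} {x : E2} (hx : x ∈ tcell ε τ) {Q : E3} {r : ℝ}
    (hU : ∀ k, ‖I.U (vert τ k) - Q‖ ≤ r) (hM : ∀ k, ‖I.M τ k - Q‖ ≤ r) (hB : ‖I.B τ - Q‖ ≤ r) :
    ‖I.lin ε x - Q‖ ≤ r := by
  obtain ⟨k, P, hP, a, b, c, ha, hb, hc, h, e⟩ := I.exists_combo hε hx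
  have hP' : ‖P - Q‖ ≤ r := by
    rcases hP with rfl | rfl <;> exact hU _
  have e' : I.lin ε x - Q = a • (P - Q) + b • (I.M τ k - Q) + c • (I.B τ - Q) := by
    rw [e]
    have : Q = (a + b + c) • Q := by rw [h, one_smul]
    nth_rewrite 1 [this]
    module
  rw [e']
  calc _ ≤ a * ‖P - Q‖ + b * ‖I.M τ k - Q‖ + c * ‖I.B τ - Q‖ := by
        refine (norm_add₃_le).trans (le_of_eq ?_)
        simp [norm_smul, abs_of_nonneg, ha, hb, hc]
    _ ≤ a * r + b * r + c * r := by gcongr; exact hM k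
    _ = r := by rw [← add_mul, ← add_mul, h, one_mul]

/-- The interpolation in a triangle is Lipschitz. -/
lemma norm_cellMap_sub_le (hε : 0 < ε) (τ : Tri) {δ : ℝ}
    (hU : ∀ k l, ‖I.U (vert τ k) - I.U (vert τ l)‖ ≤ δ) (hM : ∀ k, ‖I.M τ k - I.U (vert τ k)‖ ≤ δ)
    (hM' : ∀ k, ‖I.M τ k - I.U (vert τ (k + 1))‖ ≤ δ) (hB : ∀ k, ‖I.B τ - I.U (vert τ k)‖ ≤ δ)
    (x y : E2) : ‖I.cellMap ε τ x - I.cellMap ε τ y‖ ≤ 34 * δ / ε * ‖x - y‖ := by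
  set L := 2 / ε * ‖x - y‖ with hL
  have hδ : 0 ≤ δ := (norm_nonneg _).trans (hU 0 0)
  have hL0 : 0 ≤ L := by positivity
  have hb : ∀ k, |bary ε τ k x - bary ε τ k y| ≤ L := fun k => abs_sub_bary_le hε τ k x y
  have hmin : ∀ k l, |min (bary ε τ k x) (bary ε τ l x) - min (bary ε τ k y) (bary ε τ l y)| ≤ L :=
    fun k l => (abs_min_sub_min_le_max _ _ _ _).trans (max_le (hb k) (hb l))
  have hmin3 : |min (min (bary ε τ 0 x) (bary ε τ 1 x)) (bary ε τ 2 x) -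
      min (min (bary ε τ 0 y) (bary ε τ 1 y)) (bary ε τ 2 y)| ≤ L :=
    (abs_min_sub_min_le_max _ _ _ _).trans (max_le (hmin 0 1) (hb 2))
  -- In each of the three terms of `cellMap` the vectors are regrouped into differences of data: the
  -- barycentric coordinates sum to one, and the correction vectors have coefficients of total zero.
  -- Every term is then bounded by `δ`.
  have e : I.cellMap ε τ x - I.cellMap ε τ y =
      ∑ k, (bary ε τ k x - bary ε τ k y) • (I.U (vert τ k) - I.U (vert τ 0)) +
      ∑ k, (min (bary ε τ k x) (bary ε τ (k + 1) x) - min (bary ε τ k y) (bary ε τ (k + 1) y)) •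
        ((I.M τ k - I.U (vert τ k)) + (I.M τ k - I.U (vert τ (k + 1)))) +
      (min (min (bary ε τ 0 x) (bary ε τ 1 x)) (bary ε τ 2 x) -
        min (min (bary ε τ 0 y) (bary ε τ 1 y)) (bary ε τ 2 y)) •
        (∑ k, (I.B τ - I.U (vert τ k)) - (2 : ℝ) • ∑ k, (I.M τ k - I.U (vert τ k))) := by
    have h0 : bary ε τ 0 x = 1 - bary ε τ 1 x - bary ε τ 2 x := by
      have := sum_bary ε τ x
      rw [Fin.sum_univ_three] at this; linarith
    have h0' : bary ε τ 0 y = 1 - bary ε τ 1 y - bary ε τ 2 y := by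
      have := sum_bary ε τ y
      rw [Fin.sum_univ_three] at this; linarith
    simp only [cellMap, Fin.sum_univ_three]
    generalize min (min (bary ε τ 0 x) (bary ε τ 1 x)) (bary ε τ 2 x) = X
    generalize min (min (bary ε τ 0 y) (bary ε τ 1 y)) (bary ε τ 2 y) = Y
    generalize min (bary ε τ 0 x) (bary ε τ (0 + 1) x) = X0
    generalize min (bary ε τ 1 x) (bary ε τ (1 + 1) x) = X1
    generalize min (bary ε τ 2 x) (bary ε τ (2 + 1) x) = X2
    generalize min (bary ε τ 0 y) (bary ε τ (0 + 1) y) = Y0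
    generalize min (bary ε τ 1 y) (bary ε τ (1 + 1) y) = Y1
    generalize min (bary ε τ 2 y) (bary ε τ (2 + 1) y) = Y2
    rw [h0, h0']
    module
  have hsm : ∀ {s t : ℝ} {V : E3}, |s| ≤ L → ‖V‖ ≤ t → ‖s • V‖ ≤ L * t := by
    intro s t V h1 h2
    rw [norm_smul, Real.norm_eq_abs]
    gcongr
  rw [e]
  have b1 : ‖∑ k, (bary ε τ k x - bary ε τ k y) • (I.U (vert τ k) - I.U (vert τ 0))‖ ≤
      2 * (L * δ) := by
    rw [Fin.sum_univ_three, sub_self, smul_zero, zero_add]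
    refine (norm_add_le _ _).trans ?_
    have := hsm (hb 1) (hU 1 0)
    have := hsm (hb 2) (hU 2 0)
    linarith
  have b2 : ‖∑ k, (min (bary ε τ k x) (bary ε τ (k + 1) x) -
      min (bary ε τ k y) (bary ε τ (k + 1) y)) •
        ((I.M τ k - I.U (vert τ k)) + (I.M τ k - I.U (vert τ (k + 1))))‖ ≤ 6 * (L * δ) := by
    refine (norm_sum_le_of_le Finset.univ fun k _ => hsm (hmin k (k + 1))
      ((norm_add_le _ _).trans (add_le_add (hM k) (hM' k)))).trans (le_of_eq ?_)
    simp; ring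
  have b3 : ‖∑ k, (I.B τ - I.U (vert τ k)) - (2 : ℝ) • ∑ k, (I.M τ k - I.U (vert τ k))‖ ≤
      9 * δ := by
    refine (norm_sub_le _ _).trans ?_
    have h1 := norm_sum_le_of_le Finset.univ fun k _ => hB k
    have h2 := norm_sum_le_of_le Finset.univ fun k _ => hM k
    rw [norm_smul]
    simp at h1 h2 ⊢
    linarith
  have b4 := hsm hmin3 b3
  -- The three terms give `2 + 6 + 9 = 17` times `δ`, and the barycentric coordinates have Lipschitz
  -- constant `2 / ε`.
  refine (norm_add₃_le).trans ((add_le_add (add_le_add b1 b2) b4).trans (le_of_eq ?_))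
  rw [hL]; ring

lemma norm_lin_sub_lin_le (hε : 0 < ε) {τ : Tri} {δ : ℝ}
    (hU : ∀ k l, ‖I.U (vert τ k) - I.U (vert τ l)‖ ≤ δ) (hM : ∀ k, ‖I.M τ k - I.U (vert τ k)‖ ≤ δ)
    (hM' : ∀ k, ‖I.M τ k - I.U (vert τ (k + 1))‖ ≤ δ) (hB : ∀ k, ‖I.B τ - I.U (vert τ k)‖ ≤ δ)
    {x y : E2} (hx : x ∈ tcell ε τ) (hy : y ∈ tcell ε τ) :
    ‖I.lin ε x - I.lin ε y‖ ≤ 34 * δ / ε * ‖x - y‖ := by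
  rw [I.lin_eq hε hx, I.lin_eq hε hy]
  exact I.norm_cellMap_sub_le hε τ hU hM hM' hB x y

/-- A global bound independent of the spins: unit vectors differ by at most `2`, so `δ = 2`. -/
lemma norm_lin_sub_lin_le' (hε : 0 < ε) (x y : E2) :
    ‖I.lin ε x - I.lin ε y‖ ≤ 68 / ε * ‖x - y‖ := by
  refine lipschitz_of_locallyFinite_cover (locallyFinite_tcell hε) (isClosed_tcell ε)
    (iUnion_tcell ε) (fun τ x hx y hy => ?_) x y
  have h2 : ∀ {P Q : E3}, ‖P‖ = 1 → ‖Q‖ = 1 → ‖P - Q‖ ≤ 2 := fun {P Q} h h' =>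
    (norm_sub_le P Q).trans (by rw [h, h']; norm_num)
  have := I.norm_lin_sub_lin_le hε (fun k l => h2 (I.norm_U (vert τ k)) (I.norm_U (vert τ l)))
    (fun k => h2 (I.norm_M τ k) (I.norm_U (vert τ k)))
    (fun k => h2 (I.norm_M τ k) (I.norm_U (vert τ (k + 1))))
    (fun k => h2 (I.norm_B τ) (I.norm_U (vert τ k))) hx hy
  convert this using 3
  norm_num

lemma norm_sph_sub_le (hε : 0 < ε) (x y : E2) :
    ‖I.sph ε x - I.sph ε y‖ ≤ 4 * ‖I.lin ε x - I.lin ε y‖ :=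
  norm_normalize_sub_le (I.norm_lin_ge hε x) (I.lin_ne_zero hε y)

lemma lipschitzWith_sph (hε : 0 < ε) : LipschitzWith (Real.toNNReal (272 / ε)) (I.sph ε) := by
  refine LipschitzWith.of_dist_le_mul fun x y => ?_
  rw [dist_eq_norm, dist_eq_norm, Real.coe_toNNReal _ (by positivity)]
  refine (I.norm_sph_sub_le hε x y).trans ?_
  have := I.norm_lin_sub_lin_le' hε x y
  calc _ ≤ 4 * (68 / ε * ‖x - y‖) := by gcongr
    _ = _ := by ring

lemma continuous_lin (hε : 0 < ε) : Continuous (I.lin ε) := by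
  have : LipschitzWith (Real.toNNReal (68 / ε)) (I.lin ε) := by
    refine LipschitzWith.of_dist_le_mul fun x y => ?_
    rw [dist_eq_norm, dist_eq_norm, Real.coe_toNNReal _ (by positivity)]
    exact I.norm_lin_sub_lin_le' hε x y
  exact this.continuous

end InterpData

/-! ### Refined triangles -/

/-- The closed refined triangle of `τ` on which the barycentric coordinates are ordered. -/
def refined (ε : ℝ) (τ : Tri) (k l j : Fin 3) : Set E2 :=
  {x | 0 ≤ bary ε τ j x ∧ bary ε τ j x ≤ bary ε τ l x ∧ bary ε τ l x ≤ bary ε τ k x}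

/-- The open refined triangle of `τ` on which the barycentric coordinates are strictly ordered. -/
def orefined (ε : ℝ) (τ : Tri) (k l j : Fin 3) : Set E2 :=
  {x | 0 < bary ε τ j x ∧ bary ε τ j x < bary ε τ l x ∧ bary ε τ l x < bary ε τ k x}

lemma convex_refined (ε : ℝ) (τ : Tri) (k l j : Fin 3) : Convex ℝ (refined ε τ k l j) := by
  intro x hx y hy α β hα hβ h
  simp only [refined, mem_ofPred_eq, bary_two ε τ _ x y h] at *
  refine ⟨add_nonneg (mul_nonneg hα hx.1) (mul_nonneg hβ hy.1), ?_, ?_⟩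
  · gcongr <;> tauto
  · gcongr <;> tauto

lemma orefined_subset_refined (ε : ℝ) (τ : Tri) (k l j : Fin 3) :
    orefined ε τ k l j ⊆ refined ε τ k l j := fun _ h => ⟨h.1.le, h.2.1.le, h.2.2.le⟩

lemma isOpen_orefined (ε : ℝ) (τ : Tri) (k l j : Fin 3) : IsOpen (orefined ε τ k l j) :=
  (isOpen_lt continuous_const (continuous_bary ε τ j)).inter
    ((isOpen_lt (continuous_bary ε τ j) (continuous_bary ε τ l)).inter
      (isOpen_lt (continuous_bary ε τ l) (continuous_bary ε τ k)))

lemma fin_three_cover {k l j : Fin 3} (h1 : k ≠ l) (h2 : l ≠ j) (h3 : k ≠ j) (m : Fin 3) :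
    m = k ∨ m = l ∨ m = j := by
  fin_cases k <;> fin_cases l <;> fin_cases j <;> fin_cases m <;> simp at *

lemma refined_subset_tcell (ε : ℝ) (τ : Tri) {k l j : Fin 3} (h1 : k ≠ l) (h2 : l ≠ j)
    (h3 : k ≠ j) : refined ε τ k l j ⊆ tcell ε τ := by
  rintro x ⟨a, b, c⟩ m
  rcases fin_three_cover h1 h2 h3 m with rfl | rfl | rfl <;> linarith

/-- The midpoint of an edge. -/
noncomputable def mid (ε : ℝ) (τ : Tri) (k l : Fin 3) : E2 :=
  (1 / 2 : ℝ) • ((pos ε (vert τ k) : E2) + pos ε (vert τ l))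

lemma bary_mid {ε : ℝ} (hε : 0 < ε) (τ : Tri) (k l m : Fin 3) : bary ε τ m (mid ε τ k l) =
    1 / 2 * ((if m = k then 1 else 0) + if m = l then 1 else 0) := by
  rw [mid, smul_add, bary_two ε τ m _ _ (by norm_num), bary_vert hε, bary_vert hε]
  ring

lemma sum_three_perm {k l j : Fin 3} (h1 : k ≠ l) (h2 : l ≠ j) (h3 : k ≠ j) {M : Type*}
    [AddCommMonoid M] (f : Fin 3 → M) : ∑ m, f m = f k + f l + f j := by
  have : (Finset.univ : Finset (Fin 3)) = {k, l, j} := by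
    ext m; simpa using fin_three_cover h1 h2 h3 m
  rw [this, Finset.sum_insert (by simp [h1, h3]), Finset.sum_pair h2, add_assoc]

lemma refined_vertices_subset {ε : ℝ} (hε : 0 < ε) (τ : Tri) {k l j : Fin 3} (h1 : k ≠ l)
    (h2 : l ≠ j) (h3 : k ≠ j) : convexHull ℝ {(pos ε (vert τ k) : E2), mid ε τ k l, center ε τ} ⊆
      refined ε τ k l j := by
  refine convexHull_min ?_ (convex_refined ε τ k l j)
  rintro x (rfl | rfl | rfl)
  · simp [refined, bary_vert hε, h1.symm, h2.symm, h3.symm]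
  · simp [refined, bary_mid hε, h1, h1.symm, h2.symm, h3.symm]
  · simp [refined, bary_center hε]

lemma orefined_eq_openTri {ε : ℝ} (hε : 0 < ε) (τ : Tri) {k l j : Fin 3} (h1 : k ≠ l)
    (h2 : l ≠ j) (h3 : k ≠ j) :
    orefined ε τ k l j = openTri (pos ε (vert τ k)) (mid ε τ k l) (center ε τ) := by
  ext x
  constructor
  · rintro ⟨a, b, c⟩
    have hs := sum_bary ε τ x
    rw [sum_three_perm h1 h2 h3] at hs
    set A := bary ε τ k x with hA
    set B := bary ε τ l x with hB
    set C := bary ε τ j x with hC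
    have hr : 0 < 1 - 3 * C := by linarith
    -- The point is `A - B` times the vertex plus `2(B - C)` times the midpoint plus `3C` times the
    -- center. This fixes the radial and the angular parameter.
    refine ⟨!₂[1 - 3 * C, 2 * (B - C) / (1 - 3 * C)], ⟨⟨?_, ?_⟩, ?_, ?_⟩, ?_⟩
    · simpa using hr
    · simpa using a
    · simp only [Matrix.cons_val_one, Matrix.cons_val_fin_one]
      exact div_pos (by linarith) hr
    · simp only [Matrix.cons_val_one, Matrix.cons_val_fin_one]
      rw [div_lt_one hr]; linarith
    · have e : (1 - 3 * C) * (2 * (B - C) / (1 - 3 * C)) = 2 * (B - C) := by field_simp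
      rw [eq_sum_bary hε τ x, sum_three_perm h1 h2 h3, ← hA, ← hB, ← hC]
      simp only [coneParam, Matrix.cons_val_one, Matrix.cons_val_fin_one,
        Matrix.cons_val_zero, smul_add, smul_smul, e]
      rw [center, sum_three_perm h1 h2 h3, mid]
      have hA' : A = 1 - B - C := by linarith
      rw [hA']
      module
  · rintro ⟨p, ⟨⟨a, b⟩, c, d⟩, rfl⟩
    have hx : coneParam (pos ε (vert τ k) : E2) (mid ε τ k l) (center ε τ) (p 0) (p 1) =
      ∑ i : Fin 3, ![p 0 * (1 - p 1), p 0 * p 1, 1 - p 0] i •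
        ![(pos ε (vert τ k) : E2), mid ε τ k l, center ε τ] i := by
      simp [coneParam, Fin.sum_univ_three]
      module
    have hb : ∀ m, bary ε τ m (coneParam (pos ε (vert τ k) : E2) (mid ε τ k l) (center ε τ)
        (p 0) (p 1)) = p 0 * (1 - p 1) * (if m = k then 1 else 0) + p 0 * p 1 *
          (1 / 2 * ((if m = k then 1 else 0) + if m = l then 1 else 0)) + (1 - p 0) / 3 := by
      intro m
      rw [hx, bary_combo ε τ m _ _ _ (by simp [Fin.sum_univ_three]; ring)]
      simp only [Fin.sum_univ_three, Matrix.cons_val, bary_vert hε, bary_mid hε, bary_center hε]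
      ring
    have i1 := mul_pos a c
    have i2 := mul_pos a (sub_pos.2 d)
    refine ⟨?_, ?_, ?_⟩ <;> simp only [hb] <;>
      simp [h1, h1.symm, h2, h2.symm, h3, h3.symm] <;> nlinarith

lemma openTri_swap (a b c : E2) : openTri a b c = openTri b a c := by
  have key : ∀ a b : E2, openTri a b c ⊆ openTri b a c := by
    rintro a b x ⟨p, ⟨h0, h1, h2⟩, rfl⟩
    refine ⟨!₂[p 0, 1 - p 1], ⟨?_, ?_, ?_⟩, ?_⟩
    · simpa using h0
    · simpa using h2
    · simpa using h1
    · simp [coneParam]; module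
  exact (key a b).antisymm (key b a)

lemma det2_vert {ε : ℝ} (hε : 0 < ε) (τ : Tri) (k : Fin 3) :
    0 < det2 ((pos ε (vert τ (k + 1)) : E2) - pos ε (vert τ k))
      ((pos ε (vert τ (k + 2)) : E2) - pos ε (vert τ k)) := by
  have h3 : 0 < √(3 : ℝ) := by positivity
  have : det2 ((pos ε (vert τ (k + 1)) : E2) - pos ε (vert τ k))
      ((pos ε (vert τ (k + 2)) : E2) - pos ε (vert τ k)) = ε ^ 2 * (√3 / 2) := by
    simp only [det2, PiLp.sub_apply, pos_zero, pos_one]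
    obtain ⟨a, b, _ | _⟩ := τ <;> fin_cases k <;> simp [vert] <;> ring
  rw [this]; positivity

lemma fin_succ_ne (k : Fin 3) : k ≠ k + 1 ∧ k + 1 ≠ k + 2 ∧ k ≠ k + 2 := by
  fin_cases k <;> simp

lemma det2_refined {ε : ℝ} (hε : 0 < ε) (τ : Tri) (k : Fin 3) :
    0 < det2 (mid ε τ k (k + 1) - pos ε (vert τ k)) (center ε τ - pos ε (vert τ k)) ∧
    0 < det2 (pos ε (vert τ (k + 1)) - mid ε τ k (k + 1)) (center ε τ - mid ε τ k (k + 1)) := by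
  have h := det2_vert hε τ k
  obtain ⟨h1, h2, h3⟩ := fin_succ_ne k
  rw [center, sum_three_perm h1 h2 h3, mid]
  simp only [det2, PiLp.sub_apply, PiLp.add_apply, PiLp.smul_apply, smul_eq_mul] at *
  constructor <;> nlinarith

lemma volume_affine_eq_zero {A : E2 →ᵃ[ℝ] ℝ} {y : E2} (h : A y ≠ 0) :
    volume {x | A x = 0} = 0 := by
  have e : {x | A x = 0} = ((AffineSubspace.mk' (0 : ℝ) ⊥).comap A : Set E2) := by
    ext x; simp [AffineSubspace.mem_mk']
  rw [e]
  refine Measure.addHaar_affineSubspace _ _ fun htop => h ?_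
  have : y ∈ (AffineSubspace.mk' (0 : ℝ) ⊥).comap A := by rw [htop]; trivial
  simpa [AffineSubspace.mem_mk'] using this

lemma volume_bary_eq {ε : ℝ} (hε : 0 < ε) (τ : Tri) {k l : Fin 3} (h : k ≠ l) :
    volume {x | bary ε τ k x = bary ε τ l x} = 0 := by
  obtain ⟨A, hA⟩ := exists_affine_bary ε τ k
  obtain ⟨B, hB⟩ := exists_affine_bary ε τ l
  have := volume_affine_eq_zero (A := A - B) (y := pos ε (vert τ k))
    (by simp [hA, hB, bary_vert hε, h.symm])
  simpa [hA, hB, sub_eq_zero] using this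

lemma volume_bary_eq_zero {ε : ℝ} (hε : 0 < ε) (τ : Tri) (k : Fin 3) :
    volume {x | bary ε τ k x = 0} = 0 := by
  obtain ⟨A, hA⟩ := exists_affine_bary ε τ k
  have := volume_affine_eq_zero (A := A) (y := pos ε (vert τ k)) (by simp [hA, bary_vert hε])
  simpa [hA] using this

lemma ocell_ae_eq {ε : ℝ} (hε : 0 < ε) (τ : Tri) : ocell ε τ =ᵐ[volume] tcell ε τ := by
  refine (ocell_subset_tcell ε τ).eventuallyLE.antisymm ?_
  rw [ae_le_set]
  refine measure_mono_null (t := ⋃ k, {x | bary ε τ k x = 0}) ?_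
    (measure_iUnion_null fun k => volume_bary_eq_zero hε τ k)
  rintro x ⟨hx, hx'⟩
  simp only [ocell, mem_ofPred_eq, not_forall, not_lt] at hx'
  obtain ⟨k, hk⟩ := hx'
  exact mem_iUnion.2 ⟨k, le_antisymm hk (hx k)⟩

/-- The refined triangles with an edge on the `k`-th edge. -/
def halfCell (ε : ℝ) (τ : Tri) (i : Fin 3 × Bool) : Set E2 :=
  if i.2 then orefined ε τ i.1 (i.1 + 1) (i.1 + 2) else orefined ε τ (i.1 + 1) i.1 (i.1 + 2)

/-- What is missing lies on the sides and the medians, where a coordinate vanishes or two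
coordinates coincide. -/
lemma iUnion_halfCell_ae_eq {ε : ℝ} (hε : 0 < ε) (τ : Tri) :
    (⋃ i, halfCell ε τ i) =ᵐ[volume] tcell ε τ := by
  have hsub : (⋃ i, halfCell ε τ i) ⊆ tcell ε τ := by
    refine iUnion_subset ?_
    rintro ⟨k, _ | _⟩ <;> obtain ⟨h1, h2, h3⟩ := fin_succ_ne k
    · exact (orefined_subset_refined ε τ _ _ _).trans
        (refined_subset_tcell ε τ h1.symm h3 h2)
    · exact (orefined_subset_refined ε τ _ _ _).trans (refined_subset_tcell ε τ h1 h2 h3)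
  refine hsub.eventuallyLE.antisymm ?_
  rw [ae_le_set]
  refine measure_mono_null (t := (⋃ k, {x | bary ε τ k x = 0}) ∪
    ⋃ k, {x | bary ε τ k x = bary ε τ (k + 1) x}) ?_
    (measure_union_null (measure_iUnion_null fun k => volume_bary_eq_zero hε τ k)
      (measure_iUnion_null fun k => volume_bary_eq hε τ (fin_succ_ne k).1))
  rintro x ⟨hx, hx'⟩
  by_contra hn
  simp only [mem_union, mem_iUnion, mem_ofPred_eq, not_or, not_exists] at hn
  obtain ⟨n1, n2⟩ := hn
  obtain ⟨k, h1, h2⟩ := InterpData.exists_smallest fun k => bary ε τ k x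
  have a2 : k + 2 + 1 = k := by fin_cases k <;> rfl
  have a1 : k + 1 + 1 = k + 2 := by fin_cases k <;> rfl
  have g1 := lt_of_le_of_ne h1 (by have := n2 (k + 2); rwa [a2] at this)
  have g2 := lt_of_le_of_ne h2 (by have := n2 (k + 1); rw [a1] at this; exact Ne.symm this)
  have g3 := lt_of_le_of_ne (hx (k + 2)) (Ne.symm (n1 _))
  refine hx' (mem_iUnion.2 ?_)
  rcases lt_or_gt_of_ne (n2 k) with h | h
  · exact ⟨(k, false), by simpa [halfCell] using ⟨g3, g1, h⟩⟩
  · exact ⟨(k, true), by simpa [halfCell] using ⟨g3, g2, h⟩⟩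

lemma pairwise_disjoint_halfCell (ε : ℝ) (τ : Tri) :
    Pairwise (Function.onFun Disjoint (halfCell ε τ)) := by
  intro i j hij
  rw [Function.onFun, Set.disjoint_left]
  intro x hx hx'
  obtain ⟨k, _ | _⟩ := i <;> obtain ⟨l, _ | _⟩ := j <;> fin_cases k <;> fin_cases l <;>
    simp [halfCell, orefined] at hij hx hx' <;> linarith

lemma isOpen_halfCell (ε : ℝ) (τ : Tri) (i : Fin 3 × Bool) : IsOpen (halfCell ε τ i) := by
  unfold halfCell
  split_ifs <;> exact isOpen_orefined _ _ _ _ _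

/-! ### The interpolation on refined triangles -/

namespace InterpData

variable (I : InterpData) {ε : ℝ}

lemma affine_refined (hε : 0 < ε) (τ : Tri) {k l j e : Fin 3} (h1 : k ≠ l) (h2 : l ≠ j)
    (h3 : k ≠ j) (he : (k = e ∧ l = e + 1) ∨ (k = e + 1 ∧ l = e)) :
    ∃ A : E2 →ᵃ[ℝ] E3, EqOn (I.lin ε) A (refined ε τ k l j) ∧
      A (pos ε (vert τ k)) = I.U (vert τ k) ∧ A (mid ε τ k l) = I.M τ e ∧
      A (center ε τ) = I.B τ := by
  -- The values at the other two vertices are extrapolated: the midpoint is to receive `M` and the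
  -- center `B`.
  obtain ⟨A, hA⟩ := exists_affine_sum_bary ε τ fun m =>
    if m = k then I.U (vert τ k) else if m = l then (2 : ℝ) • I.M τ e - I.U (vert τ k) else
      (3 : ℝ) • I.B τ - (2 : ℝ) • I.M τ e
  have hA' : ∀ x, A x = bary ε τ k x • I.U (vert τ k) +
      bary ε τ l x • ((2 : ℝ) • I.M τ e - I.U (vert τ k)) +
      bary ε τ j x • ((3 : ℝ) • I.B τ - (2 : ℝ) • I.M τ e) := by
    intro x
    rw [hA, sum_three_perm h1 h2 h3, if_pos rfl, if_neg h1.symm, if_pos rfl, if_neg h3.symm,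
      if_neg h2.symm]
  refine ⟨A, fun x hx => ?_, ?_, ?_, ?_⟩
  · have hc := refined_subset_tcell ε τ h1 h2 h3 hx
    obtain ⟨i1, i2, i3⟩ := hx
    have hj : j = e + 2 := by
      fin_cases e <;> fin_cases k <;> fin_cases l <;> fin_cases j <;> simp_all
    rw [hA', I.lin_eq hε hc]
    rcases he with ⟨rfl, rfl⟩ | ⟨rfl, rfl⟩ <;> subst hj
    · rw [I.cellMap_eq ε τ k x (i2.trans i3) i2, min_eq_right i3]
      module
    · rw [I.cellMap_eq ε τ l x i2 (i2.trans i3), min_eq_left i3]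
      module
  · rw [hA']; simp [bary_vert hε, h1.symm, h3.symm]
  · rw [hA']; simp only [bary_mid hε]; simp [h1, h1.symm, h2.symm, h3.symm]; module
  · rw [hA']; simp only [bary_center hε]; module

lemma isRefinedInterpolation (hε : 0 < ε) : IsRefinedInterpolation ε (I.sph ε) := by
  refine ⟨I.lin ε, I.continuous_lin hε, I.lin_ne_zero hε, fun x => rfl, ?_⟩
  intro i j k hij hjk hki
  obtain ⟨z, rfl⟩ := pos_surjective ε i
  obtain ⟨w, rfl⟩ := pos_surjective ε j
  obtain ⟨y, rfl⟩ := pos_surjective ε k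
  rw [dist_pos_eq_iff hε] at hij hjk hki
  obtain ⟨τ, l, ⟨rfl, rfl, rfl⟩ | ⟨rfl, rfl, rfl⟩⟩ := exists_triangle hij hjk hki.symm
  all_goals obtain ⟨h1, h2, h3⟩ := fin_succ_ne l
  · obtain ⟨A, hA, -⟩ := I.affine_refined hε τ h1 h2 h3 (Or.inl ⟨rfl, rfl⟩)
    refine ⟨A, hA.mono (Subset.trans (subset_of_eq ?_) (refined_vertices_subset hε τ h1 h2 h3))⟩
    rw [center, sum_three_perm h1 h2 h3, mid, smul_add, smul_add, smul_add]
  · obtain ⟨A, hA, -⟩ := I.affine_refined hε τ h1.symm h3 h2 (Or.inr ⟨rfl, rfl⟩)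
    refine ⟨A, hA.mono (Subset.trans (subset_of_eq ?_)
      (refined_vertices_subset hε τ h1.symm h3 h2))⟩
    rw [center, sum_three_perm h1.symm h3 h2, mid]
    simp only [smul_add]

lemma norm_grad_le (hε : 0 < ε) (k : Fin 2) (x : E2) : ‖grad (I.sph ε) k x‖ ≤ 272 / ε := by
  rw [grad]
  refine (ContinuousLinearMap.le_opNorm _ _).trans ?_
  have := norm_fderiv_le_of_lipschitz ℝ (I.lipschitzWith_sph hε) (x₀ := x)
  rw [Real.coe_toNNReal _ (by positivity)] at this
  simpa using this

lemma continuous_sph (hε : 0 < ε) : Continuous (I.sph ε) := (I.lipschitzWith_sph hε).continuous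

lemma measurable_grad (w : E2 → E3) (k : Fin 2) : Measurable (grad w k) :=
  measurable_fderiv_apply_const ℝ w (bv k)

lemma measurable_cross {a b : E2 → E3} (ha : Measurable a) (hb : Measurable b) :
    Measurable fun x => cross (a x) (b x) := by
  have hc : Continuous fun p : E3 × E3 => cross p.1 p.2 := by
    refine (PiLp.continuous_toLp 2 _).comp (continuous_pi fun i => ?_)
    fin_cases i <;> simp [crossProduct] <;> fun_prop
  exact hc.measurable.comp (ha.prodMk hb)

lemma norm_cross_le (a b : E3) : ‖cross a b‖ ≤ ‖a‖ * ‖b‖ := by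
  refine le_of_sq_le_sq ?_ (by positivity)
  rw [mul_pow, norm_sq_E3, norm_sq_E3, norm_sq_E3, cross_zero, cross_one, cross_two]
  nlinarith [sq_nonneg (a 0 * b 0 + a 1 * b 1 + a 2 * b 2)]

lemma abs_chargeDensity_le {w : E2 → E3} {x : E2} (hw : ‖w x‖ = 1) (D : Fin 2 → E2 → E3) :
    |chargeDensity w D x| ≤ ‖D 0 x‖ * ‖D 1 x‖ := by
  refine (abs_real_inner_le_norm _ _).trans ?_
  rw [hw, one_mul]
  exact norm_cross_le _ _

lemma measurable_chargeDensity (hε : 0 < ε) :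
    Measurable (chargeDensity (I.sph ε) (grad (I.sph ε))) :=
  (I.continuous_sph hε).measurable.inner
    (measurable_cross (measurable_grad _ 0) (measurable_grad _ 1))

lemma integrableOn_chargeDensity (hε : 0 < ε) {s : Set E2} (hs : volume s ≠ ⊤) :
    IntegrableOn (chargeDensity (I.sph ε) (grad (I.sph ε))) s := by
  refine Measure.integrableOn_of_bounded hs (I.measurable_chargeDensity hε).aestronglyMeasurable
    (M := 272 / ε * (272 / ε)) (Eventually.of_forall fun x => ?_)
  refine (abs_chargeDensity_le (I.norm_sph hε x) _).trans ?_
  have := I.norm_grad_le hε 0 x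
  have := I.norm_grad_le hε 1 x
  gcongr

lemma goodTriple_left (τ : Tri) (k : Fin 3) : GoodTriple (I.U (vert τ k)) (I.M τ k) (I.B τ) where
  left := I.norm_U _
  mid := I.norm_M _ _
  right := I.norm_B _
  ne_neg := ne_neg_of_inner_nonneg (I.norm_U _) (by rw [real_inner_comm]; exact I.inner_MU τ k)
  inner_left := I.inner_BU τ k
  inner_mid := I.inner_BM τ k

lemma goodTriple_right (τ : Tri) (k : Fin 3) :
    GoodTriple (I.M τ k) (I.U (vert τ (k + 1))) (I.B τ) where
  left := I.norm_M _ _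
  mid := I.norm_U _
  right := I.norm_B _
  ne_neg := ne_neg_of_inner_nonneg (I.norm_M _ _) (I.inner_MU_succ τ k)
  inner_left := I.inner_BM τ k
  inner_mid := I.inner_BU τ (k + 1)

lemma isBounded_tcell (hε : 0 < ε) (τ : Tri) : Bornology.IsBounded (tcell ε τ) := by
  rw [← cell_vset hε]
  exact isBounded_convexHull.2 (((vset ε τ).finite_toSet).image _).isBounded

lemma sph_eventuallyEq {A : E2 →ᵃ[ℝ] E3} {s t : Set E2} (h : EqOn (I.lin ε) A t) (ho : IsOpen s)
    (hst : s ⊆ t) {x : E2} (hx : x ∈ s) : I.sph ε =ᶠ[𝓝 x] fun y => ‖A y‖⁻¹ • A y := by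
  filter_upwards [ho.mem_nhds hx] with y hy
  rw [sph, h (hst hy)]

/-- The integral of the charge density over a triangle. -/
lemma integral_tcell (hε : 0 < ε) (τ : Tri) :
    ∫ x in tcell ε τ, chargeDensity (I.sph ε) (grad (I.sph ε)) x =
      ∑ k, (solidAngle (I.U (vert τ k)) (I.M τ k) (I.B τ) +
        solidAngle (I.M τ k) (I.U (vert τ (k + 1))) (I.B τ)) := by
  have hfin : volume (⋃ i, halfCell ε τ i) ≠ ⊤ := by
    rw [measure_congr (iUnion_halfCell_ae_eq hε τ)]
    exact (isBounded_tcell hε τ).measure_lt_top.ne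
  rw [← setIntegral_congr_set (iUnion_halfCell_ae_eq hε τ),
    integral_iUnion_fintype (fun i => (isOpen_halfCell ε τ i).measurableSet)
      (pairwise_disjoint_halfCell ε τ) (fun i => I.integrableOn_chargeDensity hε
        (ne_top_of_le_ne_top hfin (measure_mono (subset_iUnion _ i)))), Fintype.sum_prod_type]
  refine Finset.sum_congr rfl fun k _ => ?_
  rw [Fintype.sum_bool]
  obtain ⟨h1, h2, h3⟩ := fin_succ_ne k
  obtain ⟨d1, d2⟩ := det2_refined hε τ k
  congr 1
  · obtain ⟨A, hA, a1, a2, a3⟩ := I.affine_refined hε τ h1 h2 h3 (Or.inl ⟨rfl, rfl⟩)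
    have hgood := I.goodTriple_left τ k
    rw [← a1, ← a2, ← a3] at hgood ⊢
    have hset : halfCell ε τ (k, true) =
        openTri (pos ε (vert τ k)) (mid ε τ k (k + 1)) (center ε τ) := by
      rw [← orefined_eq_openTri hε τ h1 h2 h3]; rfl
    rw [hset, integral_chargeDensity_openTri d1 hgood]
    intro x hx
    rw [← hset] at hx
    exact I.sph_eventuallyEq hA (isOpen_halfCell ε τ (k, true))
      (orefined_subset_refined ε τ _ _ _) hx
  · obtain ⟨A, hA, a1, a2, a3⟩ := I.affine_refined hε τ h1.symm h3 h2 (Or.inr ⟨rfl, rfl⟩)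
    have hgood := I.goodTriple_right τ k
    have hmid : mid ε τ (k + 1) k = mid ε τ k (k + 1) := by rw [mid, mid, add_comm]
    rw [hmid] at a2
    rw [← a1, ← a2, ← a3] at hgood ⊢
    have hset : halfCell ε τ (k, false) =
        openTri (mid ε τ k (k + 1)) (pos ε (vert τ (k + 1))) (center ε τ) := by
      rw [openTri_swap, ← hmid, ← orefined_eq_openTri hε τ h1.symm h3 h2]; rfl
    rw [hset, integral_chargeDensity_openTri d2 hgood]
    intro x hx
    rw [← hset] at hx
    exact I.sph_eventuallyEq hA (isOpen_halfCell ε τ (k, false))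
      (orefined_subset_refined ε τ _ _ _) hx

end InterpData

/-! ### Regions as connected components -/

section Regions

variable {ε : ℝ}

/-- The spin at the node with given lattice coordinates. -/
noncomputable def sv (u : SpinField ε) (z : ℤ × ℤ) : E3 := u (pos ε z)

lemma norm_sv (u : SpinField ε) (z : ℤ × ℤ) : ‖sv u z‖ = 1 :=
  mem_sphere_zero_iff_norm.1 (u (pos ε z)).2

/-- The spins at the endpoints of the `k`-th edge are antipodal. -/
def Anti (u : SpinField ε) (τ : Tri) (k : Fin 3) : Prop :=
  sv u (vert τ k) = -sv u (vert τ (k + 1))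

lemma anti_iff (u : SpinField ε) (τ : Tri) (k : Fin 3) :
    Anti u τ k ↔ u (pos ε (vert τ k)) = -u (pos ε (vert τ (k + 1))) := by
  rw [Anti, sv, sv, Subtype.ext_iff]
  rfl

lemma anti_nb {u : SpinField ε} {τ : Tri} {k : Fin 3} (h : Anti u τ k) : Anti u (nb τ k) k := by
  rw [Anti] at *
  rw [vert_nb, vert_nb_succ, h, neg_neg]

/-- The graph whose vertices are the triangles, with edges given by neighbors. -/
def triGraph (u : SpinField ε) : SimpleGraph Tri where
  Adj τ τ' := ∃ k, Anti u τ k ∧ τ' = nb τ k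
  symm := ⟨fun _ _ ⟨k, h, e⟩ => ⟨k, e ▸ anti_nb h, by rw [e, nb_nb]⟩⟩
  loopless := ⟨fun _ ⟨k, _, e⟩ => nb_ne _ k e.symm⟩

/-- The triangles connected to a given one. -/
def comp (u : SpinField ε) (τ : Tri) : Set Tri := {τ' | (triGraph u).Reachable τ τ'}

lemma mem_comp_self (u : SpinField ε) (τ : Tri) : τ ∈ comp u τ := SimpleGraph.Reachable.refl τ

lemma comp_eq {u : SpinField ε} {τ τ' : Tri} (h : τ' ∈ comp u τ) : comp u τ' = comp u τ :=
  Set.ext fun _ => ⟨fun h' => SimpleGraph.Reachable.trans h h',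
    fun h' => SimpleGraph.Reachable.trans (SimpleGraph.Reachable.symm h) h'⟩

lemma nb_mem_comp {u : SpinField ε} {τ : Tri} {k : Fin 3} (h : Anti u τ k) : nb τ k ∈ comp u τ :=
  SimpleGraph.Adj.reachable (G := triGraph u) ⟨k, h, rfl⟩

/-- The region of a triangle. -/
def region (u : SpinField ε) (τ : Tri) : Set E2 := ⋃ τ' ∈ comp u τ, tcell ε τ'

lemma region_eq {u : SpinField ε} {τ τ' : Tri} (h : τ' ∈ comp u τ) :
    region u τ' = region u τ := by rw [region, region, comp_eq h]

/-- The triangles at some vertex of which the spin is not `n`. -/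
def excited (u : SpinField ε) : Set Tri := {τ | ∃ k, sv u (vert τ k) ≠ north}

lemma Anti.mem_excited {u : SpinField ε} {τ : Tri} {k : Fin 3} (h : Anti u τ k) :
    τ ∈ excited u := by
  by_contra hn
  simp only [excited, mem_ofPred_eq, not_exists, not_not] at hn
  rw [Anti, hn, hn] at h
  have h2 := congrArg (fun x : E3 => x 2) h
  simp only [north, PiLp.neg_apply, Matrix.cons_val] at h2
  norm_num at h2

lemma anti_of_mem_comp {u : SpinField ε} {τ τ' : Tri} (h : τ' ∈ comp u τ) (hne : τ' ≠ τ) :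
    ∃ k, Anti u τ' k := by
  obtain ⟨w⟩ := SimpleGraph.Reachable.symm h
  cases w with
  | nil => exact absurd rfl hne
  | cons h _ => obtain ⟨k, hk, -⟩ := h; exact ⟨k, hk⟩

/-- In a component with several triangles each has an antipodal edge, and the two ends of such an
edge cannot both carry `north`. -/
lemma finite_comp {u : SpinField ε} (hu : (excited u).Finite) (τ : Tri) : (comp u τ).Finite := by
  refine (hu.insert τ).subset fun τ' h => ?_
  by_cases hne : τ' = τ
  · exact Or.inl hne
  · obtain ⟨k, hk⟩ := anti_of_mem_comp h hne
    exact Or.inr hk.mem_excited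

/-- A barycenter lies in no other closed triangle, so a union of triangles determines which
triangles it is made of. -/
lemma center_mem_region (hε : 0 < ε) (u : SpinField ε) {τ τ' : Tri}
    (h : center ε τ' ∈ region u τ) : τ' ∈ comp u τ := by
  simp only [region, mem_iUnion] at h
  obtain ⟨τ'', h1, h2⟩ := h
  rwa [← eq_of_mem_ocell (center_mem_ocell hε τ') h2]

lemma mem_region_of_mem {u : SpinField ε} {τ τ' : Tri} (h : τ' ∈ comp u τ) {x : E2}
    (hx : x ∈ tcell ε τ') : x ∈ region u τ := mem_biUnion h hx

lemma isConnectedRegion_iff (hε : 0 < ε) (u : SpinField ε) (R : Set E2) :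
    IsConnectedRegion u R ↔ ∃ F : Finset Tri,
      (∀ τ ∈ F, ∀ τ' ∈ F, (triGraph u).Reachable τ τ') ∧ R = ⋃ τ ∈ F, tcell ε τ := by
  classical
  have key : ∀ t t', Relation.ReflTransGen (Neighbor u) t t' → ∀ τ, t = vset ε τ →
      ∃ τ', t' = vset ε τ' ∧ (triGraph u).Reachable τ τ' := by
    intro t t' h
    induction h with
    | refl => exact fun τ h => ⟨τ, h, SimpleGraph.Reachable.refl τ⟩
    | tail _ h ih =>
      intro τ hτ
      obtain ⟨τ', rfl, h2⟩ := ih τ hτ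
      obtain ⟨τ'', rfl⟩ := (isTriangle_iff hε).1 h.2.1
      obtain ⟨k, hk, e⟩ := (neighbor_iff hε u _ _).1 h
      exact ⟨τ'', rfl, h2.trans (SimpleGraph.Adj.reachable (G := triGraph u)
        ⟨k, (anti_iff u _ _).2 hk, e⟩)⟩
  constructor
  · rintro ⟨F, h1, h2, rfl⟩
    refine ⟨F.preimage (vset ε) ((vset_injective hε).injOn), fun τ hτ τ' hτ' => ?_, ?_⟩
    · rw [Finset.mem_preimage] at hτ hτ'
      obtain ⟨τ'', e, h⟩ := key _ _ (h2 _ hτ _ hτ') τ rfl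
      rwa [vset_injective hε e]
    · ext x
      simp only [mem_iUnion, Finset.mem_preimage]
      constructor
      · rintro ⟨t, ht, hx⟩
        obtain ⟨τ, rfl⟩ := (isTriangle_iff hε).1 (h1 t ht)
        exact ⟨τ, ht, by rwa [← cell_vset hε]⟩
      · rintro ⟨τ, hτ, hx⟩
        exact ⟨_, hτ, by rwa [cell_vset hε]⟩
  · rintro ⟨F, h1, rfl⟩
    refine ⟨F.image (vset ε), ?_, ?_, ?_⟩
    · intro t ht
      obtain ⟨τ, -, rfl⟩ := Finset.mem_image.1 ht
      exact isTriangle_vset hε τ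
    · intro t ht t' ht'
      obtain ⟨τ, hτ, rfl⟩ := Finset.mem_image.1 ht
      obtain ⟨τ', hτ', rfl⟩ := Finset.mem_image.1 ht'
      have h := (SimpleGraph.reachable_iff_reflTransGen _ _).1 (h1 τ hτ τ' hτ')
      refine h.lift (vset ε) fun a b hab => ?_
      obtain ⟨k, hk, e⟩ := hab
      exact (neighbor_iff hε u a b).2 ⟨k, (anti_iff u _ _).1 hk, e⟩
    · ext x
      simp only [Finset.mem_image, mem_iUnion]
      constructor
      · rintro ⟨τ, hτ, hx⟩
        exact ⟨_, ⟨τ, hτ, rfl⟩, by rwa [cell_vset hε]⟩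
      · rintro ⟨_, ⟨τ, hτ, rfl⟩, hx⟩
        exact ⟨τ, hτ, by rwa [← cell_vset hε]⟩

lemma isConnectedRegion_region (hε : 0 < ε) {u : SpinField ε} (hu : (excited u).Finite)
    (τ : Tri) : IsConnectedRegion u (region u τ) := by
  refine (isConnectedRegion_iff hε u _).2 ⟨(finite_comp hu τ).toFinset, ?_, ?_⟩
  · intro a ha b hb
    rw [Finite.mem_toFinset] at ha hb
    exact SimpleGraph.Reachable.trans (SimpleGraph.Reachable.symm ha) hb
  · simp [region]

lemma subset_region (u : SpinField ε) {F : Finset Tri}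
    (hF : ∀ τ ∈ F, ∀ τ' ∈ F, (triGraph u).Reachable τ τ') {τ : Tri} (hτ : τ ∈ F) :
    ⋃ τ' ∈ F, tcell ε τ' ⊆ region u τ :=
  iUnion₂_subset fun τ' h => fun _ hx => mem_region_of_mem (hF τ hτ τ' h) hx

/-- Maximal connected unions are the connected components of `triGraph`. Finiteness of the excited
set ensures that a whole component is a finite union. -/
lemma mem_regions_iff (hε : 0 < ε) {u : SpinField ε} (hu : (excited u).Finite) (R : Set E2) :
    R ∈ regions u ↔ ∃ τ, R = region u τ := by
  constructor
  · rintro ⟨hR, hmax⟩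
    obtain ⟨F, hF, rfl⟩ := (isConnectedRegion_iff hε u R).1 hR
    by_cases hne : F.Nonempty
    · obtain ⟨τ, hτ⟩ := hne
      exact ⟨τ, (subset_region u hF hτ).antisymm
        (hmax (isConnectedRegion_region hε hu τ) (subset_region u hF hτ))⟩
    · rw [Finset.not_nonempty_iff_eq_empty] at hne
      subst hne
      -- The empty union is a connected region too, but it is contained in any triangle's region and
      -- hence is not maximal.
      have h1 := hmax (isConnectedRegion_region hε hu (0, 0, true)) (by simp)
      have h2 := h1 (mem_region_of_mem (mem_comp_self u _)
        (ocell_subset_tcell ε _ (center_mem_ocell hε (0, 0, true))))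
      simp at h2
  · rintro ⟨τ, rfl⟩
    refine ⟨isConnectedRegion_region hε hu τ, fun R' hR' hle => ?_⟩
    obtain ⟨F, hF, rfl⟩ := (isConnectedRegion_iff hε u R').1 hR'
    have h1 := hle (mem_region_of_mem (mem_comp_self u τ)
      (ocell_subset_tcell ε _ (center_mem_ocell hε τ)))
    simp only [mem_iUnion] at h1
    obtain ⟨τ', h2, h3⟩ := h1
    rw [eq_of_mem_ocell (center_mem_ocell hε τ) h3] at h2
    exact subset_region u hF h2

lemma mem_values_region (hε : 0 < ε) (u : SpinField ε) (τ : Tri) (w : E3) :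
    w ∈ values u (region u τ) ↔ ∃ τ' ∈ comp u τ, ∃ k, sv u (vert τ' k) = w := by
  constructor
  · rintro ⟨i, hi, rfl⟩
    obtain ⟨z, rfl⟩ := pos_surjective ε i
    simp only [region, mem_iUnion] at hi
    obtain ⟨τ', h1, h2⟩ := hi
    obtain ⟨k, rfl⟩ := pos_mem_tcell hε h2
    exact ⟨τ', h1, k, rfl⟩
  · rintro ⟨τ', h, k, rfl⟩
    exact ⟨pos ε (vert τ' k), mem_region_of_mem h (pos_vert_mem_tcell hε _ _), rfl⟩

/-! ### The structure of regions with several triangles -/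

/-- All spins of a triangle lie on the axis of `p`. -/
def OnAxis (u : SpinField ε) (p : E3) (τ : Tri) : Prop :=
  ∀ k, sv u (vert τ k) = p ∨ sv u (vert τ k) = -p

/-- A triangle with exactly one antipodal edge, from `p` to `-p`, and third spin `q`. -/
def IsEnd (u : SpinField ε) (p q : E3) (τ : Tri) : Prop :=
  ∃ k, sv u (vert τ k) = p ∧ sv u (vert τ (k + 1)) = -p ∧ sv u (vert τ (k + 2)) = q ∧
    q ≠ p ∧ q ≠ -p

lemma succ_add (k : Fin 3) : k + 1 + 1 = k + 2 ∧ k + 2 + 1 = k ∧ k + 2 + 2 = k + 1 ∧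
    k + 1 + 2 = k := by
  fin_cases k <;> simp

open Classical in
/-- The orientation of an antipodal edge with respect to the axis. -/
noncomputable def flag (u : SpinField ε) (p : E3) (τ : Tri) (k : Fin 3) : ℤ :=
  if Anti u τ k then (if sv u (vert τ k) = p then 1 else -1) else 0

open Classical in
/-- The number of antipodal edges of a triangle. -/
noncomputable def antiCount (u : SpinField ε) (τ : Tri) : ℤ :=
  ∑ k, if Anti u τ k then 1 else 0

/-- Some antipodal edge of the triangle lies on the axis of `p`. -/
def HasAxis (u : SpinField ε) (p : E3) (τ : Tri) : Prop :=
  ∃ k, Anti u τ k ∧ (sv u (vert τ k) = p ∨ sv u (vert τ k) = -p)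

/-- Any two edges of a triangle share a vertex, so two antipodal pairs in the same triangle span the
same axis. -/
lemma HasAxis.of_anti {u : SpinField ε} {p : E3} {τ : Tri} (h : HasAxis u p τ) {l : Fin 3}
    (hl : Anti u τ l) : sv u (vert τ l) = p ∨ sv u (vert τ l) = -p := by
  obtain ⟨k, hk, hp⟩ := h
  have hlk : l = k ∨ l = k + 1 ∨ l = k + 2 := by fin_cases k <;> fin_cases l <;> simp
  rcases hlk with rfl | rfl | rfl
  · exact hp
  · rw [Anti] at hk
    rw [hk, neg_inj, neg_eq_iff_eq_neg] at hp
    exact hp.symm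
  · rw [Anti, (succ_add k).2.1] at hl
    rw [hl, neg_inj, neg_eq_iff_eq_neg]
    exact hp.symm

/-- Neighbors share an antipodal edge, so the axis propagates along chains. -/
lemma HasAxis.of_mem_comp {u : SpinField ε} {p : E3} {τ τ' : Tri} (h : HasAxis u p τ)
    (h' : τ' ∈ comp u τ) : HasAxis u p τ' := by
  have h'' := (SimpleGraph.reachable_iff_reflTransGen _ _).1 h'
  induction h'' with
  | refl => exact h
  | tail hab hbc ih =>
    obtain ⟨k, hk, rfl⟩ := hbc
    have h1 := (ih ((SimpleGraph.reachable_iff_reflTransGen _ _).2 hab)).of_anti hk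
    refine ⟨k, anti_nb hk, ?_⟩
    rw [Anti] at hk
    rw [hk, neg_inj, neg_eq_iff_eq_neg] at h1
    rw [vert_nb]
    exact h1.symm

/-- If the third spin is `p` or `-p`, it is antipodal to exactly one end of the given edge and the
two antipodal edges have opposite flags. Otherwise the given edge is the only antipodal one, and its
flag is the orientation of the end. -/
lemma HasAxis.trichotomy {u : SpinField ε} {p : E3} (hp : p ≠ -p) {τ : Tri} (h : HasAxis u p τ) :
    (antiCount u τ = 2 ∧ ∑ k, flag u p τ k = 0 ∧ OnAxis u p τ) ∨
    (antiCount u τ = 1 ∧ ∑ k, flag u p τ k = 1 ∧ ∃ q, IsEnd u p q τ) ∨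
    (antiCount u τ = 1 ∧ ∑ k, flag u p τ k = -1 ∧ ∃ q, IsEnd u (-p) q τ) := by
  obtain ⟨k, hk, hkp⟩ := h
  obtain ⟨a1, a2, -, -⟩ := succ_add k
  have hk' := hk
  rw [Anti] at hk'
  have hp' : -p ≠ p := hp.symm
  have hax : ∀ {P : Fin 3 → Prop}, P k → P (k + 1) → P (k + 2) → ∀ l, P l := by
    intro P h0 h1 h2 l
    have : l = k ∨ l = k + 1 ∨ l = k + 2 := by fin_cases k <;> fin_cases l <;> simp
    rcases this with rfl | rfl | rfl <;> assumption
  rw [antiCount, sum_fin_three _ k, sum_fin_three _ k]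
  simp only [flag, Anti, a1, a2]
  by_cases h1 : sv u (vert τ (k + 2)) = p
  · left
    rcases hkp with h0 | h0
    · rw [h0] at hk'
      have h3 : sv u (vert τ (k + 1)) = -p := by rw [hk', neg_neg]
      refine ⟨?_, ?_, hax (Or.inl h0) (Or.inr h3) (Or.inl h1)⟩ <;> simp [h0, h1, h3, hp, hp']
    · rw [h0, neg_inj] at hk'
      have h3 := hk'.symm
      refine ⟨?_, ?_, hax (Or.inr h0) (Or.inl h3) (Or.inl h1)⟩ <;> simp [h0, h1, h3, hp, hp']
  · by_cases h2 : sv u (vert τ (k + 2)) = -p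
    · left
      rcases hkp with h0 | h0
      · rw [h0] at hk'
        have h3 : sv u (vert τ (k + 1)) = -p := by rw [hk', neg_neg]
        refine ⟨?_, ?_, hax (Or.inl h0) (Or.inr h3) (Or.inr h2)⟩ <;> simp [h0, h2, h3, hp, hp']
      · rw [h0, neg_inj] at hk'
        have h3 := hk'.symm
        refine ⟨?_, ?_, hax (Or.inr h0) (Or.inl h3) (Or.inr h2)⟩ <;> simp [h0, h2, h3, hp, hp']
    · right
      have h1' : p ≠ sv u (vert τ (k + 2)) := Ne.symm h1
      have h2' : p ≠ -sv u (vert τ (k + 2)) := fun h => h2 (by rw [h, neg_neg])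
      rcases hkp with h0 | h0
      · left
        rw [h0] at hk'
        have h3 : sv u (vert τ (k + 1)) = -p := by rw [hk', neg_neg]
        refine ⟨?_, ?_, sv u (vert τ (k + 2)), k, h0, h3, rfl, h1, h2⟩ <;>
          simp [h0, h3, h1', h2, hp']
      · right
        rw [h0, neg_inj] at hk'
        have h3 := hk'.symm
        refine ⟨?_, ?_, sv u (vert τ (k + 2)), k, h0, by rw [neg_neg]; exact h3, rfl, h2,
          by rw [neg_neg]; exact h1⟩ <;>
          simp [h0, h3, h1, h1', h2, h2', hp, hp']

/-- The two triangles along an antipodal edge traverse it in opposite directions, so the flags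
cancel in pairs. -/
lemma sum_flag_eq_zero {u : SpinField ε} {p : E3} (hp : p ≠ -p) {τ : Tri} (h : HasAxis u p τ)
    {F : Finset Tri} (hF : ∀ τ', τ' ∈ F ↔ τ' ∈ comp u τ) : ∑ τ' ∈ F, ∑ k, flag u p τ' k = 0 := by
  classical
  rw [← Finset.sum_product']
  refine Finset.sum_involution
    (fun x _ => if Anti u x.1 x.2 then (nb x.1 x.2, x.2) else x) ?_ ?_ ?_ ?_
  · rintro ⟨τ', k⟩ hx
    rw [Finset.mem_product, hF] at hx
    simp only
    by_cases ha : Anti u τ' k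
    · have h1 := (h.of_mem_comp hx.1).of_anti ha
      have hb := anti_nb ha
      rw [if_pos ha]
      simp only [flag, if_pos ha, if_pos hb, vert_nb]
      rw [Anti] at ha
      rcases h1 with h1 | h1
      · have h2 : sv u (vert τ' (k + 1)) = -p := by rw [← h1, ha, neg_neg]
        simp [h1, h2, hp.symm]
      · have h2 : sv u (vert τ' (k + 1)) = p := by rw [h1, neg_inj] at ha; exact ha.symm
        simp [h1, h2, hp.symm]
    · rw [if_neg ha]
      simp [flag, ha]
  · rintro ⟨τ', k⟩ hx h0
    by_cases ha : Anti u τ' k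
    · simp only [if_pos ha]
      intro e
      exact nb_ne τ' k (congrArg Prod.fst e)
    · simp [flag, ha] at h0
  · rintro ⟨τ', k⟩ hx
    rw [Finset.mem_product, hF] at hx
    by_cases ha : Anti u τ' k
    · simp only [if_pos ha, Finset.mem_product, hF, Finset.mem_univ, and_true]
      exact comp_eq hx.1 ▸ nb_mem_comp ha
    · simp only [if_neg ha, Finset.mem_product, hF, Finset.mem_univ, and_true]
      exact hx.1
  · rintro ⟨τ', k⟩ hx
    by_cases ha : Anti u τ' k
    · simp only [if_pos ha, if_pos (anti_nb ha), nb_nb]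
    · simp [if_neg ha]

-- The number of antipodal edges is the degree in `triGraph`. A connected graph with `n` vertices
-- has at least `n - 1` edges, and the degrees sum to twice the number of edges.
open Classical in
lemma card_le_sum_antiCount {u : SpinField ε} {τ : Tri} {F : Finset Tri}
    (hF : ∀ τ', τ' ∈ F ↔ τ' ∈ comp u τ) : 2 * ((F.card : ℤ) - 1) ≤ ∑ τ' ∈ F, antiCount u τ' := by
  set C := (triGraph u).connectedComponentMk τ with hC
  have hmem : ∀ τ', τ' ∈ C ↔ τ' ∈ F := by
    intro τ'
    rw [hF, hC]
    exact SimpleGraph.ConnectedComponent.eq.trans SimpleGraph.reachable_comm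
  have hfin : Finite C := by
    refine Set.Finite.to_subtype (s := C.supp) (F.finite_toSet.subset fun x hx => (hmem x).1 hx)
  have : Fintype C := Fintype.ofFinite _
  have h1 := C.connected_toSimpleGraph.card_vert_le_card_edgeSet_add_one
  have h2 := SimpleGraph.sum_degrees_eq_twice_card_edges C.toSimpleGraph
  rw [SimpleGraph.edgeFinset_card, ← Nat.card_eq_fintype_card] at h2
  have hdeg : ∀ v : C, (C.toSimpleGraph.degree v : ℤ) = antiCount u v := by
    intro v
    have e : (C.toSimpleGraph.neighborFinset v).map (Function.Embedding.subtype _) =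
        (Finset.univ.filter fun k => Anti u v k).map ⟨nb v, nb_injective v⟩ := by
      ext τ'
      simp only [Finset.mem_map, SimpleGraph.mem_neighborFinset, Finset.mem_filter,
        Finset.mem_univ, true_and, Function.Embedding.coeFn_mk, Function.Embedding.subtype_apply]
      constructor
      · rintro ⟨w, hw, rfl⟩
        obtain ⟨k, hk, e⟩ := (C.toSimpleGraph_adj v.2 w.2).1 hw
        exact ⟨k, hk, e.symm⟩
      · rintro ⟨k, hk, rfl⟩
        have hv := v.2
        have hm : nb v k ∈ C := by
          rw [hmem, hF] at hv ⊢
          exact comp_eq hv ▸ nb_mem_comp hk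
        exact ⟨⟨nb v k, hm⟩, (C.toSimpleGraph_adj v.2 hm).2 ⟨k, hk, rfl⟩, rfl⟩
    have e' := congrArg Finset.card e
    rw [Finset.card_map, Finset.card_map, SimpleGraph.card_neighborFinset_eq_degree] at e'
    rw [e', antiCount]
    simp
  have h3 : Nat.card C = F.card := by
    rw [Nat.card_eq_fintype_card]
    exact Fintype.card_of_subtype F fun x => (hmem x).symm
  have h4 : ∑ v : C, antiCount u v = ∑ τ' ∈ F, antiCount u τ' :=
    (Finset.sum_subtype F (fun x => (hmem x).symm) _).symm
  rw [← h4, ← Finset.sum_congr rfl fun v _ => hdeg v, ← Nat.cast_sum, h2]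
  push_cast
  omega

/-- A region with several triangles has no end, or two ends of opposite orientation. -/
lemma HasAxis.exists_ends {u : SpinField ε} {p : E3} (hp : p ≠ -p) {τ : Tri} (h : HasAxis u p τ)
    {F : Finset Tri} (hF : ∀ τ', τ' ∈ F ↔ τ' ∈ comp u τ) :
    (∀ τ' ∈ F, OnAxis u p τ') ∨ ∃ τ₁ ∈ F, ∃ τ₂ ∈ F, ∃ q₁ q₂, τ₁ ≠ τ₂ ∧ IsEnd u p q₁ τ₁ ∧
      IsEnd u (-p) q₂ τ₂ ∧ ∀ τ' ∈ F, τ' ≠ τ₁ → τ' ≠ τ₂ → OnAxis u p τ' := by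
  classical
  have hsum := sum_flag_eq_zero hp h hF
  have htri : ∀ τ' ∈ F, _ := fun τ' hτ' => (h.of_mem_comp ((hF τ').1 hτ')).trichotomy hp
  by_cases hall : ∀ τ' ∈ F, ∑ k, flag u p τ' k = 0
  · left
    intro τ' hτ'
    have h0 := hall τ' hτ'
    rcases htri τ' hτ' with ⟨-, -, h1⟩ | ⟨-, h1, -⟩ | ⟨-, h1, -⟩
    · exact h1
    · omega
    · omega
  · right
    push Not at hall
    -- Integers that sum to zero and do not all vanish take both signs, which gives an end of each
    -- orientation.
    obtain ⟨τ₁, h1, p1⟩ := Finset.exists_pos_of_sum_zero_of_exists_nonzero _ hsum hall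
    obtain ⟨τ₂, h2, p2⟩ := Finset.exists_pos_of_sum_zero_of_exists_nonzero
      (fun τ' => -∑ k, flag u p τ' k) (by rw [Finset.sum_neg_distrib, hsum, neg_zero])
      (by simpa using hall)
    have hne : τ₁ ≠ τ₂ := by rintro rfl; omega
    obtain ⟨q₁, e1⟩ : ∃ q, IsEnd u p q τ₁ := by
      rcases htri τ₁ h1 with ⟨-, h1, -⟩ | ⟨-, -, h1⟩ | ⟨-, h1, -⟩
      · omega
      · exact h1
      · omega
    obtain ⟨q₂, e2⟩ : ∃ q, IsEnd u (-p) q τ₂ := by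
      rcases htri τ₂ h2 with ⟨-, h1, -⟩ | ⟨-, h1, -⟩ | ⟨-, -, h1⟩
      · omega
      · omega
      · exact h1
    refine ⟨τ₁, h1, τ₂, h2, q₁, q₂, hne, e1, e2, fun τ₃ h3 n1 n2 => ?_⟩
    by_contra hax
    have hcard := card_le_sum_antiCount hF
    -- A third end would bring the sum of degrees down to at most `2 * F.card - 3`, less than
    -- connectedness requires.
    have hle : ∀ τ' ∈ F, antiCount u τ' ≤ 2 - (if τ' ∈ ({τ₁, τ₂, τ₃} : Finset Tri) then 1 else 0) := by
      intro τ' hτ'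
      rcases htri τ' hτ' with ⟨c, f, a⟩ | ⟨c, -⟩ | ⟨c, -⟩
      · rw [if_neg, c, sub_zero]
        simp only [Finset.mem_insert, Finset.mem_singleton, not_or]
        refine ⟨?_, ?_, ?_⟩
        · rintro rfl; omega
        · rintro rfl; omega
        · rintro rfl; exact hax a
      · split_ifs <;> omega
      · split_ifs <;> omega
    have hsub : ({τ₁, τ₂, τ₃} : Finset Tri) ⊆ F := by
      intro x hx
      simp only [Finset.mem_insert, Finset.mem_singleton] at hx
      rcases hx with rfl | rfl | rfl <;> assumption
    have h4 := Finset.sum_le_sum hle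
    rw [Finset.sum_sub_distrib, Finset.sum_ite_mem, Finset.inter_eq_right.2 hsub] at h4
    simp only [Finset.sum_const, nsmul_eq_mul, mul_one] at h4
    rw [Finset.card_eq_three.2 ⟨_, _, _, hne, n1.symm, n2.symm, rfl⟩] at h4
    push_cast at h4
    linarith

end Regions

/-! ### Cones -/

lemma subset_cone (W : Set E3) : W ⊆ cone W := PointedCone.subset_hull

lemma cone_mono {V W : Set E3} (h : V ⊆ W) : cone V ⊆ cone W := Submodule.span_mono h

lemma zero_mem_cone (W : Set E3) : 0 ∈ cone W := (PointedCone.hull ℝ W).zero_mem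

lemma add_mem_cone {W : Set E3} {x y : E3} (hx : x ∈ cone W) (hy : y ∈ cone W) : x + y ∈ cone W :=
  (PointedCone.hull ℝ W).add_mem hx hy

lemma smul_mem_cone {W : Set E3} {x : E3} {t : ℝ} (ht : 0 ≤ t) (hx : x ∈ cone W) :
    t • x ∈ cone W := (PointedCone.hull ℝ W).smul_mem ht hx

lemma cone_induction {W : Set E3} {P : E3 → Prop} (h : ∀ w ∈ W, P w) (h0 : P 0)
    (hadd : ∀ x y, P x → P y → P (x + y)) (hsmul : ∀ t : ℝ, 0 ≤ t → ∀ x, P x → P (t • x)) {y : E3}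
    (hy : y ∈ cone W) : P y := by
  refine Submodule.span_induction (R := {c : ℝ // 0 ≤ c}) (p := fun x _ => P x) h h0 (fun x y _ _ => hadd x y)
    (fun a x _ => hsmul a a.2 x) hy

lemma mem_cone_insert {e : E3} {W : Set E3} {y : E3} :
    y ∈ cone (insert e W) ↔ ∃ t : ℝ, 0 ≤ t ∧ ∃ z ∈ cone W, y = t • e + z := by
  rw [cone, SetLike.mem_coe, PointedCone.hull, Submodule.mem_span_insert]
  constructor
  · rintro ⟨t, z, hz, rfl⟩
    exact ⟨t, t.2, z, hz, rfl⟩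
  · rintro ⟨t, ht, z, hz, rfl⟩
    exact ⟨⟨t, ht⟩, z, hz, rfl⟩

lemma cone_subset_cone {V W : Set E3} (h : V ⊆ cone W) : cone V ⊆ cone W :=
  fun _ hy => cone_induction (P := fun y => y ∈ cone W) h (zero_mem_cone W)
    (fun _ _ => add_mem_cone) (fun _ ht _ => smul_mem_cone ht) hy

lemma cone_insert_of_mem {e : E3} {W : Set E3} (h : e ∈ cone W) : cone (insert e W) = cone W :=
  (cone_subset_cone (insert_subset h (subset_cone W))).antisymm (cone_mono (subset_insert e W))

lemma inner_nonneg_of_mem_cone {W : Set E3} {n : E3} (h : ∀ w ∈ W, 0 ≤ inner ℝ n w) {y : E3}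
    (hy : y ∈ cone W) : 0 ≤ inner ℝ n y := by
  refine cone_induction (P := fun y => 0 ≤ inner ℝ n y) h (by simp) (fun x y hx hy => ?_)
    (fun t ht x hx => ?_) hy
  · rw [inner_add_right]; positivity
  · rw [inner_smul_right]; positivity

lemma mul_triple_nonneg_of_mem_cone {W : Set E3} {a b : E3} {s : ℝ}
    (h : ∀ w ∈ W, 0 ≤ s * triple a b w) {y : E3} (hy : y ∈ cone W) : 0 ≤ s * triple a b y := by
  have h1 : ∀ w, inner ℝ (s • cross a b) w = s * triple a b w := fun w => by
    rw [inner_smul_left, inner_cross_eq_triple]; rfl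
  rw [← h1]
  exact inner_nonneg_of_mem_cone (fun w hw => by rw [h1]; exact h w hw) hy

/-- A convex cone is a subspace as soon as it contains the negatives of its generators. -/
lemma isSubspace_iff (W : Set E3) : (∃ L : Submodule ℝ E3, (L : Set E3) = cone W) ↔
    ∀ y ∈ W, -y ∈ cone W := by
  constructor
  · rintro ⟨L, hL⟩ y hy
    rw [← hL]
    refine L.neg_mem ?_
    rw [← SetLike.mem_coe, hL]
    exact subset_cone W hy
  · intro h
    have hneg : ∀ y ∈ cone W, -y ∈ cone W := fun y hy =>
      cone_induction (P := fun y => -y ∈ cone W) h (by rw [neg_zero]; exact zero_mem_cone W)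
        (fun x y hx hy => by rw [neg_add]; exact add_mem_cone hx hy)
        (fun t ht x hx => by rw [← smul_neg]; exact smul_mem_cone ht hx) hy
    refine ⟨⟨⟨⟨cone W, add_mem_cone⟩, zero_mem_cone W⟩, fun t x hx => ?_⟩, rfl⟩
    rcases le_total 0 t with ht | ht
    · exact smul_mem_cone ht hx
    · have := hneg _ (smul_mem_cone (neg_nonneg.2 ht) hx)
      rwa [neg_smul, neg_neg] at this

/-- Subtracting multiples of one nonnegative vector from another, until a coordinate vanishes. -/
lemma exists_min_ratio {ι : Type*} [Fintype ι] {c c' : ι → ℝ} (hc : ∀ i, 0 ≤ c i)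
    (hc' : ∀ i, 0 ≤ c' i) (hpos : ∃ i, 0 < c i) :
    ∃ t : ℝ, 0 ≤ t ∧ (∀ i, 0 ≤ c' i - t * c i) ∧ ∃ i, c' i - t * c i = 0 := by
  classical
  obtain ⟨i₀, h₀⟩ := hpos
  obtain ⟨i, hi, hmin⟩ := (Finset.univ.filter fun i => 0 < c i).exists_min_image
    (fun i => c' i / c i) ⟨i₀, by simpa using h₀⟩
  rw [Finset.mem_filter] at hi
  refine ⟨c' i / c i, div_nonneg (hc' i) (hc i), fun j => ?_, i, ?_⟩
  · rcases (hc j).eq_or_lt with h | h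
    · rw [← h, mul_zero, sub_zero]; exact hc' j
    · have h1 := hmin j (by simpa using h)
      rw [le_div_iff₀ h] at h1
      linarith
  · rw [div_mul_cancel₀ _ hi.2.ne', sub_self]

/-! ### Spherical triangles with a common apex -/

lemma radial_mono {K K' : Set E3} (h : K ⊆ K') : radial K ⊆ radial K' :=
  fun _ ⟨y, hy, h0, e⟩ => ⟨y, h hy, h0, e⟩

/-- Cones separated by a plane can only meet inside that plane, that is, on a great circle. -/
lemma area_radial_inter_eq_zero {K K' : Set E3} {n : E3} (hn : n ≠ 0)
    (h : ∀ y ∈ K, 0 ≤ inner ℝ n y) (h' : ∀ y ∈ K', inner ℝ n y ≤ 0) :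
    area (radial K ∩ radial K') = 0 := by
  refine measure_mono_null ?_
    (area_radial_eq_zero hn (K := {y | inner ℝ n y = 0}) fun y hy => hy)
  rintro z ⟨⟨y, hy, h0, rfl⟩, y', hy', h0', e⟩
  have i1 : 0 < ‖y‖⁻¹ := inv_pos.2 (norm_pos_iff.2 h0)
  have i2 : 0 < ‖y'‖⁻¹ := inv_pos.2 (norm_pos_iff.2 h0')
  have h1 := congrArg (fun w => inner ℝ n w) e
  simp only [inner_smul_right] at h1
  have h2 := mul_nonneg i1.le (h y hy)
  have h3 := mul_nonpos_of_nonneg_of_nonpos i2.le (h' y' hy')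
  refine ⟨y, ?_, h0, rfl⟩
  have h4 : ‖y‖⁻¹ * inner ℝ n y = 0 := le_antisymm (h1 ▸ h3) h2
  exact (mul_eq_zero.1 h4).resolve_left i1.ne'

lemma sphTri_subset_image {a b c : E3} (h : GoodTriple a b c) : sphTri a b c =
    (fun p : ℝ × ℝ => ‖coneParam a b c p.1 p.2‖⁻¹ • coneParam a b c p.1 p.2) ''
      (Icc 0 1 ×ˢ Icc 0 1) := by
  apply Subset.antisymm
  · rintro _ ⟨y, hy, h0, rfl⟩
    obtain ⟨α, β, γ, hα, hβ, hγ, rfl⟩ := mem_cone_three.1 hy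
    have hs : 0 < α + β + γ := by
      refine lt_of_le_of_ne (by positivity) fun hs => h0 ?_
      have e1 : α = 0 := by linarith
      have e2 : β = 0 := by linarith
      have e3 : γ = 0 := by linarith
      simp [e1, e2, e3]
    obtain ⟨θ, hθ, e1⟩ : ∃ θ ∈ Icc (0 : ℝ) 1, (α + β) * θ = β := by
      rcases (add_nonneg hα hβ).eq_or_lt with h1 | h1
      · exact ⟨0, by simp, by linarith⟩
      · exact ⟨β / (α + β), ⟨by positivity, by rw [div_le_one h1]; linarith⟩, by field_simp⟩
    refine ⟨((α + β) / (α + β + γ), θ), ⟨⟨by positivity, ?_⟩, hθ⟩, ?_⟩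
    · simp only; rw [div_le_one hs]; linarith
    · simp only
      have e : coneParam a b c ((α + β) / (α + β + γ)) θ =
          (α + β + γ)⁻¹ • (α • a + β • b + γ • c) := by
        have e2 : (α + β) / (α + β + γ) * θ = (α + β + γ)⁻¹ * β := by
          rw [div_mul_eq_mul_div, e1]; ring
        have e3 : 1 - (α + β) / (α + β + γ) = (α + β + γ)⁻¹ * γ := by field_simp; ring
        have e4 : (α + β) / (α + β + γ) = (α + β + γ)⁻¹ * (α + β) := by ring
        rw [coneParam, smul_add, smul_smul, e2, e3, e4]
        module
      rw [e, norm_smul, norm_inv, Real.norm_of_nonneg hs.le, mul_inv, inv_inv, smul_smul]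
      congr 1
      field_simp
  · rintro _ ⟨p, ⟨hp, hq⟩, rfl⟩
    exact ⟨_, coneParam_mem_cone hp hq, coneParam_ne_zero h hp hq, rfl⟩

lemma measurableSet_sphTri {a b c : E3} (h : GoodTriple a b c) : MeasurableSet (sphTri a b c) := by
  rw [sphTri_subset_image h]
  refine (IsCompact.image_of_continuousOn (isCompact_Icc.prod isCompact_Icc) ?_).measurableSet
  have hc : Continuous fun p : ℝ × ℝ => coneParam a b c p.1 p.2 := by
    unfold coneParam; fun_prop
  exact (hc.norm.continuousOn.inv₀ fun p hp => norm_ne_zero_iff.2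
    (coneParam_ne_zero h hp.1 hp.2)).smul hc.continuousOn

lemma cross_ne_zero_of_ne {a b : E3} (ha : ‖a‖ = 1) (hb : ‖b‖ = 1) (h : a ≠ b) (h' : a ≠ -b) :
    cross a b ≠ 0 := by
  intro h0
  have h1 : ‖cross a b‖ ^ 2 = ‖a‖ ^ 2 * ‖b‖ ^ 2 - inner ℝ a b ^ 2 := by
    rw [norm_sq_E3, norm_sq_E3, norm_sq_E3, inner_E3, cross_zero, cross_one, cross_two]; ring
  rw [h0, norm_zero, ha, hb] at h1
  have h2 : (inner ℝ a b - 1) * (inner ℝ a b + 1) = (0 : ℝ) := by linarith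
  rcases mul_eq_zero.1 h2 with h3 | h3
  · exact h ((inner_eq_one_iff_of_norm_eq_one (𝕜 := ℝ) ha hb).1 (by linarith))
  · refine h' ((inner_eq_one_iff_of_norm_eq_one (𝕜 := ℝ) ha (by rwa [norm_neg])).1 ?_)
    rw [inner_neg_right]; linarith

lemma area_sphTri_of_sign {a b e : E3} (h : GoodTriple a b e) {s : ℝ} (hs : s = 1 ∨ s = -1)
    (ht : 0 ≤ s * triple a b e) :
    0 ≤ s * solidAngle a b e ∧ area (sphTri a b e) = ENNReal.ofReal (s * solidAngle a b e) := by
  have hre := solidRe_pos h.left h.mid h.right h.ne_neg h.inner_left h.inner_mid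
  have h1 : 0 ≤ s * solidAngle a b e := by
    rcases hs with rfl | rfl
    · rw [one_mul] at *; exact solidAngle_nonneg ht
    · have := solidAngle_swap_of_ne (a := a) (b := b) (c := e) (Or.inr hre)
      rw [neg_one_mul, ← triple_swap] at ht
      rw [neg_one_mul, ← this]
      exact solidAngle_nonneg ht
  refine ⟨h1, ?_⟩
  rw [area_sphTri h]
  congr 1
  rw [← abs_of_nonneg h1, abs_mul]
  rcases hs with rfl | rfl <;> simp

/-- The plane through the common edge from `b` to `e` separates the two triangles, because both have
the orientation `s`. If `b = e` the first triangle is degenerate. -/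
lemma area_sphTri_inter {a b c e : E3} (h : GoodTriple a b e) (h' : GoodTriple b c e) {s : ℝ}
    (ht : 0 ≤ s * triple a b e) (ht' : 0 ≤ s * triple b c e) (hs : s = 1 ∨ s = -1) :
    area (sphTri a b e ∩ sphTri b c e) = 0 := by
  by_cases hbe : b = e
  · refine measure_mono_null inter_subset_left ?_
    change area (sphTri a b e) = 0
    have h0 : triple a b e = 0 := by rw [hbe, triple_self_right]
    rw [area_sphTri h, solidAngle_eq_zero h0
      (solidRe_pos h.left h.mid h.right h.ne_neg h.inner_left h.inner_mid).le, abs_zero,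
      ENNReal.ofReal_zero]
  · have hne : cross b e ≠ 0 := by
      refine cross_ne_zero_of_ne h.mid h.right hbe ?_
      rintro rfl
      have := h.inner_mid
      rw [inner_neg_right, real_inner_self_eq_norm_sq, h.right] at this
      norm_num at this
    have hs0 : s ≠ 0 := by rcases hs with rfl | rfl <;> norm_num
    refine area_radial_inter_eq_zero (n := s • cross b e) (smul_ne_zero hs0 hne) ?_ ?_
    · intro y hy
      obtain ⟨α, β, γ, hα, hβ, hγ, rfl⟩ := mem_cone_three.1 hy
      rw [inner_smul_left, inner_cross_eq_triple]
      have : triple b e (α • a + β • b + γ • e) = α * triple a b e := by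
        simp only [triple_eq, PiLp.add_apply, PiLp.smul_apply, smul_eq_mul]; ring
      rw [this]
      have := mul_nonneg hα ht
      simp only [RCLike.conj_to_real]
      linarith
    · intro y hy
      obtain ⟨α, β, γ, hα, hβ, hγ, rfl⟩ := mem_cone_three.1 hy
      rw [inner_smul_left, inner_cross_eq_triple]
      have : triple b e (α • b + β • c + γ • e) = -(β * triple b c e) := by
        simp only [triple_eq, PiLp.add_apply, PiLp.smul_apply, smul_eq_mul]; ring
      rw [this]
      have := mul_nonneg hβ ht'
      simp only [RCLike.conj_to_real]
      linarith

lemma area_union_of_inter {s t : Set E3} (ht : MeasurableSet t) (h : area (s ∩ t) = 0) :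
    area (s ∪ t) = area s + area t := by
  have h1 := measure_union_add_inter (μ := (Measure.euclideanHausdorffMeasure 2 : Measure E3)) s ht
  have h2 : (Measure.euclideanHausdorffMeasure 2 : Measure E3) (s ∩ t) = 0 := h
  rw [h2, add_zero] at h1
  exact h1

/-- Two adjacent spherical triangles with a common apex. -/
lemma area_sphTri_union {a b c e : E3} (h : GoodTriple a b e) (h' : GoodTriple b c e) {s : ℝ}
    (ht : 0 ≤ s * triple a b e) (ht' : 0 ≤ s * triple b c e) (hs : s = 1 ∨ s = -1) :
    area (sphTri a b e ∪ sphTri b c e) =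
      ENNReal.ofReal (s * solidAngle a b e + s * solidAngle b c e) := by
  obtain ⟨p1, e1⟩ := area_sphTri_of_sign h hs ht
  obtain ⟨p2, e2⟩ := area_sphTri_of_sign h' hs ht'
  rw [area_union_of_inter (measurableSet_sphTri h') (area_sphTri_inter h h' ht ht' hs), e1, e2,
    ENNReal.ofReal_add p1 p2]

/-! ### Apices -/

/-- `e` is a unit vector of the cone spanned by `W` (or orthogonal to it, if it is a subspace)
forming no obtuse angle with the vectors of `W`, such that `W` and `e` span the surface `S`. -/
structure IsApex (W S : Set E3) (e : E3) : Prop where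
  norm_eq : ‖e‖ = 1
  inner_nonneg : ∀ y ∈ W, 0 ≤ inner ℝ e y
  surface : S = radial (cone (insert e W))
  cases : e ∈ cone W ∨ ((∀ y ∈ W, inner ℝ e y = 0) ∧ ∀ y ∈ W, -y ∈ cone W)

/-- Expansion of `e` in the basis dual to `a`, `b`, `c`, paired with `e`. For `e` orthogonal to all
three it forces the triple product to vanish. -/
lemma triple_mul_inner (a b c e : E3) : triple a b c * inner ℝ e e =
    inner ℝ e a * triple b c e + inner ℝ e b * triple c a e + inner ℝ e c * triple a b e := by
  simp only [triple_eq, inner_E3]; ring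

lemma exists_sign (x : ℝ) : ∃ s : ℝ, (s = 1 ∨ s = -1) ∧ 0 ≤ s * x := by
  rcases le_total 0 x with h | h
  · exact ⟨1, Or.inl rfl, by linarith⟩
  · exact ⟨-1, Or.inr rfl, by linarith⟩

/-- The nonnegative relation between the vectors and `e` serves twice. It lets any point of the cone
be rewritten with one vector omitted, and paired with two vectors it shows that the three brackets
with `e` are nonnegative multiples of a single number, hence of one sign. -/
lemma IsApex.relation_three {a b c e : E3} {S : Set E3} (h : IsApex {a, b, c} S e) :
    (∃ α β γ κ : ℝ, 0 ≤ α ∧ 0 ≤ β ∧ 0 ≤ γ ∧ 0 ≤ κ ∧ 0 < α + β + γ ∧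
      α • a + β • b + γ • c = κ • e) ∧
    ∃ s : ℝ, (s = 1 ∨ s = -1) ∧ 0 ≤ s * triple a b e ∧ 0 ≤ s * triple b c e ∧
      0 ≤ s * triple c a e ∧ 0 ≤ s * triple a b c := by
  have he : inner ℝ e e = (1 : ℝ) := by rw [real_inner_self_eq_norm_sq, h.norm_eq]; norm_num
  rcases h.cases with h1 | ⟨h1, h2⟩
  · obtain ⟨α, β, γ, hα, hβ, hγ, e1⟩ := mem_cone_three.1 h1
    refine ⟨⟨α, β, γ, 1, hα, hβ, hγ, zero_le_one, ?_, by rw [← e1, one_smul]⟩, ?_⟩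
    · refine lt_of_le_of_ne (by positivity) fun hs => ?_
      have x1 : α = 0 := by linarith
      have x2 : β = 0 := by linarith
      have x3 : γ = 0 := by linarith
      have := h.norm_eq
      rw [e1, x1, x2, x3] at this
      simp at this
    · obtain ⟨s, hs, hD⟩ := exists_sign (triple a b c)
      have t1 : triple a b e = γ * triple a b c := by
        rw [e1]; simp only [triple_eq, PiLp.add_apply, PiLp.smul_apply, smul_eq_mul]; ring
      have t2 : triple b c e = α * triple a b c := by
        rw [e1]; simp only [triple_eq, PiLp.add_apply, PiLp.smul_apply, smul_eq_mul]; ring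
      have t3 : triple c a e = β * triple a b c := by
        rw [e1]; simp only [triple_eq, PiLp.add_apply, PiLp.smul_apply, smul_eq_mul]; ring
      refine ⟨s, hs, ?_, ?_, ?_, hD⟩
      · rw [t1, mul_left_comm]; positivity
      · rw [t2, mul_left_comm]; positivity
      · rw [t3, mul_left_comm]; positivity
  -- In the subspace case `-a` lies in the cone, which gives a relation with `κ = 0` whose first
  -- coefficient is at least one and may be divided out.
  · obtain ⟨α, β, γ, hα, hβ, hγ, e1⟩ := mem_cone_three.1 (h2 a (by simp))
    have hrel : (1 + α) • a + β • b + γ • c = 0 := by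
      have : (1 + α) • a + β • b + γ • c = a + (α • a + β • b + γ • c) := by module
      rw [this, ← e1, add_neg_cancel]
    have hD : triple a b c = 0 := by
      have := triple_mul_inner a b c e
      rwa [he, h1 a (by simp), h1 b (by simp), h1 c (by simp), mul_one, zero_mul, zero_mul,
        zero_mul, add_zero, add_zero] at this
    refine ⟨⟨1 + α, β, γ, 0, by positivity, hβ, hγ, le_rfl, by positivity,
      by rw [hrel, zero_smul]⟩, ?_⟩
    have r1 : (1 + α) * triple a b e = γ * triple b c e := by
      have x1 : triple b ((1 + α) • a + β • b + γ • c) e =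
          γ * triple b c e - (1 + α) * triple a b e := by
        simp only [triple_eq, PiLp.add_apply, PiLp.smul_apply, smul_eq_mul]; ring
      rw [hrel] at x1
      simp [triple_eq] at x1 ⊢
      linarith
    have r2 : (1 + α) * triple c a e = β * triple b c e := by
      have x1 : triple c ((1 + α) • a + β • b + γ • c) e =
          (1 + α) * triple c a e - β * triple b c e := by
        simp only [triple_eq, PiLp.add_apply, PiLp.smul_apply, smul_eq_mul]; ring
      rw [hrel] at x1
      simp [triple_eq] at x1 ⊢
      linarith
    obtain ⟨s, hs, h3⟩ := exists_sign (triple b c e)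
    refine ⟨s, hs, ?_, h3, ?_, by rw [hD, mul_zero]⟩
    · refine nonneg_of_mul_nonneg_right (a := 1 + α) ?_ (by positivity)
      rw [mul_left_comm, r1, mul_left_comm]; positivity
    · refine nonneg_of_mul_nonneg_right (a := 1 + α) ?_ (by positivity)
      rw [mul_left_comm, r2, mul_left_comm]; positivity

lemma goodTriple_of_apex {W S : Set E3} {a b e : E3} (h : IsApex W S e) (ha : ‖a‖ = 1)
    (hb : ‖b‖ = 1) (hab : a ≠ -b) (haW : a ∈ W) (hbW : b ∈ W) : GoodTriple a b e where
  left := ha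
  mid := hb
  right := h.norm_eq
  ne_neg := hab
  inner_left := h.inner_nonneg a haW
  inner_mid := h.inner_nonneg b hbW

lemma sphTri_subset_of_apex {W S : Set E3} {a b e : E3} (h : IsApex W S e) (haW : a ∈ W)
    (hbW : b ∈ W) : sphTri a b e ⊆ S := by
  rw [h.surface]
  refine radial_mono (cone_mono ?_)
  rintro x (rfl | rfl | rfl)
  · exact mem_insert_of_mem _ haW
  · exact mem_insert_of_mem _ hbW
  · exact mem_insert _ _

/-- The surface of a single triangle. -/
lemma IsApex.area_three {a b c e : E3} {S : Set E3} (h : IsApex {a, b, c} S e) (ha : ‖a‖ = 1)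
    (hb : ‖b‖ = 1) (hc : ‖c‖ = 1) (hab : a ≠ -b) (hbc : b ≠ -c) (hca : c ≠ -a) :
    ∃ s : ℝ, (s = 1 ∨ s = -1) ∧ (∀ w ∈ insert e ({a, b, c} : Set E3),
      0 ≤ s * triple a b w ∧ 0 ≤ s * triple b c w ∧ 0 ≤ s * triple c a w) ∧
      (area S).toReal = s * (solidAngle a b e + solidAngle b c e + solidAngle c a e) := by
  obtain ⟨⟨α, β, γ, κ, hα, hβ, hγ, hκ, hsum, hrel⟩, s, hs, t1, t2, t3, tD⟩ := h.relation_three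
  have g1 := goodTriple_of_apex h ha hb hab (by simp) (by simp)
  have g2 := goodTriple_of_apex h hb hc hbc (by simp) (by simp)
  have g3 := goodTriple_of_apex h hc ha hca (by simp) (by simp)
  refine ⟨s, hs, ?_, ?_⟩
  · rintro w (rfl | rfl | rfl | rfl)
    · exact ⟨t1, t2, t3⟩
    · rw [triple_self_outer, triple_self_right, triple_rotate]; simp [tD]
    · rw [triple_self_outer, triple_self_right, ← triple_rotate, ← triple_rotate] at *
      rw [triple_rotate] at tD
      simp [tD]
    · rw [triple_self_outer, triple_self_right]; simp [tD]
  · have hS : S = (sphTri a b e ∪ sphTri b c e) ∪ sphTri c a e := by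
      apply Subset.antisymm
      · rw [h.surface]
        rintro _ ⟨y, hy, h0, rfl⟩
        obtain ⟨t, ht, z, hz, e1⟩ := mem_cone_insert.1 hy
        obtain ⟨α', β', γ', hα', hβ', hγ', rfl⟩ := mem_cone_three.1 hz
        -- Subtracting a multiple of the relation until one coefficient vanishes puts the point into
        -- the cone over one edge and `e`.
        obtain ⟨r, hr, hnn, i, hi⟩ := exists_min_ratio (c := ![α, β, γ]) (c' := ![α', β', γ'])
          (by intro i; fin_cases i <;> simpa) (by intro i; fin_cases i <;> simpa) (by
            by_contra hn
            push Not at hn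
            have := hn 0; have := hn 1; have := hn 2
            simp at *
            linarith)
        have n0 := hnn 0
        have n1 := hnn 1
        have n2 := hnn 2
        simp only [Matrix.cons_val] at n0 n1 n2
        have e2 : y = (α' - r * α) • a + (β' - r * β) • b + (γ' - r * γ) • c +
            (t + r * κ) • e := by
          have : (t + r * κ) • e = t • e + r • (κ • e) := by module
          rw [e1, this, ← hrel]
          module
        have hk : 0 ≤ t + r * κ := by positivity
        fin_cases i <;> simp only [Fin.zero_eta, Fin.mk_one, Fin.reduceFinMk, Matrix.cons_val] at hi
        · refine Or.inl (Or.inr ⟨y, mem_cone_three.2 ⟨_, _, _, n1, n2, hk, ?_⟩, h0, rfl⟩)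
          rw [e2, hi]; module
        · refine Or.inr ⟨y, mem_cone_three.2 ⟨_, _, _, n2, n0, hk, ?_⟩, h0, rfl⟩
          rw [e2, hi]; module
        · refine Or.inl (Or.inl ⟨y, mem_cone_three.2 ⟨_, _, _, n0, n1, hk, ?_⟩, h0, rfl⟩)
          rw [e2, hi]; module
      · refine union_subset (union_subset ?_ ?_) ?_ <;>
          exact sphTri_subset_of_apex h (by simp) (by simp)
    have hnull : area ((sphTri a b e ∪ sphTri b c e) ∩ sphTri c a e) = 0 := by
      rw [union_inter_distrib_right]
      refine measure_union_null ?_ ?_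
      · have := area_sphTri_inter g3 g1 t3 t1 hs
        rwa [inter_comm] at this
      · exact area_sphTri_inter g2 g3 t2 t3 hs
    obtain ⟨p1, -⟩ := area_sphTri_of_sign g1 hs t1
    obtain ⟨p2, -⟩ := area_sphTri_of_sign g2 hs t2
    obtain ⟨p3, e3⟩ := area_sphTri_of_sign g3 hs t3
    rw [hS, area_union_of_inter (measurableSet_sphTri g3) hnull, area_sphTri_union g1 g2 t1 t2 hs,
      e3, ← ENNReal.ofReal_add (by positivity) p3, ENNReal.toReal_ofReal (by positivity)]
    ring

/-! ### Surfaces of regions with several triangles -/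

/-- Since both `p` and `-p` are generators, the coefficient along the axis is free. -/
lemma mem_cone_axis {p q₁ q₂ y : E3} : y ∈ cone {p, -p, q₁, q₂} ↔
    ∃ l β γ : ℝ, 0 ≤ β ∧ 0 ≤ γ ∧ y = l • p + β • q₁ + γ • q₂ := by
  rw [mem_cone_insert]
  constructor
  · rintro ⟨t, ht, z, hz, rfl⟩
    obtain ⟨α, β, γ, hα, hβ, hγ, rfl⟩ := mem_cone_three.1 hz
    exact ⟨t - α, β, γ, hβ, hγ, by module⟩
  · rintro ⟨l, β, γ, hβ, hγ, rfl⟩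
    refine ⟨max l 0, le_max_right _ _, _,
      mem_cone_three.2 ⟨max l 0 - l, β, γ, sub_nonneg.2 (le_max_left _ _), hβ, hγ, rfl⟩, ?_⟩
    module

lemma IsApex.inner_axis {p e : E3} {W S : Set E3} (h : IsApex W S e) (h1 : p ∈ W)
    (h2 : -p ∈ W) : inner ℝ e p = 0 := by
  have i1 := h.inner_nonneg p h1
  have i2 := h.inner_nonneg _ h2
  rw [inner_neg_right] at i2
  linarith

/-- The analogue of `IsApex.relation_three` modulo the axis: only the coefficients of `q₁` and `q₂`
are sign constrained, and `e` is orthogonal to `p`. -/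
lemma IsApex.relation_four {p q₁ q₂ e : E3} {S : Set E3} (h : IsApex {p, -p, q₁, q₂} S e) :
    (∃ l β γ κ : ℝ, 0 ≤ β ∧ 0 ≤ γ ∧ 0 ≤ κ ∧ 0 < β + γ ∧ l • p + β • q₁ + γ • q₂ = κ • e) ∧
    ∃ s : ℝ, (s = 1 ∨ s = -1) ∧ 0 ≤ s * triple p q₂ e ∧ 0 ≤ s * triple q₁ p e ∧
      0 ≤ s * triple p q₂ q₁ := by
  have he : inner ℝ e e = (1 : ℝ) := by rw [real_inner_self_eq_norm_sq, h.norm_eq]; norm_num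
  have hp := h.inner_axis (p := p) (by simp) (by simp)
  rcases h.cases with h1 | ⟨h1, h2⟩
  · obtain ⟨l, β, γ, hβ, hγ, e1⟩ := mem_cone_axis.1 h1
    refine ⟨⟨l, β, γ, 1, hβ, hγ, zero_le_one, ?_, by rw [← e1, one_smul]⟩, ?_⟩
    · refine lt_of_le_of_ne (by positivity) fun hs => ?_
      have x1 : β = 0 := by linarith
      have x2 : γ = 0 := by linarith
      rw [x1, x2, zero_smul, zero_smul, add_zero, add_zero] at e1
      nth_rewrite 2 [e1] at he
      rw [inner_smul_right, hp] at he
      norm_num at he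
    · obtain ⟨s, hs, hD⟩ := exists_sign (triple p q₂ q₁)
      have t1 : triple p q₂ e = β * triple p q₂ q₁ := by
        rw [e1]; simp only [triple_eq, PiLp.add_apply, PiLp.smul_apply, smul_eq_mul]; ring
      have t2 : triple q₁ p e = γ * triple p q₂ q₁ := by
        rw [e1]; simp only [triple_eq, PiLp.add_apply, PiLp.smul_apply, smul_eq_mul]; ring
      refine ⟨s, hs, ?_, ?_, hD⟩
      · rw [t1, mul_left_comm]; positivity
      · rw [t2, mul_left_comm]; positivity
  · obtain ⟨l, β, γ, hβ, hγ, e1⟩ := mem_cone_axis.1 (h2 q₁ (by simp))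
    have hrel : l • p + (1 + β) • q₁ + γ • q₂ = 0 := by
      have : l • p + (1 + β) • q₁ + γ • q₂ = q₁ + (l • p + β • q₁ + γ • q₂) := by module
      rw [this, ← e1, add_neg_cancel]
    have hD : triple p q₂ q₁ = 0 := by
      have := triple_mul_inner p q₂ q₁ e
      rwa [he, h1 p (by simp), h1 q₁ (by simp), h1 q₂ (by simp), mul_one, zero_mul, zero_mul,
        zero_mul, add_zero, add_zero] at this
    refine ⟨⟨l, 1 + β, γ, 0, by positivity, hγ, le_rfl, by positivity,
      by rw [hrel, zero_smul]⟩, ?_⟩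
    have r1 : (1 + β) * triple q₁ p e = γ * triple p q₂ e := by
      have x1 : triple p (l • p + (1 + β) • q₁ + γ • q₂) e =
          γ * triple p q₂ e - (1 + β) * triple q₁ p e := by
        simp only [triple_eq, PiLp.add_apply, PiLp.smul_apply, smul_eq_mul]; ring
      rw [hrel] at x1
      simp [triple_eq] at x1 ⊢
      linarith
    obtain ⟨s, hs, h3⟩ := exists_sign (triple p q₂ e)
    refine ⟨s, hs, h3, ?_, by rw [hD, mul_zero]⟩
    refine nonneg_of_mul_nonneg_right (a := 1 + β) ?_ (by positivity)
    rw [mul_left_comm, r1, mul_left_comm]; positivity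

/-- The surface of a region with two ends. -/
lemma IsApex.area_four {p q₁ q₂ e : E3} {S : Set E3} (h : IsApex {p, -p, q₁, q₂} S e)
    (hp : ‖p‖ = 1) (hq₁ : ‖q₁‖ = 1) (hq₂ : ‖q₂‖ = 1) (n1 : q₁ ≠ p) (n1' : q₁ ≠ -p) (n2 : q₂ ≠ p)
    (n2' : q₂ ≠ -p) :
    ∃ s : ℝ, (s = 1 ∨ s = -1) ∧ (∀ w ∈ insert e ({p, -p, q₁, q₂} : Set E3),
      0 ≤ s * triple p q₂ w ∧ 0 ≤ s * triple q₁ p w) ∧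
      (area S).toReal = s * ((solidAngle p q₂ e + solidAngle q₂ (-p) e) +
        (solidAngle (-p) q₁ e + solidAngle q₁ p e)) := by
  obtain ⟨⟨l, β, γ, κ, hβ, hγ, hκ, hsum, hrel⟩, s, hs, t1, t2, tD⟩ := h.relation_four
  have hpe := h.inner_axis (p := p) (by simp) (by simp)
  have hp' : ‖-p‖ = 1 := by rwa [norm_neg]
  have g1 := goodTriple_of_apex h hp hq₂ (fun h => n2' (by rw [h, neg_neg])) (by simp) (by simp)
  have g2 := goodTriple_of_apex h hq₂ hp' (by rwa [neg_neg]) (by simp) (by simp)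
  have g3 := goodTriple_of_apex h hp' hq₁ (fun h => n1 (neg_injective h.symm)) (by simp) (by simp)
  have g4 := goodTriple_of_apex h hq₁ hp n1' (by simp) (by simp)
  have t1' : 0 ≤ s * triple q₂ (-p) e := by rwa [triple_neg_mid, triple_swap, neg_neg]
  have t2' : 0 ≤ s * triple (-p) q₁ e := by rwa [triple_neg_left, triple_swap, neg_neg]
  refine ⟨s, hs, ?_, ?_⟩
  · rintro w (rfl | rfl | rfl | rfl | rfl)
    · exact ⟨t1, t2⟩
    · rw [triple_self_outer, triple_self_right]; simp
    · rw [triple_neg_right, triple_neg_right, triple_self_outer, triple_self_right]; simp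
    · rw [triple_self_outer]; simp [tD]
    · rw [triple_self_right, ← triple_rotate q₁ p w]; simpa using tD
  · have hS : S = (sphTri p q₂ e ∪ sphTri q₂ (-p) e) ∪ (sphTri (-p) q₁ e ∪ sphTri q₁ p e) := by
      apply Subset.antisymm
      · rw [h.surface]
        rintro _ ⟨y, hy, h0, rfl⟩
        obtain ⟨t, ht, z, hz, e1⟩ := mem_cone_insert.1 hy
        obtain ⟨l', β', γ', hβ', hγ', rfl⟩ := mem_cone_axis.1 hz
        obtain ⟨r, hr, hnn, i, hi⟩ := exists_min_ratio (c := ![β, γ]) (c' := ![β', γ'])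
          (by intro i; fin_cases i <;> simpa) (by intro i; fin_cases i <;> simpa) (by
            by_contra hn
            push Not at hn
            have := hn 0; have := hn 1
            simp at *
            linarith)
        have n0 := hnn 0
        have n1 := hnn 1
        simp only [Matrix.cons_val] at n0 n1
        have e2 : y = (l' - r * l) • p + (β' - r * β) • q₁ + (γ' - r * γ) • q₂ +
            (t + r * κ) • e := by
          have : (t + r * κ) • e = t • e + r • (κ • e) := by module
          rw [e1, this, ← hrel]
          module
        have hk : 0 ≤ t + r * κ := by positivity
        -- The coefficient along the axis may have either sign, which decides whether `p` or `-p` is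
        -- used as a vertex.
        generalize l' - r * l = m at *
        fin_cases i <;> simp only [Fin.zero_eta, Fin.mk_one, Matrix.cons_val] at hi
        · left
          rcases le_total 0 m with hm | hm
          · refine Or.inl ⟨y, mem_cone_three.2 ⟨_, _, _, hm, n1, hk, ?_⟩, h0, rfl⟩
            rw [e2, hi]; module
          · refine Or.inr ⟨y, mem_cone_three.2 ⟨_, _, _, n1, neg_nonneg.2 hm, hk, ?_⟩, h0, rfl⟩
            rw [e2, hi]; module
        · right
          rcases le_total 0 m with hm | hm
          · refine Or.inr ⟨y, mem_cone_three.2 ⟨_, _, _, n0, hm, hk, ?_⟩, h0, rfl⟩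
            rw [e2, hi]; module
          · refine Or.inl ⟨y, mem_cone_three.2 ⟨_, _, _, neg_nonneg.2 hm, n0, hk, ?_⟩, h0, rfl⟩
            rw [e2, hi]; module
      · refine union_subset (union_subset ?_ ?_) (union_subset ?_ ?_) <;>
          exact sphTri_subset_of_apex h (by simp) (by simp)
    have hne : cross e p ≠ 0 := by
      refine cross_ne_zero_of_ne h.norm_eq hp ?_ ?_
      · rintro rfl
        rw [real_inner_self_eq_norm_sq, hp] at hpe
        norm_num at hpe
      · rintro rfl
        rw [inner_neg_left, real_inner_self_eq_norm_sq, hp] at hpe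
        norm_num at hpe
    have hs0 : s ≠ 0 := by rcases hs with rfl | rfl <;> norm_num
    -- The plane through `e` and the axis separates the two triangles over `q₂` from the two over
    -- `q₁`.
    have hK : ∀ y, (y ∈ cone {p, q₂, e} ∪ cone {q₂, -p, e} → 0 ≤ inner ℝ (s • cross e p) y) ∧
        (y ∈ cone {-p, q₁, e} ∪ cone {q₁, p, e} → inner ℝ (s • cross e p) y ≤ 0) := by
      intro y
      rw [inner_smul_left, inner_cross_eq_triple]
      simp only [RCLike.conj_to_real]
      refine ⟨?_, ?_⟩
      · rintro (hy | hy)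
        · obtain ⟨a, b, c, ha, hb, hc, rfl⟩ := mem_cone_three.1 hy
          have : triple e p (a • p + b • q₂ + c • e) = b * triple p q₂ e := by
            simp only [triple_eq, PiLp.add_apply, PiLp.smul_apply, smul_eq_mul]; ring
          rw [this, mul_left_comm]; positivity
        · obtain ⟨a, b, c, ha, hb, hc, rfl⟩ := mem_cone_three.1 hy
          have : triple e p (a • q₂ + b • -p + c • e) = a * triple p q₂ e := by
            simp only [triple_eq, PiLp.add_apply, PiLp.smul_apply, PiLp.neg_apply, smul_eq_mul]
            ring
          rw [this, mul_left_comm]; positivity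
      · rintro (hy | hy)
        · obtain ⟨a, b, c, ha, hb, hc, rfl⟩ := mem_cone_three.1 hy
          have : triple e p (a • -p + b • q₁ + c • e) = -(b * triple q₁ p e) := by
            simp only [triple_eq, PiLp.add_apply, PiLp.smul_apply, PiLp.neg_apply, smul_eq_mul]
            ring
          rw [this, mul_neg, mul_left_comm, neg_nonpos]; positivity
        · obtain ⟨a, b, c, ha, hb, hc, rfl⟩ := mem_cone_three.1 hy
          have : triple e p (a • q₁ + b • p + c • e) = -(a * triple q₁ p e) := by
            simp only [triple_eq, PiLp.add_apply, PiLp.smul_apply, PiLp.neg_apply, smul_eq_mul]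
            ring
          rw [this, mul_neg, mul_left_comm, neg_nonpos]; positivity
    have hnull : area ((sphTri p q₂ e ∪ sphTri q₂ (-p) e) ∩ (sphTri (-p) q₁ e ∪ sphTri q₁ p e))
        = 0 := by
      refine measure_mono_null ?_ (area_radial_inter_eq_zero (smul_ne_zero hs0 hne)
        (fun y hy => (hK y).1 hy) (fun y hy => (hK y).2 hy))
      refine inter_subset_inter ?_ ?_ <;>
        exact union_subset (radial_mono subset_union_left) (radial_mono subset_union_right)
    obtain ⟨p1, -⟩ := area_sphTri_of_sign g1 hs t1
    obtain ⟨p2, -⟩ := area_sphTri_of_sign g2 hs t1'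
    obtain ⟨p3, -⟩ := area_sphTri_of_sign g3 hs t2'
    obtain ⟨p4, -⟩ := area_sphTri_of_sign g4 hs t2
    rw [hS, area_union_of_inter ((measurableSet_sphTri g3).union (measurableSet_sphTri g4)) hnull,
      area_sphTri_union g1 g2 t1 t1' hs, area_sphTri_union g3 g4 t2' t2 hs,
      ← ENNReal.ofReal_add (by positivity) (by positivity), ENNReal.toReal_ofReal (by positivity)]
    ring

/-- The surface of a region all of whose spins lie on an axis has no area. -/
lemma IsApex.area_axis {p e : E3} {W S : Set E3} (h : IsApex W S e) (hp : ‖p‖ = 1)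
    (hW : ∀ w ∈ W, w = p ∨ w = -p) (hp1 : p ∈ W) (hp2 : -p ∈ W) : area S = 0 := by
  have hpe := h.inner_axis hp1 hp2
  have hne : cross e p ≠ 0 := by
    refine cross_ne_zero_of_ne h.norm_eq hp ?_ ?_
    · rintro rfl
      rw [real_inner_self_eq_norm_sq, hp] at hpe
      norm_num at hpe
    · rintro rfl
      rw [inner_neg_left, real_inner_self_eq_norm_sq, hp] at hpe
      norm_num at hpe
  have h1 : ∀ w ∈ insert e W, inner ℝ (cross e p) w = 0 := by
    rintro w (rfl | hw)
    · exact inner_cross_left _ _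
    · rcases hW w hw with rfl | rfl
      · exact inner_cross_right _ _
      · rw [inner_neg_right, inner_cross_right, neg_zero]
  rw [h.surface]
  refine area_radial_eq_zero hne fun y hy => ?_
  refine cone_induction (P := fun y => inner ℝ (cross e p) y = 0) h1 (by simp)
    (fun x y hx hy => by rw [inner_add_right, hx, hy, add_zero])
    (fun t ht x hx => by rw [inner_smul_right, hx, mul_zero]) hy

/-! ### Existence of apices -/

/-- The alternative in the definition of admissible surfaces. -/
lemma exists_isApex {W S : Set E3}
    (hS : ((¬ ∃ L : Submodule ℝ E3, (L : Set E3) = cone W) ∧ S = radial (cone W)) ∨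
      ((∃ L : Submodule ℝ E3, (L : Set E3) = cone W) ∧
        ∃ h : E3, ‖h‖ = 1 ∧ (∀ y ∈ cone W, inner ℝ h y = 0) ∧ S = radial (cone (insert h W))))
    (hW : (∃ y ∈ W, -y ∉ cone W) → ∃ e ∈ cone W, e ≠ 0 ∧ ∀ y ∈ W, 0 ≤ inner ℝ e y) :
    ∃ e, IsApex W S e := by
  rcases hS with ⟨h1, rfl⟩ | ⟨h1, h, h2, h3, rfl⟩
  · rw [isSubspace_iff] at h1
    push Not at h1
    obtain ⟨e, he, h0, hin⟩ := hW h1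
    have hn : 0 < ‖e‖⁻¹ := inv_pos.2 (norm_pos_iff.2 h0)
    have hm : ‖e‖⁻¹ • e ∈ cone W := smul_mem_cone hn.le he
    refine ⟨‖e‖⁻¹ • e, ?_, fun y hy => ?_, by rw [cone_insert_of_mem hm], Or.inl hm⟩
    · rw [norm_smul, norm_inv, norm_norm, inv_mul_cancel₀ (norm_ne_zero_iff.2 h0)]
    · rw [inner_smul_left]
      exact mul_nonneg hn.le (hin y hy)
  · rw [isSubspace_iff] at h1
    refine ⟨h, h2, fun y hy => (h3 y (subset_cone W hy)).ge, rfl, Or.inr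
      ⟨fun y hy => h3 y (subset_cone W hy), h1⟩⟩

/-- Take the point of the convex hull closest to the origin; its product with every vertex is at
least its squared norm. If it were zero, the origin would be a convex combination of the vertices,
and the cone would be a subspace. -/
lemma exists_apex_three {a b c : E3} (ha : ‖a‖ = 1) (hb : ‖b‖ = 1) (hc : ‖c‖ = 1) (hab : a ≠ -b)
    (hbc : b ≠ -c) (hca : c ≠ -a) (h : ∃ y ∈ ({a, b, c} : Set E3), -y ∉ cone {a, b, c}) :
    ∃ e ∈ cone {a, b, c}, e ≠ 0 ∧ ∀ y ∈ ({a, b, c} : Set E3), 0 ≤ inner ℝ e y := by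
  have hcomp : IsComplete (convexHull ℝ ({a, b, c} : Set E3)) :=
    ((Set.toFinite ({a, b, c} : Set E3)).isCompact_convexHull ℝ).isComplete
  obtain ⟨e, he, hmin⟩ := exists_norm_eq_iInf_of_complete_convex
    (convexHull_nonempty_iff.2 ⟨a, by simp⟩) hcomp (convex_convexHull ℝ _) 0
  have hin := (norm_eq_iInf_iff_real_inner_le_zero (convex_convexHull ℝ _) he).1 hmin
  have hcone : e ∈ cone {a, b, c} := by
    refine convexHull_min (subset_cone _) ?_ he
    intro x hx y hy s t hs ht _
    exact add_mem_cone (smul_mem_cone hs hx) (smul_mem_cone ht hy)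
  have key : ∀ y ∈ ({a, b, c} : Set E3), ‖e‖ ^ 2 ≤ inner ℝ e y := by
    intro y hy
    have := hin y (subset_convexHull ℝ _ hy)
    rw [zero_sub, inner_neg_left, inner_sub_right, real_inner_self_eq_norm_sq] at this
    linarith
  refine ⟨e, hcone, ?_, fun y hy => (sq_nonneg _).trans (key y hy)⟩
  rintro rfl
  obtain ⟨y, hy, hny⟩ := h
  refine hny ?_
  obtain ⟨α, β, γ, hα, hβ, hγ, hsum, h0⟩ : ∃ α β γ : ℝ, 0 ≤ α ∧ 0 ≤ β ∧ 0 ≤ γ ∧ α + β + γ = 1 ∧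
      α • a + β • b + γ • c = 0 := by
    rw [convexHull_insert (by simp), convexHull_pair, mem_convexJoin] at he
    obtain ⟨x, rfl, z, ⟨s, t, hs, ht, hst, rfl⟩, r, q, hr, hq, hrq, he⟩ := he
    refine ⟨r, q * s, q * t, hr, by positivity, by positivity, ?_, ?_⟩
    · rw [add_assoc, ← mul_add, hst, mul_one, hrq]
    · rw [← he]; module
  have two : ∀ {x y : E3} {s t : ℝ}, ‖x‖ = 1 → ‖y‖ = 1 → 0 ≤ s → 0 ≤ t → s + t = 1 →
      s • x + t • y = 0 → x = -y := by
    intro x y s t hx hy hs ht hst h0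
    have h1 : s • x = -(t • y) := eq_neg_of_add_eq_zero_left h0
    have h2 := congrArg norm h1
    rw [norm_neg, norm_smul, norm_smul, hx, hy, mul_one, mul_one, Real.norm_of_nonneg hs,
      Real.norm_of_nonneg ht] at h2
    rw [← h2, ← smul_neg] at h1
    exact smul_right_injective E3 (show s ≠ 0 by intro h; linarith) h1
  have three : ∀ {x y z : E3} {r s t : ℝ}, 0 < r → 0 ≤ s → 0 ≤ t → r • x + s • y + t • z = 0 →
      -x = (s / r) • y + (t / r) • z := by
    intro x y z r s t hr hs ht h0
    have : -x = r⁻¹ • (s • y + t • z) := by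
      rw [eq_inv_smul_iff₀ hr.ne', smul_neg, neg_eq_iff_add_eq_zero, ← h0]; abel
    rw [this, smul_add, smul_smul, smul_smul, div_eq_inv_mul, div_eq_inv_mul]
  -- With a zero coefficient the combination would involve only two unit vectors, which would then
  -- be antipodal. As all coefficients are positive, each negative lies in the cone.
  have hα' : 0 < α := by
    refine lt_of_le_of_ne hα fun h => hbc (two hb hc hβ hγ (by linarith) ?_)
    rw [← h0, ← h]; module
  have hβ' : 0 < β := by
    refine lt_of_le_of_ne hβ fun h => hca (two hc ha hγ hα (by linarith) ?_)
    rw [← h0, ← h]; module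
  have hγ' : 0 < γ := by
    refine lt_of_le_of_ne hγ fun h => hab (two ha hb hα hβ (by linarith) ?_)
    rw [← h0, ← h]; module
  have hm : ∀ {x y : E3} {s t : ℝ}, x ∈ ({a, b, c} : Set E3) → y ∈ ({a, b, c} : Set E3) →
      0 ≤ s → 0 ≤ t → s • x + t • y ∈ cone {a, b, c} := fun hx hy hs ht =>
    add_mem_cone (smul_mem_cone hs (subset_cone _ hx)) (smul_mem_cone ht (subset_cone _ hy))
  rcases hy with rfl | rfl | rfl
  · rw [three hα' hβ hγ h0]
    exact hm (by simp) (by simp) (by positivity) (by positivity)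
  · rw [three hβ' hγ hα (x := y) (y := c) (z := a) (by rw [← h0]; abel)]
    exact hm (by simp) (by simp) (by positivity) (by positivity)
  · rw [three hγ' hα hβ (x := y) (y := a) (z := b) (by rw [← h0]; abel)]
    exact hm (by simp) (by simp) (by positivity) (by positivity)

/-- The cone is the sum of the axis and two half-planes, with unit directions `v₁` and `v₂`
orthogonal to `p`. Their bisector `v₁ + v₂` is the apex direction. -/
lemma exists_apex_four {p q₁ q₂ : E3} (hp : ‖p‖ = 1) (hq₁ : ‖q₁‖ = 1) (hq₂ : ‖q₂‖ = 1)
    (n1 : q₁ ≠ p) (n1' : q₁ ≠ -p) (n2 : q₂ ≠ p) (n2' : q₂ ≠ -p)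
    (h : ∃ y ∈ ({p, -p, q₁, q₂} : Set E3), -y ∉ cone {p, -p, q₁, q₂}) :
    ∃ e ∈ cone {p, -p, q₁, q₂}, e ≠ 0 ∧ ∀ y ∈ ({p, -p, q₁, q₂} : Set E3), 0 ≤ inner ℝ e y := by
  have hpp : inner ℝ p p = (1 : ℝ) := by rw [real_inner_self_eq_norm_sq, hp]; norm_num
  have proj : ∀ q : E3, ‖q‖ = 1 → q ≠ p → q ≠ -p → ∃ v : E3, ‖v‖ = 1 ∧ inner ℝ v p = 0 ∧
      ∃ r : ℝ, 0 < r ∧ q = inner ℝ q p • p + r • v := by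
    intro q hq h1 h2
    have h0 : q - inner ℝ q p • p ≠ 0 := by
      intro h0
      rw [sub_eq_zero] at h0
      have h3 := congrArg norm h0
      rw [norm_smul, hp, hq, mul_one, Real.norm_eq_abs] at h3
      rcases eq_or_eq_neg_of_abs_eq h3.symm with h4 | h4
      · rw [h4, one_smul] at h0; exact h1 h0
      · rw [h4, neg_smul, one_smul] at h0; exact h2 h0
    have hn := norm_pos_iff.2 h0
    refine ⟨‖q - inner ℝ q p • p‖⁻¹ • (q - inner ℝ q p • p), ?_, ?_, _, hn, ?_⟩
    · rw [norm_smul, norm_inv, norm_norm, inv_mul_cancel₀ hn.ne']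
    · rw [inner_smul_left, inner_sub_left, inner_smul_left, hpp]
      simp
    · rw [smul_smul, mul_inv_cancel₀ hn.ne', one_smul, add_sub_cancel]
  obtain ⟨v₁, nv1, vp1, r₁, hr1, e1⟩ := proj q₁ hq₁ n1 n1'
  obtain ⟨v₂, nv2, vp2, r₂, hr2, e2⟩ := proj q₂ hq₂ n2 n2'
  generalize inner ℝ q₁ p = c₁ at e1
  generalize inner ℝ q₂ p = c₂ at e2
  have w1 : v₁ = r₁⁻¹ • (q₁ - c₁ • p) := by
    rw [e1, add_sub_cancel_left, smul_smul, inv_mul_cancel₀ hr1.ne', one_smul]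
  have w2 : v₂ = r₂⁻¹ • (q₂ - c₂ • p) := by
    rw [e2, add_sub_cancel_left, smul_smul, inv_mul_cancel₀ hr2.ne', one_smul]
  have i1 := inv_pos.2 hr1
  have i2 := inv_pos.2 hr2
  have hge : -1 ≤ inner ℝ v₁ v₂ := by
    have := neg_one_le_real_inner_of_norm_eq_one nv1 nv2
    exact this
  have x1 : inner ℝ v₁ v₁ = (1 : ℝ) := by rw [real_inner_self_eq_norm_sq, nv1]; norm_num
  have x2 : inner ℝ v₂ v₂ = (1 : ℝ) := by rw [real_inner_self_eq_norm_sq, nv2]; norm_num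
  refine ⟨v₁ + v₂, ?_, ?_, ?_⟩
  · refine mem_cone_axis.2 ⟨-(r₁⁻¹ * c₁) - r₂⁻¹ * c₂, r₁⁻¹, r₂⁻¹, i1.le, i2.le, ?_⟩
    rw [w1, w2]; module
  · intro h0
    -- Opposite half-planes fill a plane, so every generator has its negative in the cone, contrary
    -- to the hypothesis.
    have hv : v₁ = -v₂ := eq_neg_of_add_eq_zero_left h0
    obtain ⟨y, hy, hny⟩ := h
    refine hny ?_
    rcases hy with rfl | rfl | rfl | rfl
    · exact subset_cone _ (by simp)
    · rw [neg_neg]; exact subset_cone _ (by simp)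
    · refine mem_cone_axis.2 ⟨-c₁ - r₁ * r₂⁻¹ * c₂, 0, r₁ * r₂⁻¹, le_rfl, by positivity, ?_⟩
      have : -y = -(c₁ • p) - r₁ • v₁ := by rw [e1]; abel
      rw [this, hv, w2]; module
    · refine mem_cone_axis.2 ⟨-c₂ - r₂ * r₁⁻¹ * c₁, r₂ * r₁⁻¹, 0, by positivity, le_rfl, ?_⟩
      have h3 : -y = -(c₂ • p) - r₂ • v₂ := by rw [e2]; abel
      have h4 : v₂ = -v₁ := by rw [hv, neg_neg]
      rw [h3, h4, w1]; module
  · rintro y (rfl | rfl | rfl | rfl)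
    · rw [inner_add_left, vp1, vp2, add_zero]
    · rw [inner_neg_right, inner_add_left, vp1, vp2, add_zero, neg_zero]
    · rw [e1, inner_add_right, inner_smul_right, inner_smul_right, inner_add_left, inner_add_left,
        vp1, vp2, x1, real_inner_comm v₁ v₂]
      have : 0 ≤ r₁ * (1 + inner ℝ v₁ v₂) := mul_nonneg hr1.le (by linarith)
      linarith
    · rw [e2, inner_add_right, inner_smul_right, inner_smul_right, inner_add_left, inner_add_left,
        vp1, vp2, x2]
      have : 0 ≤ r₂ * (1 + inner ℝ v₁ v₂) := mul_nonneg hr2.le (by linarith)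
      linarith

/-! ### Apex, sign and area of a region -/

lemma norm_sub_sq_of_unit {x y : E3} (hx : ‖x‖ = 1) (hy : ‖y‖ = 1) :
    ‖x - y‖ ^ 2 = 2 - 2 * inner ℝ x y := by
  rw [norm_sub_sq_real, hx, hy]; ring

/-- Unit vectors at no obtuse angle have distance at most `√2`. This handles the case of large
oscillation. -/
lemma norm_sub_le_two_of_inner {x y : E3} (hx : ‖x‖ = 1) (hy : ‖y‖ = 1)
    (h : 0 ≤ inner ℝ x y) {δ : ℝ} (hδ : 1 ≤ δ) : ‖x - y‖ ≤ 2 * δ := by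
  refine le_of_sq_le_sq ?_ (by positivity)
  rw [norm_sub_sq_of_unit hx hy]
  nlinarith

/-- The apex of a triangle with almost constant spins is close to the spins. -/
lemma IsApex.norm_sub_le_three {a b c e : E3} {S : Set E3} (h : IsApex {a, b, c} S e)
    (hn : ∀ x ∈ ({a, b, c} : Set E3), ‖x‖ = 1) {δ : ℝ}
    (hd : ∀ x ∈ ({a, b, c} : Set E3), ∀ y ∈ ({a, b, c} : Set E3), ‖x - y‖ ≤ δ) (hδ : δ < 1)
    {x : E3} (hx : x ∈ ({a, b, c} : Set E3)) : ‖e - x‖ ≤ δ := by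
  have hδ0 : 0 ≤ δ := (norm_nonneg _).trans (hd x hx x hx)
  have hin : ∀ x ∈ ({a, b, c} : Set E3), ∀ y ∈ ({a, b, c} : Set E3),
      1 - δ ^ 2 / 2 ≤ inner ℝ x y := by
    intro x hx y hy
    have h1 := norm_sub_sq_of_unit (hn x hx) (hn y hy)
    have h2 : ‖x - y‖ ^ 2 ≤ δ ^ 2 := by
      have := hd x hx y hy
      gcongr
    linarith
  have hc : 0 < 1 - δ ^ 2 / 2 := by nlinarith
  rcases h.cases with h1 | ⟨-, h1⟩
  · obtain ⟨α, β, γ, hα, hβ, hγ, e1⟩ := mem_cone_three.1 h1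
    -- The triangle inequality applied to a combination of unit vectors with norm one.
    have hs : 1 ≤ α + β + γ := by
      have h2 := h.norm_eq
      rw [e1] at h2
      rw [← h2]
      refine norm_add₃_le.trans (le_of_eq ?_)
      rw [norm_smul, norm_smul, norm_smul, hn a (by simp), hn b (by simp), hn c (by simp),
        Real.norm_of_nonneg hα, Real.norm_of_nonneg hβ, Real.norm_of_nonneg hγ]
      ring
    have h3 : 1 - δ ^ 2 / 2 ≤ inner ℝ e x := by
      rw [e1, inner_add_left, inner_add_left, inner_smul_left, inner_smul_left, inner_smul_left]
      simp only [RCLike.conj_to_real]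
      have i1 := mul_le_mul_of_nonneg_left (hin a (by simp) x hx) hα
      have i2 := mul_le_mul_of_nonneg_left (hin b (by simp) x hx) hβ
      have i3 := mul_le_mul_of_nonneg_left (hin c (by simp) x hx) hγ
      nlinarith
    refine le_of_sq_le_sq ?_ hδ0
    rw [norm_sub_sq_of_unit h.norm_eq (hn x hx)]
    linarith
  · exfalso
    -- Spins this close have positive mutual products, so the negative of a spin cannot lie in their
    -- cone.
    have h2 := inner_nonneg_of_mem_cone (n := a) (fun w hw => hc.le.trans (hin a (by simp) w hw))
      (h1 a (by simp))
    rw [inner_neg_right, real_inner_self_eq_norm_sq, hn a (by simp)] at h2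
    norm_num at h2

section

variable {ε : ℝ} {u : SpinField ε}

lemma OnAxis.sv_eq {p : E3} {τ : Tri} (h : OnAxis u p τ) {k : Fin 3} (hk : ¬ Anti u τ k) :
    sv u (vert τ k) = sv u (vert τ (k + 1)) := by
  rw [Anti] at hk
  rcases h k with h1 | h1 <;> rcases h (k + 1) with h2 | h2
  · rw [h1, h2]
  · exact absurd (by rw [h1, h2, neg_neg]) hk
  · exact absurd (by rw [h1, h2]) hk
  · rw [h1, h2]

lemma eq_add_cases (k l : Fin 3) : l = k ∨ l = k + 1 ∨ l = k + 2 := by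
  fin_cases k <;> fin_cases l <;> simp

lemma IsEnd.edge {p q : E3} {τ : Tri} (h : IsEnd u p q τ) {l : Fin 3} (hl : ¬ Anti u τ l) :
    (sv u (vert τ l) = -p ∧ sv u (vert τ (l + 1)) = q) ∨
      (sv u (vert τ l) = q ∧ sv u (vert τ (l + 1)) = p) := by
  obtain ⟨k, h1, h2, h3, -⟩ := h
  obtain ⟨a1, a2, -⟩ := succ_add k
  rcases eq_add_cases k l with rfl | rfl | rfl
  · exact absurd (by rw [Anti, h1, h2, neg_neg]) hl
  · exact Or.inl ⟨h2, by rw [a1, h3]⟩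
  · exact Or.inr ⟨h3, by rw [a2, h1]⟩

lemma IsEnd.value {p q : E3} {τ : Tri} (h : IsEnd u p q τ) (l : Fin 3) :
    sv u (vert τ l) = p ∨ sv u (vert τ l) = -p ∨ sv u (vert τ l) = q := by
  obtain ⟨k, h1, h2, h3, -⟩ := h
  rcases eq_add_cases k l with rfl | rfl | rfl
  · exact Or.inl h1
  · exact Or.inr (Or.inl h2)
  · exact Or.inr (Or.inr h3)

open Classical in
/-- The contribution of the boundary edges of a triangle. -/
noncomputable def edgeSum (u : SpinField ε) (g : E3 → E3 → ℝ) (τ : Tri) : ℝ :=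
  ∑ k, if Anti u τ k then 0 else g (sv u (vert τ k)) (sv u (vert τ (k + 1)))

lemma IsEnd.edgeSum_eq {p q : E3} {τ : Tri} (h : IsEnd u p q τ) (g : E3 → E3 → ℝ) :
    edgeSum u g τ = g (-p) q + g q p := by
  obtain ⟨k, h1, h2, h3, n1, n2⟩ := h
  obtain ⟨a1, a2, -⟩ := succ_add k
  rw [edgeSum, sum_fin_three _ k, a1, a2, if_pos, if_neg, if_neg, h1, h2, h3, zero_add]
  · rw [Anti, a2, h3, h1]; exact n2
  · rw [Anti, a1, h3, h2, neg_inj]; exact n1.symm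
  · rw [Anti, h1, h2, neg_neg]

lemma OnAxis.edgeSum_eq {p : E3} {τ : Tri} (h : OnAxis u p τ) {g : E3 → E3 → ℝ}
    (hg : ∀ k, g (sv u (vert τ k)) (sv u (vert τ k)) = 0) : edgeSum u g τ = 0 := by
  refine Finset.sum_eq_zero fun k _ => ?_
  split_ifs with hk
  · rfl
  · rw [← h.sv_eq hk, hg]

lemma solidAngle_self_left {W S : Set E3} {a e : E3} (h : IsApex W S e) (ha : ‖a‖ = 1)
    (haW : a ∈ W) : solidAngle a a e = 0 := by
  have hne : a ≠ -a := ne_neg_of_inner_nonneg ha (by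
    rw [real_inner_self_eq_norm_sq]; positivity)
  exact solidAngle_eq_zero (triple_self_left a e)
    (solidRe_pos ha ha h.norm_eq hne (h.inner_nonneg a haW) (h.inner_nonneg a haW)).le

/-- The apex `e` and the orientation `s` of the region of a triangle `τ` with surface `S`. -/
structure RegionData (u : SpinField ε) (τ : Tri) (S : Set E3) (e : E3) (s : ℝ) : Prop where
  isApex : IsApex (values u (region u τ)) S e
  sign : s = 1 ∨ s = -1
  edge : ∀ τ' ∈ comp u τ, ∀ k, ¬ Anti u τ' k → ∀ w ∈ insert e (values u (region u τ)),
    0 ≤ s * triple (sv u (vert τ' k)) (sv u (vert τ' (k + 1))) w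
  area_eq : ∀ F : Finset Tri, (∀ τ', τ' ∈ F ↔ τ' ∈ comp u τ) →
    (area S).toReal = s * ∑ τ' ∈ F, edgeSum u (fun a b => solidAngle a b e) τ'

lemma comp_eq_singleton {τ : Tri} (h : ∀ k, ¬ Anti u τ k) : comp u τ = {τ} := by
  ext τ'
  constructor
  · intro h'
    by_contra hne
    obtain ⟨k, hk⟩ := anti_of_mem_comp (SimpleGraph.Reachable.symm h' : τ ∈ comp u τ')
      (fun h => hne h.symm)
    exact h k hk
  · rintro rfl
    exact mem_comp_self u _

lemma values_of_singleton (hε : 0 < ε) {τ : Tri} (h : ∀ k, ¬ Anti u τ k) :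
    values u (region u τ) =
      {sv u (vert τ 0), sv u (vert τ 1), sv u (vert τ 2)} := by
  ext w
  rw [mem_values_region hε, comp_eq_singleton h]
  simp [Fin.exists_fin_succ, eq_comm]

/-- Three cases: a triangle without antipodal edge, a region with all spins on one axis, and a
region with two ends. The apex comes from the closest point of the hull, from the added vector `h`,
or from the bisector of two half-planes. -/
lemma exists_regionData (hε : 0 < ε) {τ : Tri} {S : Set E3}
    (hfin : (comp u τ).Finite) (hS : IsAdmissibleSurface u (region u τ) S) :
    ∃ e s, RegionData u τ S e s := by
  by_cases h : ∀ k, ¬ Anti u τ k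
  · have hW := values_of_singleton hε h
    have ha : sv u (vert τ 0) ≠ -sv u (vert τ 1) := h 0
    have hb : sv u (vert τ 1) ≠ -sv u (vert τ 2) := h 1
    have hc : sv u (vert τ 2) ≠ -sv u (vert τ 0) := h 2
    unfold IsAdmissibleSurface at hS
    rw [hW] at hS
    obtain ⟨e, he⟩ := exists_isApex hS (exists_apex_three (norm_sv u _) (norm_sv u _)
      (norm_sv u _) ha hb hc)
    obtain ⟨s, hs, hedge, hsum⟩ := he.area_three (norm_sv u _) (norm_sv u _)
      (norm_sv u _) ha hb hc
    refine ⟨e, s, by rwa [hW], hs, ?_, ?_⟩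
    · rw [comp_eq_singleton h, hW]
      rintro _ rfl k - w hw
      obtain ⟨h1, h2, h3⟩ := hedge w hw
      fin_cases k
      · exact h1
      · exact h2
      · exact h3
    · intro F hF
      have hF' : F = {τ} := by
        ext τ'; rw [hF, comp_eq_singleton h]; simp
      rw [hsum, hF', Finset.sum_singleton, edgeSum, Fin.sum_univ_three, if_neg (h 0),
        if_neg (h 1), if_neg (h 2)]
      rfl
  · push Not at h
    obtain ⟨k, hk⟩ := h
    set p := sv u (vert τ k) with hp
    have hpn : ‖p‖ = 1 := norm_sv u _
    have hpp : p ≠ -p := ne_neg_of_inner_nonneg hpn (by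
      rw [real_inner_self_eq_norm_sq]; positivity)
    have hax : HasAxis u p τ := ⟨k, hk, Or.inl rfl⟩
    have hk' : sv u (vert τ (k + 1)) = -p := by
      rw [Anti, ← hp] at hk; rw [hk, neg_neg]
    have hpW : p ∈ values u (region u τ) :=
      (mem_values_region hε u τ p).2 ⟨τ, mem_comp_self u τ, k, rfl⟩
    have hpW' : -p ∈ values u (region u τ) :=
      (mem_values_region hε u τ _).2 ⟨τ, mem_comp_self u τ, k + 1, hk'⟩
    have hFF : ∀ τ', τ' ∈ hfin.toFinset ↔ τ' ∈ comp u τ := fun τ' => hfin.mem_toFinset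
    rcases hax.exists_ends hpp hFF with hall | ⟨τ₁, m1, τ₂, m2, q₁, q₂, hne, e1, e2, hall⟩
    · simp only [hFF] at hall
      have hval : ∀ w ∈ values u (region u τ), w = p ∨ w = -p := by
        intro w hw
        obtain ⟨τ', h1, l, rfl⟩ := (mem_values_region hε u τ w).1 hw
        exact hall τ' h1 l
      obtain ⟨e, he⟩ := exists_isApex hS (by
        rintro ⟨y, hy, hny⟩
        exfalso
        rcases hval y hy with rfl | rfl
        · exact hny (subset_cone _ hpW')
        · rw [neg_neg] at hny; exact hny (subset_cone _ hpW))
      -- The area vanishes and all boundary edges are constant, so either sign would do.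
      refine ⟨e, 1, he, Or.inl rfl, ?_, ?_⟩
      · intro τ' hτ' l hl w _
        rw [← (hall τ' hτ').sv_eq hl, triple_self_left, mul_zero]
      · intro F hF
        rw [he.area_axis hpn hval hpW hpW', Finset.sum_eq_zero, ENNReal.toReal_zero, mul_zero]
        intro τ' hτ'
        rw [hF] at hτ'
        exact (hall τ' hτ').edgeSum_eq fun l => solidAngle_self_left he (norm_sv u _)
          ((mem_values_region hε u τ _).2 ⟨τ', hτ', l, rfl⟩)
    · simp only [hFF] at hall m1 m2
      have hW : values u (region u τ) = {p, -p, q₁, q₂} := by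
        ext w
        rw [mem_values_region hε]
        constructor
        · rintro ⟨τ', h1, l, rfl⟩
          by_cases x1 : τ' = τ₁
          · subst x1
            rcases e1.value l with h | h | h <;> simp [h]
          · by_cases x2 : τ' = τ₂
            · subst x2
              rcases e2.value l with h | h | h <;> simp [h]
            · rcases hall τ' h1 x1 x2 l with h | h <;> simp [h]
        · rintro (rfl | rfl | rfl | rfl)
          · exact ⟨τ, mem_comp_self u τ, k, rfl⟩
          · exact ⟨τ, mem_comp_self u τ, k + 1, hk'⟩
          · obtain ⟨l, -, -, h3, -⟩ := e1
            exact ⟨τ₁, m1, l + 2, h3⟩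
          · obtain ⟨l, -, -, h3, -⟩ := e2
            exact ⟨τ₂, m2, l + 2, h3⟩
      obtain ⟨n1, n1', hq1⟩ : q₁ ≠ p ∧ q₁ ≠ -p ∧ ‖q₁‖ = 1 := by
        obtain ⟨l, -, -, h3, h4, h5⟩ := e1
        exact ⟨h4, h5, h3 ▸ norm_sv u _⟩
      obtain ⟨n2, n2', hq2⟩ : q₂ ≠ p ∧ q₂ ≠ -p ∧ ‖q₂‖ = 1 := by
        obtain ⟨l, -, -, h3, h4, h5⟩ := e2
        exact ⟨by rwa [neg_neg] at h5, h4, h3 ▸ norm_sv u _⟩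
      unfold IsAdmissibleSurface at hS
      rw [hW] at hS
      obtain ⟨e, he⟩ := exists_isApex hS (exists_apex_four hpn hq1 hq2 n1 n1' n2 n2')
      obtain ⟨s, hs, hedge, hsum⟩ := he.area_four hpn hq1 hq2 n1 n1' n2 n2'
      refine ⟨e, s, by rwa [hW], hs, ?_, ?_⟩
      · rw [hW]
        intro τ' hτ' l hl w hw
        obtain ⟨h1, h2⟩ := hedge w hw
        by_cases x1 : τ' = τ₁
        · subst x1
          rcases e1.edge hl with ⟨y1, y2⟩ | ⟨y1, y2⟩ <;> rw [y1, y2]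
          · rwa [triple_neg_left, triple_swap, neg_neg]
          · exact h2
        · by_cases x2 : τ' = τ₂
          · subst x2
            rcases e2.edge hl with ⟨y1, y2⟩ | ⟨y1, y2⟩ <;> rw [y1, y2]
            · rwa [neg_neg]
            · rwa [triple_neg_mid, triple_swap, neg_neg]
          · rw [← (hall τ' hτ' x1 x2).sv_eq hl, triple_self_left, mul_zero]
      · intro F hF
        -- Only the two ends contribute. Their edges `-p → q₁ → p` and `p → q₂ → -p` close up to the
        -- boundary quadrilateral of the surface.
        rw [hsum, Finset.sum_eq_add_of_mem τ₁ τ₂ ((hF _).2 m1) ((hF _).2 m2) hne,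
          e1.edgeSum_eq, e2.edgeSum_eq, neg_neg, add_comm]
        intro τ' hτ' hx
        rw [hF] at hτ'
        refine (hall τ' hτ' hx.1 hx.2).edgeSum_eq fun l => solidAngle_self_left he (norm_sv u _) ?_
        rw [← hW]
        exact (mem_values_region hε u τ _).2 ⟨τ', hτ', l, rfl⟩

/-- An antipodal edge has oscillation `2`. For `δ < 1` the triangle is thus a region by itself with
a nearby apex, and for `δ ≥ 1` nonobtuse angles suffice. -/
lemma RegionData.norm_sub_le (hε : 0 < ε) {τ : Tri} {S : Set E3} {e : E3} {s : ℝ}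
    (h : RegionData u τ S e s) {τ' : Tri} (hτ' : τ' ∈ comp u τ) {δ : ℝ}
    (hδ : ∀ k l, ‖sv u (vert τ' k) - sv u (vert τ' l)‖ ≤ δ) (k : Fin 3) :
    ‖e - sv u (vert τ' k)‖ ≤ 2 * δ := by
  have hδ0 : 0 ≤ δ := (norm_nonneg _).trans (hδ 0 0)
  by_cases h1 : 1 ≤ δ
  · exact norm_sub_le_two_of_inner h.isApex.norm_eq (norm_sv u _)
      (h.isApex.inner_nonneg _ ((mem_values_region hε u τ _).2 ⟨τ', hτ', k, rfl⟩)) h1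
  · have hno : ∀ k, ¬ Anti u τ' k := by
      intro k hk
      have h2 := hδ k (k + 1)
      rw [Anti] at hk
      rw [hk, ← neg_add', norm_neg, ← two_smul ℝ, norm_smul, norm_sv] at h2
      norm_num at h2
      linarith
    have hA := h.isApex
    rw [← region_eq hτ', values_of_singleton hε hno] at hA
    have hmem : ∀ x ∈ ({sv u (vert τ' 0), sv u (vert τ' 1), sv u (vert τ' 2)} : Set E3),
        ∃ k, x = sv u (vert τ' k) := by
      rintro x (rfl | rfl | rfl)
      exacts [⟨0, rfl⟩, ⟨1, rfl⟩, ⟨2, rfl⟩]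
    refine (hA.norm_sub_le_three (δ := δ) ?_ ?_ (not_le.1 h1) ?_).trans (by linarith)
    · intro x hx
      obtain ⟨k, rfl⟩ := hmem x hx
      exact norm_sv u _
    · intro x hx y hy
      obtain ⟨k, rfl⟩ := hmem x hx
      obtain ⟨l, rfl⟩ := hmem y hy
      exact hδ k l
    · fin_cases k <;> simp

end

/-! ### The sign of a region -/

/-- A geodesic stays in the plane of `p` and `q`, and its angular momentum is constant, equal to `θ
/ sin θ` times `p × q`. For `p = q` both sides vanish. -/
lemma inner_cross_geodesic {p q : E3} (hp : ‖p‖ = 1) (hq : ‖q‖ = 1) (hpq : p ≠ -q) (s : ℝ) :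
    ∃ c : ℝ, 0 < c ∧ ∀ b, inner ℝ (cross (geodesic p q s) (deriv (geodesic p q) s)) b =
      c * triple p q b := by
  by_cases h : p = q
  · subst h
    have h1 : geodesic p p = fun _ => p := by ext s : 1; simp [geodesic]
    refine ⟨1, one_pos, fun b => ?_⟩
    rw [h1, deriv_const, inner_cross_eq_triple, triple_self_left]
    simp [triple_eq]
  · have hsin : 0 < Real.sin (InnerProductGeometry.angle p q) := by
      refine InnerProductGeometry.sin_angle_nonneg p q |>.lt_of_ne' fun h0 => ?_
      rcases InnerProductGeometry.sin_eq_zero_iff_angle_eq_zero_or_angle_eq_pi.1 h0 with h1 | h1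
      · exact h ((inner_eq_one_iff_of_norm_eq_one (𝕜 := ℝ) hp hq).1 (by
          rw [← InnerProductGeometry.cos_angle_mul_norm_mul_norm, h1, hp, hq]; simp))
      · refine hpq ((inner_eq_one_iff_of_norm_eq_one (𝕜 := ℝ) hp (by rwa [norm_neg])).1 ?_)
        rw [inner_neg_right, ← InnerProductGeometry.cos_angle_mul_norm_mul_norm, h1, hp, hq]
        simp
    set θ := InnerProductGeometry.angle p q with hθ
    have hθ0 : 0 < θ := by
      refine (InnerProductGeometry.angle_nonneg p q).lt_of_ne' fun h0 => ?_
      rw [← hθ] at h0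
      rw [h0, Real.sin_zero] at hsin
      exact hsin.false
    have hg : geodesic p q = fun s => (Real.sin θ)⁻¹ •
        (Real.sin ((1 - s) * θ) • p + Real.sin (s * θ) • q) := by
      ext s : 1; rw [geodesic, if_neg h]
    have d1 : HasDerivAt (fun s => Real.sin ((1 - s) * θ)) (Real.cos ((1 - s) * θ) * (-1 * θ)) s :=
      (((hasDerivAt_id s).const_sub 1).mul_const θ).sin
    have d2 : HasDerivAt (fun s => Real.sin (s * θ)) (Real.cos (s * θ) * (1 * θ)) s :=
      ((hasDerivAt_id s).mul_const θ).sin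
    have d := ((d1.smul_const p).add (d2.smul_const q)).const_smul (Real.sin θ)⁻¹
    have hd : deriv (geodesic p q) s = (Real.sin θ)⁻¹ •
        ((Real.cos ((1 - s) * θ) * (-1 * θ)) • p + (Real.cos (s * θ) * (1 * θ)) • q) := by
      rw [hg]; exact d.deriv
    refine ⟨θ / Real.sin θ, by positivity, fun b => ?_⟩
    rw [hd, hg, inner_cross_eq_triple]
    have e1 : Real.sin θ = Real.sin ((1 - s) * θ) * Real.cos (s * θ) +
        Real.cos ((1 - s) * θ) * Real.sin (s * θ) := by
      rw [← Real.sin_add]; ring_nf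
    have e2 : θ / Real.sin θ = (Real.sin θ)⁻¹ * (Real.sin θ)⁻¹ *
        (θ * (Real.sin ((1 - s) * θ) * Real.cos (s * θ) +
          Real.cos ((1 - s) * θ) * Real.sin (s * θ))) := by
      rw [← e1]; field_simp
    have key : ∀ i A B C D : ℝ, triple (i • (A • p + B • q)) (i • ((C * (-1 * θ)) • p +
        (D * (1 * θ)) • q)) b = i * i * (θ * (A * D + C * B)) * triple p q b := by
      intro i A B C D
      simp only [triple_eq, PiLp.add_apply, PiLp.smul_apply, smul_eq_mul]; ring
    rw [e2]
    exact key _ _ _ _ _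

section

variable {ε : ℝ} {u : SpinField ε}

lemma center_mem_convexHull (ε : ℝ) (τ : Tri) (k : Fin 3) : center ε τ ∈
    convexHull ℝ {(pos ε (vert τ k) : E2), (pos ε (vert τ (k + 1)) : E2),
      (pos ε (vert τ (k + 2)) : E2)} := by
  rw [center]
  refine (convex_convexHull ℝ _).sum_mem (fun _ _ => by norm_num) (by simp) fun l _ => ?_
  refine subset_convexHull ℝ _ ?_
  rcases eq_add_cases k l with rfl | rfl | rfl <;> simp

/-- The triangle on the left of an oriented boundary edge. -/
lemma IsBoundaryEdge.exists_triangle (hε : 0 < ε) {τ : Tri} {Γ : lattice ε × lattice ε}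
    (h : IsBoundaryEdge u (region u τ) Γ) : ∃ τ' ∈ comp u τ, ∃ k, ¬ Anti u τ' k ∧
      sv u (vert τ' k) = u Γ.1 ∧ sv u (vert τ' (k + 1)) = u Γ.2 := by
  obtain ⟨i, j⟩ := Γ
  obtain ⟨z, rfl⟩ := pos_surjective ε i
  obtain ⟨w, rfl⟩ := pos_surjective ε j
  obtain ⟨h1, h2, h3, -⟩ := h
  simp only at h1 h2 h3
  rw [dist_pos_eq_iff hε] at h1
  obtain ⟨τ', k, rfl, rfl, e3⟩ := exists_left_triangle h1
  rw [leftVertex_pos, ← e3] at h3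
  exact ⟨τ', center_mem_region hε u (h3 (center_mem_convexHull ε τ' k)), k,
    fun h => h2 ((anti_iff u _ _).1 h), rfl, rfl⟩

lemma radial_subset_sphere (K : Set E3) : radial K ⊆ S2 := by
  rintro _ ⟨y, -, h0, rfl⟩
  rw [mem_sphere_zero_iff_norm, norm_smul, norm_inv, norm_norm,
    inv_mul_cancel₀ (norm_ne_zero_iff.2 h0)]

lemma RegionData.nonneg_of_boundaryEdge (hε : 0 < ε) {τ : Tri} {S : Set E3} {e : E3} {s : ℝ}
    (h : RegionData u τ S e s) {Γ : lattice ε × lattice ε}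
    (hΓ : IsBoundaryEdge u (region u τ) Γ) {y : E3}
    (hy : y ∈ cone (insert e (values u (region u τ)))) :
    0 ≤ s * triple (u Γ.1 : E3) (u Γ.2) y := by
  obtain ⟨τ', h1, k, h2, e1, e2⟩ := hΓ.exists_triangle hε
  rw [← e1, ← e2]
  exact mul_triple_nonneg_of_mem_cone (h.edge τ' h1 k h2) hy

lemma norm_spin (u : SpinField ε) (i : lattice ε) : ‖(u i : E3)‖ = 1 :=
  mem_sphere_zero_iff_norm.1 (u i).2

lemma spin_ne_neg {i j : lattice ε} (h : u i ≠ -u j) : (u i : E3) ≠ -(u j : E3) :=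
  fun h' => h (Subtype.ext h')

lemma geodesic_mem_span {p q : E3} (s : ℝ) : ∃ a b : ℝ, geodesic p q s = a • p + b • q := by
  unfold geodesic
  split_ifs
  · exact ⟨1, 0, by simp⟩
  · rw [smul_add, smul_smul, smul_smul]; exact ⟨_, _, rfl⟩

lemma triple_span_right (a b : E3) (s t : ℝ) : triple a b (s • a + t • b) = 0 := by
  simp only [triple_eq, PiLp.add_apply, PiLp.smul_apply, smul_eq_mul]; ring

lemma curve_eventuallyEq {N : ℕ} {α : ℝ → E3} {g : ℕ → ℝ → E3}
    (hα : ∀ m < N, ∀ s ∈ Icc (0 : ℝ) 1, α (m + s) = g m s) {m : ℕ} (hm : m < N) {t : ℝ}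
    (h1 : (m : ℝ) < t) (h2 : t < m + 1) : α =ᶠ[𝓝 t] fun t => g m (t - m) := by
  filter_upwards [Ioo_mem_nhds h1 h2] with r hr
  have := hα m hm (r - m) ⟨by linarith [hr.1], by linarith [hr.2]⟩
  rwa [add_sub_cancel] at this

/-- If the bracket of the boundary edges is nonnegative on the surface, then the boundary curve is
positively oriented. -/
lemma RegionData.isPositivelyOriented (hε : 0 < ε) {τ : Tri} {S : Set E3} {e : E3}
    (h : RegionData u τ S e 1) {N : ℕ} {α : ℝ → E3} (hα : IsBoundaryCurve u (region u τ) S N α) :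
    IsPositivelyOriented S N α := by
  obtain ⟨-, ⟨Γ, -, hΓ, -, hg⟩, -⟩ := hα
  intro t ht hnat β b hβ0 hβ hβS
  obtain ⟨m, hm, h1, h2⟩ : ∃ m : ℕ, m < N ∧ (m : ℝ) < t ∧ t < m + 1 := by
    refine ⟨⌊t⌋₊, (Nat.floor_lt ht.1.le).2 ht.2,
      (Nat.floor_le ht.1.le).lt_of_ne (hnat _).symm, Nat.lt_floor_add_one t⟩
  have heq := curve_eventuallyEq (g := fun m s => geodesic (u (Γ m).1) (u (Γ m).2) s) hg hm h1 h2
  have hd : deriv α t = deriv (geodesic (u (Γ m).1) (u (Γ m).2)) (t - m) := by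
    rw [heq.deriv_eq, deriv_comp_sub_const]
  obtain ⟨c, hc, hcb⟩ := inner_cross_geodesic (norm_spin u (Γ m).1) (norm_spin u (Γ m).2)
    (spin_ne_neg (hΓ m hm).2.1) (t - m)
  have hαt : α t = geodesic (u (Γ m).1) (u (Γ m).2) (t - m) := heq.self_of_nhds
  rw [hd, hαt, hcb]
  refine mul_nonneg hc.le ?_
  -- The linear functional `triple p q` vanishes at the starting point of the curve and is
  -- nonnegative on the surface, so its right derivative is nonnegative.
  have hlin : HasDerivWithinAt (fun r => triple (u (Γ m).1 : E3) (u (Γ m).2) (β r))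
      (triple (u (Γ m).1 : E3) (u (Γ m).2) b) (Ici 0) 0 := by
    simp only [← inner_cross_eq_triple]
    simpa using (hasDerivWithinAt_const _ _ _).inner ℝ hβ
  rw [← hasDerivWithinAt_Ioi_iff_Ici, hasDerivWithinAt_iff_tendsto_slope' (by simp)] at hlin
  refine ge_of_tendsto hlin ?_
  filter_upwards [hβS, self_mem_nhdsWithin] with r hr hr0
  have h0 : triple (u (Γ m).1 : E3) (u (Γ m).2) (β 0) = 0 := by
    obtain ⟨x, y, hxy⟩ := geodesic_mem_span (p := (u (Γ m).1 : E3)) (q := u (Γ m).2) (t - m)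
    rw [hβ0, hαt, hxy, triple_span_right]
  rw [slope_def_field, h0, sub_zero, sub_zero]
  refine div_nonneg ?_ (le_of_lt hr0)
  rw [h.isApex.surface] at hr
  obtain ⟨y, hy, -, hyr⟩ := hr
  have := h.nonneg_of_boundaryEdge hε (hΓ m hm) hy
  rw [one_mul] at this
  rw [hyr, triple_smul_right]
  positivity

lemma sin_mul_angle_nonneg {p q : E3} {s : ℝ} (hs : s ∈ Icc (0 : ℝ) 1) :
    0 ≤ Real.sin (s * InnerProductGeometry.angle p q) := by
  have h1 := InnerProductGeometry.angle_nonneg p q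
  have h2 := InnerProductGeometry.angle_le_pi p q
  exact Real.sin_nonneg_of_nonneg_of_le_pi (mul_nonneg hs.1 h1)
    ((mul_le_of_le_one_left h1 hs.2).trans h2)

lemma geodesic_mem_cone {p q : E3} {W : Set E3} (hp : p ∈ W) (hq : q ∈ W) {s : ℝ}
    (hs : s ∈ Icc (0 : ℝ) 1) : geodesic p q s ∈ cone W := by
  unfold geodesic
  split_ifs
  · exact subset_cone W hp
  · have h1 : 0 ≤ Real.sin ((1 - s) * InnerProductGeometry.angle p q) :=
      sin_mul_angle_nonneg ⟨sub_nonneg.2 hs.2, by linarith [hs.1]⟩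
    exact smul_mem_cone (inv_nonneg.2 (InnerProductGeometry.sin_angle_nonneg p q))
      (add_mem_cone (smul_mem_cone h1 (subset_cone W hp))
        (smul_mem_cone (sin_mul_angle_nonneg hs) (subset_cone W hq)))

lemma relBoundary_subset (K : Set E3) : relBoundary (radial K) ⊆ S2 :=
  inter_subset_left.trans (closure_minimal (radial_subset_sphere K) Metric.isClosed_sphere)

/-- If the bracket of the boundary edges is nonpositive on the surface, and the surface has
positive area, then the boundary curve is not positively oriented. -/
lemma RegionData.not_isPositivelyOriented (hε : 0 < ε) {τ : Tri} {S : Set E3} {e : E3}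
    (h : RegionData u τ S e (-1)) (hS : 0 < area S) {N : ℕ} {α : ℝ → E3}
    (hα : IsBoundaryCurve u (region u τ) S N α) : ¬ IsPositivelyOriented S N α := by
  intro hpos
  obtain ⟨hN, ⟨Γ, -, hΓ, -, hg⟩, -, hinj, himg⟩ := hα
  have hN0 : 0 < N := by omega
  have hN1 : (1 : ℝ) ≤ N := by exact_mod_cast hN0
  have hb := hΓ 0 hN0
  set p := Subtype.val (u (Γ 0).1) with hp
  set q := Subtype.val (u (Γ 0).2) with hq
  have hg0 : ∀ s ∈ Icc (0 : ℝ) 1, α s = geodesic p q s := by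
    intro s hs
    have := hg 0 hN0 s hs
    rwa [Nat.cast_zero, zero_add] at this
  -- A constant geodesic would contradict the injectivity of the boundary parametrization.
  have hpq : p ≠ q := by
    intro hpq
    have h1 : α (1 / 4) = α (1 / 2) := by
      rw [hg0 _ ⟨by norm_num, by norm_num⟩, hg0 _ ⟨by norm_num, by norm_num⟩]
      simp [geodesic, hpq]
    have h2 := hinj ⟨by norm_num, by linarith⟩ ⟨by norm_num, by linarith⟩ h1
    norm_num at h2
  have hpq' : p ≠ -q := spin_ne_neg hb.2.1
  have hne := cross_ne_zero_of_ne (norm_spin u _) (norm_spin u _) hpq hpq'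
  -- If `triple p q` vanished on the whole cone, the surface would lie on a great circle and have no
  -- area.
  obtain ⟨w, hw, hneg⟩ : ∃ w ∈ cone (insert e (values u (region u τ))), triple p q w < 0 := by
    by_contra hn
    push Not at hn
    refine hS.ne' ?_
    rw [h.isApex.surface]
    refine area_radial_eq_zero hne fun y hy => ?_
    rw [inner_cross_eq_triple]
    have h1 := h.nonneg_of_boundaryEdge hε hb hy
    exact le_antisymm (by linarith) (hn y hy)
  set g := α (1 / 2) with hgdef
  have hgg : g = geodesic p q (1 / 2) := hg0 _ ⟨by norm_num, by norm_num⟩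
  have hgn : ‖g‖ = 1 := by
    have : g ∈ relBoundary S := himg ▸ ⟨1 / 2, ⟨by norm_num, by linarith⟩, rfl⟩
    rw [h.isApex.surface] at this
    exact mem_sphere_zero_iff_norm.1 (relBoundary_subset _ this)
  obtain ⟨τ', hτ', k, -, e1, e2⟩ := hb.exists_triangle hε
  have hpW : p ∈ insert e (values u (region u τ)) :=
    mem_insert_of_mem _ ((mem_values_region hε u τ _).2 ⟨τ', hτ', k, e1⟩)
  have hqW : q ∈ insert e (values u (region u τ)) :=
    mem_insert_of_mem _ ((mem_values_region hε u τ _).2 ⟨τ', hτ', k + 1, e2⟩)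
  have hgK : g ∈ cone (insert e (values u (region u τ))) := by
    rw [hgg]; exact geodesic_mem_cone hpW hqW ⟨by norm_num, by norm_num⟩
  -- The test curve leaves the middle of the first geodesic in the direction `w`, normalized. It
  -- stays in the surface because the cone is convex.
  have hline : HasDerivAt (fun r : ℝ => g + r • w) w 0 := by
    simpa using ((hasDerivAt_id (0 : ℝ)).smul_const w).const_add g
  have hg0' : g + (0 : ℝ) • w ≠ 0 := by
    rw [zero_smul, add_zero, ← norm_ne_zero_iff, hgn]; exact one_ne_zero
  have hdiff : DifferentiableAt ℝ (fun r : ℝ => ‖g + r • w‖⁻¹) 0 :=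
    (hline.differentiableAt.norm ℝ hg0').inv (norm_ne_zero_iff.2 hg0')
  have hβ := hdiff.hasDerivAt.smul hline
  generalize deriv (fun r : ℝ => ‖g + r • w‖⁻¹) 0 = d at hβ
  rw [zero_smul, add_zero, hgn, inv_one, one_smul] at hβ
  have hmain := hpos (1 / 2) ⟨by norm_num, by linarith⟩ (by
      intro m hm
      have h2 : (2 * m : ℝ) = 1 := by rw [← hm]; norm_num
      have h3 : 2 * m = 1 := by exact_mod_cast h2
      omega) (fun r => ‖g + r • w‖⁻¹ • (g + r • w)) _ (by
        change ‖g + (0 : ℝ) • w‖⁻¹ • (g + (0 : ℝ) • w) = g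
        rw [zero_smul, add_zero, hgn, inv_one, one_smul])
      hβ.hasDerivWithinAt (by
        have hev : ∀ᶠ r in 𝓝[>] (0 : ℝ), g + r • w ≠ 0 :=
          (hline.continuousAt.eventually_ne hg0').filter_mono nhdsWithin_le_nhds
        filter_upwards [hev, self_mem_nhdsWithin] with r hr hr0
        rw [h.isApex.surface]
        exact ⟨_, add_mem_cone hgK (smul_mem_cone (le_of_lt hr0) hw), hr, rfl⟩)
  have heq := curve_eventuallyEq (g := fun m s => geodesic (u (Γ m).1) (u (Γ m).2) s) hg hN0
    (t := 1 / 2) (by norm_num) (by norm_num)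
  have hd : deriv α (1 / 2) = deriv (geodesic p q) (1 / 2) := by
    rw [heq.deriv_eq, deriv_comp_sub_const]; simp [hp, hq]
  obtain ⟨c, hc, hcb⟩ := inner_cross_geodesic (norm_spin u (Γ 0).1) (norm_spin u (Γ 0).2) hpq'
    (1 / 2)
  obtain ⟨x, y, hxy⟩ := geodesic_mem_span (p := p) (q := q) (1 / 2)
  -- The derivative of the normalizing factor contributes a multiple of a vector in the plane of `p`
  -- and `q`, which the bracket ignores.
  rw [hd, ← hgdef, hgg, hcb, triple_add_right, triple_smul_right _ _ _ d, hxy,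
    ← hp, ← hq, triple_span_right, mul_zero] at hmain
  nlinarith

/-- The charge of a region is the sum of the solid angles of its boundary edges. -/
lemma RegionData.charge_eq (hε : 0 < ε) {τ : Tri} {S : Set E3} {e : E3} {s σ : ℝ}
    (h : RegionData u τ S e s) (hσ : IsAdmissibleSign u (region u τ) S σ) {F : Finset Tri}
    (hF : ∀ τ', τ' ∈ F ↔ τ' ∈ comp u τ) :
    σ * (area S).toReal = ∑ τ' ∈ F, edgeSum u (fun a b => solidAngle a b e) τ' := by
  have hA := h.area_eq F hF
  by_cases h0 : 0 < area S
  · obtain ⟨N, α, hα, hiff⟩ := hσ.2 h0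
    have hs : σ = s := by
      rcases h.sign with rfl | rfl
      · exact hiff.2 (h.isPositivelyOriented hε hα)
      · exact hσ.1.resolve_left fun h1 => h.not_isPositivelyOriented hε h0 hα (hiff.1 h1)
    rw [hA, hs, ← mul_assoc]
    rcases h.sign with rfl | rfl <;> norm_num
  -- Without area the sign is arbitrary, but then both sides vanish.
  · have h1 : area S = 0 := by simpa using h0
    rw [h1, ENNReal.toReal_zero] at hA ⊢
    rw [mul_zero]
    rcases h.sign with rfl | rfl <;> linarith

end

/-! ### The interpolation of a spin field -/

section

variable {ε : ℝ} {u : SpinField ε}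

lemma RegionData.congr {τ τ' : Tri} {S : Set E3} {e : E3} {s : ℝ} (h : RegionData u τ S e s)
    (hc : τ' ∈ comp u τ) : RegionData u τ' S e s where
  isApex := by rw [region_eq hc]; exact h.isApex
  sign := h.sign
  edge := by rw [region_eq hc, comp_eq hc]; exact h.edge
  area_eq := by rw [comp_eq hc]; exact h.area_eq

/-- A choice of values at the barycenters of the triangles, constant across antipodal edges and
close to the spins. -/
structure IsFilling (u : SpinField ε) (e : Tri → E3) : Prop where
  norm_eq : ∀ τ, ‖e τ‖ = 1
  inner_nonneg : ∀ τ k, 0 ≤ inner ℝ (e τ) (sv u (vert τ k))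
  eq_nb : ∀ τ k, Anti u τ k → e (nb τ k) = e τ
  norm_sub_le : ∀ τ (δ : ℝ), (∀ k l, ‖sv u (vert τ k) - sv u (vert τ l)‖ ≤ δ) →
    ∀ k, ‖e τ - sv u (vert τ k)‖ ≤ 2 * δ

/-- The region data depend on `τ` only through its component, so one apex can serve all triangles of
a region. -/
lemma exists_filling (hε : 0 < ε) (hu : (excited u).Finite) {S : Set E2 → Set E3}
    (hS : ∀ R ∈ regions u, IsAdmissibleSurface u R (S R)) :
    ∃ e, IsFilling u e ∧ (∀ τ, ∀ τ' ∈ comp u τ, e τ' = e τ) ∧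
      ∀ τ, ∃ s, RegionData u τ (S (region u τ)) (e τ) s := by
  classical
  set P : Set E2 → E3 → Prop := fun R e =>
    ∃ τ s, region u τ = R ∧ RegionData u τ (S R) e s with hP
  have hex : ∀ τ, ∃ e, P (region u τ) e := fun τ => by
    obtain ⟨e, s, h⟩ := exists_regionData hε (finite_comp hu τ)
      (hS _ ((mem_regions_iff hε hu _).2 ⟨τ, rfl⟩))
    exact ⟨e, τ, s, rfl, h⟩
  -- The choice is made from a predicate on the set `region u τ`, which makes it literally equal for
  -- all triangles of the region.
  set g : Tri → E3 := fun τ => Classical.epsilon (P (region u τ)) with hg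
  have hdata : ∀ τ, ∃ s, RegionData u τ (S (region u τ)) (g τ) s := by
    intro τ
    obtain ⟨τ', s, h1, h2⟩ := Classical.epsilon_spec (hex τ)
    refine ⟨s, h2.congr (center_mem_region hε u ?_)⟩
    rw [h1]
    exact mem_region_of_mem (mem_comp_self u τ) (ocell_subset_tcell _ _ (center_mem_ocell hε τ))
  have hconst : ∀ τ, ∀ τ' ∈ comp u τ, g τ' = g τ := fun τ τ' h => by
    simp only [hg, region_eq h]
  refine ⟨g, ⟨fun τ => ?_, fun τ k => ?_, fun τ k h => hconst τ _ (nb_mem_comp h),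
    fun τ δ hδ k => ?_⟩, hconst, hdata⟩
  · obtain ⟨s, h⟩ := hdata τ
    exact h.isApex.norm_eq
  · obtain ⟨s, h⟩ := hdata τ
    exact h.isApex.inner_nonneg _ ((mem_values_region hε u τ _).2 ⟨τ, mem_comp_self u τ, k, rfl⟩)
  · obtain ⟨s, h⟩ := hdata τ
    exact h.norm_sub_le hε (mem_comp_self u τ) hδ k

/-- With `t = ‖a + b‖ ≤ 2` the squared distances are `2 - t` on the left and `4 - t²` on the right.
-/
lemma norm_midVec_sub_le {a b : E3} (ha : ‖a‖ = 1) (hb : ‖b‖ = 1) (hab : a ≠ -b) :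
    ‖midVec a b - a‖ ≤ ‖a - b‖ := by
  refine le_of_sq_le_sq ?_ (norm_nonneg _)
  rw [norm_sub_sq_of_unit (norm_midVec hab) ha, norm_sub_sq_of_unit ha hb, inner_midVec,
    real_inner_self_eq_norm_sq, ha, real_inner_comm]
  have h1 : ‖a + b‖ ^ 2 = 2 + 2 * inner ℝ a b := by
    rw [norm_add_sq_real, ha, hb]; ring
  have h2 : 0 < ‖a + b‖ := norm_pos_iff.2 (add_ne_zero_of_ne_neg hab)
  have h3 : ‖a + b‖ ≤ 2 := (norm_add_le a b).trans (by rw [ha, hb]; norm_num)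
  have h4 : ‖a + b‖⁻¹ * (1 ^ 2 + inner ℝ a b) = ‖a + b‖ / 2 := by
    field_simp
    linarith
  rw [h4]
  nlinarith

open Classical in
/-- The interpolation data of a spin field with a filling. -/
noncomputable def IsFilling.data {e : Tri → E3} (he : IsFilling u e) : InterpData where
  U := sv u
  -- Antipodal spins have no mean direction. The apex is used instead, and it is shared by the
  -- triangle on the other side.
  M τ k := if Anti u τ k then e τ else midVec (sv u (vert τ k)) (sv u (vert τ (k + 1)))
  B := e
  M_nb τ k := by
    by_cases h : Anti u τ k
    · rw [if_pos h, if_pos (anti_nb h), he.eq_nb τ k h]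
    · have h' : ¬ Anti u (nb τ k) k := fun h2 => h (by simpa only [nb_nb] using anti_nb h2)
      rw [if_neg h, if_neg h', vert_nb, vert_nb_succ, midVec_comm]
  norm_U := norm_sv u
  norm_M τ k := by
    split_ifs with h
    · exact he.norm_eq τ
    · exact norm_midVec h
  norm_B := he.norm_eq
  inner_BU := he.inner_nonneg
  inner_BM τ k := by
    split_ifs with h
    · rw [real_inner_self_eq_norm_sq]; positivity
    · exact inner_midVec_nonneg (he.inner_nonneg τ _) (he.inner_nonneg τ _)
  inner_MU τ k := by
    split_ifs with h
    · exact he.inner_nonneg τ _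
    · exact inner_midVec_left_nonneg (norm_sv u _) (norm_sv u _)
  inner_MU_succ τ k := by
    split_ifs with h
    · exact he.inner_nonneg τ _
    · exact inner_midVec_right_nonneg (norm_sv u _) (norm_sv u _)

/-! ### Energy of a single triangle and the oscillation it controls. -/

lemma exchangeT_vset (hε : 0 < ε) (u : SpinField ε) (τ : Tri) : exchangeT u (vset ε τ) =
    1 / 4 * ∑ k, ∑ l, ‖sv u (vert τ k) - sv u (vert τ l)‖ ^ 2 := by
  rw [exchangeT, sum_vset hε]
  simp only [sum_vset hε]
  rfl

lemma exchangeT_nonneg (u : SpinField ε) (t : Finset (lattice ε)) : 0 ≤ exchangeT u t := by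
  unfold exchangeT; positivity

lemma zeemanT_nonneg (u : SpinField ε) (t : Finset (lattice ε)) : 0 ≤ zeemanT u t := by
  unfold zeemanT; positivity

lemma zeemanT_vset (hε : 0 < ε) (u : SpinField ε) (τ : Tri) : zeemanT u (vset ε τ) =
    1 / 2 * ∑ k, ‖sv u (vert τ k) - north‖ ^ 2 := by
  rw [zeemanT, sum_vset hε]
  rfl

lemma norm_sv_sub_le (hε : 0 < ε) (u : SpinField ε) (τ : Tri) (k l : Fin 3) :
    ‖sv u (vert τ k) - sv u (vert τ l)‖ ≤ 2 * √(exchangeT u (vset ε τ)) := by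
  have h0 := exchangeT_nonneg u (vset ε τ)
  refine le_of_sq_le_sq ?_ (by positivity)
  rw [mul_pow, Real.sq_sqrt h0, exchangeT_vset hε]
  have h1 := Finset.single_le_sum (f := fun k => ∑ l, ‖sv u (vert τ k) - sv u (vert τ l)‖ ^ 2)
    (fun _ _ => by positivity) (Finset.mem_univ k)
  have h2 := Finset.single_le_sum (f := fun l => ‖sv u (vert τ k) - sv u (vert τ l)‖ ^ 2)
    (fun _ _ => by positivity) (Finset.mem_univ l)
  linarith

lemma norm_sv_sub_north_le (hε : 0 < ε) (u : SpinField ε) (τ : Tri) (k : Fin 3) :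
    ‖sv u (vert τ k) - north‖ ≤ √(2 * zeemanT u (vset ε τ)) := by
  have h0 := zeemanT_nonneg u (vset ε τ)
  refine le_of_sq_le_sq ?_ (by positivity)
  rw [Real.sq_sqrt (by positivity), zeemanT_vset hε]
  have h1 := Finset.single_le_sum (f := fun k => ‖sv u (vert τ k) - north‖ ^ 2)
    (fun _ _ => by positivity) (Finset.mem_univ k)
  linarith

/-- A triangle with an antipodal edge has a definite amount of energy. -/
lemma Anti.one_le_exchangeT (hε : 0 < ε) {τ : Tri} {k : Fin 3} (h : Anti u τ k) :
    1 ≤ exchangeT u (vset ε τ) := by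
  have h1 := norm_sv_sub_le hε u τ k (k + 1)
  rw [Anti] at h
  rw [h, ← neg_add', norm_neg, ← two_smul ℝ, norm_smul, norm_sv] at h1
  norm_num at h1
  exact h1

lemma dist_le_of_mem_tcell (hε : 0 < ε) {τ : Tri} {x y : E2} (hx : x ∈ tcell ε τ)
    (hy : y ∈ tcell ε τ) : dist x y ≤ ε := by
  rw [← cell_vset hε, cell] at hx hy
  obtain ⟨_, ⟨i, hi, rfl⟩, _, ⟨j, hj, rfl⟩, h⟩ := convexHull_exists_dist_ge2 hx hy
  refine h.trans ?_
  by_cases hij : i = j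
  · rw [hij, dist_self]; exact hε.le
  · exact ((isTriangle_vset hε τ).2 i hi j hj hij).le

lemma volume_tcell_le (hε : 0 < ε) (τ : Tri) : volume.real (tcell ε τ) ≤ Real.pi * ε ^ 2 := by
  have h1 : tcell ε τ ⊆ Metric.closedBall (pos ε (vert τ 0) : E2) ε := fun x hx =>
    dist_le_of_mem_tcell hε hx (pos_vert_mem_tcell hε τ 0)
  refine (measureReal_mono h1 (Metric.isBounded_closedBall.measure_lt_top.ne)).trans ?_
  rw [Measure.real, EuclideanSpace.volume_closedBall_fin_two]
  simp [hε.le, mul_comm, ENNReal.toReal_ofReal Real.pi_pos.le]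

namespace IsFilling

variable {e : Tri → E3} (he : IsFilling u e)

lemma norm_mid_sub_le {τ : Tri} {δ : ℝ}
    (hδ : ∀ k l, ‖sv u (vert τ k) - sv u (vert τ l)‖ ≤ δ) (k : Fin 3) :
    ‖he.data.M τ k - sv u (vert τ k)‖ ≤ 2 * δ ∧
      ‖he.data.M τ k - sv u (vert τ (k + 1))‖ ≤ 2 * δ := by
  have hδ0 : 0 ≤ δ := (norm_nonneg _).trans (hδ 0 0)
  simp only [data]
  split_ifs with h
  · exact ⟨he.norm_sub_le τ δ hδ _, he.norm_sub_le τ δ hδ _⟩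
  · constructor
    · exact (norm_midVec_sub_le (norm_sv u _) (norm_sv u _) h).trans (by linarith [hδ k (k + 1)])
    · rw [midVec_comm]
      exact (norm_midVec_sub_le (norm_sv u _) (norm_sv u _)
        (fun h' => h (by rw [Anti, h', neg_neg]))).trans (by linarith [hδ (k + 1) k])

/-- The constant is `4 · 34 · 2 · 2`: normalization, the Lipschitz bound of `cellMap`, the distance
of the filling values to the spins, and the oscillation in terms of the energy. -/
lemma norm_fderiv_le (hε : 0 < ε) {τ : Tri} {x : E2} (hx : x ∈ ocell ε τ) :
    ‖fderiv ℝ (he.data.sph ε) x‖ ≤ 544 * √(exchangeT u (vset ε τ)) / ε := by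
  set δ := 2 * √(exchangeT u (vset ε τ)) with hδ
  have hδ0 : 0 ≤ δ := by positivity
  have h1 := norm_sv_sub_le hε u τ
  rw [← hδ] at h1
  refine norm_fderiv_le_of_lip' ℝ (by positivity) ?_
  filter_upwards [(isOpen_ocell ε τ).mem_nhds hx] with y hy
  refine (he.data.norm_sph_sub_le hε y x).trans ?_
  have h2 := he.data.norm_lin_sub_lin_le hε (τ := τ) (δ := 2 * δ) (x := y) (y := x)
    (fun k l => (h1 k l).trans (by linarith)) (fun k => (he.norm_mid_sub_le h1 k).1)
    (fun k => (he.norm_mid_sub_le h1 k).2) (fun k => he.norm_sub_le τ δ h1 k)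
    (ocell_subset_tcell _ _ hy) (ocell_subset_tcell _ _ hx)
  calc _ ≤ 4 * (34 * (2 * δ) / ε * ‖y - x‖) := by gcongr
    _ = _ := by rw [hδ]; ring

lemma norm_grad_sq_le (hε : 0 < ε) {τ : Tri} {x : E2} (hx : x ∈ ocell ε τ) (k : Fin 2) :
    ‖grad (he.data.sph ε) k x‖ ^ 2 ≤ 544 ^ 2 * exchangeT u (vset ε τ) / ε ^ 2 := by
  have h1 : ‖grad (he.data.sph ε) k x‖ ≤ 544 * √(exchangeT u (vset ε τ)) / ε := by
    rw [grad]
    refine (ContinuousLinearMap.le_opNorm _ _).trans ?_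
    simpa using he.norm_fderiv_le hε hx
  calc _ ≤ (544 * √(exchangeT u (vset ε τ)) / ε) ^ 2 := by gcongr
    _ = _ := by rw [div_pow, mul_pow, Real.sq_sqrt (exchangeT_nonneg _ _)]

lemma abs_chargeDensity_le (hε : 0 < ε) {τ : Tri} {x : E2} (hx : x ∈ ocell ε τ) :
    |chargeDensity (he.data.sph ε) (grad (he.data.sph ε)) x| ≤
      544 ^ 2 * exchangeT u (vset ε τ) / ε ^ 2 := by
  refine (InterpData.abs_chargeDensity_le (he.data.norm_sph hε x) _).trans ?_
  have h1 := he.norm_grad_sq_le hε hx 0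
  have h2 := he.norm_grad_sq_le hε hx 1
  nlinarith [sq_nonneg (‖grad (he.data.sph ε) 0 x‖ - ‖grad (he.data.sph ε) 1 x‖)]

/-- The spins are within `z` of `north`, hence within `2z` of each other, and the filling values are
within `4z` of the spins. This gives `5z` before normalization, which costs a factor `4`. -/
lemma norm_sph_sub_north_le (hε : 0 < ε) {τ : Tri} {x : E2} (hx : x ∈ tcell ε τ) :
    ‖he.data.sph ε x - north‖ ≤ 20 * √(2 * zeemanT u (vset ε τ)) := by
  set z := √(2 * zeemanT u (vset ε τ)) with hz
  have hz0 : 0 ≤ z := Real.sqrt_nonneg _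
  have h1 := norm_sv_sub_north_le hε u τ
  rw [← hz] at h1
  have h2 : ∀ k l, ‖sv u (vert τ k) - sv u (vert τ l)‖ ≤ 2 * z := fun k l => by
    refine (norm_sub_le_norm_sub_add_norm_sub _ north _).trans ?_
    rw [norm_sub_rev north]
    linarith [h1 k, h1 l]
  have h3 : ‖he.data.lin ε x - north‖ ≤ 5 * z := by
    refine he.data.norm_lin_sub_le hε hx (fun k => (h1 k).trans (by linarith)) (fun k => ?_) ?_
    · refine (norm_sub_le_norm_sub_add_norm_sub _ (sv u (vert τ k)) _).trans ?_
      linarith [(he.norm_mid_sub_le h2 k).1, h1 k]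
    · refine (norm_sub_le_norm_sub_add_norm_sub _ (sv u (vert τ 0)) _).trans ?_
      have := he.norm_sub_le τ _ h2 0
      change ‖e τ - _‖ + _ ≤ _
      linarith [h1 0]
  have h4 : ‖(north : E3)‖ = 1 := norm_north
  have h5 := norm_normalize_sub_le (he.data.norm_lin_ge hε x)
    (norm_ne_zero_iff.1 (by rw [h4]; norm_num : ‖north‖ ≠ 0))
  rw [h4, inv_one, one_smul] at h5
  change ‖he.data.sph ε x - north‖ ≤ _ at h5
  linarith

lemma sph_eq_north (hε : 0 < ε) {τ : Tri} {x : E2} (hx : x ∈ tcell ε τ)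
    (h : ∀ k, sv u (vert τ k) = north) : he.data.sph ε x = north := by
  have h1 := he.norm_sph_sub_north_le hε hx
  rw [zeemanT_vset hε] at h1
  simp only [h, sub_self] at h1
  simpa [sub_eq_zero] using h1

lemma sph_pos (hε : 0 < ε) (i : lattice ε) : he.data.sph ε i = u i := by
  obtain ⟨z, rfl⟩ := pos_surjective ε i
  rw [InterpData.sph, InterpData.lin_pos _ hε]
  change ‖sv u z‖⁻¹ • sv u z = _
  rw [norm_sv, inv_one, one_smul, sv]

/-- The integral of the charge density over a triangle. -/
lemma integral_tcell (hε : 0 < ε) (τ : Tri) :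
    ∫ x in tcell ε τ, chargeDensity (he.data.sph ε) (grad (he.data.sph ε)) x =
      edgeSum u (fun a b => solidAngle a b (e τ)) τ := by
  rw [InterpData.integral_tcell _ hε, edgeSum]
  refine Finset.sum_congr rfl fun k _ => ?_
  have n1 := norm_sv u (vert τ k)
  have n2 := norm_sv u (vert τ (k + 1))
  have i1 := he.inner_nonneg τ k
  have i2 := he.inner_nonneg τ (k + 1)
  have n3 := he.norm_eq τ
  simp only [data]
  split_ifs with h
  -- At an antipodal edge the midpoint value equals the barycenter value, so both half triangles are
  -- degenerate.
  · have i3 : 0 ≤ inner ℝ (e τ) (e τ) := by rw [real_inner_self_eq_norm_sq]; positivity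
    rw [solidAngle_eq_zero (triple_self_right _ _) (solidRe_pos n1 n3 n3
        (ne_neg_of_inner_nonneg n1 (by rwa [real_inner_comm])) i1 i3).le,
      solidAngle_eq_zero (triple_self_outer _ _) (solidRe_pos n3 n2 n3
        (ne_neg_of_inner_nonneg n3 i2) i3 i2).le, add_zero]
  · exact solidAngle_midVec_add n1 n2 n3 h i1 i2

lemma pairwise_disjoint_ocell (ε : ℝ) : Pairwise (Function.onFun Disjoint (ocell ε)) := by
  intro τ τ' h
  rw [Function.onFun, Set.disjoint_left]
  intro x hx hx'
  exact h (eq_of_mem_ocell hx (ocell_subset_tcell _ _ hx')).symm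

lemma setIntegral_biUnion_tcell (hε : 0 < ε) (F : Finset Tri) {f : E2 → ℝ}
    (hf : ∀ τ ∈ F, IntegrableOn f (tcell ε τ)) :
    ∫ x in ⋃ τ ∈ F, tcell ε τ, f x = ∑ τ ∈ F, ∫ x in tcell ε τ, f x := by
  rw [← setIntegral_congr_set (Finset.eventuallyEq_iUnion F fun τ _ => ocell_ae_eq hε τ),
    integral_biUnion_finset F (fun τ _ => (isOpen_ocell ε τ).measurableSet)
      (fun τ _ τ' _ h => pairwise_disjoint_ocell ε h)
      (fun τ h => (hf τ h).mono_set (ocell_subset_tcell _ _))]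
  exact Finset.sum_congr rfl fun τ _ => setIntegral_congr_set (ocell_ae_eq hε τ)

lemma integrableOn_tcell (hε : 0 < ε) (τ : Tri) :
    IntegrableOn (chargeDensity (he.data.sph ε) (grad (he.data.sph ε))) (tcell ε τ) :=
  he.data.integrableOn_chargeDensity hε (InterpData.isBounded_tcell hε τ).measure_lt_top.ne

/-- The integral of the charge density over a region. -/
lemma integral_region (hε : 0 < ε) {τ : Tri} {F : Finset Tri} (hF : ∀ τ', τ' ∈ F ↔ τ' ∈ comp u τ)
    (hconst : ∀ τ' ∈ comp u τ, e τ' = e τ) :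
    ∫ x in region u τ, chargeDensity (he.data.sph ε) (grad (he.data.sph ε)) x =
      ∑ τ' ∈ F, edgeSum u (fun a b => solidAngle a b (e τ)) τ' := by
  have h1 : region u τ = ⋃ τ' ∈ F, tcell ε τ' := by
    simp only [region, hF]
  rw [h1, setIntegral_biUnion_tcell hε F fun τ' _ => he.integrableOn_tcell hε τ']
  refine Finset.sum_congr rfl fun τ' h => ?_
  rw [he.integral_tcell hε, hconst τ' ((hF τ').1 h)]

end IsFilling

end

/-! ### Energy estimates and Sobolev regularity -/

section

variable {ε : ℝ}

/-- The triangles contained in a set. -/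
def inside (ε : ℝ) (Ω : Set E2) : Set Tri := {τ | tcell ε τ ⊆ Ω}

lemma finite_inside (hε : 0 < ε) {Ω : Set E2} (hb : Bornology.IsBounded Ω) :
    (inside ε Ω).Finite := by
  refine ((locallyFinite_tcell hε).finite_nonempty_inter_compact hb.isCompact_closure).subset
    fun τ hτ => ⟨center ε τ, ?_⟩
  have h := ocell_subset_tcell _ _ (center_mem_ocell hε τ)
  exact ⟨h, subset_closure (hτ h)⟩

lemma finsum_triangles (hε : 0 < ε) {Ω : Set E2} (hb : Bornology.IsBounded Ω)
    (f : Finset (lattice ε) → ℝ) :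
    ∑ᶠ t ∈ {t : Finset (lattice ε) | IsTriangle t ∧ cell t ⊆ Ω}, f t =
      ∑ τ ∈ (finite_inside hε hb).toFinset, f (vset ε τ) := by
  have h : {t : Finset (lattice ε) | IsTriangle t ∧ cell t ⊆ Ω} = vset ε '' inside ε Ω := by
    ext t
    simp only [mem_ofPred_eq, isTriangle_iff hε, mem_image, inside]
    constructor
    · rintro ⟨⟨τ, rfl⟩, h⟩
      exact ⟨τ, by rwa [← cell_vset hε], rfl⟩
    · rintro ⟨τ, h, rfl⟩
      exact ⟨⟨τ, rfl⟩, by rwa [cell_vset hε]⟩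
  rw [h, finsum_mem_image (vset_injective hε).injOn,
    finsum_mem_eq_finite_toFinset_sum _ (finite_inside hε hb)]

lemma ae_mem_ocell (hε : 0 < ε) : ∀ᵐ x : E2, ∃ τ, x ∈ ocell ε τ := by
  have h : ∀ᵐ x : E2, ∀ τ, x ∈ tcell ε τ → x ∈ ocell ε τ :=
    ae_all_iff.2 fun τ => (ocell_ae_eq hε τ).mem_iff.mono fun x hx => hx.2
  exact h.mono fun x hx => ⟨_, hx _ (mem_tcell_loc ε x)⟩

lemma setIntegral_tcell_le (hε : 0 < ε) {f : E2 → ℝ} {τ : Tri} {c : ℝ}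
    (hf : ∀ x ∈ ocell ε τ, |f x| ≤ c) :
    |∫ x in tcell ε τ, f x| ≤ c * (Real.pi * ε ^ 2) := by
  have h := norm_setIntegral_le_of_norm_le_const_ae' (f := f) (C := c)
    (InterpData.isBounded_tcell hε τ).measure_lt_top
    ((ocell_ae_eq hε τ).mem_iff.mono fun x hx h => hf x (hx.2 h))
  have hc : 0 ≤ c := (abs_nonneg _).trans (hf _ (center_mem_ocell hε τ))
  exact h.trans (mul_le_mul_of_nonneg_left (volume_tcell_le hε τ) hc)

/-- A function vanishing on the triangles which are not contained in `Ω` is integrated over `Ω`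
triangle by triangle. -/
lemma setIntegral_eq_sum_inside (hε : 0 < ε) {Ω : Set E2} (hb : Bornology.IsBounded Ω)
    (ho : IsOpen Ω) {f : E2 → ℝ} (hf : ∀ τ, IntegrableOn f (tcell ε τ))
    (h0 : ∀ τ ∉ inside ε Ω, ∀ x ∈ ocell ε τ, f x = 0) :
    ∫ x in Ω, f x = ∑ τ ∈ (finite_inside hε hb).toFinset, ∫ x in tcell ε τ, f x := by
  rw [← IsFilling.setIntegral_biUnion_tcell hε _ fun τ _ => hf τ]
  refine setIntegral_eq_of_subset_of_ae_sdiff_eq_zero ho.measurableSet.nullMeasurableSet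
    (iUnion₂_subset fun τ h => (Finite.mem_toFinset _).1 h) ?_
  filter_upwards [ae_mem_ocell hε] with x ⟨τ, hx⟩ hx'
  refine h0 τ (fun h => hx'.2 ?_) x hx
  exact mem_biUnion (by simpa using h) (ocell_subset_tcell _ _ hx)

lemma setIntegral_le_sum_inside (hε : 0 < ε) {Ω : Set E2} (hb : Bornology.IsBounded Ω)
    (ho : IsOpen Ω) {f : E2 → ℝ} (hf : ∀ τ, IntegrableOn f (tcell ε τ))
    (h0 : ∀ τ ∉ inside ε Ω, ∀ x ∈ ocell ε τ, f x = 0) {c : Tri → ℝ}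
    (hc : ∀ τ, ∀ x ∈ ocell ε τ, |f x| ≤ c τ) :
    ∫ x in Ω, f x ≤ (∑ τ ∈ (finite_inside hε hb).toFinset, c τ) * (Real.pi * ε ^ 2) := by
  rw [setIntegral_eq_sum_inside hε hb ho hf h0, Finset.sum_mul]
  exact Finset.sum_le_sum fun τ _ => (le_abs_self _).trans (setIntegral_tcell_le hε (hc τ))

lemma integrableOn_tcell_of_bound (hε : 0 < ε) {f : E2 → ℝ} (hm : Measurable f) {C : ℝ}
    (hC : ∀ x, |f x| ≤ C) (τ : Tri) : IntegrableOn f (tcell ε τ) :=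
  Measure.integrableOn_of_bounded (InterpData.isBounded_tcell hε τ).measure_lt_top.ne
    hm.aestronglyMeasurable (Eventually.of_forall hC)

variable {u : SpinField ε} {e : Tri → E3}

lemma excited_subset_inside {Ω : Set E2}
    (hu : ∀ τ ∉ inside ε Ω, ∀ k, sv u (vert τ k) = north) : excited u ⊆ inside ε Ω := by
  rintro τ ⟨k, hk⟩
  by_contra h
  exact hk (hu τ h k)

namespace IsFilling

variable (he : IsFilling u e)

lemma sph_eq_north_of_notMem (hε : 0 < ε) {Ω : Set E2}
    (hu : ∀ τ ∉ inside ε Ω, ∀ k, sv u (vert τ k) = north) {x : E2} (hx : x ∉ Ω) :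
    he.data.sph ε x = north :=
  he.sph_eq_north hε (mem_tcell_loc ε x) (hu _ fun h => hx (h (mem_tcell_loc ε x)))

lemma grad_eq_zero_of_mem_ocell (hε : 0 < ε) {τ : Tri} {x : E2} (hx : x ∈ ocell ε τ)
    (h : ∀ k, sv u (vert τ k) = north) (k : Fin 2) : grad (he.data.sph ε) k x = 0 := by
  have h1 := he.norm_grad_sq_le hε hx k
  rw [exchangeT_vset hε] at h1
  simpa [h] using h1

/-- Each partial derivative contributes `544²` times the energy over `ε²`, and a triangle has area
at most `π ε²`. -/
lemma half_integral_grad_le (hε : 0 < ε) {Ω : Set E2} (hb : Bornology.IsBounded Ω)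
    (ho : IsOpen Ω) (hu : ∀ τ ∉ inside ε Ω, ∀ k, sv u (vert τ k) = north) :
    1 / 2 * ∫ y in Ω, ∑ k, ‖grad (he.data.sph ε) k y‖ ^ 2 ≤
      544 ^ 2 * Real.pi * exchange u Ω := by
  have h1 := setIntegral_le_sum_inside hε hb ho
    (f := fun y => ∑ k, ‖grad (he.data.sph ε) k y‖ ^ 2)
    (c := fun τ => 2 * (544 ^ 2 * exchangeT u (vset ε τ) / ε ^ 2)) ?_ ?_ ?_
  · rw [exchange, finsum_triangles hε hb]
    rw [← Finset.mul_sum, ← Finset.sum_div, ← Finset.mul_sum] at h1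
    set s := ∑ τ ∈ (finite_inside hε hb).toFinset, exchangeT u (vset ε τ)
    have h2 : 2 * (544 ^ 2 * s / ε ^ 2) * (Real.pi * ε ^ 2) = 2 * (544 ^ 2 * Real.pi * s) := by
      field_simp
    linarith
  · refine integrableOn_tcell_of_bound hε (C := ∑ k : Fin 2, (272 / ε) ^ 2) ?_ fun x => ?_
    · exact Finset.measurable_sum _ fun k _ => (InterpData.measurable_grad _ k).norm.pow_const 2
    · rw [abs_of_nonneg (by positivity)]
      exact Finset.sum_le_sum fun k _ => by
        have := he.data.norm_grad_le hε k x
        gcongr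
  · intro τ hτ x hx
    simp [he.grad_eq_zero_of_mem_ocell hε hx (hu τ hτ)]
  · intro τ x hx
    rw [abs_of_nonneg (by positivity), Fin.sum_univ_two]
    linarith [he.norm_grad_sq_le hε hx 0, he.norm_grad_sq_le hε hx 1]

/-- The constant is `20² · 2`, from the pointwise bound by the Zeeman energy. -/
lemma integral_sub_north_le (hε : 0 < ε) {Ω : Set E2} (hb : Bornology.IsBounded Ω)
    (ho : IsOpen Ω) (hu : ∀ τ ∉ inside ε Ω, ∀ k, sv u (vert τ k) = north) :
    1 / ε ^ 2 * ∫ y in Ω, ‖he.data.sph ε y - north‖ ^ 2 ≤ 800 * Real.pi * zeeman u Ω := by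
  have h1 := setIntegral_le_sum_inside hε hb ho
    (f := fun y => ‖he.data.sph ε y - north‖ ^ 2)
    (c := fun τ => 800 * zeemanT u (vset ε τ)) ?_ ?_ ?_
  · rw [zeeman, finsum_triangles hε hb]
    rw [← Finset.mul_sum] at h1
    set s := ∑ τ ∈ (finite_inside hε hb).toFinset, zeemanT u (vset ε τ)
    calc _ ≤ 1 / ε ^ 2 * (800 * s * (Real.pi * ε ^ 2)) := by gcongr
      _ = _ := by field_simp
  · refine integrableOn_tcell_of_bound hε (C := 2 ^ 2) ?_ fun x => ?_
    · exact ((he.data.continuous_sph hε).sub continuous_const).norm.measurable.pow_const 2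
    · rw [abs_of_nonneg (by positivity)]
      have : ‖he.data.sph ε x - north‖ ≤ 2 := (_root_.norm_sub_le _ _).trans
        (by rw [he.data.norm_sph hε, norm_north]; norm_num)
      gcongr
  · intro τ hτ x hx
    simp [he.sph_eq_north hε (ocell_subset_tcell _ _ hx) (hu τ hτ)]
  · intro τ x hx
    rw [abs_of_nonneg (by positivity)]
    have h2 := he.norm_sph_sub_north_le hε (ocell_subset_tcell _ _ hx)
    calc _ ≤ (20 * √(2 * zeemanT u (vset ε τ))) ^ 2 := by gcongr
      _ = _ := by
        rw [mul_pow, Real.sq_sqrt (by have := zeemanT_nonneg u (vset ε τ); positivity)]; ring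

end IsFilling

/-- A Lipschitz map on the plane has its almost everywhere derivative as weak derivative. -/
lemma isWeakPartial_grad {w : E2 → E3} {K : ℝ≥0} (hw : LipschitzWith K w) (k : Fin 2)
    (hm : Measurable (grad w k)) : IsWeakPartial w k (grad w k) := by
  intro φ hφ hc
  have hb : bv k = EuclideanSpace.single k 1 := rfl
  obtain ⟨Kφ, hKφ⟩ := (hφ.of_le (by simp) : ContDiff ℝ 1 φ).lipschitzWith_of_hasCompactSupport hc
    one_ne_zero
  have hbd : ∀ x, ‖grad w k x‖ ≤ K := fun x => by
    rw [grad]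
    refine (ContinuousLinearMap.le_opNorm _ _).trans ?_
    have := norm_fderiv_le_of_lipschitz ℝ hw (x₀ := x)
    simpa [bv] using this
  have hφ' : Continuous fun x => fderiv ℝ φ x (EuclideanSpace.single k 1) :=
    (hφ.continuous_fderiv (by simp)).clm_apply continuous_const
  have i1 : Integrable fun x => fderiv ℝ φ x (EuclideanSpace.single k 1) • w x := by
    refine (hφ'.smul hw.continuous).integrable_of_hasCompactSupport ?_
    exact (hc.fderiv_apply (𝕜 := ℝ) _).smul_right
  have i2 : Integrable fun x => φ x • grad w k x :=
    (hφ.continuous.integrable_of_hasCompactSupport hc).smul_bdd _ hm.aestronglyMeasurable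
      (Eventually.of_forall hbd)
  ext i
  have hwi : LipschitzWith K fun x => w x i := by
    refine LipschitzWith.of_dist_le_mul fun x y => ?_
    refine le_trans ?_ (hw.dist_le_mul x y)
    rw [dist_eq_norm, dist_eq_norm]
    exact PiLp.norm_apply_le (w x - w y) i
  -- Integration by parts for line derivatives of Lipschitz functions, applied to each component of
  -- `w`.
  have h1 := hwi.integral_lineDeriv_mul_eq (μ := volume) hKφ hc (bv k)
  have h2 : (∫ x, fderiv ℝ φ x (EuclideanSpace.single k 1) • w x) i =
      ∫ x, fderiv ℝ φ x (EuclideanSpace.single k 1) * w x i := by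
    have := ContinuousLinearMap.integral_comp_comm (EuclideanSpace.proj i : E3 →L[ℝ] ℝ) i1
    simpa using this.symm
  have h3 : (∫ x, φ x • grad w k x) i = ∫ x, φ x * grad w k x i := by
    have := ContinuousLinearMap.integral_comp_comm (EuclideanSpace.proj i : E3 →L[ℝ] ℝ) i2
    simpa using this.symm
  rw [PiLp.neg_apply, h2, h3]
  have h4 : ∫ x, φ x * grad w k x i = ∫ x, lineDeriv ℝ (fun x => w x i) x (bv k) * φ x := by
    refine integral_congr_ae ?_
    filter_upwards [hw.ae_differentiableAt (μ := volume)] with x hx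
    have h5 : HasFDerivAt (fun x => w x i)
        ((EuclideanSpace.proj i : E3 →L[ℝ] ℝ).comp (fderiv ℝ w x)) x :=
      (EuclideanSpace.proj i : E3 →L[ℝ] ℝ).hasFDerivAt.comp x hx.hasFDerivAt
    rw [h5.differentiableAt.lineDeriv_eq_fderiv, h5.fderiv]
    simp [grad, mul_comm]
  have h6 : ∫ x, lineDeriv ℝ φ x (-bv k) * w x i =
      -∫ x, fderiv ℝ φ x (EuclideanSpace.single k 1) * w x i := by
    rw [← integral_neg]
    refine integral_congr_ae (Eventually.of_forall fun x => ?_)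
    simp only
    rw [(hφ.differentiable (by simp)).differentiableAt.lineDeriv_eq_fderiv, map_neg, hb, neg_mul]
  rw [h4, h1, h6, neg_neg]

lemma IsFilling.memU (he : IsFilling u e) (hε : 0 < ε) {Ω : Set E2}
    (hb : Bornology.IsBounded Ω)
    (hu : ∀ τ ∉ inside ε Ω, ∀ k, sv u (vert τ k) = north) :
    MemU Ω (he.data.sph ε) (grad (he.data.sph ε)) where
  norm_eq_one := Eventually.of_forall (he.data.norm_sph hε)
  eq_north := Eventually.of_forall fun x => he.sph_eq_north_of_notMem hε hu
  memLp := by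
    refine ((he.data.continuous_sph hε).sub continuous_const).memLp_of_hasCompactSupport ?_
    refine HasCompactSupport.intro hb.isCompact_closure fun x hx => ?_
    rw [Pi.sub_apply, he.sph_eq_north_of_notMem hε hu fun h => hx (subset_closure h), sub_self]
  memLp_grad k := by
    have h1 : (closure Ω).indicator (grad (he.data.sph ε) k) = grad (he.data.sph ε) k := by
      rw [indicator_eq_self]
      intro x hx
      by_contra hx'
      refine hx ?_
      have h2 : he.data.sph ε =ᶠ[𝓝 x] fun _ => north := by
        filter_upwards [isClosed_closure.isOpen_compl.mem_nhds hx'] with y hy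
        exact he.sph_eq_north_of_notMem hε hu fun h => hy (subset_closure h)
      rw [grad, h2.fderiv_eq]
      simp
    rw [← h1, memLp_indicator_iff_restrict isClosed_closure.measurableSet]
    have : IsFiniteMeasure (volume.restrict (closure Ω)) :=
      ⟨by rw [Measure.restrict_apply_univ]; exact hb.closure.measure_lt_top⟩
    exact MemLp.of_bound (InterpData.measurable_grad _ k).aestronglyMeasurable (272 / ε)
      (Eventually.of_forall (he.data.norm_grad_le hε k))
  weak_grad k := isWeakPartial_grad (he.data.lipschitzWith_sph hε) k (InterpData.measurable_grad _ k)

end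

/-! ### The total charge is quantized -/

/-- The phase of a complex number. -/
noncomputable def phase : ℂ →* ℂ where
  toFun z := if z = 0 then 0 else z / ‖z‖
  map_one' := by simp
  map_mul' z w := by
    by_cases hz : z = 0
    · simp [hz]
    by_cases hw : w = 0
    · simp [hw]
    simp only [hz, hw, mul_eq_zero, or_self, if_false, norm_mul, Complex.ofReal_mul]
    rw [mul_div_mul_comm]

lemma phase_apply {z : ℂ} (hz : z ≠ 0) : phase z = z / ‖z‖ := if_neg hz

lemma phase_ofReal {r : ℝ} (hr : 0 < r) : phase (r : ℂ) = 1 := by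
  have h : (r : ℂ) ≠ 0 := Complex.ofReal_ne_zero.2 hr.ne'
  rw [phase_apply h, Complex.norm_of_nonneg hr.le, div_self h]

lemma phase_mul_conj {z : ℂ} (hz : z ≠ 0) : phase z * phase (starRingEnd ℂ z) = 1 := by
  rw [← map_mul, Complex.mul_conj, phase_ofReal (Complex.normSq_pos.2 hz)]

lemma phase_solidZ {a b c : E3} (h : solidZ a b c ≠ 0) :
    phase (solidZ a b c) = Complex.exp ((solidAngle a b c / 2 : ℝ) * Complex.I) := by
  have hn : ((‖solidZ a b c‖ : ℝ) : ℂ) ≠ 0 := Complex.ofReal_ne_zero.2 (norm_ne_zero_iff.2 h)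
  rw [phase_apply h, div_eq_iff hn, mul_comm, exp_solidAngle_mul_norm]

lemma overlap_self {a : E3} (ha : ‖a‖ = 1) : overlap a a = (2 : ℝ) := by
  obtain ⟨h1, h2, -⟩ := spinor_spec ha
  rw [overlap, mul_comm, h1, mul_comm, h2]
  push_cast
  ring

section

variable {ε : ℝ} {u : SpinField ε} {e : Tri → E3}

/-- The transport from the end to the beginning of an edge of a triangle through its center. -/
noncomputable def transport (u : SpinField ε) (e : Tri → E3) (τ : Tri) (k : Fin 3) : ℂ :=
  overlap (sv u (vert τ (k + 1))) (e τ) * overlap (e τ) (sv u (vert τ k))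

open Classical in
/-- The transport along an edge of a triangle. -/
noncomputable def edgeTransport (u : SpinField ε) (e : Tri → E3) (τ : Tri) (k : Fin 3) : ℂ :=
  if Anti u τ k then (transport u e τ k)⁻¹ else
    overlap (sv u (vert τ k)) (sv u (vert τ (k + 1)))

namespace IsFilling

variable (he : IsFilling u e)

include he

lemma overlap_ne_zero (τ : Tri) (k : Fin 3) : overlap (e τ) (sv u (vert τ k)) ≠ 0 :=
  LatticeSpin.overlap_ne_zero (he.norm_eq τ) (norm_sv u _)
    (ne_neg_of_inner_nonneg (he.norm_eq τ) (he.inner_nonneg τ k))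

lemma overlap_ne_zero' (τ : Tri) (k : Fin 3) : overlap (sv u (vert τ k)) (e τ) ≠ 0 := by
  rw [← conj_overlap]
  simpa using he.overlap_ne_zero τ k

lemma transport_ne_zero (τ : Tri) (k : Fin 3) : transport u e τ k ≠ 0 :=
  mul_ne_zero (he.overlap_ne_zero' τ _) (he.overlap_ne_zero τ _)

lemma edgeTransport_ne_zero (τ : Tri) (k : Fin 3) : edgeTransport u e τ k ≠ 0 := by
  rw [edgeTransport]
  split_ifs with h
  · exact inv_ne_zero (he.transport_ne_zero τ k)
  · exact LatticeSpin.overlap_ne_zero (norm_sv u _) (norm_sv u _) h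

/-- The neighboring triangle traverses the edge backwards, and reversing an overlap conjugates it.
At an antipodal edge this uses that both triangles have the same center value. -/
lemma edgeTransport_nb (τ : Tri) (k : Fin 3) :
    edgeTransport u e (nb τ k) k = starRingEnd ℂ (edgeTransport u e τ k) := by
  simp only [edgeTransport]
  by_cases h : Anti u τ k
  · rw [if_pos h, if_pos (anti_nb h), map_inv₀, transport, transport, vert_nb, vert_nb_succ,
      he.eq_nb τ k h, map_mul, conj_overlap, conj_overlap, mul_comm]
  · have h' : ¬ Anti u (nb τ k) k := fun h2 => h (by simpa only [nb_nb] using anti_nb h2)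
    rw [if_neg h, if_neg h', vert_nb, vert_nb_succ, conj_overlap]

-- For a non-antipodal edge the product is the loop of overlaps through both ends and the center,
-- whose phase is half the solid angle. For an antipodal edge `edgeTransport` is the inverse of
-- `transport`, matching a contribution of zero.
open Classical in
lemma phase_edge (τ : Tri) (k : Fin 3) :
    phase (edgeTransport u e τ k) * phase (transport u e τ k) =
      Complex.exp (((if Anti u τ k then 0 else
        solidAngle (sv u (vert τ k)) (sv u (vert τ (k + 1))) (e τ)) / 2 : ℝ) * Complex.I) := by
  rw [← map_mul, edgeTransport]
  split_ifs with h
  · rw [inv_mul_cancel₀ (he.transport_ne_zero τ k)]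
    simp
  · have h1 := overlap_mul_three (norm_sv u (vert τ k)) (norm_sv u (vert τ (k + 1))) (he.norm_eq τ)
    have h2 : solidZ (sv u (vert τ k)) (sv u (vert τ (k + 1))) (e τ) ≠ 0 := by
      intro h0
      rw [h0, mul_zero] at h1
      exact mul_ne_zero (mul_ne_zero (LatticeSpin.overlap_ne_zero (norm_sv u _) (norm_sv u _) h)
        (he.overlap_ne_zero' τ _)) (he.overlap_ne_zero τ _) h1
    rw [transport, ← mul_assoc, h1, map_mul, phase_solidZ h2]
    have := phase_ofReal (r := 2) (by norm_num)
    push_cast at this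
    rw [this, one_mul]

/-- Around a triangle every vertex is joined to the center once in each direction, and conjugate
phases cancel. -/
lemma prod_phase_transport (τ : Tri) : ∏ k, phase (transport u e τ k) = 1 := by
  have h : ∏ k, phase (transport u e τ k) =
      ∏ k, (phase (overlap (sv u (vert τ k)) (e τ)) * phase (overlap (e τ) (sv u (vert τ k)))) := by
    simp only [transport, map_mul, Fin.prod_univ_three, Fin.reduceAdd]
    ring
  rw [h]
  refine Finset.prod_eq_one fun k _ => ?_
  have := phase_mul_conj (he.overlap_ne_zero' τ k)
  rwa [conj_overlap] at this

/-- Edges between two triangles of `F` cancel in pairs. An edge of a triangle outside `F` has the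
spin `north` at both ends, and the overlap of `north` with itself is the positive number `2`. -/
lemma prod_phase_edgeTransport {F : Finset Tri} (hF : ∀ τ ∉ F, ∀ k, sv u (vert τ k) = north) :
    ∏ p ∈ F ×ˢ (Finset.univ : Finset (Fin 3)), phase (edgeTransport u e p.1 p.2) = 1 := by
  classical
  have hout : ∀ τ k, nb τ k ∉ F → phase (edgeTransport u e τ k) = 1 := by
    intro τ k h
    have h1 := hF _ h
    have hn : ¬ Anti u τ k := fun ha => by
      obtain ⟨l, hl⟩ := (anti_nb ha).mem_excited
      exact hl (h1 l)
    have h2 : sv u (vert τ (k + 1)) = north := by rw [← vert_nb]; exact h1 k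
    have h3 : sv u (vert τ k) = north := by rw [← vert_nb_succ]; exact h1 _
    rw [edgeTransport, if_neg hn, h2, h3, overlap_self norm_north, phase_ofReal (by norm_num)]
  refine Finset.prod_involution
    (fun p _ => if nb p.1 p.2 ∈ F then (nb p.1 p.2, p.2) else p) ?_ ?_ ?_ ?_
  · rintro ⟨τ, k⟩ -
    simp only
    split_ifs with h
    · rw [he.edgeTransport_nb, phase_mul_conj (he.edgeTransport_ne_zero τ k)]
    · simp only [hout τ k h, mul_one]
  · rintro ⟨τ, k⟩ - hne
    simp only at hne ⊢
    split_ifs with h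
    · exact fun heq => nb_ne τ k (congrArg Prod.fst heq)
    · exact absurd (hout τ k h) hne
  · rintro ⟨τ, k⟩ hp
    simp only
    split_ifs with h
    · simpa using h
    · exact hp
  · rintro ⟨τ, k⟩ hp
    have hτ : τ ∈ F := (Finset.mem_product.1 hp).1
    simp only
    by_cases h : nb τ k ∈ F
    · simp [h, nb_nb, hτ]
    · simp [h]

/-- The solid angles of all triangles sum up to a multiple of `4π`. -/
lemma exists_int_sum_edgeSum {F : Finset Tri} (hF : ∀ τ ∉ F, ∀ k, sv u (vert τ k) = north) :
    ∃ d : ℤ, ∑ τ ∈ F, edgeSum u (fun a b => solidAngle a b (e τ)) τ = 4 * Real.pi * d := by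
  have h1 : ∏ p ∈ F ×ˢ (Finset.univ : Finset (Fin 3)),
      (phase (edgeTransport u e p.1 p.2) * phase (transport u e p.1 p.2)) = 1 := by
    rw [Finset.prod_mul_distrib, he.prod_phase_edgeTransport hF, one_mul, Finset.prod_product]
    exact Finset.prod_eq_one fun τ _ => he.prod_phase_transport τ
  simp only [he.phase_edge] at h1
  -- Half of the sum of the solid angles is a multiple of `2π`, so the sum is a multiple of `4π`.
  rw [← Complex.exp_sum, Complex.exp_eq_one_iff] at h1
  obtain ⟨d, hd⟩ := h1
  refine ⟨d, ?_⟩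
  rw [← Finset.sum_mul, ← Complex.ofReal_sum, ← Finset.sum_div, Finset.sum_product] at hd
  change ((((∑ τ ∈ F, edgeSum u (fun a b => solidAngle a b (e τ)) τ) / 2 : ℝ) : ℂ)) * _ = _ at hd
  rw [← mul_assoc] at hd
  have h2 := mul_right_cancel₀ Complex.I_ne_zero hd
  have h3 : (∑ τ ∈ F, edgeSum u (fun a b => solidAngle a b (e τ)) τ) / 2 = d * (2 * Real.pi) := by
    exact_mod_cast h2
  linarith

end IsFilling

end

/-! ### The distance of the charge density to the topological charge -/

/-- Integration against the signed measure is reduced to the finite measures with densities the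
positive and the negative part of `q`. -/
lemma integral_withDensityᵥ {q φ : E2 → ℝ} (hq : Integrable q) (hqm : Measurable q)
    (hφ : Continuous φ) {C : ℝ} (hC : ∀ x, |φ x| ≤ C) :
    ∫ᵛ x, φ x ∂•(volume.withDensityᵥ q) = ∫ x, φ x * q x := by
  have hB : (ContinuousLinearMap.lsmul ℝ ℝ : ℝ →L[ℝ] ℝ →L[ℝ] ℝ) =
      (ContinuousLinearMap.lsmul ℝ ℝ).flip := by
    ext; simp
  have key : ∀ g : E2 → ℝ, Integrable g → Measurable g →
      ∃ _ : IsFiniteMeasure (volume.withDensity fun x => ENNReal.ofReal (g x)),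
        Integrable φ (volume.withDensity fun x => ENNReal.ofReal (g x)) ∧
        ∫ x, φ x ∂(volume.withDensity fun x => ENNReal.ofReal (g x)) =
          ∫ x, (ENNReal.ofReal (g x)).toReal * φ x := by
    intro g hg hgm
    have := isFiniteMeasure_withDensity_ofReal hg.2
    refine ⟨this, Integrable.of_bound hφ.aestronglyMeasurable C (Eventually.of_forall hC), ?_⟩
    rw [integral_withDensity_eq_integral_toReal_smul hgm.ennreal_ofReal
      (Eventually.of_forall fun x => ENNReal.ofReal_lt_top)]
    rfl
  obtain ⟨f1, i1, e1⟩ := key q hq hqm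
  obtain ⟨f2, i2, e2⟩ := key (fun x => -q x) hq.neg hqm.neg
  have hint : ∀ g : E2 → ℝ, Integrable g →
      Integrable fun x => (ENNReal.ofReal (g x)).toReal * φ x := by
    intro g hg
    simp only [ENNReal.toReal_ofReal']
    exact hg.pos_part.mul_bdd (c := C) hφ.aestronglyMeasurable (Eventually.of_forall hC)
  rw [withDensityᵥ_eq_withDensity_pos_part_sub_withDensity_neg_part hq,
    VectorMeasure.integral_sub_vectorMeasure, hB, VectorMeasure.integral_toSignedMeasure,
    VectorMeasure.integral_toSignedMeasure, e1, e2, ← integral_sub (hint q hq)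
      (hint (fun x => -q x) hq.neg)]
  · refine integral_congr_ae (Eventually.of_forall fun x => ?_)
    simp only [ENNReal.toReal_ofReal']
    rw [← sub_mul, mul_comm]
    congr 1
    rcases le_total 0 (q x) with h | h
    · rw [max_eq_left h, max_eq_right (by linarith)]; ring
    · rw [max_eq_right h, max_eq_left (by linarith)]; ring
  · simpa only [VectorMeasure.Integrable, Measure.variation_toSignedMeasure] using i1
  · simpa only [VectorMeasure.Integrable, Measure.variation_toSignedMeasure] using i2

lemma integrable_dirac {φ : E2 → ℝ} (hφ : Continuous φ) {C : ℝ} (hC : ∀ x, |φ x| ≤ C) (x : E2)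
    (c : ℝ) : (VectorMeasure.dirac x c).Integrable φ := by
  have : IsFiniteMeasure (VectorMeasure.dirac x c).variation := by
    have h : ‖c‖ₑ • Measure.dirac x = ‖c‖₊ • Measure.dirac x := rfl
    rw [VectorMeasure.variation_dirac, h]
    infer_instance
  exact Integrable.of_bound hφ.aestronglyMeasurable C (Eventually.of_forall hC)

/-! ### Diameters of regions, the charge as a finite sum, and the flat norm. -/

section

variable {ε : ℝ} {u : SpinField ε} {e : Tri → E3}

/-- A function vanishing outside finitely many triangles is integrated triangle by triangle. -/
lemma integral_eq_sum_tcell (hε : 0 < ε) {F : Finset Tri} {f : E2 → ℝ}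
    (hf : ∀ τ, IntegrableOn f (tcell ε τ)) (h0 : ∀ τ ∉ F, ∀ x ∈ ocell ε τ, f x = 0) :
    ∫ x, f x = ∑ τ ∈ F, ∫ x in tcell ε τ, f x := by
  rw [← IsFilling.setIntegral_biUnion_tcell hε _ fun τ _ => hf τ, ← setIntegral_univ]
  refine setIntegral_eq_of_subset_of_ae_sdiff_eq_zero nullMeasurableSet_univ (subset_univ _) ?_
  filter_upwards [ae_mem_ocell hε] with x ⟨τ, hx⟩ hx'
  exact h0 τ (fun h => hx'.2 (mem_biUnion h (ocell_subset_tcell _ _ hx))) x hx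

/-- Consecutive triangles of a walk share a vertex, so each triangle visited adds at most `ε`. -/
lemma dist_le_of_walk (hε : 0 < ε) {τ τ' : Tri} (p : (triGraph u).Walk τ τ') {x y : E2}
    (hx : x ∈ tcell ε τ) (hy : y ∈ tcell ε τ') : dist x y ≤ (p.length + 1) * ε := by
  induction p generalizing x with
  | nil => simpa using dist_le_of_mem_tcell hε hx hy
  | @cons a b c h p ih =>
    obtain ⟨k, -, rfl⟩ := h
    have h1 := pos_vert_mem_tcell hε a (k + 1)
    have h2 := pos_vert_mem_tcell hε (nb a k) k
    rw [vert_nb] at h2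
    have h3 := ih h2 hy
    have h4 := dist_le_of_mem_tcell hε hx h1
    change dist x y ≤ (((p.length + 1 : ℕ) : ℝ) + 1) * ε
    push_cast
    linarith [dist_triangle x (pos ε (vert a (k + 1)) : E2) y]

lemma anti_of_mem_comp_of_ne {τ τ' : Tri} (h : τ' ∈ comp u τ) (hne : τ' ≠ τ) {τ'' : Tri}
    (h' : τ'' ∈ comp u τ) : ∃ k, Anti u τ'' k := by
  by_cases h1 : τ'' = τ
  · subst h1
    exact anti_of_mem_comp (SimpleGraph.Reachable.symm h) hne.symm
  · exact anti_of_mem_comp h' h1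

/-- The diameter of a region is controlled by the energy. -/
lemma dist_le_of_mem_region (hε : 0 < ε) {τ : Tri} {F : Finset Tri} (hF : excited u ⊆ F)
    {x y : E2} (hx : x ∈ tcell ε τ) (hy : y ∈ region u τ) :
    dist x y ≤ ε * (∑ τ' ∈ F, exchangeT u (vset ε τ') + 1) := by
  classical
  have hs : 0 ≤ ∑ τ' ∈ F, exchangeT u (vset ε τ') :=
    Finset.sum_nonneg fun _ _ => exchangeT_nonneg _ _
  simp only [region, mem_iUnion] at hy
  obtain ⟨τ', h, hy⟩ := hy
  -- Within a single triangle the distance is at most `ε`; this is the origin of the `+ 1`, since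
  -- such a triangle may have little energy.
  by_cases hne : τ' = τ
  · subst hne
    nlinarith [dist_le_of_mem_tcell hε hx hy]
  obtain ⟨p, hp⟩ := SimpleGraph.Reachable.exists_isPath h
  refine (dist_le_of_walk hε p hx hy).trans ?_
  rw [mul_comm]
  refine mul_le_mul_of_nonneg_left ?_ hε.le
  have h1 : ∀ τ'' ∈ p.support, ∃ k, Anti u τ'' k := fun τ'' h'' =>
    anti_of_mem_comp_of_ne h hne (p.takeUntil τ'' h'').reachable
  have h2 : (p.length + 1 : ℝ) = p.support.toFinset.card := by
    rw [List.toFinset_card_of_nodup hp.support_nodup, SimpleGraph.Walk.length_support]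
    push_cast; rfl
  rw [h2]
  -- A path visits distinct triangles, and each of them has an antipodal edge and thus energy at
  -- least one.
  have h3 : (p.support.toFinset.card : ℝ) ≤ ∑ τ'' ∈ p.support.toFinset, exchangeT u (vset ε τ'') := by
    rw [← nsmul_one]
    refine Finset.card_nsmul_le_sum _ _ _ fun τ'' h'' => ?_
    obtain ⟨k, hk⟩ := h1 τ'' (List.mem_toFinset.1 h'')
    exact hk.one_le_exchangeT hε
  have h4 : ∑ τ'' ∈ p.support.toFinset, exchangeT u (vset ε τ'') ≤
      ∑ τ' ∈ F, exchangeT u (vset ε τ') := by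
    refine Finset.sum_le_sum_of_subset_of_nonneg (fun τ'' h'' => ?_)
      fun _ _ _ => exchangeT_nonneg _ _
    obtain ⟨k, hk⟩ := h1 τ'' (List.mem_toFinset.1 h'')
    exact hF hk.mem_excited
  linarith

lemma comp_subset_excited {τ τ' : Tri} (hτ : τ ∈ excited u) (h : τ' ∈ comp u τ) :
    τ' ∈ excited u := by
  by_cases hne : τ' = τ
  · rwa [hne]
  · obtain ⟨k, hk⟩ := anti_of_mem_comp h hne
    exact hk.mem_excited

lemma mem_comp_of_region_eq (hε : 0 < ε) {τ τ' : Tri} (h : region u τ' = region u τ) :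
    τ' ∈ comp u τ := by
  refine center_mem_region hε u ?_
  rw [← h]
  exact mem_region_of_mem (mem_comp_self u _) (ocell_subset_tcell _ _ (center_mem_ocell hε τ'))

namespace IsFilling

variable (he : IsFilling u e)

include he

/-- Where the spins are constantly `north` the charge density vanishes, and so does its integral
over the triangle. -/
lemma edgeSum_eq_zero (hε : 0 < ε) {τ : Tri} (hτ : τ ∉ excited u) :
    edgeSum u (fun a b => solidAngle a b (e τ)) τ = 0 := by
  have h : ∀ k, sv u (vert τ k) = north := by
    simpa [excited] using hτ
  have hx : ∀ x ∈ ocell ε τ,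
      |chargeDensity (he.data.sph ε) (grad (he.data.sph ε)) x| ≤ 0 := fun x hx => by
    have := he.abs_chargeDensity_le hε hx
    rw [exchangeT_vset hε] at this
    simpa [h] using this
  rw [← he.integral_tcell hε]
  have := setIntegral_tcell_le hε hx
  rw [zero_mul] at this
  exact abs_nonpos_iff.1 this

open Classical in
/-- The topological charge is a finite sum over the triangles. -/
lemma charge_eq_sum (hε : 0 < ε) (hu : (excited u).Finite) (hc : ∀ τ, ∀ τ' ∈ comp u τ, e τ' = e τ)
    {S : Set E2 → Set E3} (hd : ∀ τ, ∃ s, RegionData u τ (S (region u τ)) (e τ) s)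
    {μ : SignedMeasure E2} {x : Set E2 → E2} {σ : Set E2 → ℝ}
    (hμ : IsAdmissibleCharge u μ x S σ) :
    μ = ∑ R ∈ hu.toFinset.image (region u), VectorMeasure.dirac (x R)
      (∑ τ ∈ hu.toFinset with region u τ = R, edgeSum u (fun a b => solidAngle a b (e τ)) τ) := by
  have hq : ∀ τ (F : Finset Tri), (∀ τ', τ' ∈ F ↔ τ' ∈ comp u τ) →
      σ (region u τ) * (area (S (region u τ))).toReal =
        ∑ τ' ∈ F, edgeSum u (fun a b => solidAngle a b (e τ')) τ' := by
    intro τ F hF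
    obtain ⟨s, h⟩ := hd τ
    rw [h.charge_eq hε (hμ.sign _ ((mem_regions_iff hε hu _).2 ⟨τ, rfl⟩)) hF]
    exact Finset.sum_congr rfl fun τ' h' => by rw [hc τ τ' ((hF τ').1 h')]
  conv_lhs => rw [hμ.eq_sum]
  rw [finsum_mem_eq_sum_of_inter_support_eq _ (t := hu.toFinset.image (region u))]
  · refine Finset.sum_congr rfl fun R hR => ?_
    obtain ⟨τ, hτ, rfl⟩ := Finset.mem_image.1 hR
    rw [hq τ (hu.toFinset.filter fun τ' => region u τ' = region u τ)]
    intro τ'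
    rw [Finset.mem_filter, Finite.mem_toFinset]
    exact ⟨fun h => mem_comp_of_region_eq hε h.2,
      fun h => ⟨comp_subset_excited (hu.mem_toFinset.1 hτ) h, region_eq h⟩⟩
  · ext R
    simp only [mem_inter_iff, Function.mem_support, Finset.coe_image, Finite.coe_toFinset]
    refine and_congr_left fun hne => ⟨fun h => ?_, ?_⟩
    · obtain ⟨τ, rfl⟩ := (mem_regions_iff hε hu R).1 h
      by_contra hn
      -- There are infinitely many regions, but a region outside the excited set is a single
      -- triangle of zero charge.
      have hτ : τ ∉ excited u := fun h => hn ⟨τ, h, rfl⟩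
      have hcomp : comp u τ = {τ} := comp_eq_singleton fun k hk => hτ hk.mem_excited
      refine hne ?_
      rw [hq τ {τ} (by simp [hcomp]), Finset.sum_singleton, he.edgeSum_eq_zero hε hτ,
        VectorMeasure.dirac_zero]
    · rintro ⟨τ, -, rfl⟩
      exact (mem_regions_iff hε hu _).2 ⟨τ, rfl⟩

end IsFilling

lemma integral_charge {F : Finset Tri} {g : Tri → Set E2} {x : Set E2 → E2} {c : Tri → ℝ}
    [DecidableEq (Set E2)] {φ : E2 → ℝ} (hφ : Continuous φ) {C : ℝ} (hC : ∀ x, |φ x| ≤ C) :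
    (∑ R ∈ F.image g, VectorMeasure.dirac (x R) (∑ τ ∈ F with g τ = R, c τ)).Integrable φ ∧
    ∫ᵛ y, φ y ∂•(∑ R ∈ F.image g, VectorMeasure.dirac (x R) (∑ τ ∈ F with g τ = R, c τ)) =
      ∑ τ ∈ F, φ (x (g τ)) * c τ := by
  refine ⟨VectorMeasure.Integrable.finsetSum_vectorMeasure fun R _ => integrable_dirac hφ hC _ _, ?_⟩
  rw [VectorMeasure.integral_finsetSum_vectorMeasure fun R _ => integrable_dirac hφ hC _ _]
  rw [← Finset.sum_fiberwise_of_maps_to (g := g) (t := F.image g)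
    fun τ h => Finset.mem_image_of_mem g h]
  refine Finset.sum_congr rfl fun R _ => ?_
  rw [VectorMeasure.integral_dirac, ContinuousLinearMap.lsmul_apply, smul_eq_mul, Finset.mul_sum]
  refine Finset.sum_congr rfl fun τ h => ?_
  rw [(Finset.mem_filter.1 h).2]

lemma charge_univ {F : Finset Tri} {g : Tri → Set E2} {x : Set E2 → E2} {c : Tri → ℝ}
    [DecidableEq (Set E2)] :
    (∑ R ∈ F.image g, VectorMeasure.dirac (x R) (∑ τ ∈ F with g τ = R, c τ)) univ =
      ∑ τ ∈ F, c τ := by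
  rw [FunLike.coe_sum, Finset.sum_apply, ← Finset.sum_fiberwise_of_maps_to (g := g)
    (t := F.image g) fun τ h => Finset.mem_image_of_mem g h]
  exact Finset.sum_congr rfl fun R _ =>
    VectorMeasure.dirac_apply_of_mem MeasurableSet.univ (mem_univ _)

/-- The charge at `x R` is itself a sum of integrals of the density over the triangles of `R`. On
each triangle only the variation of the test function between that triangle and `x R` matters. -/
lemma IsFilling.flatNorm_le (he : IsFilling u e) (hε : 0 < ε) {Ω : Set E2} {G : Finset Tri}
    (hu : (excited u).Finite) (hG : excited u ⊆ G)
    (hc : ∀ τ, ∀ τ' ∈ comp u τ, e τ' = e τ)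
    {S : Set E2 → Set E3} (hd : ∀ τ, ∃ s, RegionData u τ (S (region u τ)) (e τ) s)
    {μ : SignedMeasure E2} {x : Set E2 → E2} {σ : Set E2 → ℝ}
    (hμ : IsAdmissibleCharge u μ x S σ) :
    flatNorm Ω (volume.withDensityᵥ (chargeDensity (he.data.sph ε) (grad (he.data.sph ε))) - μ) ≤
      ENNReal.ofReal (544 ^ 2 * Real.pi * ε * (∑ τ ∈ G, exchangeT u (vset ε τ) + 1) *
        ∑ τ ∈ G, exchangeT u (vset ε τ)) := by
  classical
  refine iSup₂_le fun φ hφ => ENNReal.ofReal_le_ofReal ?_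
  obtain ⟨hs, hcs, -, hC, hL⟩ := hφ
  set q := chargeDensity (he.data.sph ε) (grad (he.data.sph ε)) with hq
  set H := ∑ τ ∈ G, exchangeT u (vset ε τ) with hH
  have hH0 : 0 ≤ H := Finset.sum_nonneg fun _ _ => exchangeT_nonneg _ _
  have hqm : Measurable q := he.data.measurable_chargeDensity hε
  have hq0 : ∀ τ ∉ hu.toFinset, ∀ x ∈ ocell ε τ, q x = 0 := by
    intro τ hτ x hx
    have h : ∀ k, sv u (vert τ k) = north := by
      simpa [excited] using hτ
    have := he.abs_chargeDensity_le hε hx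
    rw [exchangeT_vset hε] at this
    simpa [h] using this
  have hqi : Integrable q := by
    have h1 : IntegrableOn q (⋃ τ ∈ hu.toFinset, tcell ε τ) :=
      (integrableOn_finset_iUnion).2 fun τ _ => he.integrableOn_tcell hε τ
    rw [← integrableOn_univ]
    refine h1.of_ae_sdiff_eq_zero nullMeasurableSet_univ ?_
    filter_upwards [ae_mem_ocell hε] with x ⟨τ, hx⟩ hx'
    exact hq0 τ (fun h => hx'.2 (mem_biUnion h (ocell_subset_tcell _ _ hx))) x hx
  have hφc := hs.continuous
  obtain ⟨hμi, hμe⟩ := integral_charge (F := hu.toFinset) (g := region u) (x := x)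
    (c := fun τ => edgeSum u (fun a b => solidAngle a b (e τ)) τ) hφc hC
  have hi1 : (volume.withDensityᵥ q).Integrable φ := by
    have : IsFiniteMeasure (volume.withDensityᵥ q).variation := by
      rw [Measure.variation_withDensityᵥ hqi]
      exact ⟨by simpa using! hqi.2⟩
    exact Integrable.of_bound hφc.aestronglyMeasurable 1 (Eventually.of_forall hC)
  have hmul : ∀ (τ : Tri) (r : ℝ), IntegrableOn (fun y => (φ y - r) * q y) (tcell ε τ) := by
    intro τ r
    refine (he.integrableOn_tcell hε τ).bdd_mul (c := 1 + |r|)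
      (hφc.sub continuous_const).aestronglyMeasurable (Eventually.of_forall fun y => ?_)
    exact (abs_sub _ _).trans (by gcongr; exact hC y)
  rw [he.charge_eq_sum hε hu hc hd hμ, VectorMeasure.integral_sub_vectorMeasure hi1 hμi, hμe,
    integral_withDensityᵥ hqi hqm hφc hC, integral_eq_sum_tcell hε (F := hu.toFinset)
      (fun τ => by simpa using hmul τ 0) (fun τ hτ y hy => by rw [hq0 τ hτ y hy, mul_zero]),
    ← Finset.sum_sub_distrib]
  have hmul0 : ∀ τ, IntegrableOn (fun y => φ y * q y) (tcell ε τ) := fun τ => by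
    simpa using hmul τ 0
  -- The factor `ε (H + 1)` is the bound on the distance to `x R`, the test function being
  -- `1`-Lipschitz. The bounds on density and area give `544² π` times the energy of the triangle.
  have hterm : ∀ τ, (∫ y in tcell ε τ, φ y * q y) -
      φ (x (region u τ)) * edgeSum u (fun a b => solidAngle a b (e τ)) τ ≤
      544 ^ 2 * Real.pi * ε * (H + 1) * exchangeT u (vset ε τ) := by
    intro τ
    rw [← he.integral_tcell hε, ← integral_const_mul, ← integral_sub (hmul0 τ)
      ((he.integrableOn_tcell hε τ).const_mul _)]
    simp only [← hq, ← sub_mul]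
    refine (le_abs_self _).trans ((setIntegral_tcell_le hε (c := ε * (H + 1) *
      (544 ^ 2 * exchangeT u (vset ε τ) / ε ^ 2)) fun y hy => ?_).trans (le_of_eq ?_))
    · rw [abs_mul]
      refine mul_le_mul ?_ (he.abs_chargeDensity_le hε hy) (abs_nonneg _) (by positivity)
      have hx : x (region u τ) ∈ region u τ :=
        interior_subset (hμ.mem_interior _ ((mem_regions_iff hε hu _).2 ⟨τ, rfl⟩))
      refine le_trans ?_ (dist_le_of_mem_region hε hG (ocell_subset_tcell _ _ hy) hx)
      have h1 := convex_univ.norm_image_sub_le_of_norm_fderiv_le (𝕜 := ℝ) (f := φ) (C := 1)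
        (fun z _ => (hs.differentiable (by simp)) z) (fun z _ => hL z)
        (mem_univ (x (region u τ))) (mem_univ y)
      rwa [one_mul, ← dist_eq_norm y] at h1
    · field_simp
  calc _ ≤ ∑ τ ∈ hu.toFinset, 544 ^ 2 * Real.pi * ε * (H + 1) * exchangeT u (vset ε τ) :=
        Finset.sum_le_sum fun τ _ => hterm τ
    _ = 544 ^ 2 * Real.pi * ε * (H + 1) * ∑ τ ∈ hu.toFinset, exchangeT u (vset ε τ) := by
        rw [Finset.mul_sum]
    _ ≤ _ := by
        refine mul_le_mul_of_nonneg_left ?_ (by have := Real.pi_pos; positivity)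
        refine Finset.sum_le_sum_of_subset_of_nonneg (fun τ h => hG (hu.mem_toFinset.1 h))
          fun _ _ _ => exchangeT_nonneg _ _

end

end LatticeSpin

/-! ### Conclusion. -/

theorem theorem5p1 :
    ∃ C₁ : ℝ, 0 < C₁ ∧ ∃ C₂ : ℝ, 0 < C₂ ∧
      ∀ (ε : ℝ), 0 < ε → ∀ (Ω : Set E2), IsOpen Ω → Bornology.IsBounded Ω →
      ∀ (u : SpinField ε), IsSpinFieldOn Ω u →
      -- `u = n` on the vertices of every triangle not compactly contained in `Ω`
      (∀ t : Finset (lattice ε), IsTriangle t → ¬ cell t ⊆ Ω → ∀ i ∈ t, (u i : E3) = north) →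
      ∀ (μ : SignedMeasure E2) (x : Set E2 → E2) (S : Set E2 → Set E3) (σ : Set E2 → ℝ),
      IsAdmissibleCharge u μ x S σ →
      (∃ (w : E2 → E3) (D : Fin 2 → E2 → E3),
        (∃ K : ℝ≥0, LipschitzWith K w) ∧
        IsRefinedInterpolation ε w ∧
        MemU Ω w D ∧
        (∀ i : lattice ε, w i = u i) ∧
        1 / 2 * ∫ y in Ω, ∑ k, ‖D k y‖ ^ 2 ≤ C₁ * exchange u Ω ∧
        1 / ε ^ 2 * ∫ y in Ω, ‖w y - north‖ ^ 2 ≤ C₁ * zeeman u Ω ∧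
        (∀ R ∈ regions u,
          ∫ y in R, chargeDensity w D y = σ R * (area (S R)).toReal) ∧
        flatNorm Ω (volume.withDensityᵥ (chargeDensity w D) - μ) ≤
          ENNReal.ofReal (C₂ * ε * (exchange u Ω + 1) * exchange u Ω)) ∧
      ∃ d : ℤ, μ univ = 4 * Real.pi * d := by
  -- The gradient estimate determines `C₁`; the Zeeman estimate needs only `800 π`.
  refine ⟨544 ^ 2 * Real.pi, by positivity, 544 ^ 2 * Real.pi, by positivity, ?_⟩
  intro ε hε Ω ho hb u _ hu μ x S σ hμ
  -- Closed triangles are compact and `Ω` is open, so containment in `Ω` is compact containment.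
  have hn : ∀ τ ∉ inside ε Ω, ∀ k, sv u (vert τ k) = north := fun τ hτ k =>
    hu (vset ε τ) (isTriangle_vset hε τ) (by rwa [cell_vset hε]) _ (mem_vset.2 ⟨k, rfl⟩)
  have hsub := excited_subset_inside hn
  have hfin : (excited u).Finite := (finite_inside hε hb).subset hsub
  obtain ⟨e, he, hc, hd⟩ := exists_filling hε hfin hμ.surface
  refine ⟨⟨he.data.sph ε, grad (he.data.sph ε), ⟨_, he.data.lipschitzWith_sph hε⟩,
    he.data.isRefinedInterpolation hε, he.memU hε hb hn, he.sph_pos hε,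
    he.half_integral_grad_le hε hb ho hn, ?_, ?_, ?_⟩, ?_⟩
  · refine (he.integral_sub_north_le hε hb ho hn).trans ?_
    have hz : 0 ≤ zeeman u Ω := by
      rw [zeeman, finsum_triangles hε hb]
      exact Finset.sum_nonneg fun _ _ => zeemanT_nonneg _ _
    have := Real.pi_pos
    gcongr
    norm_num
  · intro R hR
    obtain ⟨τ, rfl⟩ := (mem_regions_iff hε hfin R).1 hR
    obtain ⟨s, h⟩ := hd τ
    have hF := fun τ' => (finite_comp hfin τ).mem_toFinset (a := τ')
    rw [he.integral_region hε hF (hc τ), h.charge_eq hε (hμ.sign _ hR) hF]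
  · rw [exchange, finsum_triangles hε hb]
    exact he.flatNorm_le hε hfin (by simpa using hsub) hc hd hμ
  · obtain ⟨d, h⟩ := he.exists_int_sum_edgeSum (F := hfin.toFinset) fun τ hτ => by
      simpa [excited] using hτ
    classical
    refine ⟨d, ?_⟩
    rw [← h, he.charge_eq_sum hε hfin hc hd hμ, charge_univ]
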